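/- **Setting.** Let $\mathfrak g=\bigoplus_{k\in\mathbb Z}\mathfrak g_k$ be a finite-dimensional $\mathbb Z$-graded Lie superalgebra over $\mathbb C$ with a nondegenerate even supersymmetric invariant bilinear form $(\,|\,)$ such that $(\mathfrak g_k|\mathfrak g_l)=0$ for $k+l\neq0$. Let $\mathfrak n\subset\mathfrak g_{>0}$ be a homogeneous subalgebra, $\mathfrak m\subset\mathfrak n$ a homogeneous $\mathfrak n$-submodule, $\mathfrak b_-$ a homogeneous complement of $\mathfrak m$ in $\mathfrak g$, and $\mathfrak b=\mathfrak m^\perp$. Let $f\in\mathfrak g_{-i}$ and $s\in\mathfrak g_j$ ($i,j>0$) be odd elements with (A-1) $\mathfrak g_{\ge i}\subset\mathfrak m$; (A-2) $[f,\mathfrak n]\subset\mathfrak b$; (A-3) $\mathrm{ad}\,f|_{\mathfrak n}$ is injective; (A-4) $[s,\mathfrak n]=0$; (A-5) with $\Lambda=f+zs$ and $\Lambda^2=\frac12[\Lambda,\Lambda]$ one has $\hat{\mathfrak g}:=\mathfrak g(\!(z^{-1})\!)=\mathcal K\oplus\mathcal I$, where $\mathcal K=\ker\mathrm{ad}\,\Lambda^2$,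 $\mathcal I=\mathrm{im}\,\mathrm{ad}\,\Lambda^2$. Let $\mathcal Z$ be the center of $\mathcal K$, let $V$ be a homogeneous complement of $[f,\mathfrak n]$ in $\mathfrak b$, let $(q_t)_{t\in\tilde I}$ be a homogeneous basis of $\mathfrak g$ such that $(q_t)_{t\in I}$ is a basis of $\mathfrak b_-$ and $(q_t)_{t\notin I}$ one of $\mathfrak m$, and let $(q^t)$ be the dual basis, $(q^t|q_{t'})=\delta_{t,t'}$. Let $\bar{\mathfrak g}$ be $\mathfrak g$ with reversed parity, $\mathcal P(\bar{\mathfrak g})=S(\mathbb C[D]\otimes\bar{\mathfrak g})$ the superalgebra of differential polynomials in the $\bar q_t$ with its odd derivation $D$, and $\mathcal P=S(\mathbb C[D]\otimes\bar{\mathfrak b}_-)$. Put $\int a=a+D\mathcal P(\bar{\mathfrak g})$, and let $\{\,{}_\chi\,\}_2$ be the supersymmetric Poisson vertex algebra bracket on $\mathcal P(\bar{\mathfrak g})$ with $\{\bar a{}_\chi\bar b\}_2=(-1)^{p(a)+1}(s|[a,b])$ for $a,b\in\mathfrak g$. For odd $\mathcal Q\in\mathfrak b\otimes\mathcal P$ put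 $\mathcal L(\mathcal Q)=D+\mathcal Q+f\otimes1$ and $\mathcal L_s(\mathcal Q)=D+\mathcal Q+\Lambda\otimes1$, and let $\mathcal P_{\mathcal Q}$ be the differential superalgebra generated by the coefficients of $\mathcal Q$. Let $z$ have degree $-i-j$; tensor products of $\hat{\mathfrak g}$ and its subspaces with $\mathcal P$ are understood in the completed sense, as Laurent series in $z^{-1}$ with coefficients in $\mathfrak g\otimes\mathcal P$. Let $T_{\mathcal Q}\in\mathcal I\otimes\mathcal P_{\mathcal Q}$ be the even element of positive degree such that $e^{\mathrm{ad}\,T_{\mathcal Q}}\frac12[\mathcal L_s(\mathcal Q),\mathcal L_s(\mathcal Q)]=D^2+H+\Lambda^2\otimes1$ for some $H\in\mathcal K\otimes\mathcal P_{\mathcal Q}$, and let $K_{\mathcal Q}=e^{\mathrm{ad}\,T_{\mathcal Q}}\mathcal L_s(\mathcal Q)-D-\Lambda\otimes1$. Let $\mathcal Q_u=\sum_{t\in I}q^t\otimes\bar q_t$, $\mathcal L_s=\mathcal L_s(\mathcal Q_u)$, and let $\mathcal Q^c\in(V\otimes\mathcal P)_{\bar1}$ be the canonical form of $\mathcal Q_u$: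 $\mathcal L(\mathcal Q^c)=e^{\mathrm{ad}\,N}\mathcal L(\mathcal Q_u)$ for some $N\in(\mathfrak n\otimes\mathcal P)_{\bar0}$. For $C\in\mathcal Z$ put $$h_C=(K_{\mathcal Q^c}\,|\,C\otimes1),\qquad M_C=e^{-\mathrm{ad}\,T_{\mathcal Q_u}}(C\otimes1),$$ and let $M_C^+$ be the part of $M_C$ with nonnegative powers of $z$. The form on $\hat{\mathfrak g}\otimes\mathcal P(\bar{\mathfrak g})$ is $(az^m\otimes u|bz^n\otimes v)=(-1)^{p(b)p(u)}\delta_{m+n,0}(a|b)uv$. **Theorem.** The elements $\mathcal Q^c$, $T_{\mathcal Q_u}$, $T_{\mathcal Q^c}$, $h_C$ and $M_C$ above exist. For every $C\in\mathcal Z$ one has $z^kC\in\mathcal Z$ ($k\in\mathbb Z$), and: 1. The Lax equation $d\mathcal L_s/dt=[M_C^+,\mathcal L_s]$ is well defined: $[M_C^+,\mathcal L_s]\in\mathfrak b\otimes\mathcal P$. 2. Let $d/dt_C$ be the map $a\mapsto\{\int h_C{}_\chi a\}_2|_{\chi=0}$ of $\mathcal P(\bar{\mathfrak g})$, which depends on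 $h_C$ only through $\int h_C$. For homogeneous $C$ it is a derivation of parity $p(C)$ that supercommutes with $D$ and preserves $\mathcal P$, and, with $d/dt_C(a\otimes u)=(-1)^{p(C)p(a)}a\otimes du/dt_C$, it satisfies $$\frac{d\mathcal L_s}{dt_C}=-[M_{z^{-1}C}^+,\mathcal L_s].$$ Hence the Lax equation $d\mathcal L_s/dt=[M_C^+,\mathcal L_s]$ induces on $\mathcal P$ the super Hamiltonian equation $d\bar q_t/dt=-\{\int h_{zC}{}_\chi\bar q_t\}_2|_{\chi=0}$, $t\in I$; this is the only derivation of $\mathcal P$ obtained by restricting a derivation of $\mathcal P(\bar{\mathfrak g})$ of parity $p(C)$ that supercommutes with $D$ and solves the Lax equation. 3. The super Hamiltonian equations $d\bar q_t/dt_C=\{\int h_C{}_\chi\bar q_t\}_2|_{\chi=0}$, $t\in\tilde I$, are pairwise compatible: for homogeneous $C_1,C_2\in\mathcal Z$ the derivations $d/dt_{C_1}$ and $d/dt_{C_2}$ of $\mathcal P(\bar{\mathfrak g})$ supercommute. 4. For all $C_1,C_2\in\mathcal Z$ one has $\{\int h_{C_1},\int h_{C_2}\}_2=\int\{h_{C_1}{}_\chi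 h_{C_2}\}_2|_{\chi=0}=0$; that is, each $\int h_C$ is an integral of motion of each of these equations. -/

import Mathlib

noncomputable section
namespace SuperDS

/-- The sign `(-1)^e` of a parity `e ∈ ℤ/2`. -/
def sgn (e : ZMod 2) : ℂ := if e = 0 then 1 else -1

/-- The relations `x y = (-1)^{p(x) p(y)} y x` between the generators. -/
inductive SuperPoly.Rel {X : Type*} (p : X → ZMod 2) : FreeAlgebra ℂ X → FreeAlgebra ℂ X → Prop
  | comm (x y : X) : SuperPoly.Rel p (FreeAlgebra.ι ℂ x * FreeAlgebra.ι ℂ y)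
      (sgn (p x * p y) • (FreeAlgebra.ι ℂ y * FreeAlgebra.ι ℂ x))

/-- The free unital associative supercommutative `ℂ`-superalgebra (the symmetric superalgebra) on
generators `x ∈ X` of parity `p x`. -/
def SuperPoly {X : Type*} (p : X → ZMod 2) : Type _ := RingQuot (SuperPoly.Rel p)

namespace SuperPoly

variable {X : Type*} (p : X → ZMod 2)

instance : Ring (SuperPoly p) := inferInstanceAs (Ring (RingQuot (SuperPoly.Rel p)))

instance : Algebra ℂ (SuperPoly p) := inferInstanceAs (Algebra ℂ (RingQuot (SuperPoly.Rel p)))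

/-- The generator `x`. -/
def gen (x : X) : SuperPoly p := RingQuot.mkAlgHom ℂ (SuperPoly.Rel p) (FreeAlgebra.ι ℂ x)

/-- The universal property: algebra morphisms out of `SuperPoly p`. -/
def lift {B : Type*} [Semiring B] [Algebra ℂ B] (v : X → B)
    (hv : ∀ x y, v x * v y = sgn (p x * p y) • (v y * v x)) : SuperPoly p →ₐ[ℂ] B :=
  RingQuot.liftAlgHom ℂ ⟨FreeAlgebra.lift ℂ v, by
    rintro _ _ ⟨x, y⟩
    simp [hv x y]⟩

theorem lift_gen {B : Type*} [Semiring B] [Algebra ℂ B] (v : X → B)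
    (hv : ∀ x y, v x * v y = sgn (p x * p y) • (v y * v x)) (x : X) :
    lift p v hv (gen p x) = v x := by
  unfold lift gen
  erw [RingQuot.liftAlgHom_mkAlgHom_apply]
  simp

theorem gen_comm (x y : X) :
    gen p x * gen p y = sgn (p x * p y) • (gen p y * gen p x) := by
  have h := RingQuot.mkAlgHom_rel ℂ (Rel.comm (p := p) x y)
  rw [map_mul, map_smul, map_mul] at h
  exact h

theorem induction {C : SuperPoly p → Prop} (hs : ∀ r : ℂ, C (algebraMap ℂ _ r))
    (hg : ∀ x, C (gen p x)) (hm : ∀ a b, C a → C b → C (a * b))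
    (ha : ∀ a b, C a → C b → C (a + b)) (a : SuperPoly p) : C a := by
  obtain ⟨a, rfl⟩ := RingQuot.mkAlgHom_surjective ℂ (SuperPoly.Rel p) a
  induction a using FreeAlgebra.induction with
  | grade0 r => rw [AlgHom.commutes]; exact hs r
  | grade1 x => exact hg x
  | mul a b h1 h2 => rw [map_mul]; exact hm _ _ h1 h2
  | add a b h1 h2 => rw [map_add]; exact ha _ _ h1 h2

/-- The parity automorphism: `σ a = (-1)^{p(a)} a` for homogeneous `a`. -/
def σ : SuperPoly p →ₐ[ℂ] SuperPoly p :=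
  lift p (fun x => sgn (p x) • gen p x) (fun x y => by
    rw [smul_mul_smul_comm, smul_mul_smul_comm, gen_comm p x y, smul_smul, smul_smul]
    ring_nf)

/-- `parPow e a = (-1)^{e p(a)} a` for homogeneous `a`. -/
def parPow (e : ZMod 2) : SuperPoly p →ₐ[ℂ] SuperPoly p :=
  if e = 0 then AlgHom.id ℂ _ else σ p

theorem σ_gen (x : X) : σ p (gen p x) = sgn (p x) • gen p x := lift_gen p _ _ x

theorem sgn_aux (e a b : ZMod 2) : sgn (e * a) * sgn (a * (e + b)) = sgn (a * b) := by
  have : ∀ e : ZMod 2, e = 0 ∨ e = 1 := by decide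
  have h : (1 + 1 : ZMod 2) = 0 := by decide
  rcases this e with rfl | rfl <;> rcases this a with rfl | rfl <;>
    rcases this b with rfl | rfl <;> simp [sgn, h]

theorem sgn_mul_self (e : ZMod 2) : sgn e * sgn e = 1 := by
  unfold sgn; split_ifs <;> norm_num

theorem parPow_of_hom (e e' : ZMod 2) (a : SuperPoly p) (h : σ p a = sgn e' • a) :
    parPow p e a = sgn (e * e') • a := by
  have : ∀ e : ZMod 2, e = 0 ∨ e = 1 := by decide
  rcases this e with rfl | rfl
  · simp [parPow, sgn]
  · simp [parPow, h]

theorem gen_mul (x : X) (a : SuperPoly p) : gen p x * a = parPow p (p x) a * gen p x := by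
  induction a using SuperPoly.induction with
  | hs r => rw [AlgHom.commutes, Algebra.commutes]
  | hg y => rw [parPow_of_hom p (p x) (p y) _ (σ_gen p y), smul_mul_assoc, gen_comm]
  | hm a b h1 h2 => rw [map_mul, mul_assoc, ← h2, ← mul_assoc, h1, mul_assoc]
  | ha a b h1 h2 => rw [mul_add, map_add, add_mul, h1, h2]

/-- The algebra morphism `a ↦ !![(-1)^{e p(a)} a, d a; 0, a]` that encodes the derivation `d` of
parity `e` with values `v x` (of parity `e + p x`) on the generators. -/
def derHom (e : ZMod 2) (v : X → SuperPoly p) (hv : ∀ x, σ p (v x) = sgn (e + p x) • v x) :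
    SuperPoly p →ₐ[ℂ] Matrix (Fin 2) (Fin 2) (SuperPoly p) :=
  lift p (fun x => !![parPow p e (gen p x), v x; 0, gen p x]) (fun x y => by
      have h1 := gen_mul p x (v y)
      rw [parPow_of_hom p (p x) (e + p y) _ (hv y)] at h1
      have h2 := gen_mul p y (v x)
      rw [parPow_of_hom p (p y) (e + p x) _ (hv x)] at h2
      rw [parPow_of_hom p e (p x) _ (σ_gen p x), parPow_of_hom p e (p y) _ (σ_gen p y)]
      ext i j
      fin_cases i <;> fin_cases j
      · simp [gen_comm p x y, smul_smul]; ring_nf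
      · suffices sgn (e * p x) • (gen p x * v y) + v x * gen p y =
            sgn (p x * p y) • (sgn (e * p y) • (gen p y * v x) + v y * gen p x) by
          simpa using this
        rw [h1, h2, smul_mul_assoc, smul_mul_assoc, smul_smul, smul_smul, sgn_aux, sgn_aux,
          smul_add, smul_smul, mul_comm (p y) (p x), sgn_mul_self, one_smul, add_comm]
      · simp
      · simp [gen_comm p x y])

/-- The derivation of parity `e` with prescribed values `v x` (of parity `e + p x`) on the
generators. -/
def der (e : ZMod 2) (v : X → SuperPoly p) (hv : ∀ x, σ p (v x) = sgn (e + p x) • v x) :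
    SuperPoly p →ₗ[ℂ] SuperPoly p :=
  (Matrix.entryLinearMap ℂ (SuperPoly p) (0 : Fin 2) (1 : Fin 2)).comp (derHom p e v hv).toLinearMap

variable {p} in
theorem derHom_eq {e : ZMod 2} {v : X → SuperPoly p} {hv : ∀ x, σ p (v x) = sgn (e + p x) • v x}
    (a : SuperPoly p) : derHom p e v hv a = !![parPow p e a, der p e v hv a; 0, a] := by
  suffices h : derHom p e v hv a 0 0 = parPow p e a ∧ derHom p e v hv a 1 0 = 0 ∧
      derHom p e v hv a 1 1 = a by
    ext i j
    fin_cases i <;> fin_cases j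
    · exact h.1
    · rfl
    · exact h.2.1
    · exact h.2.2
  induction a using SuperPoly.induction with
  | hs r => simp [AlgHom.commutes, Matrix.algebraMap_matrix_apply]
  | hg x => simp [derHom, lift_gen]
  | hm a b h1 h2 => simp [Matrix.mul_apply, Fin.sum_univ_two, h1, h2]
  | ha a b h1 h2 => simp [h1, h2]

variable {p} in
theorem der_gen {e : ZMod 2} {v : X → SuperPoly p} {hv : ∀ x, σ p (v x) = sgn (e + p x) • v x}
    (x : X) : der p e v hv (gen p x) = v x := by
  simp [der, derHom, lift_gen]

variable {p} in
theorem der_mul {e : ZMod 2} {v : X → SuperPoly p} {hv : ∀ x, σ p (v x) = sgn (e + p x) • v x}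
    (a b : SuperPoly p) :
    der p e v hv (a * b) = der p e v hv a * b + parPow p e a * der p e v hv b := by
  have h : derHom p e v hv (a * b) 0 1 = _ :=
    congrFun (congrFun (map_mul (derHom p e v hv) a b) 0) 1
  rw [Matrix.mul_apply, Fin.sum_univ_two] at h
  simp only [derHom_eq] at h
  simpa [add_comm] using h

variable {p} in
theorem der_algebraMap {e : ZMod 2} {v : X → SuperPoly p}
    {hv : ∀ x, σ p (v x) = sgn (e + p x) • v x} (r : ℂ) :
    der p e v hv (algebraMap ℂ _ r) = 0 := by
  simp [der, AlgHom.commutes, Matrix.algebraMap_matrix_apply]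

variable [DecidableEq X]

/-- The partial derivative `∂/∂x`: the derivation of parity `p x` with `∂y/∂x = δ_{x,y}`. -/
def pderiv (x : X) : SuperPoly p →ₗ[ℂ] SuperPoly p :=
  der p (p x) (fun y => if y = x then 1 else 0) (fun y => by
    have : ∀ e : ZMod 2, e + e = 0 := by decide
    split_ifs with h
    · subst h; simp [sgn, this]
    · simp)

theorem pderiv_finite (a : SuperPoly p) : (Function.support fun x => pderiv p x a).Finite := by
  induction a using SuperPoly.induction with
  | hs r => simp [pderiv, der_algebraMap]
  | hg y =>
    refine (Set.finite_singleton y).subset fun x hx => ?_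
    by_contra h
    have h' : ¬ y = x := fun h' => h (by simp [h'])
    exact hx (by simp [pderiv, der_gen, h'])
  | hm a b h1 h2 =>
    refine (h1.union h2).subset fun x hx => ?_
    by_contra h
    simp only [Set.mem_union, Function.mem_support, not_or, not_not] at h
    exact hx (by
      have := der_mul (p := p) (e := p x) (v := fun y => if y = x then 1 else 0)
        (hv := fun y => by
          have : ∀ e : ZMod 2, e + e = 0 := by decide
          split_ifs with h
          · subst h; simp [sgn, this]
          · simp) a b
      have h1 := h.1
      have h2 := h.2
      unfold pderiv at h1 h2 ⊢
      simp only [this, h1, h2, zero_mul, mul_zero, add_zero])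
  | ha a b h1 h2 =>
    refine (h1.union h2).subset fun x hx => ?_
    by_contra h
    simp only [Set.mem_union, Function.mem_support, not_or, not_not] at h
    exact hx (by simp [h.1, h.2])

/-- All partial derivatives of `a`, as a finitely supported family. -/
def grad : SuperPoly p →ₗ[ℂ] (X →₀ SuperPoly p) where
  toFun a := Finsupp.ofSupportFinite (fun x => pderiv p x a) (pderiv_finite p a)
  map_add' a b := by ext x; simp [Finsupp.ofSupportFinite_coe]
  map_smul' r a := by ext x; simp [Finsupp.ofSupportFinite_coe]

end SuperPoly

open scoped TensorProduct

/-- The Laurent series `A((z⁻¹))`, as Hahn series in `z⁻¹`: the index of a coefficient is the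
exponent of `z⁻¹`. -/
def Laurent (A : Type*) [Zero A] : Type _ := HahnSeries ℤ A

namespace Laurent

variable {A B : Type*} [Ring A] [Algebra ℂ A] [Ring B] [Algebra ℂ B]

instance : Ring (Laurent A) := inferInstanceAs (Ring (HahnSeries ℤ A))

instance : Algebra ℂ (Laurent A) := inferInstanceAs (Algebra ℂ (HahnSeries ℤ A))

/-- The coefficient of `z^k`. -/
def coeff (k : ℤ) : Laurent A →ₗ[ℂ] A where
  toFun x := HahnSeries.coeff x (-k)
  map_add' _ _ := rfl
  map_smul' r x := (HahnSeries.coeff.linearMap (R := ℂ) (V := A) (-k)).map_smul r x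

/-- `a ↦ a z^k`. -/
def mono (k : ℤ) : A →ₗ[ℂ] Laurent A where
  toFun a := HahnSeries.single (-k) a
  map_add' a b := HahnSeries.single_add (-k) a b
  map_smul' r a := (HahnSeries.single.linearMap (R := ℂ) (V := A) (-k)).map_smul r a

/-- A linear map applied to all coefficients. -/
def map (d : A →ₗ[ℂ] B) : Laurent A →ₗ[ℂ] Laurent B where
  toFun x := HahnSeries.map x d
  map_add' x y := HahnSeries.ext (by ext k; exact d.map_add _ _)
  map_smul' r x := HahnSeries.ext (by ext k; exact d.map_smul r _)

/-- `∑ a_k z^k ↦ ∑_{k ≥ 0} a_k z^k`. -/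
def posPart : Laurent A →ₗ[ℂ] Laurent A where
  toFun x := HahnSeries.truncLT (1 : ℤ) x
  map_add' x y := HahnSeries.truncLT_add (1 : ℤ) x y
  map_smul' r x := HahnSeries.truncLT_smul (1 : ℤ) r x

end Laurent

/-- A Lie superalgebra over `ℂ`. The `ℤ/2`-grading is given by the parity involution `par`, with
`par a = (-1)^{p(a)} a`. -/
structure LieSuperalgebra (𝔤 : Type*) [AddCommGroup 𝔤] [Module ℂ 𝔤] where
  par : 𝔤 →ₗ[ℂ] 𝔤
  par_par : ∀ a, par (par a) = a
  br : 𝔤 →ₗ[ℂ] 𝔤 →ₗ[ℂ] 𝔤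
  par_br : ∀ a b, par (br a b) = br (par a) (par b)
  skew : ∀ (e e' : ZMod 2) (a b : 𝔤), par a = sgn e • a → par b = sgn e' • b →
    br a b = -(sgn (e * e') • br b a)
  jacobi : ∀ (e e' : ZMod 2) (a b c : 𝔤), par a = sgn e • a → par b = sgn e' • b →
    br a (br b c) = br (br a b) c + sgn (e * e') • br b (br a c)

namespace LieSuperalgebra

variable {𝔤 : Type*} [AddCommGroup 𝔤] [Module ℂ 𝔤] (L : LieSuperalgebra 𝔤)
  {R : Type*} [Ring R] [Algebra ℂ R] (τ : R →ₗ[ℂ] R)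

/-- The projection onto the part of parity `e`. -/
def proj (e : ZMod 2) : 𝔤 →ₗ[ℂ] 𝔤 := (2 : ℂ)⁻¹ • (LinearMap.id + sgn e • L.par)

/-- `parPow e a = (-1)^{e p(a)} a` for homogeneous `a`. -/
def parPow (e : ZMod 2) : 𝔤 →ₗ[ℂ] 𝔤 := if e = 0 then LinearMap.id else L.par

/-- The bracket `[a ⊗ u, b ⊗ v] = (-1)^{p(b) p(u)} [a, b] ⊗ u v` on `𝔤 ⊗ R`, for a superalgebra `R`
with parity involution `τ`; the two summands are the contributions of the even and of the odd part
of `b`. -/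
def brT : 𝔤 ⊗[ℂ] R →ₗ[ℂ] 𝔤 ⊗[ℂ] R →ₗ[ℂ] 𝔤 ⊗[ℂ] R :=
  TensorProduct.map₂ (L.br.compl₂ (L.proj 0)) (LinearMap.mul ℂ R) +
    TensorProduct.map₂ (L.br.compl₂ (L.proj 1)) ((LinearMap.mul ℂ R).comp τ)

/-- The `R`-valued form `(a ⊗ u | b ⊗ v) = (-1)^{p(b) p(u)} (a | b) u v` on `𝔤 ⊗ R`. -/
def formT (form : LinearMap.BilinForm ℂ 𝔤) : 𝔤 ⊗[ℂ] R →ₗ[ℂ] 𝔤 ⊗[ℂ] R →ₗ[ℂ] R :=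
  (TensorProduct.map₂ (form.compl₂ (L.proj 0)) (LinearMap.mul ℂ R) +
    TensorProduct.map₂ (form.compl₂ (L.proj 1)) ((LinearMap.mul ℂ R).comp τ)).compr₂
      (TensorProduct.lid ℂ R).toLinearMap

end LieSuperalgebra

/-- The algebraic data of a supersymmetric Drinfeld-Sokolov reduction: a finite-dimensional Lie
superalgebra `𝔤` with a nondegenerate even supersymmetric invariant bilinear form and a compatible
`ℤ`-grading, a homogeneous subalgebra `𝔫 ⊆ 𝔤_{>0}`, a homogeneous `𝔫`-submodule `𝔪 ⊆ 𝔫`, odd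
elements `f ∈ 𝔤_{-i}` and `s ∈ 𝔤_j` with `i, j > 0` subject to four conditions, a homogeneous basis
`(q_t)` of `𝔤` adapted to `𝔪` and to a complement `𝔟₋` of `𝔪`, and a homogeneous complement `V` of
`[f, 𝔫]` in `𝔟 = 𝔪^⊥`. -/
structure DSData (𝔤 : Type*) [AddCommGroup 𝔤] [Module ℂ 𝔤] (ι : Type*)
    extends LieSuperalgebra 𝔤 where
  -- the bilinear form
  form : LinearMap.BilinForm ℂ 𝔤
  form_nondeg : form.Nondegenerate
  form_even : ∀ a b, form (par a) (par b) = form a b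
  form_supersymm : ∀ (e e' : ZMod 2) (a b : 𝔤), par a = sgn e • a → par b = sgn e' • b →
    form a b = sgn (e * e') * form b a
  form_invariant : ∀ a b c, form (br a b) c = form a (br b c)
  -- the `ℤ`-grading
  gr : ℤ → Submodule ℂ 𝔤
  gr_internal : DirectSum.IsInternal gr
  gr_par : ∀ k, ∀ a ∈ gr k, par a ∈ gr k
  gr_br : ∀ k l, ∀ a ∈ gr k, ∀ b ∈ gr l, br a b ∈ gr (k + l)
  gr_form : ∀ k l, k + l ≠ 0 → ∀ a ∈ gr k, ∀ b ∈ gr l, form a b = 0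
  -- the subalgebra `𝔫`
  n : Submodule ℂ 𝔤
  n_par : ∀ a ∈ n, par a ∈ n
  n_gr : n ≤ ⨆ k : ℤ, ⨆ _ : 0 < k, n ⊓ gr k
  n_br : ∀ a ∈ n, ∀ b ∈ n, br a b ∈ n
  -- the `𝔫`-module `𝔪`
  m : Submodule ℂ 𝔤
  m_le_n : m ≤ n
  n_br_m : ∀ a ∈ n, ∀ b ∈ m, br a b ∈ m
  -- the basis `(q_t)`; `q_t` has parity `p t`; `𝔟₋` is the span of the `q_t` with `t ∈ I`
  q : Module.Basis ι ℂ 𝔤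
  p : ι → ZMod 2
  q_par : ∀ t, par (q t) = sgn (p t) • q t
  q_gr : ∀ t, ∃ k, q t ∈ gr k
  I : Set ι
  span_q : Submodule.span ℂ (q '' Iᶜ) = m
  -- the odd elements `f` and `s`
  i : ℤ
  j : ℤ
  i_pos : 0 < i
  j_pos : 0 < j
  f : 𝔤
  s : 𝔤
  f_odd : par f = -f
  s_odd : par s = -s
  f_gr : f ∈ gr (-i)
  s_gr : s ∈ gr j
  -- the conditions (A-1), ..., (A-4)
  gr_le_m : ∀ k, i ≤ k → gr k ≤ m
  br_f_n : ∀ a ∈ n, ∀ b ∈ m, form (br f a) b = 0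
  f_inj : ∀ a ∈ n, br f a = 0 → a = 0
  s_n : ∀ a ∈ n, br s a = 0
  -- the complement `V` of `[f, 𝔫]` in `𝔟`
  V : Submodule ℂ 𝔤
  V_par : ∀ a ∈ V, par a ∈ V
  V_gr : V ≤ ⨆ k : ℤ, V ⊓ gr k
  V_inf : V ⊓ n.map (br f) = ⊥
  V_sup : ∀ a, a ∈ V ⊔ n.map (br f) ↔ ∀ b ∈ m, form a b = 0

namespace DSData

variable {𝔤 : Type*} [AddCommGroup 𝔤] [Module ℂ 𝔤] {ι : Type*} [Fintype ι] [DecidableEq ι]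
  (S : DSData 𝔤 ι)

/-! ### The loop algebra -/

/-- `ĝ = 𝔤((z⁻¹)) = 𝔤 ⊗ ℂ((z⁻¹))`. -/
abbrev Loop (_ : DSData 𝔤 ι) : Type _ := 𝔤 ⊗[ℂ] Laurent ℂ

/-- The Lie superbracket of `ĝ`. -/
def loopBr : S.Loop →ₗ[ℂ] S.Loop →ₗ[ℂ] S.Loop := S.brT LinearMap.id

/-- Multiplication by `z^k` on `ĝ`. -/
def zmul (k : ℤ) : S.Loop →ₗ[ℂ] S.Loop :=
  LinearMap.lTensor 𝔤 (LinearMap.mulLeft ℂ (Laurent.mono k (1 : ℂ)))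

/-- `Λ = f + z s`. -/
def Lam : S.Loop :=
  S.f ⊗ₜ Laurent.mono 0 (1 : ℂ) + S.s ⊗ₜ Laurent.mono 1 (1 : ℂ)

/-- `Λ² = [Λ, Λ] / 2`. -/
def LamSq : S.Loop := (2 : ℂ)⁻¹ • S.loopBr S.Lam S.Lam

/-- Condition (A-5): `ĝ = ker ad Λ² ⊕ im ad Λ²`. -/
def SemisimpleLamSq : Prop :=
  IsCompl (LinearMap.ker (S.loopBr S.LamSq)) (LinearMap.range (S.loopBr S.LamSq))

/-- The center `𝒵` of `𝒦 = ker ad Λ²`. -/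
def center : Submodule ℂ S.Loop where
  carrier := {C | S.loopBr S.LamSq C = 0 ∧ ∀ X, S.loopBr S.LamSq X = 0 → S.loopBr C X = 0}
  add_mem' := by
    rintro a b ⟨h1, h2⟩ ⟨h3, h4⟩
    exact ⟨by simp [h1, h3], fun X hX => by simp [h2 X hX, h4 X hX]⟩
  zero_mem' := by simp
  smul_mem' := by
    rintro r a ⟨h1, h2⟩
    exact ⟨by simp [h1], fun X hX => by simp [h2 X hX]⟩

/-- `C ∈ ĝ` is homogeneous of parity `e`. -/
def HasParity (e : ZMod 2) (C : S.Loop) : Prop :=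
  LinearMap.rTensor (Laurent ℂ) S.par C = sgn e • C

/-! ### Differential polynomials -/

/-- The parity `p(t) + 1 + n` of the variable `q̄_t^{(n)}`. -/
def varPar (x : ι × ℕ) : ZMod 2 := S.p x.1 + 1 + (x.2 : ZMod 2)

/-- The superalgebra `𝒫(ḡ) = S(ℂ[D] ⊗ ḡ)` of differential polynomials in the variables `q̄_t`. -/
abbrev A : Type _ := SuperPoly S.varPar

/-- The variable `q̄_t^{(n)} = D^n q̄_t`. -/
def qbar (t : ι) (n : ℕ) : S.A := SuperPoly.gen S.varPar (t, n)

/-- The odd derivation `D` of `𝒫(ḡ)` with `D q̄_t^{(n)} = q̄_t^{(n+1)}`. -/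
def D : S.A →ₗ[ℂ] S.A :=
  SuperPoly.der S.varPar 1 (fun x => S.qbar x.1 (x.2 + 1)) (fun x => by
    have h : S.varPar (x.1, x.2 + 1) = 1 + S.varPar x := by
      simp only [varPar]; push_cast; ring
    rw [← h]
    exact SuperPoly.σ_gen S.varPar (x.1, x.2 + 1))

/-- `(-1)^{e p(a)} a` for homogeneous `a ∈ 𝒫(ḡ)`. -/
abbrev pp (e : ZMod 2) : S.A →ₐ[ℂ] S.A := SuperPoly.parPow S.varPar e

/-- The subalgebra `𝒫 = S(ℂ[D] ⊗ 𝔟̄₋)` of `𝒫(ḡ)`. -/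
def P : Subalgebra ℂ S.A := Algebra.adjoin ℂ {a | ∃ t ∈ S.I, ∃ n, a = S.qbar t n}

/-- `d` is a derivation of `𝒫(ḡ)` of parity `e`. -/
def IsDer (e : ZMod 2) (d : S.A →ₗ[ℂ] S.A) : Prop :=
  (∀ a, S.pp 1 (d (S.pp 1 a)) = sgn e • d a) ∧ ∀ a b, d (a * b) = d a * b + S.pp e a * d b

/-- The linear maps `d` and `d'` of parities `e` and `e'` supercommute. -/
def SuperComm (e e' : ZMod 2) (d d' : S.A →ₗ[ℂ] S.A) : Prop :=
  ∀ a, d (d' a) = sgn (e * e') • d' (d a)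

/-! ### The second `χ`-bracket -/

/-- `𝒫(ḡ)[χ]`; the family `(a_n)` stands for `∑ χ^n a_n`, with `χ` odd. -/
abbrev Chi : Type _ := ℕ →₀ S.A

/-- The operator `χ + D` on `𝒫(ḡ)[χ]`, where `D χ = - χ D - 2 χ²`, hence
`D χ^n a = (-1)^n χ^n D a - 2 χ^{n+1} a` for odd `n` and `D χ^n a = χ^n D a` for even `n`. -/
def chiD : S.Chi →ₗ[ℂ] S.Chi :=
  Finsupp.lsum ℂ fun n : ℕ =>
    (Finsupp.lsingle (n + 1) : S.A →ₗ[ℂ] S.Chi) +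
      (sgn (n : ZMod 2) • (Finsupp.lsingle n : S.A →ₗ[ℂ] S.Chi).comp S.D -
        (if Odd n then (2 : ℂ) else 0) • (Finsupp.lsingle (n + 1) : S.A →ₗ[ℂ] S.Chi))

/-- `b ↦ (∑ χ^n a_n) b = ∑ χ^n a_n b`. -/
def chiMul (Y : S.Chi) : S.A →ₗ[ℂ] S.Chi where
  toFun b := Finsupp.mapRange.linearMap (LinearMap.mulRight ℂ b) Y
  map_add' b c := by ext n; simp [mul_add]
  map_smul' r b := by ext n; simp

/-- The bracket of two variables, `{ā _χ b̄}₂ = (-1)^{p(a)+1} (s | [a, b])` for `a = q_k`,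
`b = q_l`. -/
def brVars (k l : ι) : ℂ := sgn (S.p k + 1) * S.form S.s (S.br (S.q k) (S.q l))

/-- `{a _χ q̄_l}₂ = ∑_{k, m} ± {q̄_k _χ q̄_l}₂ (χ + D)^m (∂a / ∂q̄_k^{(m)})`. With `k` and `l` short for
the parities of `q̄_k` and `q̄_l`, the sign is `(-1)^{l (p(a) + k + m) + m (k + l + 1) + m (m - 1) / 2}`.
-/
def brLeft (l : ι) : S.A →ₗ[ℂ] S.Chi :=
  (Finsupp.lsum ℂ fun x : ι × ℕ =>
    (sgn (S.varPar (l, 0) * (S.varPar (x.1, 0) + x.2) +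
        x.2 * (S.varPar (x.1, 0) + S.varPar (l, 0) + 1) + ((x.2 * (x.2 - 1) / 2 : ℕ) : ZMod 2)) *
      S.brVars x.1 l) •
      (S.chiD ^ x.2).comp (Finsupp.lsingle 0 : S.A →ₗ[ℂ] S.Chi)).comp
  ((SuperPoly.grad S.varPar).comp (S.pp (S.varPar (l, 0))).toLinearMap)

/-- `{a _χ q̄_l^{(n)}}₂ = (-1)^{n (p(a) + 1)} (χ + D)^n {a _χ q̄_l}₂`. -/
def brLeftDer (x : ι × ℕ) (a : S.A) : S.Chi :=
  sgn (x.2 : ZMod 2) • (S.chiD ^ x.2) (S.brLeft x.1 (S.pp (x.2 : ZMod 2) a))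

/-- The second `χ`-bracket of the affine SUSY Poisson vertex algebra, extended from the variables
to `𝒫(ḡ)` by sesquilinearity and by the Leibniz rules, that is, through the super master formula:
`{a _χ b}₂ = ∑_{l, n} {a _χ q̄_l^{(n)}}₂ (∂b / ∂q̄_l^{(n)})`. -/
def chiBr (a : S.A) : S.A →ₗ[ℂ] S.Chi :=
  (Finsupp.lsum ℂ fun x : ι × ℕ => S.chiMul (S.brLeftDer x a)).comp (SuperPoly.grad S.varPar)

/-- The super Hamiltonian vector field `b ↦ {∫h _χ b}₂ |_{χ = 0}` of `∫h`. -/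
def ham (h : S.A) : S.A →ₗ[ℂ] S.A := (Finsupp.lapply 0).comp (S.chiBr h)

/-- The projection `a ↦ ∫a` of `𝒫(ḡ)` onto the functionals `𝒫(ḡ) / D 𝒫(ḡ)`. -/
def functional : S.A →ₗ[ℂ] S.A ⧸ LinearMap.range S.D := (LinearMap.range S.D).mkQ

/-! ### Lax operators -/

/-- The parity involution of `𝔤 ⊗ 𝒫(ḡ)`. -/
def parTens : 𝔤 ⊗[ℂ] S.A →ₗ[ℂ] 𝔤 ⊗[ℂ] S.A := TensorProduct.map S.par (S.pp 1).toLinearMap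

/-- `U ⊗ B` as a subspace of `𝔤 ⊗ 𝒫(ḡ)`. -/
def tens (U : Submodule ℂ 𝔤) (B : Subalgebra ℂ S.A) : Submodule ℂ (𝔤 ⊗[ℂ] S.A) :=
  LinearMap.range (TensorProduct.map U.subtype B.val.toLinearMap)

/-- `ĝ ⊗ 𝒫(ḡ)`, in the completed sense: Laurent series in `z⁻¹` with coefficients in
`𝔤 ⊗ 𝒫(ḡ)`, as `𝔤 ⊗ 𝒫(ḡ)((z⁻¹))`. -/
abbrev G : Type _ := 𝔤 ⊗[ℂ] Laurent S.A

/-- The coefficient of `z^k`. -/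
def zcoeff (k : ℤ) : S.G →ₗ[ℂ] 𝔤 ⊗[ℂ] S.A :=
  LinearMap.lTensor 𝔤 (Laurent.coeff k)

/-- `∑_{k ≥ 0} X_k z^k`. -/
def posPart : S.G →ₗ[ℂ] S.G := LinearMap.lTensor 𝔤 Laurent.posPart

/-- The inclusion of `𝔤 ⊗ 𝒫(ḡ)`. -/
def const : 𝔤 ⊗[ℂ] S.A →ₗ[ℂ] S.G :=
  LinearMap.lTensor 𝔤 (Laurent.mono 0)

/-- `C ↦ C ⊗ 1`. -/
def tensOne : S.Loop →ₗ[ℂ] S.G := LinearMap.lTensor 𝔤 (Laurent.map (Algebra.linearMap ℂ S.A))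

/-- The parity involution of `ĝ ⊗ 𝒫(ḡ)`. -/
def parG : S.G →ₗ[ℂ] S.G := TensorProduct.map S.par (Laurent.map (S.pp 1).toLinearMap)

/-- The Lie superbracket of `ĝ ⊗ 𝒫(ḡ)`. -/
def brG : S.G →ₗ[ℂ] S.G →ₗ[ℂ] S.G := S.brT (Laurent.map (S.pp 1).toLinearMap)

/-- The bilinear form `(a z^m ⊗ u | b z^n ⊗ v) = (-1)^{p(b) p(u)} δ_{m+n,0} (a | b) u v`. -/
def formG (X Y : S.G) : S.A :=
  Laurent.coeff 0 (S.formT (Laurent.map (S.pp 1).toLinearMap) S.form X Y)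

/-- `[D, a ⊗ u] = (-1)^{p(a)} a ⊗ D u`. -/
def DG : S.G →ₗ[ℂ] S.G := TensorProduct.map S.par (Laurent.map S.D)

/-- The triple `(α, β, X)` stands for `α D + β D² + X` in `ℂ[D] ⋉ (ĝ ⊗ 𝒫(ḡ))`. -/
abbrev Op : Type _ := ℂ × ℂ × S.G

/-- The Lie superbracket of `ℂ[D] ⋉ (ĝ ⊗ 𝒫(ḡ))`: `[D, D] = 2 D²`, `[D, X] = DG X`,
`[X, D] = - (-1)^{p(X)} [D, X]`, `[D², X] = DG (DG X) = - [X, D²]`. -/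
def opBr (x y : S.Op) : S.Op :=
  (0, 2 * x.1 * y.1,
    S.brG x.2.2 y.2.2 + x.1 • S.DG y.2.2 + x.2.1 • S.DG (S.DG y.2.2) -
      y.1 • S.DG (S.parG x.2.2) - y.2.1 • S.DG (S.DG x.2.2))

/-- The inclusion of `ĝ ⊗ 𝒫(ḡ)`. -/
def op (X : S.G) : S.Op := (0, 0, X)

/-- `y = e^{ad U} x`: in each power of `z` the series `∑ (ad U)^k x / k!` has finitely many
nonzero terms, and its sum is `y`. -/
def IsExpAd (U : S.G) (x y : S.Op) : Prop :=
  y.1 = x.1 ∧ y.2.1 = x.2.1 ∧ ∀ l : ℤ,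
    (Function.support fun k : ℕ => S.zcoeff l (((S.opBr (S.op U))^[k] x).2.2)).Finite ∧
    S.zcoeff l y.2.2 =
      ∑ᶠ k : ℕ, ((k.factorial : ℂ)⁻¹) • S.zcoeff l (((S.opBr (S.op U))^[k] x).2.2)

open Classical in
/-- `e^{ad U} x`. -/
def expAd (U : S.G) (x : S.Op) : S.Op :=
  if h : ∃ y, S.IsExpAd U x y then h.choose else 0

/-- `ℒ(𝒬) = D + 𝒬 + f ⊗ 1`. -/
def lax (Q : 𝔤 ⊗[ℂ] S.A) : S.Op := (1, 0, S.const (Q + S.f ⊗ₜ 1))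

/-- `ℒ_s(𝒬) = D + 𝒬 + Λ ⊗ 1`. -/
def laxS (Q : 𝔤 ⊗[ℂ] S.A) : S.Op := (1, 0, S.const Q + S.tensOne S.Lam)

/-- `𝔟 = 𝔪^⊥`. -/
def b : Submodule ℂ 𝔤 where
  carrier := {a | ∀ c ∈ S.m, S.form a c = 0}
  add_mem' := by intro a b ha hb c hc; simp [ha c hc, hb c hc]
  zero_mem' := by intro c _; simp
  smul_mem' := by intro r a ha c hc; simp [ha c hc]

/-- The basis `(q^t)` dual to `(q_t)`: `(q^t | q_t') = δ_{t,t'}`. -/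
def qd : Module.Basis ι ℂ 𝔤 := S.form.dualBasis S.form_nondeg S.q

open Classical in
/-- `𝒬_u = ∑_{t ∈ I} q^t ⊗ q̄_t`. -/
def Qu : 𝔤 ⊗[ℂ] S.A := ∑ t, if t ∈ S.I then S.qd t ⊗ₜ S.qbar t 0 else 0

/-- The universal Lax operator `ℒ_s = ℒ_s(𝒬_u)`. -/
def L : S.Op := S.laxS S.Qu

/-! ### The canonical form and the dressing -/

/-- `𝒬ᶜ ∈ (V ⊗ 𝒫)_1` and `ℒ(𝒬ᶜ) = e^{ad N} ℒ(𝒬_u)` for some `N ∈ (𝔫 ⊗ 𝒫)_0`. -/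
def IsCanonical (Qc : 𝔤 ⊗[ℂ] S.A) : Prop :=
  Qc ∈ S.tens S.V S.P ∧ S.parTens Qc = -Qc ∧
    ∃ N ∈ S.tens S.n S.P, S.parTens N = N ∧ S.IsExpAd (S.const N) (S.lax S.Qu) (S.lax Qc)

open Classical in
/-- The canonical form `𝒬_u^c` of `𝒬_u`. -/
def Qc : 𝔤 ⊗[ℂ] S.A := if h : ∃ Q, S.IsCanonical Q then h.choose else 0

/-- `𝒫_𝒬`, the differential superalgebra generated by the coefficients of `𝒬`. -/
def PQ (Q : 𝔤 ⊗[ℂ] S.A) : Subalgebra ℂ S.A :=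
  Algebra.adjoin ℂ {a | ∃ (φ : Module.Dual ℂ 𝔤) (n : ℕ),
    a = (S.D ^ n) (TensorProduct.lid ℂ S.A (LinearMap.rTensor S.A φ Q))}

/-- `⨁_{k > d} 𝔤_k`. -/
def grGT (d : ℤ) : Submodule ℂ 𝔤 := ⨆ k : ℤ, ⨆ _ : d < k, S.gr k

/-- `(T, H)` is the pair attached to `𝒬`: `T ∈ ℐ ⊗ 𝒫_𝒬` and `H ∈ 𝒦 ⊗ 𝒫_𝒬`, where `𝒦` and `ℐ` are
the kernel and the image of `ad Λ²`, the element `T` is even of positive degree (`z` has degree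
`-i-j`), and `e^{ad T} [ℒ_s(𝒬), ℒ_s(𝒬)] / 2 = D² + H + Λ² ⊗ 1`. -/
structure IsDressing (Q : 𝔤 ⊗[ℂ] S.A) (T H : S.G) : Prop where
  T_even : S.parG T = T
  T_pos : ∀ l : ℤ, S.zcoeff l T ∈ S.tens (S.grGT (l * (S.i + S.j))) (S.PQ Q)
  T_image : T ∈ LinearMap.range (S.brG (S.tensOne S.LamSq))
  H_coeff : ∀ l : ℤ, S.zcoeff l H ∈ S.tens ⊤ (S.PQ Q)
  H_ker : S.brG (S.tensOne S.LamSq) H = 0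
  eq : S.IsExpAd T ((2 : ℂ)⁻¹ • S.opBr (S.laxS Q) (S.laxS Q)) (0, 1, H + S.tensOne S.LamSq)

open Classical in
/-- `T_𝒬`. -/
def dressing (Q : 𝔤 ⊗[ℂ] S.A) : S.G :=
  if h : ∃ T, ∃ H, S.IsDressing Q T H then h.choose else 0

/-- `K_𝒬 = e^{ad T_𝒬} ℒ_s(𝒬) - D - Λ ⊗ 1`. -/
def K (Q : 𝔤 ⊗[ℂ] S.A) : S.G :=
  (S.expAd (S.dressing Q) (S.laxS Q)).2.2 - S.tensOne S.Lam

/-- `h_C = (K^c | C ⊗ 1)`, where `K^c = K_𝒬` for the canonical form `𝒬` of `𝒬_u`. -/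
def h (C : S.Loop) : S.A := S.formG (S.K S.Qc) (S.tensOne C)

/-- `M_C = e^{- ad T} (C ⊗ 1)`, where `T = T_𝒬` for `𝒬 = 𝒬_u`. -/
def M (C : S.Loop) : S.G := (S.expAd (-S.dressing S.Qu) (S.op (S.tensOne C))).2.2

/-- `[M_C^+, ℒ_s]`. -/
def laxRHS (C : S.Loop) : S.Op := S.opBr (S.op (S.posPart (S.M C))) S.L

/-- The derivation `d/dt_C = {∫h_C _χ •}₂ |_{χ = 0}` of `𝒫(ḡ)`. -/
def flow (C : S.Loop) : S.A →ₗ[ℂ] S.A := S.ham (S.h C)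

/-- The extension of a derivation `d` of `𝒫(ḡ)` of parity `e` to Lax operators:
`a ⊗ u ↦ (-1)^{e p(a)} a ⊗ d u`, with `D ↦ 0`. -/
def extDer (e : ZMod 2) (d : S.A →ₗ[ℂ] S.A) (x : S.Op) : S.Op :=
  S.op (TensorProduct.map (S.parPow e) (Laurent.map d) x.2.2)

/-- `d` is an evolutionary derivation (a derivation of parity `e` that supercommutes with `D`) that
solves the Lax equation `d ℒ_s = [M_C^+, ℒ_s]`. -/
def SolvesLax (e : ZMod 2) (C : S.Loop) (d : S.A →ₗ[ℂ] S.A) : Prop :=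
  S.IsDer e d ∧ S.SuperComm e 1 d S.D ∧ S.extDer e d S.L = S.laxRHS C

end DSData

end SuperDS

end

/-!
The proof works in the Lie superalgebra of operators `c D + c' D² + X` with `X ∈ ĝ ⊗ 𝒫(ḡ)` (`Op`,
with the bracket `opB`), which is complete for the filtration by degree (`Fil`, `filOp`), where `z`
has degree `-i-j`. An even `T` of positive degree raises this filtration, so that `e^{ad T}`
converges and is an automorphism compatible with parity, the bilinear form and powers of `z`. What
is needed of products of such exponentials is collected in the structure `Gauge`, together with
their logarithmic derivatives along derivations of `𝒫(ḡ)` (`Filt.exp_derivative`).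

*Existence.* The dressing `T_𝒬` and the canonical form `𝒬^c` are found degree by degree
(`exists_solution`). Since `ĝ = 𝒦 ⊕ ℐ`, the operator `ad Λ²` has a pseudoinverse `B` that commutes
with all natural operations (`exists_isPinv`); a correction `T ↦ T + B² (ad Λ²) X` removes the
leading term of the component in `ℐ` of the transformed operator `X`, which gives `exists_dressing`.
In the same way an inverse of `ad f : 𝔫 → [f, 𝔫]` gives `exists_isCanonical`.

*A single diagonalization.* In the statement `h_C` is built from `𝒬^c` and `M_C` from `𝒬_u`. Both
`𝒬_u` and `𝒬^c` are dressed by transformations without constant term (`IsDressing.degG_zero`,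
`degG_zero_gauge`). If `E` and `E'` are two such diagonalizations of `½ [ℒ_s, ℒ_s]` and `C ∈ 𝒵`,
then `E E'⁻¹ C` lies in the kernel of `ad Λ²` (`adSq_eq_zero`) and has the constant term `C`, and
since `D` kills only constants, `E E'⁻¹ C = C` (`IsDiag.onG_invG_center`). Hence one diagonalization
`E` serves for everything (`exists_isDiag`): with `E ℒ_s = D + Y` one has `M_C = E⁻¹ C` and, up to a
constant, `h_C = (Y | C)`.

*The flows.* The variation of `(Y | C)` along a derivation `δ` is `(δ ℒ_s | M_C)` up to terms that
are total derivatives for evolutionary `δ` and that cancel in variational derivatives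
(`IsDiag.der_ham`): the contribution of the logarithmic derivative of `E` has this form because `C`
commutes with `Y ∈ 𝒦 ⊗ 𝒫`. Therefore the variational derivatives of `h_C` are the coefficients of
the constant term of `M_C` in `z` (`IsDiag.varD_ham`). Since `M_C` commutes with `ℒ_s`, and `z`
enters `ℒ_s` only through `z s`, the bracket `[M_C^+, ℒ_s]` does not involve `z` (`opB_posPart_L`).
A comparison of coordinates then puts the Hamiltonian flow in Lax form (`IsDiag.extOp_flow_L`).

*Commutativity and conservation.* Along a Lax flow `δ ℒ_s = -[X, ℒ_s]` one has `δ M_C = -[X, M_C]`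
(`IsDiag.extG_invG_center`). By the `r`-matrix identity for the splitting of a Laurent series into
its nonnegative and negative powers (`residue_posPart`), two of the flows supercommute on the
variables `q̄_t`, hence everywhere (`IsDiag.flow_comm`). The variation of a density along a flow is
`-([X, ℒ_s] | M)` up to total derivatives, and by invariance of the form and `[ℒ_s, M] = 0` this is
a total derivative as well (`IsDiag.functional_flow_dens`).
-/

set_option linter.unusedSectionVars false

noncomputable section
namespace SuperDS

open scoped TensorProduct

/-! ### Signs and parity operators -/

theorem parity_cases (e : ZMod 2) : e = 0 ∨ e = 1 := by revert e; decide

@[simp] theorem sgn_zero : sgn 0 = 1 := by simp [sgn]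

@[simp] theorem sgn_one : sgn 1 = -1 := by simp [sgn]

theorem sgn_add (a b : ZMod 2) : sgn (a + b) = sgn a * sgn b := by
  have h : (1 + 1 : ZMod 2) = 0 := by decide
  rcases parity_cases a with rfl | rfl <;> rcases parity_cases b with rfl | rfl <;> simp [h]

@[simp] theorem sgn_mul_sgn (e : ZMod 2) : sgn e * sgn e = 1 := SuperPoly.sgn_mul_self e

theorem sgn_ne_zero (e : ZMod 2) : sgn e ≠ 0 := fun h => by
  have := sgn_mul_sgn e
  rw [h] at this
  simp at this

@[simp] theorem parity_add_self (e : ZMod 2) : e + e = 0 := by revert e; decide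

section pw

variable {W : Type*} [AddCommGroup W] [Module ℂ W]

/-- The power `τ ^ e` of an involution `τ`, for `e ∈ ℤ/2`. If `τ` is a parity operator, this map is
`x ↦ (-1)^{e p(x)} x`. -/
def pw (τ : W →ₗ[ℂ] W) (e : ZMod 2) : W →ₗ[ℂ] W := if e = 0 then LinearMap.id else τ

@[simp] theorem pw_zero (τ : W →ₗ[ℂ] W) : pw τ 0 = LinearMap.id := by simp [pw]

@[simp] theorem pw_one (τ : W →ₗ[ℂ] W) : pw τ 1 = τ := by simp [pw]

theorem pw_of_hom (τ : W →ₗ[ℂ] W) (e e' : ZMod 2) (x : W) (h : τ x = sgn e' • x) :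
    pw τ e x = sgn (e * e') • x := by
  rcases parity_cases e with rfl | rfl <;> simp [h]

theorem pw_add (τ : W →ₗ[ℂ] W) (hτ : ∀ x, τ (τ x) = x) (e e' : ZMod 2) (x : W) :
    pw τ (e + e') x = pw τ e (pw τ e' x) := by
  have h : (1 + 1 : ZMod 2) = 0 := by decide
  rcases parity_cases e with rfl | rfl <;> rcases parity_cases e' with rfl | rfl <;> simp [h, hτ]

/-- The projection onto the part of parity `e`. -/
def prj (τ : W →ₗ[ℂ] W) (e : ZMod 2) : W →ₗ[ℂ] W := (2 : ℂ)⁻¹ • (LinearMap.id + sgn e • τ)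

theorem prj_add_prj (τ : W →ₗ[ℂ] W) (x : W) : prj τ 0 x + prj τ 1 x = x := by
  simp only [prj, sgn_zero, sgn_one, LinearMap.smul_apply, LinearMap.add_apply, LinearMap.id_apply]
  module

theorem prj_hom (τ : W →ₗ[ℂ] W) (hτ : ∀ x, τ (τ x) = x) (e : ZMod 2) (x : W) :
    τ (prj τ e x) = sgn e • prj τ e x := by
  simp only [prj, LinearMap.smul_apply, LinearMap.add_apply, LinearMap.id_apply, map_smul, map_add,
    hτ, smul_add, smul_smul]
  rw [add_comm, show sgn e * ((2 : ℂ)⁻¹ * sgn e) = (2 : ℂ)⁻¹ * (sgn e * sgn e) by ring,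
    sgn_mul_sgn, mul_one, mul_comm (sgn e) (2 : ℂ)⁻¹]

theorem prj_of_hom (τ : W →ₗ[ℂ] W) (e e' : ZMod 2) (x : W) (h : τ x = sgn e' • x) :
    prj τ e x = if e = e' then x else 0 := by
  have h2 : (2 : ℂ)⁻¹ * (1 + 1) = 1 := by norm_num
  simp only [prj, LinearMap.smul_apply, LinearMap.add_apply, LinearMap.id_apply, h]
  rcases parity_cases e with rfl | rfl <;> rcases parity_cases e' with rfl | rfl
  · simp only [sgn_zero, if_true]; module
  · simp
  · simp
  · simp only [sgn_one, if_true]; module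

end pw

namespace SuperPoly

variable {X : Type*} (p : X → ZMod 2)

/-! ### Supercommutativity and derivations of the symmetric superalgebra -/

theorem algHom_ext' {B : Type*} [Semiring B] [Algebra ℂ B] {f g : SuperPoly p →ₐ[ℂ] B}
    (h : ∀ x, f (gen p x) = g (gen p x)) (a : SuperPoly p) : f a = g a := by
  induction a using SuperPoly.induction with
  | hs r => simp
  | hg x => exact h x
  | hm a b h1 h2 => simp [h1, h2]
  | ha a b h1 h2 => simp [h1, h2]

@[simp] theorem σ_σ (a : SuperPoly p) : σ p (σ p a) = a :=
  algHom_ext' p (f := (σ p).comp (σ p)) (g := AlgHom.id ℂ _)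
    (fun x => by simp [σ_gen, smul_smul]) a

theorem parPow_eq (e : ZMod 2) (a : SuperPoly p) :
    parPow p e a = pw (σ p).toLinearMap e a := by
  rcases parity_cases e with rfl | rfl <;> simp [parPow]

@[simp] theorem parPow_one (a : SuperPoly p) : parPow p 1 a = σ p a := by simp [parPow]

@[simp] theorem parPow_zero (a : SuperPoly p) : parPow p 0 a = a := by simp [parPow]

theorem parPow_add (e e' : ZMod 2) (a : SuperPoly p) :
    parPow p (e + e') a = parPow p e (parPow p e' a) := by
  simp only [parPow_eq]
  exact pw_add _ (σ_σ p) _ _ _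

@[simp] theorem parPow_parPow (e : ZMod 2) (a : SuperPoly p) :
    parPow p e (parPow p e a) = a := by
  rw [← parPow_add]; simp

theorem prj_mul (e : ZMod 2) (a b : SuperPoly p) :
    prj (σ p).toLinearMap e (a * b) =
      prj (σ p).toLinearMap 0 a * prj (σ p).toLinearMap e b +
        prj (σ p).toLinearMap 1 a * prj (σ p).toLinearMap (e + 1) b := by
  simp only [prj, sgn_add, sgn_zero, sgn_one, LinearMap.smul_apply, LinearMap.add_apply,
    LinearMap.id_apply, AlgHom.toLinearMap_apply, map_mul, add_mul, mul_add,
    smul_add, smul_smul, mul_smul_comm, smul_mul_assoc]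
  module

theorem prj_mul_comm (e : ZMod 2) (a b : SuperPoly p) :
    prj (σ p).toLinearMap e a * b = parPow p e b * prj (σ p).toLinearMap e a := by
  induction a using SuperPoly.induction generalizing e b with
  | hs r =>
    have h : (σ p).toLinearMap (algebraMap ℂ _ r) = sgn 0 • algebraMap ℂ (SuperPoly p) r := by simp
    rw [prj_of_hom _ _ _ _ h]
    split_ifs with h0
    · subst h0; rw [parPow_zero, Algebra.commutes]
    · simp
  | hg x =>
    rw [prj_of_hom _ _ (p x) _ (σ_gen p x)]
    split_ifs with h0
    · subst h0; exact gen_mul p x b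
    · simp
  | hm c d h1 h2 =>
    rw [prj_mul, add_mul, mul_assoc, mul_assoc, h2, h2, ← mul_assoc, ← mul_assoc, h1, h1,
      mul_add, ← mul_assoc, ← mul_assoc, ← parPow_add, ← parPow_add]
    congr 4
    · rw [zero_add]
    · rw [add_comm, add_assoc]; simp
  | ha c d h1 h2 => rw [map_add, add_mul, h1, h2, mul_add]

theorem mul_comm_of_hom (e : ZMod 2) (a b : SuperPoly p) (h : σ p a = sgn e • a) :
    a * b = parPow p e b * a := by
  have := prj_mul_comm p e a b
  rwa [prj_of_hom _ _ _ _ h, if_pos rfl] at this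

/-- `d` is a superderivation of parity `e`; the first condition says that `d` has parity `e`. -/
def IsSDer (e : ZMod 2) (d : SuperPoly p →ₗ[ℂ] SuperPoly p) : Prop :=
  (∀ a, σ p (d a) = sgn e • d (σ p a)) ∧ ∀ a b, d (a * b) = d a * b + parPow p e a * d b

variable {p}

theorem IsSDer.map_one {e : ZMod 2} {d : SuperPoly p →ₗ[ℂ] SuperPoly p} (h : IsSDer p e d) :
    d 1 = 0 := by
  have := h.2 1 1
  simpa using this

theorem IsSDer.map_algebraMap {e : ZMod 2} {d : SuperPoly p →ₗ[ℂ] SuperPoly p} (h : IsSDer p e d)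
    (r : ℂ) : d (algebraMap ℂ _ r) = 0 := by
  rw [Algebra.algebraMap_eq_smul_one, map_smul, h.map_one, smul_zero]

theorem IsSDer.ext {e : ZMod 2} {d d' : SuperPoly p →ₗ[ℂ] SuperPoly p} (h : IsSDer p e d)
    (h' : IsSDer p e d') (hg : ∀ x, d (gen p x) = d' (gen p x)) (a : SuperPoly p) : d a = d' a := by
  induction a using SuperPoly.induction with
  | hs r => rw [h.map_algebraMap, h'.map_algebraMap]
  | hg x => exact hg x
  | hm a b h1 h2 => rw [h.2, h'.2, h1, h2]
  | ha a b h1 h2 => rw [map_add, map_add, h1, h2]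

theorem IsSDer.map_parPow {e : ZMod 2} {d : SuperPoly p →ₗ[ℂ] SuperPoly p} (h : IsSDer p e d)
    (e' : ZMod 2) (a : SuperPoly p) : parPow p e' (d a) = sgn (e * e') • d (parPow p e' a) := by
  rcases parity_cases e' with rfl | rfl <;> simp [h.1]

theorem IsSDer.smul {e : ZMod 2} {d : SuperPoly p →ₗ[ℂ] SuperPoly p} (h : IsSDer p e d) (r : ℂ) :
    IsSDer p e (r • d) := by
  refine ⟨fun a => ?_, fun a b => ?_⟩
  · simp only [LinearMap.smul_apply, map_smul, h.1]; module
  · simp only [LinearMap.smul_apply, h.2, smul_add, smul_mul_assoc, mul_smul_comm]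

theorem IsSDer.neg {e : ZMod 2} {d : SuperPoly p →ₗ[ℂ] SuperPoly p} (h : IsSDer p e d) :
    IsSDer p e (-d) := by
  refine ⟨fun a => ?_, fun a b => ?_⟩
  · simp only [LinearMap.neg_apply, map_neg, h.1, smul_neg]
  · simp only [LinearMap.neg_apply, h.2, neg_add, neg_mul, mul_neg]

/-- The supercommutator of two superderivations is a superderivation. -/
theorem IsSDer.comm {e e' : ZMod 2} {d d' : SuperPoly p →ₗ[ℂ] SuperPoly p} (h : IsSDer p e d)
    (h' : IsSDer p e' d') : IsSDer p (e + e') (d ∘ₗ d' - sgn (e * e') • d' ∘ₗ d) := by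
  refine ⟨fun a => ?_, fun a b => ?_⟩
  · simp only [LinearMap.sub_apply, LinearMap.comp_apply, LinearMap.smul_apply, map_sub, map_smul,
      h.1, h'.1, sgn_add, smul_smul, smul_sub]
    module
  · simp only [LinearMap.sub_apply, LinearMap.comp_apply, LinearMap.smul_apply, h.2, h'.2, map_add,
      h.map_parPow, h'.map_parPow, parPow_add, smul_mul_assoc]
    have h1 : ∀ x, parPow p e' (parPow p e x) = parPow p e (parPow p e' x) := fun x => by
      rw [← parPow_add, add_comm, parPow_add]
    simp only [h1, sub_mul, mul_sub, smul_add, smul_smul, mul_comm e' e, mul_smul_comm,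
      smul_mul_assoc, sgn_mul_sgn, one_smul]
    abel

theorem der_isSDer {e : ZMod 2} {v : X → SuperPoly p} {hv : ∀ x, σ p (v x) = sgn (e + p x) • v x} :
    IsSDer p e (der p e v hv) := by
  refine ⟨fun a => ?_, der_mul⟩
  induction a using SuperPoly.induction with
  | hs r => simp [der_algebraMap]
  | hg x => simp [der_gen, hv, σ_gen, sgn_add, smul_smul]
  | hm a b h1 h2 =>
    have h3 : ∀ x, σ p (SuperPoly.parPow p e x) = SuperPoly.parPow p e (σ p x) := fun x => by
      rw [← parPow_one, ← parPow_one, ← parPow_add, ← parPow_add, add_comm]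
    simp only [der_mul, map_add, map_mul, h1, h2, h3, smul_add, smul_mul_assoc, mul_smul_comm]
  | ha a b h1 h2 => simp only [map_add, h1, h2, smul_add]

theorem pderiv_isSDer [DecidableEq X] (x : X) : IsSDer p (p x) (pderiv p x) := der_isSDer

theorem pderiv_gen [DecidableEq X] (x y : X) :
    pderiv p x (gen p y) = if y = x then 1 else 0 := der_gen y

theorem grad_apply [DecidableEq X] (a : SuperPoly p) (x : X) : grad p a x = pderiv p x a := rfl

/-- A superderivation is determined by the gradient: `d a = ∑ d(x) ∂a/∂x`. -/
theorem IsSDer.eq_sum_grad [DecidableEq X] {e : ZMod 2} {d : SuperPoly p →ₗ[ℂ] SuperPoly p}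
    (h : IsSDer p e d) (a : SuperPoly p) :
    d a = (grad p a).sum fun x c => d (gen p x) * c := by
  have key : ∀ a, (Finsupp.lsum ℂ fun x => LinearMap.mulLeft ℂ (d (gen p x))).comp (grad p) a =
      (grad p a).sum fun x c => d (gen p x) * c := fun a => rfl
  rw [← key]
  have hpar : ∀ x, σ p (d (gen p x)) = sgn (e + p x) • d (gen p x) := fun x => by
    rw [h.1, σ_gen, map_smul, smul_smul, sgn_add]
  have hs : ∀ (a : SuperPoly p) (s : Finset X), (grad p a).support ⊆ s →
      (Finsupp.lsum ℂ fun x => LinearMap.mulLeft ℂ (d (gen p x))).comp (grad p) a =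
        ∑ x ∈ s, d (gen p x) * pderiv p x a := fun a s hs => by
    rw [key, Finsupp.sum_of_support_subset _ hs _ (by simp)]
    rfl
  classical
  induction a using SuperPoly.induction with
  | hs r =>
    rw [h.map_algebraMap, hs _ _ subset_rfl]
    simp [(pderiv_isSDer _).map_algebraMap]
  | hg y =>
    rw [hs _ ((grad p (gen p y)).support ∪ {y}) Finset.subset_union_left]
    simp [pderiv_gen]
  | hm a b h1 h2 =>
    set s := (grad p (a * b)).support ∪ ((grad p a).support ∪ (grad p b).support)
    rw [hs (a * b) s Finset.subset_union_left]
    rw [hs a s (fun x hx => by simp [s] at hx ⊢; tauto)] at h1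
    rw [hs b s (fun x hx => by simp [s] at hx ⊢; tauto)] at h2
    rw [h.2, h1, h2, Finset.sum_mul, Finset.mul_sum, ← Finset.sum_add_distrib]
    refine Finset.sum_congr rfl fun x _ => ?_
    have h3 : d (gen p x) * SuperPoly.parPow p (p x) a = SuperPoly.parPow p e a * d (gen p x) := by
      rw [mul_comm_of_hom p _ _ _ (hpar x), parPow_add, parPow_parPow]
    rw [(pderiv_isSDer x).2, mul_add, ← mul_assoc, ← mul_assoc, ← mul_assoc, h3]
  | ha a b h1 h2 => rw [map_add, map_add, h1, h2]

/-! ### The grading by polynomial degree -/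

open Polynomial in
/-- The algebra morphism `x ↦ λ x` into `SuperPoly p [λ]`. -/
def gradHom (p : X → ZMod 2) : SuperPoly p →ₐ[ℂ] (SuperPoly p)[X] :=
  lift p (fun x => monomial 1 (gen p x)) fun x y => by
    rw [monomial_mul_monomial, monomial_mul_monomial, gen_comm p x y, smul_monomial]

/-- The component of polynomial degree `r`. -/
def degPart (p : X → ZMod 2) (r : ℕ) : SuperPoly p →ₗ[ℂ] SuperPoly p where
  toFun a := (gradHom p a).coeff r
  map_add' a b := by simp
  map_smul' c a := by simp

theorem degPart_gen (r : ℕ) (x : X) : degPart p r (gen p x) = if r = 1 then gen p x else 0 := by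
  simp [degPart, gradHom, lift_gen, Polynomial.coeff_monomial, eq_comm]

theorem degPart_algebraMap (r : ℕ) (c : ℂ) :
    degPart p r (algebraMap ℂ _ c) = if r = 0 then algebraMap ℂ _ c else 0 := by
  have : (gradHom p) (algebraMap ℂ _ c) = Polynomial.C (algebraMap ℂ (SuperPoly p) c) := by
    rw [AlgHom.commutes]; rfl
  simp [degPart, this, Polynomial.coeff_C]

theorem degPart_mul (r : ℕ) (a b : SuperPoly p) :
    degPart p r (a * b) =
      ∑ x ∈ Finset.HasAntidiagonal.antidiagonal r, degPart p x.1 a * degPart p x.2 b := by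
  simp [degPart, Polynomial.coeff_mul]

theorem eq_zero_of_degPart {a : SuperPoly p} (h : ∀ r, degPart p r a = 0) : a = 0 := by
  have h1 : gradHom p a = 0 := Polynomial.ext fun r => by simpa [degPart] using h r
  have h2 : ∀ a, (Polynomial.eval₂RingHom' (AlgHom.id ℂ (SuperPoly p)).toRingHom (1 : SuperPoly p)
      (fun a => (Commute.one_right _))) (gradHom p a) = a := fun a => by
    induction a using SuperPoly.induction with
    | hs r =>
      rw [AlgHom.commutes, Polynomial.algebraMap_apply]; simp
    | hg x => simp [gradHom, lift_gen]
    | hm a b h1 h2 => rw [map_mul, map_mul, h1, h2]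
    | ha a b h1 h2 => rw [map_add, map_add, h1, h2]
  rw [← h2 a, h1, map_zero]

theorem exists_degPart_zero (a : SuperPoly p) : ∃ c : ℂ, degPart p 0 a = algebraMap ℂ _ c := by
  induction a using SuperPoly.induction with
  | hs r => exact ⟨r, by simp [degPart_algebraMap]⟩
  | hg x => exact ⟨0, by simp [degPart_gen]⟩
  | hm a b h1 h2 =>
    obtain ⟨c, hc⟩ := h1
    obtain ⟨d, hd⟩ := h2
    exact ⟨c * d, by simp [degPart_mul, hc, hd]⟩
  | ha a b h1 h2 =>
    obtain ⟨c, hc⟩ := h1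
    obtain ⟨d, hd⟩ := h2
    exact ⟨c + d, by simp [hc, hd]⟩

theorem degPart_parPow (r : ℕ) (e : ZMod 2) (a : SuperPoly p) :
    degPart p r (parPow p e a) = parPow p e (degPart p r a) := by
  induction a using SuperPoly.induction generalizing r with
  | hs c => simp only [AlgHom.commutes, degPart_algebraMap]; split_ifs <;> simp
  | hg x =>
    rw [parPow_of_hom p e _ _ (σ_gen p x), map_smul, degPart_gen]
    split_ifs
    · rw [parPow_of_hom p e _ _ (σ_gen p x)]
    · simp
  | hm a b h1 h2 => simp [degPart_mul, h1, h2]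
  | ha a b h1 h2 => simp [h1, h2]

/-- A derivation that is linear on the generators respects the polynomial degree. -/
theorem degPart_der {e : ZMod 2} {d : SuperPoly p →ₗ[ℂ] SuperPoly p} (h : IsSDer p e d)
    (hg : ∀ x r, degPart p r (d (gen p x)) = if r = 1 then d (gen p x) else 0) (r : ℕ)
    (a : SuperPoly p) : degPart p r (d a) = d (degPart p r a) := by
  induction a using SuperPoly.induction generalizing r with
  | hs c => rw [h.map_algebraMap, degPart_algebraMap]; split_ifs <;> simp [h.map_algebraMap]
  | hg x => rw [hg, degPart_gen]; split_ifs <;> simp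
  | hm a b h1 h2 =>
    simp only [h.2, map_add, degPart_mul, degPart_parPow, map_sum, h1, h2, Finset.sum_add_distrib]
  | ha a b h1 h2 => simp [h1, h2]

/-- An element all of whose partial derivatives vanish is a constant: on the part of polynomial
degree `r`, the Euler derivation `∑ x ∂/∂x` is multiplication by `r`. -/
theorem eq_zero_of_pderiv [DecidableEq X] {a : SuperPoly p} (h0 : degPart p 0 a = 0)
    (h : ∀ x, pderiv p x a = 0) : a = 0 := by
  set E : SuperPoly p →ₗ[ℂ] SuperPoly p := der p 0 (gen p) (fun x => by simp [σ_gen]) with hE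
  have hEd : IsSDer p 0 E := der_isSDer
  have hEr : ∀ (r : ℕ) (b : SuperPoly p), degPart p r (E b) = (r : ℂ) • degPart p r b := by
    intro r b
    induction b using SuperPoly.induction generalizing r with
    | hs c =>
      rw [hEd.map_algebraMap, degPart_algebraMap]
      split_ifs with h <;> simp [h]
    | hg x =>
      rw [show E (gen p x) = gen p x from der_gen x, degPart_gen]
      split_ifs with h <;> simp [h]
    | hm b c h1 h2 =>
      rw [hEd.2, map_add, degPart_mul, degPart_mul, degPart_mul, ← Finset.sum_add_distrib,
        Finset.smul_sum]
      refine Finset.sum_congr rfl fun x hx => ?_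
      rw [h1, parPow_zero, h2, ← Finset.HasAntidiagonal.mem_antidiagonal.1 hx]
      push_cast
      rw [smul_mul_assoc, mul_smul_comm, add_smul]
    | ha b c h1 h2 => simp [h1, h2]
  have hEa : E a = 0 := by
    rw [hEd.eq_sum_grad]
    exact Finset.sum_eq_zero fun x _ => by simp [grad_apply, h]
  refine eq_zero_of_degPart fun r => ?_
  rcases eq_or_ne r 0 with rfl | hr
  · exact h0
  · have := hEr r a
    rw [hEa, map_zero] at this
    exact (smul_eq_zero.1 this.symm).resolve_left (by exact_mod_cast hr)

end SuperPoly

/-! ### The Lie superalgebra `𝔤 ⊗ R` over a supercommutative superalgebra `R` -/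

/-- `R` is a supercommutative superalgebra with parity involution `τ`. -/
structure IsSuper {R : Type*} [Ring R] [Algebra ℂ R] (τ : R →ₗ[ℂ] R) : Prop where
  map_one : τ 1 = 1
  map_mul : ∀ u v, τ (u * v) = τ u * τ v
  invol : ∀ u, τ (τ u) = u
  comm : ∀ (e e' : ZMod 2) (u v : R), τ u = sgn e • u → τ v = sgn e' • v →
    u * v = sgn (e * e') • (v * u)

/-- `δ` is a superderivation of parity `e` of the superalgebra `(R, τ)`. -/
structure IsDerOf {R : Type*} [Ring R] [Algebra ℂ R] (τ : R →ₗ[ℂ] R) (e : ZMod 2)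
    (δ : R →ₗ[ℂ] R) : Prop where
  parity : ∀ u, τ (δ u) = sgn e • δ (τ u)
  leibniz : ∀ u v, δ (u * v) = δ u * v + pw τ e u * δ v

namespace LieSuperalgebra

variable {𝔤 : Type*} [AddCommGroup 𝔤] [Module ℂ 𝔤] (L : LieSuperalgebra 𝔤)
  {R : Type*} [Ring R] [Algebra ℂ R] (τ : R →ₗ[ℂ] R)

/-- The extension `(a ⊗ u, b ⊗ v) ↦ (-1)^{p(b) p(u)} m(a, b) ⊗ u v` of a bilinear map `m`. -/
def bilT {W : Type*} [AddCommGroup W] [Module ℂ W] (m : 𝔤 →ₗ[ℂ] 𝔤 →ₗ[ℂ] W) :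
    𝔤 ⊗[ℂ] R →ₗ[ℂ] 𝔤 ⊗[ℂ] R →ₗ[ℂ] W ⊗[ℂ] R :=
  TensorProduct.map₂ (m.compl₂ (L.proj 0)) (LinearMap.mul ℂ R) +
    TensorProduct.map₂ (m.compl₂ (L.proj 1)) ((LinearMap.mul ℂ R).comp τ)

theorem formT_apply (form : LinearMap.BilinForm ℂ 𝔤) (X Y : 𝔤 ⊗[ℂ] R) :
    L.formT τ form X Y = TensorProduct.lid ℂ R (L.bilT τ form X Y) := rfl

theorem proj_eq (e : ZMod 2) : L.proj e = prj L.par e := rfl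

theorem parPow_eq_pw (e : ZMod 2) : L.parPow e = pw L.par e := rfl

/-- The parity involution of `𝔤 ⊗ R`. -/
def parT : 𝔤 ⊗[ℂ] R →ₗ[ℂ] 𝔤 ⊗[ℂ] R := TensorProduct.map L.par τ

/-- The extension `a ⊗ u ↦ (-1)^{e p(a)} a ⊗ δ u` of a map `δ` of parity `e`. -/
def extT (e : ZMod 2) (δ : R →ₗ[ℂ] R) : 𝔤 ⊗[ℂ] R →ₗ[ℂ] 𝔤 ⊗[ℂ] R :=
  TensorProduct.map (L.parPow e) δ

@[simp] theorem parT_tmul (a : 𝔤) (u : R) : L.parT τ (a ⊗ₜ u) = L.par a ⊗ₜ τ u := rfl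

@[simp] theorem extT_tmul (e : ZMod 2) (δ : R →ₗ[ℂ] R) (a : 𝔤) (u : R) :
    L.extT e δ (a ⊗ₜ u) = pw L.par e a ⊗ₜ δ u := rfl

variable {τ}

theorem bilT_tmul {W : Type*} [AddCommGroup W] [Module ℂ W] (m : 𝔤 →ₗ[ℂ] 𝔤 →ₗ[ℂ] W)
    {e e' : ZMod 2} (a b : 𝔤) (u v : R) (hb : L.par b = sgn e' • b) (hu : τ u = sgn e • u) :
    L.bilT τ m (a ⊗ₜ u) (b ⊗ₜ v) = sgn (e' * e) • (m a b ⊗ₜ (u * v)) := by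
  simp only [bilT, LinearMap.add_apply, TensorProduct.map₂_apply_tmul,
    LinearMap.comp_apply, hu, proj_eq]
  rcases parity_cases e' with rfl | rfl <;> simp [prj_of_hom L.par _ _ _ hb]

theorem brT_tmul {e e' : ZMod 2} (a b : 𝔤) (u v : R) (hb : L.par b = sgn e' • b)
    (hu : τ u = sgn e • u) :
    L.brT τ (a ⊗ₜ u) (b ⊗ₜ v) = sgn (e' * e) • (L.br a b ⊗ₜ (u * v)) :=
  L.bilT_tmul L.br a b u v hb hu

theorem formT_tmul (form : LinearMap.BilinForm ℂ 𝔤) {e e' : ZMod 2} (a b : 𝔤) (u v : R)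
    (hb : L.par b = sgn e' • b) (hu : τ u = sgn e • u) :
    L.formT τ form (a ⊗ₜ u) (b ⊗ₜ v) = (sgn (e' * e) * form a b) • (u * v) := by
  rw [formT_apply, L.bilT_tmul form a b u v hb hu, map_smul, TensorProduct.lid_tmul, smul_smul]

theorem parT_parT (hτ : IsSuper τ) (X : 𝔤 ⊗[ℂ] R) : L.parT τ (L.parT τ X) = X := by
  induction X using TensorProduct.induction_on with
  | zero => simp
  | tmul a u => simp [L.par_par, hτ.invol]
  | add x y h1 h2 => simp [h1, h2]

/-- `𝔤 ⊗ R` is spanned by the products of homogeneous elements. -/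
theorem tens_induction (hτ : IsSuper τ) {C : 𝔤 ⊗[ℂ] R → Prop} (h0 : C 0)
    (ha : ∀ X Y, C X → C Y → C (X + Y))
    (ht : ∀ (e e' : ZMod 2) (a : 𝔤) (u : R), L.par a = sgn e • a → τ u = sgn e' • u → C (a ⊗ₜ u))
    (X : 𝔤 ⊗[ℂ] R) : C X := by
  induction X using TensorProduct.induction_on with
  | zero => exact h0
  | tmul a u =>
    have h1 := fun e => prj_hom L.par L.par_par e a
    have h2 := fun e => prj_hom τ hτ.invol e u
    rw [← prj_add_prj L.par a, ← prj_add_prj τ u, TensorProduct.add_tmul, TensorProduct.tmul_add,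
      TensorProduct.tmul_add]
    exact ha _ _ (ha _ _ (ht _ _ _ _ (h1 0) (h2 0)) (ht _ _ _ _ (h1 0) (h2 1)))
      (ha _ _ (ht _ _ _ _ (h1 1) (h2 0)) (ht _ _ _ _ (h1 1) (h2 1)))
  | add X Y h1 h2 => exact ha X Y h1 h2

theorem parT_tmul_hom {e e' : ZMod 2} {a : 𝔤} {u : R} (h1 : L.par a = sgn e • a)
    (h2 : τ u = sgn e' • u) : L.parT τ (a ⊗ₜ u) = sgn (e + e') • (a ⊗ₜ u) := by
  rw [parT_tmul, h1, h2, TensorProduct.smul_tmul_smul, sgn_add]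

theorem pw_parT_tmul {e e' : ZMod 2} {a : 𝔤} {u : R} (h1 : L.par a = sgn e • a)
    (h2 : τ u = sgn e' • u) (e'' : ZMod 2) :
    pw (L.parT τ) e'' (a ⊗ₜ u) = sgn (e'' * (e + e')) • (a ⊗ₜ u) :=
  pw_of_hom _ _ _ _ (L.parT_tmul_hom h1 h2)

/-- The part of parity `e` of `𝔤 ⊗ R` is spanned by products of homogeneous elements. -/
theorem tens_hom_induction (hτ : IsSuper τ) {C : 𝔤 ⊗[ℂ] R → Prop} (e : ZMod 2) (h0 : C 0)
    (ha : ∀ X Y, C X → C Y → C (X + Y))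
    (ht : ∀ (e₁ e₂ : ZMod 2) (a : 𝔤) (u : R), L.par a = sgn e₁ • a → τ u = sgn e₂ • u →
      e = e₁ + e₂ → C (a ⊗ₜ u))
    (X : 𝔤 ⊗[ℂ] R) (hX : L.parT τ X = sgn e • X) : C X := by
  have key : ∀ X, C (prj (L.parT τ) e X) := by
    intro X
    induction X using L.tens_induction hτ with
    | h0 => rw [map_zero]; exact h0
    | ha X Y h1 h2 => rw [map_add]; exact ha _ _ h1 h2
    | ht e₁ e₂ a u h1 h2 =>
      rw [prj_of_hom _ _ _ _ (L.parT_tmul_hom h1 h2)]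
      split_ifs with h
      · exact ht _ _ _ _ h1 h2 h
      · exact h0
  have := key X
  rwa [prj_of_hom _ _ _ _ hX, if_pos rfl] at this

theorem par_br_hom {e e' : ZMod 2} {a b : 𝔤} (h1 : L.par a = sgn e • a) (h2 : L.par b = sgn e' • b) :
    L.par (L.br a b) = sgn (e + e') • L.br a b := by
  rw [L.par_br, h1, h2, map_smul, LinearMap.map_smul₂, smul_smul, sgn_add, mul_comm]

theorem _root_.SuperDS.IsSuper.mul_hom {R : Type*} [Ring R] [Algebra ℂ R] {τ : R →ₗ[ℂ] R}
    (hτ : IsSuper τ) {e e' : ZMod 2} {u v : R} (h1 : τ u = sgn e • u)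
    (h2 : τ v = sgn e' • v) : τ (u * v) = sgn (e + e') • (u * v) := by
  rw [hτ.map_mul, h1, h2, smul_mul_smul_comm, sgn_add]

theorem two_parity : (2 : ZMod 2) = 0 := rfl

theorem par_brT (hτ : IsSuper τ) (X Y : 𝔤 ⊗[ℂ] R) :
    L.parT τ (L.brT τ X Y) = L.brT τ (L.parT τ X) (L.parT τ Y) := by
  induction X using L.tens_induction hτ with
  | h0 => simp
  | ha X X' h1 h2 => simp [h1, h2]
  | ht p₁ p₂ a u ha hu =>
    induction Y using L.tens_induction hτ with
    | h0 => simp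
    | ha Y Y' h1 h2 => simp [h1, h2]
    | ht q₁ q₂ b v hb hv =>
      rw [L.parT_tmul_hom ha hu, L.parT_tmul_hom hb hv, map_smul, LinearMap.map_smul₂,
        L.brT_tmul a b u v hb hu, map_smul, L.parT_tmul_hom (L.par_br_hom ha hb) (hτ.mul_hom hu hv)]
      simp only [smul_smul, ← sgn_add]
      congr 2; ring

theorem skewT (hτ : IsSuper τ) {e : ZMod 2} {X : 𝔤 ⊗[ℂ] R} (hX : L.parT τ X = sgn e • X)
    (Y : 𝔤 ⊗[ℂ] R) : L.brT τ X Y = -L.brT τ (pw (L.parT τ) e Y) X := by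
  refine L.tens_hom_induction (C := fun X => L.brT τ X Y = -L.brT τ (pw (L.parT τ) e Y) X) hτ e (by simp)
    (fun X X' h1 h2 => by simp only [map_add, LinearMap.add_apply, h1, h2, neg_add])
    (fun p₁ p₂ a u ha hu he => ?_) X hX
  · subst he
    induction Y using L.tens_induction hτ with
    | h0 => simp
    | ha Y Y' h1 h2 => simp only [map_add, LinearMap.add_apply, h1, h2, neg_add]
    | ht q₁ q₂ b v hb hv =>
      rw [L.pw_parT_tmul hb hv, LinearMap.map_smul₂, L.brT_tmul a b u v hb hu,
        L.brT_tmul b a v u ha hv, L.skew _ _ _ _ ha hb, hτ.comm _ _ _ _ hu hv,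
        TensorProduct.neg_tmul, TensorProduct.smul_tmul_smul]
      simp only [smul_smul, ← sgn_add, smul_neg]
      congr 3
      linear_combination (-p₁ * q₂) * two_parity

theorem jacobiT (hτ : IsSuper τ) {e : ZMod 2} {X : 𝔤 ⊗[ℂ] R} (hX : L.parT τ X = sgn e • X)
    (Y Z : 𝔤 ⊗[ℂ] R) : L.brT τ X (L.brT τ Y Z) =
      L.brT τ (L.brT τ X Y) Z + L.brT τ (pw (L.parT τ) e Y) (L.brT τ X Z) := by
  refine L.tens_hom_induction (C := fun X => L.brT τ X (L.brT τ Y Z) =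
      L.brT τ (L.brT τ X Y) Z + L.brT τ (pw (L.parT τ) e Y) (L.brT τ X Z)) hτ e (by simp)
    (fun X X' h1 h2 => by simp only [map_add, LinearMap.add_apply, h1, h2]; abel)
    (fun p₁ p₂ a u ha hu he => ?_) X hX
  · subst he
    induction Y using L.tens_induction hτ with
    | h0 => simp
    | ha Y Y' h1 h2 => simp only [map_add, LinearMap.add_apply, h1, h2]; abel
    | ht q₁ q₂ b v hb hv =>
      induction Z using L.tens_induction hτ with
      | h0 => simp
      | ha Z Z' h1 h2 => simp only [map_add, h1, h2]; abel
      | ht r₁ r₂ c w hc hw =>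
        rw [L.pw_parT_tmul hb hv, LinearMap.map_smul₂, L.brT_tmul b c v w hc hv,
          L.brT_tmul a b u v hb hu, L.brT_tmul a c u w hc hu, map_smul, map_smul,
          LinearMap.smul_apply, map_smul, L.brT_tmul a _ u _ (L.par_br_hom hb hc) hu,
          L.brT_tmul _ c _ w hc (hτ.mul_hom hu hv), L.brT_tmul b _ v _ (L.par_br_hom ha hc) hv,
          L.jacobi _ _ _ _ c ha hb, TensorProduct.add_tmul, ← mul_assoc, ← mul_assoc,
          hτ.comm _ _ _ _ hv hu, ← TensorProduct.smul_tmul', smul_mul_assoc,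
          TensorProduct.tmul_smul]
        simp only [smul_smul, ← sgn_add, smul_add]
        congr 3
        · ring
        · linear_combination (- p₁*q₂ - p₂*q₂) * two_parity

theorem formT_inv (hτ : IsSuper τ) {form : LinearMap.BilinForm ℂ 𝔤}
    (hf : ∀ a b c, form (L.br a b) c = form a (L.br b c)) (X Y Z : 𝔤 ⊗[ℂ] R) :
    L.formT τ form (L.brT τ X Y) Z = L.formT τ form X (L.brT τ Y Z) := by
  induction X using L.tens_induction hτ with
  | h0 => simp
  | ha X X' h1 h2 => simp only [map_add, LinearMap.add_apply, h1, h2]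
  | ht p₁ p₂ a u ha hu =>
    induction Y using L.tens_induction hτ with
    | h0 => simp
    | ha Y Y' h1 h2 => simp only [map_add, LinearMap.add_apply, h1, h2]
    | ht q₁ q₂ b v hb hv =>
      induction Z using L.tens_induction hτ with
      | h0 => simp
      | ha Z Z' h1 h2 => simp only [map_add, h1, h2]
      | ht r₁ r₂ c w hc hw =>
        rw [L.brT_tmul b c v w hc hv, L.brT_tmul a b u v hb hu, map_smul, map_smul,
          LinearMap.smul_apply, L.formT_tmul form _ c _ w hc (hτ.mul_hom hu hv),
          L.formT_tmul form a _ u _ (L.par_br_hom hb hc) hu, hf, mul_assoc, smul_smul, smul_smul]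
        simp only [← mul_assoc, ← sgn_add]
        congr 3; ring

theorem form_parity {form : LinearMap.BilinForm ℂ 𝔤}
    (hf : ∀ a b, form (L.par a) (L.par b) = form a b) {e e' : ZMod 2} {a b : 𝔤}
    (ha : L.par a = sgn e • a) (hb : L.par b = sgn e' • b) : e = e' ∨ form a b = 0 := by
  have h := hf a b
  rw [ha, hb] at h
  rcases parity_cases e with rfl | rfl <;> rcases parity_cases e' with rfl | rfl
  · exact Or.inl rfl
  · refine Or.inr ?_
    simp at h
    linear_combination -(1 / 2 : ℂ) * h
  · refine Or.inr ?_
    simp at h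
    linear_combination -(1 / 2 : ℂ) * h
  · exact Or.inl rfl

theorem par_formT (hτ : IsSuper τ) {form : LinearMap.BilinForm ℂ 𝔤}
    (hf : ∀ a b, form (L.par a) (L.par b) = form a b) (X Y : 𝔤 ⊗[ℂ] R) :
    τ (L.formT τ form X Y) = L.formT τ form (L.parT τ X) (L.parT τ Y) := by
  induction X using L.tens_induction hτ with
  | h0 => simp
  | ha X X' h1 h2 => simp [h1, h2]
  | ht p₁ p₂ a u ha hu =>
    induction Y using L.tens_induction hτ with
    | h0 => simp
    | ha Y Y' h1 h2 => simp [h1, h2]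
    | ht q₁ q₂ b v hb hv =>
      rw [L.parT_tmul_hom ha hu, L.parT_tmul_hom hb hv, map_smul, LinearMap.map_smul₂,
        L.formT_tmul form a b u v hb hu, map_smul, hτ.mul_hom hu hv]
      rcases L.form_parity hf ha hb with rfl | h
      · have hs : sgn (p₁ * p₂) * sgn (p₂ + q₂) =
            sgn (p₁ + q₂) * sgn (p₁ + p₂) * sgn (p₁ * p₂) := by
          simp only [← sgn_add]
          congr 1
          linear_combination (- p₁) * two_parity
        simp only [smul_smul]
        congr 1
        linear_combination form a b * hs
      · simp [h]

theorem extT_parity {e : ZMod 2} {δ : R →ₗ[ℂ] R} (hδ : IsDerOf τ e δ) (X : 𝔤 ⊗[ℂ] R) :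
    L.parT τ (L.extT e δ X) = sgn e • L.extT e δ (L.parT τ X) := by
  have h : ∀ a, L.par (pw L.par e a) = pw L.par e (L.par a) := fun a => by
    rcases parity_cases e with rfl | rfl <;> simp
  induction X using TensorProduct.induction_on with
  | zero => simp
  | tmul a u => simp [hδ.parity, h]
  | add x y h1 h2 => simp [h1, h2]

theorem extT_brT (hτ : IsSuper τ) {e : ZMod 2} {δ : R →ₗ[ℂ] R} (hδ : IsDerOf τ e δ)
    (X Y : 𝔤 ⊗[ℂ] R) : L.extT e δ (L.brT τ X Y) =
      L.brT τ (L.extT e δ X) Y + L.brT τ (pw (L.parT τ) e X) (L.extT e δ Y) := by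
  induction X using L.tens_induction hτ with
  | h0 => simp
  | ha X X' h1 h2 => simp only [map_add, LinearMap.add_apply, h1, h2]; abel
  | ht p₁ p₂ a u ha hu =>
    induction Y using L.tens_induction hτ with
    | h0 => simp
    | ha Y Y' h1 h2 => simp only [map_add, h1, h2]; abel
    | ht q₁ q₂ b v hb hv =>
      have hδu : τ (δ u) = sgn (e + p₂) • δ u := by
        rw [hδ.parity, hu, map_smul, smul_smul, sgn_add]
      rw [L.brT_tmul a b u v hb hu, map_smul, extT_tmul, extT_tmul, extT_tmul,
        pw_of_hom _ _ _ _ (L.par_br_hom ha hb), pw_of_hom _ _ _ _ ha, pw_of_hom _ _ _ _ hb,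
        L.pw_parT_tmul ha hu, hδ.leibniz, pw_of_hom _ _ _ _ hu]
      simp only [← TensorProduct.smul_tmul', map_smul, LinearMap.smul_apply]
      rw [L.brT_tmul a b _ v hb hδu, L.brT_tmul a b u _ hb hu, TensorProduct.tmul_add,
        smul_mul_assoc, TensorProduct.tmul_smul]
      simp only [smul_smul, ← sgn_add, smul_add]
      congr 3
      · ring
      · ring

theorem extT_formT (hτ : IsSuper τ) {form : LinearMap.BilinForm ℂ 𝔤}
    (hf : ∀ a b, form (L.par a) (L.par b) = form a b) {e : ZMod 2} {δ : R →ₗ[ℂ] R}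
    (hδ : IsDerOf τ e δ) (X Y : 𝔤 ⊗[ℂ] R) : δ (L.formT τ form X Y) =
      L.formT τ form (L.extT e δ X) Y + L.formT τ form (pw (L.parT τ) e X) (L.extT e δ Y) := by
  induction X using L.tens_induction hτ with
  | h0 => simp
  | ha X X' h1 h2 => simp only [map_add, LinearMap.add_apply, h1, h2]; abel
  | ht p₁ p₂ a u ha hu =>
    induction Y using L.tens_induction hτ with
    | h0 => simp
    | ha Y Y' h1 h2 => simp only [map_add, h1, h2]; abel
    | ht q₁ q₂ b v hb hv =>
      have hδu : τ (δ u) = sgn (e + p₂) • δ u := by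
        rw [hδ.parity, hu, map_smul, smul_smul, sgn_add]
      rw [L.formT_tmul form a b u v hb hu, map_smul, extT_tmul, extT_tmul,
        pw_of_hom _ _ _ _ ha, pw_of_hom _ _ _ _ hb,
        L.pw_parT_tmul ha hu, hδ.leibniz, pw_of_hom _ _ _ _ hu]
      simp only [← TensorProduct.smul_tmul', map_smul, LinearMap.smul_apply]
      rw [L.formT_tmul form a b _ v hb hδu, L.formT_tmul form a b u _ hb hu, smul_mul_assoc]
      rcases L.form_parity hf ha hb with rfl | h
      · simp only [smul_smul, smul_add, ← mul_assoc, ← sgn_add]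
        rw [mul_right_comm _ (form a b), ← sgn_add]
        congr 4
        · linear_combination (- e*p₁) * two_parity
        · linear_combination (- e*p₁) * two_parity
      · simp [h]

/-- The bracket, the form and the other maps `bilT` are linear over the right multiplications. -/
theorem bilT_rmul {W : Type*} [AddCommGroup W] [Module ℂ W] (m : 𝔤 →ₗ[ℂ] 𝔤 →ₗ[ℂ] W)
    (w : R) (X Y : 𝔤 ⊗[ℂ] R) : L.bilT τ m X (LinearMap.lTensor 𝔤 (LinearMap.mulRight ℂ w) Y) =
      LinearMap.lTensor W (LinearMap.mulRight ℂ w) (L.bilT τ m X Y) := by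
  induction X using TensorProduct.induction_on with
  | zero => simp
  | add x y h1 h2 => simp only [map_add, LinearMap.add_apply, h1, h2]
  | tmul a u =>
    induction Y using TensorProduct.induction_on with
    | zero => simp
    | add x y h1 h2 => simp only [map_add, h1, h2]
    | tmul b v => simp [bilT, mul_assoc]

theorem bilT_map {W R' : Type*} [AddCommGroup W] [Module ℂ W] [Ring R'] [Algebra ℂ R']
    (m : 𝔤 →ₗ[ℂ] 𝔤 →ₗ[ℂ] W) {τ' : R' →ₗ[ℂ] R'} (φ : R →ₗ[ℂ] R')
    (hm : ∀ u v, φ (u * v) = φ u * φ v) (hφ : ∀ u, φ (τ u) = τ' (φ u)) (X Y : 𝔤 ⊗[ℂ] R) :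
    L.bilT τ' m (LinearMap.lTensor 𝔤 φ X) (LinearMap.lTensor 𝔤 φ Y) =
      LinearMap.lTensor W φ (L.bilT τ m X Y) := by
  induction X using TensorProduct.induction_on with
  | zero => simp
  | add x y h1 h2 => simp only [map_add, LinearMap.add_apply, h1, h2]
  | tmul a u =>
    induction Y using TensorProduct.induction_on with
    | zero => simp
    | add x y h1 h2 => simp only [map_add, h1, h2]
    | tmul b v => simp [bilT, hm, hφ]

end LieSuperalgebra

/-! ### Laurent series with coefficients in a superalgebra -/

namespace Laurent

variable {A B : Type*} [Ring A] [Algebra ℂ A] [Ring B] [Algebra ℂ B]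

theorem ext_coeff {x y : Laurent A} (h : ∀ k, coeff k x = coeff k y) : x = y :=
  HahnSeries.ext (funext fun k => by simpa [coeff] using h (-k))

@[simp] theorem coeff_map (d : A →ₗ[ℂ] B) (k : ℤ) (x : Laurent A) :
    coeff k (map d x) = d (coeff k x) := rfl

theorem coeff_mono (k l : ℤ) (a : A) : coeff l (mono k a) = if l = k then a else 0 := by
  show HahnSeries.coeff (HahnSeries.single (-k) a) (-l) = _
  rw [HahnSeries.coeff_single]
  simp

theorem coeff_posPart (k : ℤ) (x : Laurent A) :
    coeff k (posPart x) = if 0 ≤ k then coeff k x else 0 := by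
  show (if -k < 1 then _ else _) = _
  simp only [show -k < 1 ↔ 0 ≤ k by omega]
  rfl

theorem exists_coeff_eq_zero (x : Laurent A) : ∃ K : ℤ, ∀ k, K < k → coeff k x = 0 := by
  by_cases hx : x = 0
  · exact ⟨0, fun k _ => by rw [hx, _root_.map_zero]⟩
  · refine ⟨-HahnSeries.order (x : HahnSeries ℤ A), fun k hk => ?_⟩
    exact HahnSeries.coeff_eq_zero_of_lt_order (by omega)

theorem exists_of_coeff (c : ℤ → A) (K : ℤ) (h : ∀ k, K < k → c k = 0) :
    ∃ x : Laurent A, ∀ k, coeff k x = c k := by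
  refine ⟨HahnSeries.ofSuppBddBelow (fun k => c (-k)) ⟨-K, fun k hk => ?_⟩, fun k => ?_⟩
  · by_contra h'
    exact hk (h _ (by omega))
  · show c (- -k) = _
    rw [neg_neg]

theorem coeff_mul (l : ℤ) (x y : Laurent A) : ∃ K : ℕ, ∀ K', K ≤ K' →
    coeff l (x * y) = ∑ k ∈ Finset.Icc (-(K' : ℤ)) K', coeff k x * coeff (l - k) y := by
  set s := Finset.antidiagonal (HahnSeries.isPWO_support (x : HahnSeries ℤ A))
    (HahnSeries.isPWO_support (y : HahnSeries ℤ A)) (-l) with hs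
  refine ⟨s.sup fun ij => ij.1.natAbs, fun K' hK => ?_⟩
  have h1 : coeff l (x * y) = ∑ ij ∈ s, HahnSeries.coeff x ij.1 * HahnSeries.coeff y ij.2 :=
    HahnSeries.coeff_mul (x := (x : HahnSeries ℤ A)) (y := y)
  rw [h1]
  refine Finset.sum_of_injOn (fun ij => -ij.1) ?_ ?_ ?_ ?_
  · rintro ⟨i, j⟩ hi ⟨i', j'⟩ hi' h
    simp only [hs, Finset.mem_coe, Finset.mem_antidiagonal] at hi hi'
    simp only [Prod.mk.injEq] at h ⊢
    omega
  · rintro ⟨i, j⟩ hi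
    have := Finset.le_sup (f := fun ij : ℤ × ℤ => ij.1.natAbs) hi
    simp only [Finset.coe_Icc, Set.mem_Icc] at this ⊢
    omega
  · intro k _ hk
    by_contra h
    refine hk ⟨(-k, -(l - k)), ?_, by simp⟩
    simp only [hs, Finset.mem_coe, Finset.mem_antidiagonal]
    exact ⟨left_ne_zero_of_mul h, right_ne_zero_of_mul h, by omega⟩
  · rintro ⟨i, j⟩ hi
    simp only [hs, Finset.mem_antidiagonal] at hi
    show _ = HahnSeries.coeff x (- -i) * HahnSeries.coeff y (-(l - -i))
    rw [neg_neg, show -(l - -i) = j by omega]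

theorem mono_one_mul_mono_one (k l : ℤ) :
    (mono k (1 : A) : Laurent A) * mono l (1 : A) = mono (k + l) (1 : A) := by
  have h := HahnSeries.single_mul_single (a := -k) (b := -l) (r := (1 : A)) (s := (1 : A))
  rw [← neg_add, mul_one] at h
  exact h

theorem mono_zero_one : (mono 0 (1 : A) : Laurent A) = 1 := by
  show HahnSeries.single (-0) (1 : A) = 1
  rw [neg_zero]; rfl

theorem coeff_mono_mul (k l : ℤ) (x : Laurent A) :
    coeff l (mono k (1 : A) * x) = coeff (l - k) x := by
  have h := HahnSeries.coeff_single_mul_add (r := (1 : A)) (x := (x : HahnSeries ℤ A))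
    (a := -(l - k)) (b := -k)
  rw [one_mul, show -(l - k) + -k = -l by omega] at h
  exact h

theorem mono_mul_comm (k : ℤ) (x : Laurent A) : mono k (1 : A) * x = x * mono k (1 : A) := by
  refine ext_coeff fun l => ?_
  have h := HahnSeries.coeff_mul_single_add (r := (1 : A)) (x := (x : HahnSeries ℤ A))
    (a := -(l - k)) (b := -k)
  rw [mul_one, show -(l - k) + -k = -l by omega] at h
  rw [coeff_mono_mul]
  exact h.symm

theorem map_mul_of {d : A →ₗ[ℂ] B} (h : ∀ u v, d (u * v) = d u * d v) (x y : Laurent A) :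
    map d (x * y) = map d x * map d y := by
  refine ext_coeff fun l => ?_
  obtain ⟨K, hK⟩ := coeff_mul l x y
  obtain ⟨K', hK'⟩ := coeff_mul l (map d x) (map d y)
  rw [coeff_map, hK _ (le_max_left K K'), hK' _ (le_max_right K K'), map_sum]
  simp only [h, coeff_map]

theorem mul_comm_of (c : ℂ) (x y : Laurent A)
    (h : ∀ k l, coeff k x * coeff l y = c • (coeff l y * coeff k x)) : x * y = c • (y * x) := by
  refine ext_coeff fun l => ?_
  rw [map_smul]
  have h1 : coeff l (x * y) = _ := HahnSeries.coeff_mul (x := (x : HahnSeries ℤ A)) (y := y)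
  have h2 : coeff l (y * x) = _ := HahnSeries.coeff_mul (x := (y : HahnSeries ℤ A)) (y := x)
  rw [h1, h2, Finset.smul_sum]
  refine Finset.sum_nbij' Prod.swap Prod.swap ?_ ?_ (by simp) (by simp) ?_
  · rintro ⟨i, j⟩ hi
    simp only [Finset.mem_antidiagonal, Prod.swap] at hi ⊢
    exact ⟨hi.2.1, hi.1, by omega⟩
  · rintro ⟨i, j⟩ hi
    simp only [Finset.mem_antidiagonal, Prod.swap] at hi ⊢
    exact ⟨hi.2.1, hi.1, by omega⟩
  · rintro ⟨i, j⟩ _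
    have := h (-i) (-j)
    simpa [coeff] using this

theorem isSuper {τ : A →ₗ[ℂ] A} (hτ : IsSuper τ) : IsSuper (map τ) where
  map_one := by
    refine ext_coeff fun k => ?_
    rw [← mono_zero_one, coeff_map, coeff_mono]
    split_ifs <;> simp [hτ.map_one]
  map_mul := map_mul_of hτ.map_mul
  invol x := ext_coeff fun k => by simp [hτ.invol]
  comm e e' u v hu hv := mul_comm_of _ _ _ fun k l => by
    refine hτ.comm _ _ _ _ ?_ ?_
    · rw [← coeff_map, hu, map_smul]
    · rw [← coeff_map, hv, map_smul]

theorem pw_map (τ : A →ₗ[ℂ] A) (e : ZMod 2) (x : Laurent A) :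
    pw (map τ) e x = map (pw τ e) x := by
  rcases parity_cases e with rfl | rfl
  · exact ext_coeff fun k => by simp
  · simp

theorem isDerOf {τ : A →ₗ[ℂ] A} {e : ZMod 2} {δ : A →ₗ[ℂ] A} (h : IsDerOf τ e δ) :
    IsDerOf (map τ) e (map δ) where
  parity x := ext_coeff fun k => by simp [h.parity]
  leibniz x y := by
    refine ext_coeff fun l => ?_
    rw [pw_map, map_add]
    obtain ⟨K, hK⟩ := coeff_mul l x y
    obtain ⟨K₁, hK₁⟩ := coeff_mul l (map δ x) y
    obtain ⟨K₂, hK₂⟩ := coeff_mul l (map (pw τ e) x) (map δ y)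
    rw [coeff_map, hK (max K (max K₁ K₂)) (by omega), hK₁ (max K (max K₁ K₂)) (by omega),
      hK₂ (max K (max K₁ K₂)) (by omega), map_sum, ← Finset.sum_add_distrib]
    simp only [h.leibniz, coeff_map]

end Laurent

theorem SuperPoly.isSuper {X : Type*} (p : X → ZMod 2) : IsSuper (SuperPoly.σ p).toLinearMap where
  map_one := map_one (SuperPoly.σ p)
  map_mul := map_mul (SuperPoly.σ p)
  invol := SuperPoly.σ_σ p
  comm e e' u v hu hv := by
    rw [SuperPoly.mul_comm_of_hom p e u v hu, SuperPoly.parPow_of_hom p e e' v hv, smul_mul_assoc]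

theorem SuperPoly.IsSDer.isDerOf {X : Type*} {p : X → ZMod 2} {e : ZMod 2}
    {d : SuperPoly p →ₗ[ℂ] SuperPoly p} (h : SuperPoly.IsSDer p e d) :
    IsDerOf (SuperPoly.σ p).toLinearMap e d where
  parity := h.1
  leibniz u v := by rw [h.2, SuperPoly.parPow_eq]

theorem isSuper_laurent_complex : IsSuper (LinearMap.id : Laurent ℂ →ₗ[ℂ] Laurent ℂ) where
  map_one := rfl
  map_mul _ _ := rfl
  invol _ := rfl
  comm e e' u v hu hv := by
    have hc : u * v = (1 : ℂ) • (v * u) := Laurent.mul_comm_of 1 u v fun k l => by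
      rw [one_smul, mul_comm]
    have h0 : ∀ (e : ZMod 2) (w : Laurent ℂ), LinearMap.id (R := ℂ) w = sgn e • w → e = 0 ∨ w = 0 := by
      intro e w h
      rcases parity_cases e with rfl | rfl
      · exact Or.inl rfl
      · right
        have h2 : (2 : ℂ) • w = (1 : ℂ) • w - sgn 1 • w := by rw [sgn_one]; module
        rw [← h, one_smul, LinearMap.id_apply, sub_self] at h2
        exact (smul_eq_zero.1 h2).resolve_left (by norm_num)
    rcases h0 e u hu with rfl | rfl
    · simpa using hc
    · simp

/-! ### Coefficients of elements of `𝔤 ⊗ R` -/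

section coord

variable {𝔤 : Type*} [AddCommGroup 𝔤] [Module ℂ 𝔤] {R R' : Type*} [AddCommGroup R] [Module ℂ R]
  [AddCommGroup R'] [Module ℂ R']

/-- The coefficient `a ⊗ u ↦ φ(a) u` of elements of `𝔤 ⊗ R`. -/
def coord (φ : Module.Dual ℂ 𝔤) : 𝔤 ⊗[ℂ] R →ₗ[ℂ] R :=
  (TensorProduct.lid ℂ R).toLinearMap ∘ₗ LinearMap.rTensor R φ

@[simp] theorem coord_tmul (φ : Module.Dual ℂ 𝔤) (a : 𝔤) (u : R) : coord φ (a ⊗ₜ u) = φ a • u := by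
  simp [coord]

theorem coord_lTensor (φ : Module.Dual ℂ 𝔤) (g : R →ₗ[ℂ] R') (X : 𝔤 ⊗[ℂ] R) :
    coord φ (LinearMap.lTensor 𝔤 g X) = g (coord φ X) := by
  induction X using TensorProduct.induction_on with
  | zero => simp
  | tmul a u => simp
  | add x y h1 h2 => simp [h1, h2]

theorem sum_coord {ι : Type*} [Fintype ι] (q : Module.Basis ι ℂ 𝔤) (X : 𝔤 ⊗[ℂ] R) :
    ∑ t, q t ⊗ₜ[ℂ] coord (q.coord t) X = X := by
  induction X using TensorProduct.induction_on with
  | zero => simp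
  | tmul a u =>
    simp only [coord_tmul, ← TensorProduct.smul_tmul, ← TensorProduct.sum_tmul]
    congr 1
    exact q.sum_repr a
  | add x y h1 h2 => simp only [map_add, TensorProduct.tmul_add, Finset.sum_add_distrib, h1, h2]

theorem ext_coord {ι : Type*} [Fintype ι] (q : Module.Basis ι ℂ 𝔤) {X Y : 𝔤 ⊗[ℂ] R}
    (h : ∀ t, coord (q.coord t) X = coord (q.coord t) Y) : X = Y := by
  rw [← sum_coord q X, ← sum_coord q Y]
  simp only [h]

end coord

section zc

variable {𝔤 : Type*} [AddCommGroup 𝔤] [Module ℂ 𝔤] {R : Type*} [Ring R] [Algebra ℂ R]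
  {ι : Type*} [Fintype ι]

theorem ext_zc (q : Module.Basis ι ℂ 𝔤) {X Y : 𝔤 ⊗[ℂ] Laurent R}
    (h : ∀ l, LinearMap.lTensor 𝔤 (Laurent.coeff l) X = LinearMap.lTensor 𝔤 (Laurent.coeff l) Y) :
    X = Y :=
  ext_coord q fun t => Laurent.ext_coeff fun k => by
    rw [← coord_lTensor, ← coord_lTensor, h]

theorem exists_zc_eq_zero (X : 𝔤 ⊗[ℂ] Laurent R) :
    ∃ K : ℤ, ∀ k, K < k → LinearMap.lTensor 𝔤 (Laurent.coeff k) X = 0 := by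
  induction X using TensorProduct.induction_on with
  | zero => exact ⟨0, by simp⟩
  | tmul a u =>
    obtain ⟨K, hK⟩ := Laurent.exists_coeff_eq_zero u
    exact ⟨K, fun k hk => by simp [hK k hk]⟩
  | add x y h1 h2 =>
    obtain ⟨K, hK⟩ := h1
    obtain ⟨K', hK'⟩ := h2
    exact ⟨max K K', fun k hk => by simp [hK k (by omega), hK' k (by omega)]⟩

theorem exists_of_zc (q : Module.Basis ι ℂ 𝔤) (c : ℤ → 𝔤 ⊗[ℂ] R) (K : ℤ)
    (h : ∀ k, K < k → c k = 0) :
    ∃ X : 𝔤 ⊗[ℂ] Laurent R, ∀ k, LinearMap.lTensor 𝔤 (Laurent.coeff k) X = c k := by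
  have h1 := fun t => Laurent.exists_of_coeff (fun k => coord (q.coord t) (c k)) K
    fun k hk => by rw [h k hk, map_zero]
  choose u hu using h1
  refine ⟨∑ t, q t ⊗ₜ u t, fun k => ?_⟩
  simp only [map_sum, LinearMap.lTensor_tmul, hu, sum_coord]

theorem zc_bilT (L : LieSuperalgebra 𝔤) {τ : R →ₗ[ℂ] R} {W : Type*} [AddCommGroup W] [Module ℂ W]
    (m : 𝔤 →ₗ[ℂ] 𝔤 →ₗ[ℂ] W) (l : ℤ) (X Y : 𝔤 ⊗[ℂ] Laurent R) : ∃ K : ℕ, ∀ K', K ≤ K' →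
    LinearMap.lTensor W (Laurent.coeff l) (L.bilT (Laurent.map τ) m X Y) =
      ∑ k ∈ Finset.Icc (-(K' : ℤ)) K', L.bilT τ m (LinearMap.lTensor 𝔤 (Laurent.coeff k) X)
        (LinearMap.lTensor 𝔤 (Laurent.coeff (l - k)) Y) := by
  induction X using TensorProduct.induction_on with
  | zero => exact ⟨0, by simp⟩
  | add x y h1 h2 =>
    obtain ⟨K, hK⟩ := h1
    obtain ⟨K', hK'⟩ := h2
    refine ⟨max K K', fun k hk => ?_⟩
    simp only [map_add, LinearMap.add_apply, Finset.sum_add_distrib, hK k (by omega),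
      hK' k (by omega)]
  | tmul a u =>
    induction Y using TensorProduct.induction_on with
    | zero => exact ⟨0, by simp⟩
    | add x y h1 h2 =>
      obtain ⟨K, hK⟩ := h1
      obtain ⟨K', hK'⟩ := h2
      refine ⟨max K K', fun k hk => ?_⟩
      simp only [map_add, Finset.sum_add_distrib, hK k (by omega), hK' k (by omega)]
    | tmul b v =>
      obtain ⟨K, hK⟩ := Laurent.coeff_mul l u v
      obtain ⟨K', hK'⟩ := Laurent.coeff_mul l (Laurent.map τ u) v
      refine ⟨max K K', fun k hk => ?_⟩
      simp only [LieSuperalgebra.bilT, LinearMap.add_apply, TensorProduct.map₂_apply_tmul,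
        LinearMap.mul_apply', LinearMap.comp_apply, map_add, LinearMap.lTensor_tmul,
        TensorProduct.map_tmul, hK k (by omega), hK' k (by omega), Laurent.coeff_map,
        TensorProduct.tmul_sum,
        Finset.sum_add_distrib]

end zc

/-! ### Exponentials in complete filtered spaces -/

/-- A complete, separated and exhaustive decreasing filtration of a complex vector space. -/
structure Filt (W : Type*) [AddCommGroup W] [Module ℂ W] where
  F : ℤ → Submodule ℂ W
  anti : Antitone F
  separated : ∀ x, (∀ d, x ∈ F d) → x = 0
  exhaustive : ∀ x, ∃ d, x ∈ F d
  complete : ∀ (x : ℕ → W) (d : ℤ), (∀ k : ℕ, x k ∈ F (d + k)) →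
    ∃ y, ∀ n : ℕ, y - ∑ k ∈ Finset.range n, x k ∈ F (d + n)

namespace Filt

variable {W W' U : Type*} [AddCommGroup W] [Module ℂ W] [AddCommGroup W'] [Module ℂ W']
  [AddCommGroup U] [Module ℂ U] {Φ : Filt W} {Φ' : Filt W'} {Ψ : Filt U}

/-- The linear map `φ` shifts the filtration by at least `c`. -/
def Shift (Φ : Filt W) (Φ' : Filt W') (c : ℤ) (φ : W →ₗ[ℂ] W') : Prop :=
  ∀ d, ∀ x ∈ Φ.F d, φ x ∈ Φ'.F (d + c)

/-- The bilinear map `β` is compatible with the filtrations. -/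
def Shift₂ (Ψ : Filt U) (Φ : Filt W) (Φ' : Filt W') (β : U →ₗ[ℂ] W →ₗ[ℂ] W') : Prop :=
  ∀ d e, ∀ x ∈ Ψ.F d, ∀ y ∈ Φ.F e, β x y ∈ Φ'.F (d + e)

/-- `y = ∑ x_k`, where the terms lie in a shift of the filtration. -/
def IsSum (Φ : Filt W) (x : ℕ → W) (y : W) : Prop :=
  ∃ d : ℤ, (∀ k : ℕ, x k ∈ Φ.F (d + k)) ∧ ∀ n : ℕ, y - ∑ k ∈ Finset.range n, x k ∈ Φ.F (d + n)

theorem eq_of_sub_mem {x y : W} (d : ℤ) (h : ∀ n : ℕ, x - y ∈ Φ.F (d + n)) : x = y := by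
  refine sub_eq_zero.1 (Φ.separated _ fun d' => Φ.anti ?_ (h (d' - d).toNat))
  omega

theorem IsSum.of_le {x : ℕ → W} {y : W} {d d' : ℤ} (hd : d' ≤ d) (h1 : ∀ k : ℕ, x k ∈ Φ.F (d + k))
    (h2 : ∀ n : ℕ, y - ∑ k ∈ Finset.range n, x k ∈ Φ.F (d + n)) :
    (∀ k : ℕ, x k ∈ Φ.F (d' + k)) ∧ ∀ n : ℕ, y - ∑ k ∈ Finset.range n, x k ∈ Φ.F (d' + n) :=
  ⟨fun k => Φ.anti (by omega) (h1 k), fun k => Φ.anti (by omega) (h2 k)⟩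

theorem IsSum.unique {x : ℕ → W} {y y' : W} (h : Φ.IsSum x y) (h' : Φ.IsSum x y') : y = y' := by
  obtain ⟨d, h1, h2⟩ := h
  obtain ⟨d', h1', h2'⟩ := h'
  have a := IsSum.of_le (min_le_left d d') h1 h2
  have a' := IsSum.of_le (min_le_right d d') h1' h2'
  refine eq_of_sub_mem (Φ := Φ) (min d d') fun n => ?_
  have := Submodule.sub_mem _ (a.2 n) (a'.2 n)
  simpa using this

theorem IsSum.add {x x' : ℕ → W} {y y' : W} (h : Φ.IsSum x y) (h' : Φ.IsSum x' y') :
    Φ.IsSum (fun k => x k + x' k) (y + y') := by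
  obtain ⟨d, h1, h2⟩ := h
  obtain ⟨d', h1', h2'⟩ := h'
  have a := IsSum.of_le (min_le_left d d') h1 h2
  have a' := IsSum.of_le (min_le_right d d') h1' h2'
  refine ⟨min d d', fun k => Submodule.add_mem _ (a.1 k) (a'.1 k), fun n => ?_⟩
  rw [Finset.sum_add_distrib, add_sub_add_comm]
  exact Submodule.add_mem _ (a.2 n) (a'.2 n)

theorem IsSum.map {x : ℕ → W} {y : W} (h : Φ.IsSum x y) {c : ℤ} {φ : W →ₗ[ℂ] W'}
    (hφ : Shift Φ Φ' c φ) : Φ'.IsSum (fun k => φ (x k)) (φ y) := by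
  obtain ⟨d, h1, h2⟩ := h
  refine ⟨d + c, fun k => ?_, fun n => ?_⟩
  · rw [add_right_comm]; exact hφ _ _ (h1 k)
  · rw [add_right_comm, ← map_sum, ← map_sub]; exact hφ _ _ (h2 n)

/-- A sequence that vanishes at `0` may be summed after a shift of the index. -/
theorem IsSum.of_succ {x : ℕ → W} {y : W} (h0 : x 0 = 0) (h : Φ.IsSum (fun k => x (k + 1)) y) :
    Φ.IsSum x y := by
  obtain ⟨d, h1, h2⟩ := h
  refine ⟨d - 1, fun k => ?_, fun n => ?_⟩
  · cases k with
    | zero => rw [h0]; exact Submodule.zero_mem _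
    | succ k => exact Φ.anti (by push_cast; omega) (h1 k)
  · cases n with
    | zero => exact Φ.anti (by simp) (h2 0)
    | succ n =>
      rw [Finset.sum_range_succ', h0, add_zero]
      exact Φ.anti (by push_cast; omega) (h2 n)

theorem IsSum.of_zero {x : ℕ → W} (h : ∀ k, x (k + 1) = 0) : Φ.IsSum x (x 0) := by
  obtain ⟨d, hd⟩ := Φ.exhaustive (x 0)
  refine ⟨d, fun k => ?_, fun n => ?_⟩
  · cases k with
    | zero => simpa using hd
    | succ k => rw [h]; exact Submodule.zero_mem _
  · cases n with
    | zero => simpa using hd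
    | succ n => rw [Finset.sum_range_succ']; simp [h]

/-- A double sum may be rearranged along the antidiagonals. -/
theorem IsSum.double {f : ℕ → ℕ → W} {g : ℕ → W} {y : W} (d : ℤ)
    (hf : ∀ k l : ℕ, f k l ∈ Φ.F (d + k + l))
    (hg : ∀ k n : ℕ, g k - ∑ l ∈ Finset.range n, f k l ∈ Φ.F (d + k + n))
    (hy : ∀ n : ℕ, y - ∑ k ∈ Finset.range n, g k ∈ Φ.F (d + n)) :
    Φ.IsSum (fun n => ∑ x ∈ Finset.HasAntidiagonal.antidiagonal n, f x.1 x.2) y := by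
  refine ⟨d, fun n => Submodule.sum_mem _ fun x hx => ?_, fun n => ?_⟩
  · rw [← Finset.HasAntidiagonal.mem_antidiagonal.1 hx]
    push_cast
    rw [← add_assoc]
    exact hf _ _
  · have h1 : ∑ m ∈ Finset.range n, ∑ x ∈ Finset.HasAntidiagonal.antidiagonal m, f x.1 x.2 =
        ∑ k ∈ Finset.range n, ∑ l ∈ Finset.range (n - k), f k l := by
      rw [← Finset.sum_range_diag_flip n f]
      refine Finset.sum_congr rfl fun m _ => ?_
      rw [Finset.Nat.sum_antidiagonal_eq_sum_range_succ (fun k l => f k l)]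
    have h2 : y - ∑ k ∈ Finset.range n, ∑ l ∈ Finset.range (n - k), f k l =
        (y - ∑ k ∈ Finset.range n, g k) +
          ∑ k ∈ Finset.range n, (g k - ∑ l ∈ Finset.range (n - k), f k l) := by
      rw [Finset.sum_sub_distrib]; abel
    rw [h1, h2]
    refine Submodule.add_mem _ (hy n) (Submodule.sum_mem _ fun k hk => ?_)
    have := Finset.mem_range.1 hk
    exact Φ.anti (by omega) (hg k (n - k))

theorem IsSum.bilin {β : U →ₗ[ℂ] W →ₗ[ℂ] W'} (hβ : Shift₂ Ψ Φ Φ' β) {u : ℕ → U} {x : ℕ → W}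
    {v : U} {y : W} (hu : Ψ.IsSum u v) (hx : Φ.IsSum x y) :
    Φ'.IsSum (fun n => ∑ z ∈ Finset.HasAntidiagonal.antidiagonal n, β (u z.1) (x z.2)) (β v y) := by
  obtain ⟨d, h1, h2⟩ := hu
  obtain ⟨d', h1', h2'⟩ := hx
  have hy : y ∈ Φ.F d' := by simpa using h2' 0
  refine IsSum.double (f := fun k l => β (u k) (x l)) (g := fun k => β (u k) y) (d + d')
    (fun k l => ?_) (fun k n => ?_) fun n => ?_
  · rw [show d + d' + k + l = (d + k) + (d' + l) by ring]
    exact hβ _ _ _ (h1 k) _ (h1' l)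
  · rw [← map_sum, ← map_sub, show d + d' + k + n = (d + k) + (d' + n) by ring]
    exact hβ _ _ _ (h1 k) _ (h2' n)
  · rw [← LinearMap.sum_apply, ← map_sum, ← LinearMap.sub_apply, ← map_sub,
      show d + d' + n = (d + n) + d' by ring]
    exact hβ _ _ _ (h2 n) _ hy

/-- Sequential closedness: a subspace that contains limits of its elements. -/
def Closed (Φ : Filt W) (Z : Submodule ℂ W) : Prop :=
  ∀ x, (∀ d, ∃ y ∈ Z, x - y ∈ Φ.F d) → x ∈ Z

theorem IsSum.mem {x : ℕ → W} {y : W} (h : Φ.IsSum x y) {Z : Submodule ℂ W} (hZ : Φ.Closed Z)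
    (hx : ∀ k, x k ∈ Z) : y ∈ Z := by
  obtain ⟨d, h1, h2⟩ := h
  refine hZ _ fun d' => ⟨∑ k ∈ Finset.range (d' - d).toNat, x k,
    Submodule.sum_mem _ fun k _ => hx k, Φ.anti ?_ (h2 (d' - d).toNat)⟩
  omega

theorem closed_F (d : ℤ) : Φ.Closed (Φ.F d) := fun x h => by
  obtain ⟨y, hy, hxy⟩ := h d
  simpa using Submodule.add_mem _ hxy hy

theorem Closed.inf {Z Z' : Submodule ℂ W} (h : Φ.Closed Z) (h' : Φ.Closed Z') :
    Φ.Closed (Z ⊓ Z') := fun x hx =>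
  ⟨h x fun d => (hx d).imp fun _ hy => ⟨hy.1.1, hy.2⟩,
    h' x fun d => (hx d).imp fun _ hy => ⟨hy.1.2, hy.2⟩⟩

theorem closed_ker {c : ℤ} {φ : W →ₗ[ℂ] W'} (hφ : Shift Φ Φ' c φ) :
    Φ.Closed (LinearMap.ker φ) := fun x hx => by
  refine Φ'.separated _ fun d => ?_
  obtain ⟨y, hy, hxy⟩ := hx (d - c)
  have := hφ _ _ hxy
  rwa [map_sub, LinearMap.mem_ker.1 hy, sub_zero, sub_add_cancel] at this

theorem Shift.iterate {N : W →ₗ[ℂ] W} (hN : Shift Φ Φ 1 N) {d : ℤ} {x : W} (hx : x ∈ Φ.F d)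
    (k : ℕ) : (N ^ k) x ∈ Φ.F (d + k) := by
  induction k with
  | zero => simpa using hx
  | succ k ih =>
    rw [pow_succ', Module.End.mul_apply]
    have := hN _ _ ih
    push_cast
    rwa [← add_assoc]

/-- The terms `N^k x / k!` of the exponential series. -/
def expTerm (N : W →ₗ[ℂ] W) (k : ℕ) : W →ₗ[ℂ] W := ((k.factorial : ℂ)⁻¹) • N ^ k

/-- The terms `N^k x / (k + 1)!` of the series of `(e^N - 1) / N`. -/
def expTerm₁ (N : W →ₗ[ℂ] W) (k : ℕ) : W →ₗ[ℂ] W := (((k + 1).factorial : ℂ)⁻¹) • N ^ k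

@[simp] theorem expTerm_zero (N : W →ₗ[ℂ] W) (x : W) : expTerm N 0 x = x := by simp [expTerm]

@[simp] theorem expTerm₁_zero (N : W →ₗ[ℂ] W) (x : W) : expTerm₁ N 0 x = x := by simp [expTerm₁]

theorem expTerm_succ (N : W →ₗ[ℂ] W) (k : ℕ) (x : W) :
    ((k : ℂ) + 1) • expTerm N (k + 1) x = N (expTerm N k x) := by
  have h : (k.factorial : ℂ) ≠ 0 := by exact_mod_cast k.factorial_ne_zero
  have h' : (k : ℂ) + 1 ≠ 0 := by exact_mod_cast k.succ_ne_zero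
  simp only [expTerm, LinearMap.smul_apply, map_smul, smul_smul, pow_succ', Module.End.mul_apply]
  congr 1
  rw [Nat.factorial_succ]
  push_cast
  field_simp

theorem expTerm₁_succ (N : W →ₗ[ℂ] W) (k : ℕ) (x : W) :
    ((k : ℂ) + 1 + 1) • expTerm₁ N (k + 1) x = N (expTerm₁ N k x) := by
  have h : ((k + 1).factorial : ℂ) ≠ 0 := by exact_mod_cast (k + 1).factorial_ne_zero
  have h' : (k : ℂ) + 1 + 1 ≠ 0 := by exact_mod_cast (k + 1).succ_ne_zero
  simp only [expTerm₁, LinearMap.smul_apply, map_smul, smul_smul, pow_succ', Module.End.mul_apply]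
  congr 1
  rw [Nat.factorial_succ (k + 1)]
  push_cast
  field_simp

theorem expTerm_mem {N : W →ₗ[ℂ] W} (hN : Shift Φ Φ 1 N) {d : ℤ} {x : W} (hx : x ∈ Φ.F d) (k : ℕ) :
    expTerm N k x ∈ Φ.F (d + k) := Submodule.smul_mem _ _ (hN.iterate hx k)

theorem expTerm₁_mem {N : W →ₗ[ℂ] W} (hN : Shift Φ Φ 1 N) {d : ℤ} {x : W} (hx : x ∈ Φ.F d)
    (k : ℕ) : expTerm₁ N k x ∈ Φ.F (d + k) := Submodule.smul_mem _ _ (hN.iterate hx k)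

theorem exists_sum (c : ℕ → W →ₗ[ℂ] W) (hc : ∀ d, ∀ x ∈ Φ.F d, ∀ k : ℕ, c k x ∈ Φ.F (d + k)) :
    ∃ E : W →ₗ[ℂ] W, ∀ x d, x ∈ Φ.F d → ∀ n : ℕ,
      E x - ∑ k ∈ Finset.range n, c k x ∈ Φ.F (d + n) := by
  have h : ∀ x, ∃ y, ∀ d, x ∈ Φ.F d → ∀ n : ℕ,
      y - ∑ k ∈ Finset.range n, c k x ∈ Φ.F (d + n) := by
    intro x
    obtain ⟨d₀, hd₀⟩ := Φ.exhaustive x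
    obtain ⟨y, hy⟩ := Φ.complete (fun k => c k x) d₀ (hc d₀ x hd₀)
    refine ⟨y, fun d hd n => ?_⟩
    rcases le_total d d₀ with h | h
    · exact Φ.anti (by omega) (hy n)
    · have h1 : y - ∑ k ∈ Finset.range n, c k x =
          (y - ∑ k ∈ Finset.range (n + (d - d₀).toNat), c k x) +
          ∑ k ∈ Finset.range (d - d₀).toNat, c (n + k) x := by
        rw [Finset.sum_range_add]; abel
      rw [h1]
      refine Submodule.add_mem _ (Φ.anti (by push_cast; omega) (hy _))
        (Submodule.sum_mem _ fun k _ => Φ.anti (by push_cast; omega) (hc d x hd (n + k)))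
  choose E hE using h
  refine ⟨⟨⟨E, fun x x' => ?_⟩, fun r x => ?_⟩, hE⟩
  · obtain ⟨d, hd⟩ := Φ.exhaustive x
    obtain ⟨d', hd'⟩ := Φ.exhaustive x'
    have a := Φ.anti (min_le_left d d') hd
    have a' := Φ.anti (min_le_right d d') hd'
    refine eq_of_sub_mem (Φ := Φ) (min d d') fun n => ?_
    have h1 := hE (x + x') _ (Submodule.add_mem _ a a') n
    have h2 := Submodule.add_mem _ (hE x _ a n) (hE x' _ a' n)
    have := Submodule.sub_mem _ h1 h2
    simp only [map_add, Finset.sum_add_distrib] at this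
    convert this using 1
    abel
  · obtain ⟨d, hd⟩ := Φ.exhaustive x
    refine eq_of_sub_mem (Φ := Φ) d fun n => ?_
    have h1 := hE (r • x) _ (Submodule.smul_mem _ r hd) n
    have h2 := Submodule.smul_mem _ r (hE x _ hd n)
    have := Submodule.sub_mem _ h1 h2
    simp only [map_smul, ← Finset.smul_sum, smul_sub] at this
    convert this using 1
    simp

open Classical in
/-- The sum of a series of operators the `k`-th of which raises the filtration by `k`. -/
def sumOp (Φ : Filt W) (c : ℕ → W →ₗ[ℂ] W) : W →ₗ[ℂ] W :=
  if hc : ∀ d, ∀ x ∈ Φ.F d, ∀ k : ℕ, c k x ∈ Φ.F (d + k) then (exists_sum c hc).choose else 0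

/-- The exponential `e^N` of an operator that raises the filtration. -/
def exp (Φ : Filt W) (N : W →ₗ[ℂ] W) : W →ₗ[ℂ] W := Φ.sumOp (expTerm N)

/-- The operator `(e^N - 1) / N`. -/
def exp₁ (Φ : Filt W) (N : W →ₗ[ℂ] W) : W →ₗ[ℂ] W := Φ.sumOp (expTerm₁ N)

theorem sumOp_spec {c : ℕ → W →ₗ[ℂ] W} (hc : ∀ d, ∀ x ∈ Φ.F d, ∀ k : ℕ, c k x ∈ Φ.F (d + k))
    {x : W} {d : ℤ} (hx : x ∈ Φ.F d) (n : ℕ) :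
    Φ.sumOp c x - ∑ k ∈ Finset.range n, c k x ∈ Φ.F (d + n) := by
  rw [sumOp, dif_pos hc]
  exact (exists_sum c hc).choose_spec x d hx n

theorem sumOp_isSum {c : ℕ → W →ₗ[ℂ] W}
    (hc : ∀ d, ∀ x ∈ Φ.F d, ∀ k : ℕ, c k x ∈ Φ.F (d + k)) (x : W) :
    Φ.IsSum (fun k => c k x) (Φ.sumOp c x) := by
  obtain ⟨d, hd⟩ := Φ.exhaustive x
  exact ⟨d, fun k => hc d x hd k, fun n => sumOp_spec hc hd n⟩

variable {N : W →ₗ[ℂ] W} (hN : Shift Φ Φ 1 N)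

include hN

theorem exp_spec {x : W} {d : ℤ} (hx : x ∈ Φ.F d) (n : ℕ) :
    Φ.exp N x - ∑ k ∈ Finset.range n, expTerm N k x ∈ Φ.F (d + n) :=
  sumOp_spec (fun _ _ h k => expTerm_mem hN h k) hx n

theorem exp_isSum (x : W) : Φ.IsSum (fun k => expTerm N k x) (Φ.exp N x) :=
  sumOp_isSum (fun _ _ h k => expTerm_mem hN h k) x

theorem exp₁_isSum (x : W) : Φ.IsSum (fun k => expTerm₁ N k x) (Φ.exp₁ N x) :=
  sumOp_isSum (fun _ _ h k => expTerm₁_mem hN h k) x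

theorem exp_mem {x : W} {d : ℤ} (hx : x ∈ Φ.F d) : Φ.exp N x ∈ Φ.F d := by
  simpa using exp_spec hN hx 0

theorem exp₁_mem {x : W} {d : ℤ} (hx : x ∈ Φ.F d) : Φ.exp₁ N x ∈ Φ.F d := by
  simpa [exp₁] using sumOp_spec (Φ := Φ) (fun _ _ h k => expTerm₁_mem hN h k) hx 0

theorem exp_sub_mem {x : W} {d : ℤ} (hx : x ∈ Φ.F d) : Φ.exp N x - x ∈ Φ.F (d + 1) := by
  simpa using exp_spec hN hx 1

/-- A subspace stable under `N` is stable under `e^N`. -/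
theorem exp_mem_closed {Z : Submodule ℂ W} (hZ : Φ.Closed Z) (h : ∀ x ∈ Z, N x ∈ Z) {x : W}
    (hx : x ∈ Z) : Φ.exp N x ∈ Z := by
  refine (exp_isSum hN x).mem hZ fun k => Submodule.smul_mem _ _ ?_
  induction k with
  | zero => simpa using hx
  | succ k ih => rw [pow_succ', Module.End.mul_apply]; exact h _ ih

theorem exp₁_mem_closed {Z : Submodule ℂ W} (hZ : Φ.Closed Z) (h : ∀ x ∈ Z, N x ∈ Z) {x : W}
    (hx : x ∈ Z) : Φ.exp₁ N x ∈ Z := by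
  refine (exp₁_isSum hN x).mem hZ fun k => Submodule.smul_mem _ _ ?_
  induction k with
  | zero => simpa using hx
  | succ k ih => rw [pow_succ', Module.End.mul_apply]; exact h _ ih

theorem exp_of_apply_eq_zero {x : W} (hx : N x = 0) : Φ.exp N x = x := by
  refine (exp_isSum hN x).unique ?_
  have h : Φ.IsSum (fun k => expTerm N k x) (expTerm N 0 x) :=
    IsSum.of_zero fun k => by simp [expTerm, pow_succ, hx]
  simpa using h

/-- Exponentials are compatible with intertwining maps. -/
theorem exp_map {N' : W' →ₗ[ℂ] W'} (hN' : Shift Φ' Φ' 1 N') {c : ℤ} {φ : W →ₗ[ℂ] W'}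
    (hφ : Shift Φ Φ' c φ) (h : ∀ x, φ (N x) = N' (φ x)) (x : W) :
    φ (Φ.exp N x) = Φ'.exp N' (φ x) := by
  refine ((exp_isSum hN x).map hφ).unique ?_
  have h1 : ∀ k, φ ((N ^ k) x) = (N' ^ k) (φ x) := fun k => by
    induction k with
    | zero => simp
    | succ k ih => rw [pow_succ', Module.End.mul_apply, h, ih, pow_succ', Module.End.mul_apply]
  simp only [expTerm, LinearMap.smul_apply, map_smul, h1]
  exact exp_isSum hN' (φ x)

theorem neg_shift : Shift Φ Φ 1 (-N) := fun d x hx => Submodule.neg_mem _ (hN d x hx)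

theorem exp_neg_exp (x : W) : Φ.exp (-N) (Φ.exp N x) = x := by
  obtain ⟨d, hd⟩ := Φ.exhaustive x
  have hN' := neg_shift hN
  have h1 : Φ.IsSum (fun n => ∑ z ∈ Finset.HasAntidiagonal.antidiagonal n,
      expTerm (-N) z.2 (expTerm N z.1 x)) (Φ.exp (-N) (Φ.exp N x)) := by
    refine IsSum.double (f := fun k l => expTerm (-N) l (expTerm N k x))
      (g := fun k => Φ.exp (-N) (expTerm N k x)) d (fun k l => ?_)
      (fun k n => exp_spec hN' (expTerm_mem hN hd k) n) fun n => ?_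
    · exact expTerm_mem hN' (expTerm_mem hN hd k) l
    · rw [← map_sum, ← map_sub]
      exact exp_mem hN' (exp_spec hN hd n)
  have h2 : ∀ n, ∑ z ∈ Finset.HasAntidiagonal.antidiagonal (n + 1),
      expTerm (-N) z.2 (expTerm N z.1 x) = 0 := by
    intro n
    have hc : Commute (-N) N := (Commute.refl N).neg_left
    have h3 := hc.add_pow' (n + 1)
    rw [neg_add_cancel, zero_pow n.succ_ne_zero] at h3
    have hn : ((n + 1).factorial : ℂ) ≠ 0 := by exact_mod_cast (n + 1).factorial_ne_zero
    refine smul_right_injective W hn ?_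
    show ((n + 1).factorial : ℂ) • _ = ((n + 1).factorial : ℂ) • (0 : W)
    rw [Finset.smul_sum, smul_zero]
    have h4 := congrArg (fun f => f x) h3
    simp only [LinearMap.sum_apply, LinearMap.zero_apply] at h4
    rw [← Finset.Nat.sum_antidiagonal_swap] at h4
    rw [h4]
    refine Finset.sum_congr rfl fun z hz => ?_
    have hz := Finset.HasAntidiagonal.mem_antidiagonal.1 hz
    have h5 := Nat.add_choose_mul_factorial_mul_factorial z.1 z.2
    rw [hz, mul_right_comm] at h5
    have h6 : ((n + 1).factorial : ℂ) =
        ((n + 1).choose z.2 : ℂ) * (z.2.factorial : ℂ) * (z.1.factorial : ℂ) := by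
      exact_mod_cast h5.symm
    have h7 : (z.2.factorial : ℂ) ≠ 0 := by exact_mod_cast z.2.factorial_ne_zero
    have h8 : (z.1.factorial : ℂ) ≠ 0 := by exact_mod_cast z.1.factorial_ne_zero
    simp only [expTerm, LinearMap.smul_apply, map_smul, smul_smul, Prod.swap, Module.End.mul_apply]
    rw [h6, ← Nat.cast_smul_eq_nsmul ℂ]
    congr 1
    field_simp
  have h3 := IsSum.of_zero (Φ := Φ) (x := fun n => ∑ z ∈ Finset.HasAntidiagonal.antidiagonal n,
      expTerm (-N) z.2 (expTerm N z.1 x)) h2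
  have := h1.unique h3
  simpa using this

theorem exp_exp_neg (x : W) : Φ.exp N (Φ.exp (-N) x) = x := by
  simpa using exp_neg_exp (neg_shift hN) x

omit hN in
/-- The recursion for the Cauchy product of two exponential series, of which the first may be
shifted. -/
theorem cauchy_recursion {β : U →ₗ[ℂ] W →ₗ[ℂ] W'} {NU : U →ₗ[ℂ] U} {N' : W' →ₗ[ℂ] W'}
    (hβ : ∀ u x, N' (β u x) = β (NU u) x + β u (N x)) (c : ℂ) (u : ℕ → U)
    (hu : ∀ k : ℕ, ((k : ℂ) + 1 + c) • u (k + 1) = NU (u k)) (x : W) (n : ℕ) :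
    ((n : ℂ) + 1 + c) • ∑ z ∈ Finset.HasAntidiagonal.antidiagonal (n + 1),
      β (u z.1) (expTerm N z.2 x) =
    N' (∑ z ∈ Finset.HasAntidiagonal.antidiagonal n, β (u z.1) (expTerm N z.2 x)) +
      c • β (u 0) (expTerm N (n + 1) x) := by
  have h1 : ((n : ℂ) + 1 + c) • ∑ z ∈ Finset.HasAntidiagonal.antidiagonal (n + 1),
      β (u z.1) (expTerm N z.2 x) =
      (∑ z ∈ Finset.HasAntidiagonal.antidiagonal (n + 1),
        ((z.1 : ℂ) + c) • β (u z.1) (expTerm N z.2 x)) +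
      ∑ z ∈ Finset.HasAntidiagonal.antidiagonal (n + 1),
        (z.2 : ℂ) • β (u z.1) (expTerm N z.2 x) := by
    rw [Finset.smul_sum, ← Finset.sum_add_distrib]
    refine Finset.sum_congr rfl fun z hz => ?_
    rw [← add_smul]
    congr 1
    have : ((z.1 + z.2 : ℕ) : ℂ) = ((n + 1 : ℕ) : ℂ) := by
      rw [Finset.HasAntidiagonal.mem_antidiagonal.1 hz]
    push_cast at this
    linear_combination -this
  have h2 := Finset.Nat.sum_antidiagonal_succ (n := n)
    (f := fun z => ((z.1 : ℂ) + c) • β (u z.1) (expTerm N z.2 x))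
  have h3 := Finset.Nat.sum_antidiagonal_succ' (n := n)
    (f := fun z => (z.2 : ℂ) • β (u z.1) (expTerm N z.2 x))
  rw [h1, h2, h3]
  have h4 : ∀ k l : ℕ, (((k + 1 : ℕ) : ℂ) + c) • β (u (k + 1)) (expTerm N l x) =
      β (NU (u k)) (expTerm N l x) := fun k l => by
    rw [← hu k, map_smul, LinearMap.smul_apply]; push_cast; rfl
  have h5 : ∀ k l : ℕ, ((l + 1 : ℕ) : ℂ) • β (u k) (expTerm N (l + 1) x) =
      β (u k) (N (expTerm N l x)) := fun k l => by
    rw [← expTerm_succ, map_smul]; push_cast; rfl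
  simp only [h4, h5, map_sum, hβ, Finset.sum_add_distrib]
  simp
  abel

/-- Exponentials of derivations of a bilinear map are automorphisms of it. -/
theorem exp_bilin {β : U →ₗ[ℂ] W →ₗ[ℂ] W'} (hβ : Shift₂ Ψ Φ Φ' β) {NU : U →ₗ[ℂ] U}
    (hNU : Shift Ψ Ψ 1 NU) {N' : W' →ₗ[ℂ] W'} (hN' : Shift Φ' Φ' 1 N')
    (h : ∀ u x, N' (β u x) = β (NU u) x + β u (N x)) (u : U) (x : W) :
    Φ'.exp N' (β u x) = β (Ψ.exp NU u) (Φ.exp N x) := by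
  refine IsSum.unique ?_ (IsSum.bilin hβ (exp_isSum hNU u) (exp_isSum hN x))
  convert exp_isSum hN' (β u x) using 1
  funext n
  induction n with
  | zero => simp
  | succ n ih =>
    have h' : (n : ℂ) + 1 ≠ 0 := by exact_mod_cast n.succ_ne_zero
    have h1 := cauchy_recursion h 0 (fun k => expTerm NU k u)
      (fun k => by rw [add_zero]; exact expTerm_succ NU k u) x n
    rw [ih, ← expTerm_succ, add_zero, zero_smul, add_zero] at h1
    exact smul_right_injective _ h' h1

/-- The derivative of an exponential: if `[δ, N] = β(y, ·) + β'(y', ·)`, then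
`δ e^N x = e^N δ x + β(z, e^N x) + β'(z', e^N x)`, where `z = (e^N - 1) / N y` and
`z' = (e^N - 1) / N y'`. -/
theorem exp_derivative {β β' : U →ₗ[ℂ] W →ₗ[ℂ] W} (hβ : Shift₂ Ψ Φ Φ β) (hβ' : Shift₂ Ψ Φ Φ β')
    {NU : U →ₗ[ℂ] U} (hNU : Shift Ψ Ψ 1 NU)
    (h : ∀ u x, N (β u x) = β (NU u) x + β u (N x))
    (h' : ∀ u x, N (β' u x) = β' (NU u) x + β' u (N x))
    {c : ℤ} {δ : W →ₗ[ℂ] W} (hδ : Shift Φ Φ c δ) {y y' : U} (Z : Submodule ℂ W)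
    (hZ : ∀ x ∈ Z, N x ∈ Z) (hy : ∀ x ∈ Z, δ (N x) = N (δ x) + β y x + β' y' x) {x : W}
    (hx : x ∈ Z) :
    δ (Φ.exp N x) = Φ.exp N (δ x) + β (Ψ.exp₁ NU y) (Φ.exp N x) +
      β' (Ψ.exp₁ NU y') (Φ.exp N x) := by
  have hxZ : ∀ n, expTerm N n x ∈ Z := fun n => Submodule.smul_mem _ _ (by
    induction n with
    | zero => simpa using hx
    | succ n ih => rw [pow_succ', Module.End.mul_apply]; exact hZ _ ih)
  have s1 := (exp_isSum hN x).map hδ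
  have s2 := (IsSum.bilin hβ (exp₁_isSum hNU y) (exp_isSum hN x)).add
    (IsSum.bilin hβ' (exp₁_isSum hNU y') (exp_isSum hN x))
  set f : ℕ → W := fun n => (∑ z ∈ Finset.HasAntidiagonal.antidiagonal n,
    β (expTerm₁ NU z.1 y) (expTerm N z.2 x)) + ∑ z ∈ Finset.HasAntidiagonal.antidiagonal n,
    β' (expTerm₁ NU z.1 y') (expTerm N z.2 x) with hf
  have key : ∀ n, δ (expTerm N (n + 1) x) = expTerm N (n + 1) (δ x) + f n := by
    intro n
    have hn : (n : ℂ) + 1 ≠ 0 := by exact_mod_cast n.succ_ne_zero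
    refine smul_right_injective _ hn ?_
    show ((n : ℂ) + 1) • δ (expTerm N (n + 1) x) = ((n : ℂ) + 1) • (expTerm N (n + 1) (δ x) + f n)
    rw [← map_smul, expTerm_succ, hy _ (hxZ n), smul_add, expTerm_succ]
    have r : ((n : ℂ) + 1) • f n =
        N (δ (expTerm N n x) - expTerm N n (δ x)) + β y (expTerm N n x) +
          β' y' (expTerm N n x) := by
      induction n with
      | zero => simp [hf]
      | succ n ih =>
        have ih := ih (by exact_mod_cast n.succ_ne_zero)
        have hn' : (n : ℂ) + 1 ≠ 0 := by exact_mod_cast n.succ_ne_zero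
        have e1 : δ (expTerm N (n + 1) x) - expTerm N (n + 1) (δ x) = f n := by
          refine smul_right_injective _ hn' ?_
          show ((n : ℂ) + 1) • (δ (expTerm N (n + 1) x) - expTerm N (n + 1) (δ x)) =
            ((n : ℂ) + 1) • f n
          rw [smul_sub, ← map_smul, expTerm_succ, hy _ (hxZ n), expTerm_succ, ih, map_sub]
          abel
        have c1 := cauchy_recursion h 1 (fun k => expTerm₁ NU k y)
          (fun k => expTerm₁_succ NU k y) x n
        have c2 := cauchy_recursion h' 1 (fun k => expTerm₁ NU k y')
          (fun k => expTerm₁_succ NU k y') x n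
        simp only [expTerm₁_zero, one_smul] at c1 c2
        rw [e1]
        push_cast
        simp only [hf, smul_add, map_add]
        rw [c1, c2]
        abel
    rw [r, map_sub]
    abel
  have s3 := (exp_isSum hN (δ x)).add (IsSum.of_succ (x := fun n => n.casesOn 0 f) rfl s2)
  rw [add_assoc]
  refine s1.unique ?_
  convert s3 using 1
  funext n
  cases n with
  | zero => simp
  | succ n => exact key n

omit hN in
/-- The leading term of the variation of an exponential. -/
theorem exp_add_sub_mem {M : W →ₗ[ℂ] W} (hN : Shift Φ Φ 1 N) {c : ℕ} (hM : Shift Φ Φ (c + 1) M)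
    {x : W} {d : ℤ} (hx : x ∈ Φ.F d) :
    Φ.exp (N + M) x - Φ.exp N x - M x ∈ Φ.F (d + c + 2) := by
  have hM1 : Shift Φ Φ 1 M := fun d x hx => Φ.anti (by omega) (hM d x hx)
  have hNM : Shift Φ Φ 1 (N + M) := fun d x hx => Submodule.add_mem _ (hN d x hx) (hM1 d x hx)
  have h1 : ∀ k : ℕ, ((N + M) ^ (k + 1)) x - (N ^ (k + 1)) x ∈ Φ.F (d + c + (k + 1)) := by
    intro k
    induction k with
    | zero =>
      have := hM d x hx
      simpa [add_assoc] using this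
    | succ k ih =>
      have e : ((N + M) ^ (k + 1 + 1)) x - (N ^ (k + 1 + 1)) x =
          N (((N + M) ^ (k + 1)) x - (N ^ (k + 1)) x) + M (((N + M) ^ (k + 1)) x) := by
        rw [pow_succ', Module.End.mul_apply, pow_succ' N, Module.End.mul_apply,
          LinearMap.add_apply, map_sub]
        abel
      rw [e]
      refine Submodule.add_mem _ (Φ.anti (by push_cast; omega) (hN _ _ ih))
        (Φ.anti (by push_cast; omega) (hM _ _ (hNM.iterate hx (k + 1))))
  have h2 := exp_spec hNM hx (c + 2)
  have h3 := exp_spec hN hx (c + 2)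
  have h4 : ∑ k ∈ Finset.range (c + 2), expTerm (N + M) k x -
      ∑ k ∈ Finset.range (c + 2), expTerm N k x - M x ∈ Φ.F (d + c + 2) := by
    rw [← Finset.sum_sub_distrib, Finset.sum_range_succ', Finset.sum_range_succ']
    have e : expTerm (N + M) (0 + 1) x - expTerm N (0 + 1) x = M x := by simp [expTerm]
    rw [e, expTerm_zero, expTerm_zero, sub_self, add_zero, add_sub_cancel_right]
    refine Submodule.sum_mem _ fun k _ => ?_
    simp only [expTerm, LinearMap.smul_apply, ← smul_sub]
    exact Submodule.smul_mem _ _ (Φ.anti (by push_cast; omega) (h1 (k + 1)))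
  have := Submodule.add_mem _ (Submodule.sub_mem _ h2 h3)
    (Φ.anti (show d + ((c + 2 : ℕ) : ℤ) ≤ d + c + 2 by push_cast; omega) h4)
  refine Φ.anti (show d + c + 2 ≤ d + ((c + 2 : ℕ) : ℤ) by push_cast; omega) ?_
  convert this using 1
  abel

omit hN in
variable (W) in
/-- The discrete filtration, concentrated in degree `0`. -/
def discrete : Filt W where
  F d := if d ≤ 0 then ⊤ else ⊥
  anti d d' h := by
    show (if d' ≤ 0 then (⊤ : Submodule ℂ W) else ⊥) ≤ if d ≤ 0 then ⊤ else ⊥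
    split_ifs
    · exact le_rfl
    · omega
    · exact bot_le
    · exact le_rfl
  separated x h := by simpa using h 1
  exhaustive x := ⟨0, by simp⟩
  complete x d h := by
    refine ⟨∑ k ∈ Finset.range (1 - d).toNat, x k, fun n => ?_⟩
    by_cases hn : d + n ≤ 0
    · simp [hn]
    · obtain ⟨c, rfl⟩ := Nat.exists_eq_add_of_le (show (1 - d).toNat ≤ n by omega)
      rw [Finset.sum_range_add, sub_add_cancel_left, neg_mem_iff]
      refine Submodule.sum_mem _ fun k _ => ?_
      have h1 := h ((1 - d).toNat + k)
      rw [if_neg (by push_cast; omega), Submodule.mem_bot] at h1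
      rw [h1]
      exact Submodule.zero_mem _

omit hN in
theorem mem_discrete {x : W} {d : ℤ} : x ∈ (discrete W).F d ↔ (0 < d → x = 0) := by
  show x ∈ (if d ≤ 0 then (⊤ : Submodule ℂ W) else ⊥) ↔ _
  split_ifs with h
  · simp [not_lt.2 h]
  · simp [not_le.1 h]

omit hN in
theorem exp_zero (x : W) : Φ.exp (0 : W →ₗ[ℂ] W) x = x :=
  exp_of_apply_eq_zero (fun _ _ _ => Submodule.zero_mem _) rfl

end Filt

namespace DSData

variable {𝔤 : Type*} [AddCommGroup 𝔤] [Module ℂ 𝔤] {ι : Type*} [Fintype ι] [DecidableEq ι]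
  (S : DSData 𝔤 ι)

/-! ### The filtration of `ĝ ⊗ 𝒫(ḡ)` by degree -/

/-- The parity involution of `𝒫(ḡ)`. -/
abbrev tau : S.A →ₗ[ℂ] S.A := (S.pp 1).toLinearMap

theorem pp_one : S.pp 1 = SuperPoly.σ S.varPar := by simp [SuperPoly.parPow]

theorem tau_eq : S.tau = (SuperPoly.σ S.varPar).toLinearMap := by rw [tau, pp_one]

theorem isSuper_tau : IsSuper S.tau := by rw [tau_eq]; exact SuperPoly.isSuper _

theorem isSuper_tauL : IsSuper (Laurent.map S.tau) := Laurent.isSuper S.isSuper_tau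

theorem isDerOf {e : ZMod 2} {d : S.A →ₗ[ℂ] S.A} (h : SuperPoly.IsSDer S.varPar e d) :
    IsDerOf S.tau e d := by rw [tau_eq]; exact h.isDerOf

theorem D_isSDer : SuperPoly.IsSDer S.varPar 1 S.D := SuperPoly.der_isSDer

theorem D_qbar (t : ι) (n : ℕ) : S.D (S.qbar t n) = S.qbar t (n + 1) := SuperPoly.der_gen (t, n)

/-- The Lie superbracket of `𝔤 ⊗ 𝒫(ḡ)`. -/
def brA : 𝔤 ⊗[ℂ] S.A →ₗ[ℂ] 𝔤 ⊗[ℂ] S.A →ₗ[ℂ] 𝔤 ⊗[ℂ] S.A := S.brT S.tau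

theorem zcoeff_brG (l : ℤ) (X Y : S.G) : ∃ K : ℕ, ∀ K', K ≤ K' → S.zcoeff l (S.brG X Y) =
    ∑ k ∈ Finset.Icc (-(K' : ℤ)) K', S.brA (S.zcoeff k X) (S.zcoeff (l - k) Y) :=
  zc_bilT S.toLieSuperalgebra S.br l X Y

theorem ext_zcoeff {X Y : S.G} (h : ∀ l, S.zcoeff l X = S.zcoeff l Y) : X = Y := ext_zc S.q h

section tens

variable {S}

theorem tmul_mem_tens {U : Submodule ℂ 𝔤} {B : Subalgebra ℂ S.A} {a : 𝔤} {u : S.A} (ha : a ∈ U)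
    (hu : u ∈ B) : a ⊗ₜ u ∈ S.tens U B := ⟨(⟨a, ha⟩ : U) ⊗ₜ (⟨u, hu⟩ : B), rfl⟩

@[elab_as_elim]
theorem tens_induction {U : Submodule ℂ 𝔤} {B : Subalgebra ℂ S.A} {C : 𝔤 ⊗[ℂ] S.A → Prop}
    (h0 : C 0) (ha : ∀ X Y, C X → C Y → C (X + Y)) (ht : ∀ a ∈ U, ∀ u ∈ B, C (a ⊗ₜ u))
    {X : 𝔤 ⊗[ℂ] S.A} (hX : X ∈ S.tens U B) : C X := by
  obtain ⟨Y, rfl⟩ := hX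
  induction Y using TensorProduct.induction_on with
  | zero => simpa using h0
  | tmul a u => exact ht _ a.2 _ u.2
  | add x y h1 h2 => rw [map_add]; exact ha _ _ h1 h2

theorem tens_le {U : Submodule ℂ 𝔤} {B : Subalgebra ℂ S.A} {Z : Submodule ℂ (𝔤 ⊗[ℂ] S.A)}
    (h : ∀ a ∈ U, ∀ u ∈ B, a ⊗ₜ u ∈ Z) : S.tens U B ≤ Z := fun _ hX =>
  tens_induction (C := fun X => X ∈ Z) Z.zero_mem (fun _ _ => Z.add_mem) h hX

theorem tens_mono {U U' : Submodule ℂ 𝔤} {B B' : Subalgebra ℂ S.A} (h : U ≤ U') (h' : B ≤ B') :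
    S.tens U B ≤ S.tens U' B' := tens_le fun _ ha _ hu => tmul_mem_tens (h ha) (h' hu)

theorem tens_bot (B : Subalgebra ℂ S.A) : S.tens ⊥ B = ⊥ :=
  le_bot_iff.1 (tens_le fun a ha u _ => by rw [(Submodule.mem_bot ℂ).1 ha]; simp)

theorem mem_tens_top (X : 𝔤 ⊗[ℂ] S.A) : X ∈ S.tens ⊤ ⊤ := by
  induction X using TensorProduct.induction_on with
  | zero => exact Submodule.zero_mem _
  | tmul a u => exact tmul_mem_tens trivial trivial
  | add x y h1 h2 => exact Submodule.add_mem _ h1 h2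

theorem map_mem_tens {U U' : Submodule ℂ 𝔤} {B B' : Subalgebra ℂ S.A} {g : 𝔤 →ₗ[ℂ] 𝔤}
    {d : S.A →ₗ[ℂ] S.A} (hg : ∀ a ∈ U, g a ∈ U') (hd : ∀ u ∈ B, d u ∈ B') {X : 𝔤 ⊗[ℂ] S.A}
    (hX : X ∈ S.tens U B) : TensorProduct.map g d X ∈ S.tens U' B' := by
  refine tens_induction (by simp) (fun X Y h1 h2 => ?_) (fun a ha u hu => ?_) hX
  · rw [map_add]; exact Submodule.add_mem _ h1 h2
  · exact tmul_mem_tens (hg a ha) (hd u hu)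

theorem prj_mem {Z : Submodule ℂ 𝔤} (h : ∀ a ∈ Z, S.par a ∈ Z) (e : ZMod 2) {a : 𝔤} (ha : a ∈ Z) :
    S.proj e a ∈ Z :=
  Submodule.smul_mem _ _ (Submodule.add_mem _ ha (Submodule.smul_mem _ _ (h a ha)))

theorem brA_mem_tens {U U' U'' : Submodule ℂ 𝔤} {B : Subalgebra ℂ S.A}
    (hB : ∀ u ∈ B, S.tau u ∈ B) (hU : ∀ a ∈ U', S.par a ∈ U')
    (h : ∀ a ∈ U, ∀ b ∈ U', S.br a b ∈ U'') {X Y : 𝔤 ⊗[ℂ] S.A} (hX : X ∈ S.tens U B)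
    (hY : Y ∈ S.tens U' B) : S.brA X Y ∈ S.tens U'' B := by
  refine tens_induction (C := fun X => S.brA X Y ∈ S.tens U'' B) (by simp)
    (fun X X' h1 h2 => ?_) (fun a ha u hu => ?_) hX
  · rw [map_add, LinearMap.add_apply]; exact Submodule.add_mem _ h1 h2
  · refine tens_induction (by simp) (fun Y Y' h1 h2 => ?_) (fun b hb v hv => ?_) hY
    · rw [map_add]; exact Submodule.add_mem _ h1 h2
    · simp only [brA, LieSuperalgebra.brT, LinearMap.add_apply, TensorProduct.map₂_apply_tmul]
      exact Submodule.add_mem _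
        (tmul_mem_tens (h _ ha _ (prj_mem hU 0 hb)) (B.mul_mem hu hv))
        (tmul_mem_tens (h _ ha _ (prj_mem hU 1 hb)) (B.mul_mem (hB u hu) hv))

theorem coord_mem_of_tens {U : Submodule ℂ 𝔤} {B : Subalgebra ℂ S.A} {X : 𝔤 ⊗[ℂ] S.A}
    (hX : X ∈ S.tens U B) (φ : Module.Dual ℂ 𝔤) : coord φ X ∈ B := by
  refine tens_induction (by simp) (fun X Y h1 h2 => ?_) (fun a _ u hu => ?_) hX
  · rw [map_add]; exact B.add_mem h1 h2
  · rw [coord_tmul]; exact B.smul_mem hu _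

theorem mem_tens_of_coord {B : Subalgebra ℂ S.A} {X : 𝔤 ⊗[ℂ] S.A}
    (h : ∀ t, coord (S.q.coord t) X ∈ B) : X ∈ S.tens ⊤ B := by
  rw [← sum_coord S.q X]
  exact Submodule.sum_mem _ fun t _ => tmul_mem_tens trivial (h t)

/-- An element of `U ⊗ 𝒫(ḡ)` with coefficients in `B` lies in `U ⊗ B`. -/
theorem mem_tens_inf {U : Submodule ℂ 𝔤} {B : Subalgebra ℂ S.A} {X : 𝔤 ⊗[ℂ] S.A}
    (h : X ∈ S.tens U ⊤) (h' : X ∈ S.tens ⊤ B) : X ∈ S.tens U B := by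
  obtain ⟨π, hπ⟩ := Submodule.exists_isCompl U |>.imp fun V hV => hV
  have h1 : ∀ a ∈ U, (U.subtype ∘ₗ U.projectionOnto π hπ) a = a := fun a ha => by
    simpa using congrArg Subtype.val (Submodule.projectionOnto_apply_left hπ ⟨a, ha⟩)
  have h2 : TensorProduct.map (U.subtype ∘ₗ U.projectionOnto π hπ)
      (LinearMap.id : S.A →ₗ[ℂ] S.A) X = X := by
    refine tens_induction (by simp) (fun X Y h1 h2 => ?_) (fun a ha u hu => ?_) h
    · rw [map_add, h1, h2]
    · rw [TensorProduct.map_tmul, h1 a ha]; rfl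
  rw [← h2]
  exact map_mem_tens (fun a _ => Subtype.prop _) (fun u hu => hu) h'

end tens

/-- The subspace of the series whose coefficients of `z^l` lie in `Z l`. -/
def coefIn (Z : ℤ → Submodule ℂ (𝔤 ⊗[ℂ] S.A)) : Submodule ℂ S.G where
  carrier := {X | ∀ l, S.zcoeff l X ∈ Z l}
  add_mem' h h' l := by rw [map_add]; exact Submodule.add_mem _ (h l) (h' l)
  zero_mem' l := by rw [map_zero]; exact Submodule.zero_mem _
  smul_mem' r X h l := by rw [map_smul]; exact Submodule.smul_mem _ _ (h l)

theorem brG_mem_coefIn {Z Z' Z'' : ℤ → Submodule ℂ (𝔤 ⊗[ℂ] S.A)}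
    (h : ∀ k l, ∀ X ∈ Z k, ∀ Y ∈ Z' l, S.brA X Y ∈ Z'' (k + l)) {X Y : S.G}
    (hX : X ∈ S.coefIn Z) (hY : Y ∈ S.coefIn Z') : S.brG X Y ∈ S.coefIn Z'' := fun l => by
  obtain ⟨K, hK⟩ := S.zcoeff_brG l X Y
  rw [hK K le_rfl]
  refine Submodule.sum_mem _ fun k _ => ?_
  have := h k (l - k) _ (hX k) _ (hY (l - k))
  rwa [add_sub_cancel] at this

theorem zcoeff_map (g : 𝔤 →ₗ[ℂ] 𝔤) (d : S.A →ₗ[ℂ] S.A) (l : ℤ) (X : S.G) :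
    S.zcoeff l (TensorProduct.map g (Laurent.map d) X) = TensorProduct.map g d (S.zcoeff l X) := by
  induction X using TensorProduct.induction_on with
  | zero => simp
  | tmul a u => simp [zcoeff]
  | add x y h1 h2 => simp only [map_add, h1, h2]

theorem zcoeff_const (l : ℤ) (X : 𝔤 ⊗[ℂ] S.A) :
    S.zcoeff l (S.const X) = if l = 0 then X else 0 := by
  induction X using TensorProduct.induction_on with
  | zero => simp
  | tmul a u =>
    simp only [zcoeff, const, LinearMap.lTensor_tmul, Laurent.coeff_mono]
    split_ifs <;> simp
  | add x y h1 h2 => simp only [map_add, h1, h2]; split_ifs <;> simp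

theorem zcoeff_tensOne_tmul (l : ℤ) (a : 𝔤) (u : Laurent ℂ) :
    S.zcoeff l (S.tensOne (a ⊗ₜ u)) = Laurent.coeff l u • (a ⊗ₜ 1) := by
  simp [zcoeff, tensOne, Algebra.algebraMap_eq_smul_one]

theorem zcoeff_posPart (l : ℤ) (X : S.G) :
    S.zcoeff l (S.posPart X) = if 0 ≤ l then S.zcoeff l X else 0 := by
  induction X using TensorProduct.induction_on with
  | zero => simp
  | tmul a u =>
    simp only [zcoeff, posPart, LinearMap.lTensor_tmul, Laurent.coeff_posPart]
    split_ifs <;> simp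
  | add x y h1 h2 => simp only [map_add, h1, h2]; split_ifs <;> simp

section grading

variable {S}

@[elab_as_elim]
theorem grGT_induction {d : ℤ} {C : 𝔤 → Prop} (h0 : C 0) (ha : ∀ a b, C a → C b → C (a + b))
    (hg : ∀ k, d < k → ∀ a ∈ S.gr k, C a) {a : 𝔤} (h : a ∈ S.grGT d) : C a := by
  refine Submodule.iSup_induction _ (motive := C) h (fun k a hk => ?_) h0 ha
  refine Submodule.iSup_induction _ (motive := C) hk (fun hd a h' => hg k hd a h') h0 ha

theorem gr_le_grGT {d k : ℤ} (h : d < k) : S.gr k ≤ S.grGT d :=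
  le_trans (le_iSup (fun _ : d < k => S.gr k) h) (le_iSup (fun k => ⨆ _ : d < k, S.gr k) k)

theorem grGT_anti {d d' : ℤ} (h : d ≤ d') : S.grGT d' ≤ S.grGT d := fun _ ha =>
  grGT_induction (Submodule.zero_mem _) (fun _ _ => Submodule.add_mem _)
    (fun _ hk _ h' => gr_le_grGT (by omega) h') ha

theorem grGT_par {d : ℤ} {a : 𝔤} (ha : a ∈ S.grGT d) : S.par a ∈ S.grGT d :=
  grGT_induction (C := fun a => S.par a ∈ S.grGT d) (by simp)
    (fun a b h1 h2 => by rw [map_add]; exact Submodule.add_mem _ h1 h2)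
    (fun k hk a h => gr_le_grGT hk (S.gr_par k a h)) ha

theorem br_mem_grGT {d d' : ℤ} {a b : 𝔤} (ha : a ∈ S.grGT d) (hb : b ∈ S.grGT d') :
    S.br a b ∈ S.grGT (d + d' + 1) := by
  refine grGT_induction (C := fun a => S.br a b ∈ S.grGT (d + d' + 1)) (by simp)
    (fun a b h1 h2 => by rw [map_add, LinearMap.add_apply]; exact Submodule.add_mem _ h1 h2)
    (fun k hk a h => ?_) ha
  refine grGT_induction (C := fun b => S.br a b ∈ S.grGT (d + d' + 1)) (by simp)
    (fun a b h1 h2 => by rw [map_add]; exact Submodule.add_mem _ h1 h2)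
    (fun l hl b h' => gr_le_grGT (by omega) (S.gr_br k l a h b h')) hb

theorem form_eq_zero_of_grGT {d d' : ℤ} (h : -2 < d + d') {a b : 𝔤} (ha : a ∈ S.grGT d)
    (hb : b ∈ S.grGT d') : S.form a b = 0 := by
  refine grGT_induction (C := fun a => S.form a b = 0) (by simp)
    (fun a b h1 h2 => by rw [map_add, LinearMap.add_apply, h1, h2, add_zero])
    (fun k hk a h1 => ?_) ha
  refine grGT_induction (C := fun b => S.form a b = 0) (by simp)
    (fun a b h1 h2 => by rw [map_add, h1, h2, add_zero])
    (fun l hl b h2 => S.gr_form k l (by omega) a h1 b h2) hb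

variable (S) in
/-- The grading of the finite-dimensional space `𝔤` is bounded. -/
theorem exists_gr_bound : ∃ B : ℤ, 0 < B ∧ ∀ k, (k < -B ∨ B < k) → S.gr k = ⊥ := by
  have : FiniteDimensional ℂ 𝔤 := Module.Basis.finiteDimensional_of_finite S.q
  have h := WellFoundedGT.finite_ne_bot_of_iSupIndep S.gr_internal.submodule_iSupIndep
  obtain ⟨B, hB⟩ := h.bddAbove
  obtain ⟨B', hB'⟩ := h.bddBelow
  refine ⟨max (max B (-B')) 1, by omega, fun k hk => ?_⟩
  by_contra h'
  have h1 := hB h'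
  have h2 := hB' h'
  omega

variable (S) in
/-- A bound for the degrees of `𝔤`. -/
def bd : ℤ := S.exists_gr_bound.choose

theorem bd_pos : 0 < S.bd := S.exists_gr_bound.choose_spec.1

theorem gr_eq_bot {k : ℤ} (h : k < -S.bd ∨ S.bd < k) : S.gr k = ⊥ :=
  S.exists_gr_bound.choose_spec.2 k h

theorem grGT_eq_bot {d : ℤ} (h : S.bd ≤ d) : S.grGT d = ⊥ := by
  refine le_bot_iff.1 fun a ha => ?_
  refine grGT_induction (Submodule.zero_mem _) (fun _ _ => Submodule.add_mem _)
    (fun k hk a h' => ?_) ha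
  rwa [gr_eq_bot (Or.inr (by omega))] at h'

theorem grGT_eq_top {d : ℤ} (h : d < -S.bd) : S.grGT d = ⊤ := by
  refine top_le_iff.1 ?_
  rw [← S.gr_internal.submodule_iSup_eq_top]
  refine iSup_le fun k => ?_
  by_cases hk : d < k
  · exact gr_le_grGT hk
  · rw [gr_eq_bot (Or.inl (by omega))]; exact bot_le

end grading

/-- `N = i + j`, minus the degree of `z`. -/
abbrev zdeg : ℤ := S.i + S.j

theorem zdeg_pos : 0 < S.zdeg := add_pos S.i_pos S.j_pos

/-- The series all of whose terms have degree at least `d`. -/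
def Fil (d : ℤ) : Submodule ℂ S.G := S.coefIn fun l => S.tens (S.grGT (l * S.zdeg + d - 1)) ⊤

theorem Fil_anti : Antitone S.Fil := fun _ _ h _ hX l =>
  tens_mono (grGT_anti (by omega)) le_rfl (hX l)

theorem zcoeff_eq_zero_of_mem {d l : ℤ} {X : S.G} (hX : X ∈ S.Fil d)
    (h : S.bd < l * S.zdeg + d) : S.zcoeff l X = 0 := by
  have : S.zcoeff l X ∈ S.tens (S.grGT (l * S.zdeg + d - 1)) ⊤ := hX l
  rwa [grGT_eq_bot (by omega), tens_bot, Submodule.mem_bot] at this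

/-- The filtration of `ĝ ⊗ 𝒫(ḡ)` by degree. -/
def filG : Filt S.G where
  F := S.Fil
  anti := S.Fil_anti
  separated X hX := S.ext_zcoeff fun l => by
    rw [map_zero]
    exact S.zcoeff_eq_zero_of_mem (hX (S.bd + 1 - l * S.zdeg)) (by omega)
  exhaustive X := by
    obtain ⟨K, hK⟩ := exists_zc_eq_zero X
    refine ⟨-S.bd - K * S.zdeg, fun l => ?_⟩
    by_cases hl : K < l
    · have : S.zcoeff l X = 0 := hK l hl
      rw [this]; exact Submodule.zero_mem _
    · show S.zcoeff l X ∈ S.tens (S.grGT (l * S.zdeg + (-S.bd - K * S.zdeg) - 1)) ⊤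
      rw [grGT_eq_top]
      · exact mem_tens_top _
      · have := mul_le_mul_of_nonneg_right (not_lt.1 hl) S.zdeg_pos.le
        omega
  complete x d hx := by
    -- the coefficient of `z^l` of `x k` vanishes for `k ≥ m l`
    obtain ⟨m, hm⟩ : ∃ m : ℤ → ℕ, ∀ l, m l = (S.bd + 1 - l * S.zdeg - d).toNat := ⟨_, fun _ => rfl⟩
    have h1 : ∀ l (k : ℕ), m l ≤ k → S.zcoeff l (x k) = 0 := fun l k hk =>
      S.zcoeff_eq_zero_of_mem (hx k) (by have := hm l; omega)
    obtain ⟨y, hy⟩ := exists_of_zc S.q (fun l => ∑ k ∈ Finset.range (m l), S.zcoeff l (x k))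
      ((S.bd + 1 - d).natAbs) (fun l hl => by
        have h2 : S.bd + 1 - d < l * S.zdeg := by nlinarith [S.zdeg_pos, Int.le_natAbs (a := S.bd + 1 - d)]
        rw [show m l = 0 by have := hm l; omega]; rfl)
    have hy : ∀ l, S.zcoeff l y = ∑ k ∈ Finset.range (m l), S.zcoeff l (x k) := hy
    refine ⟨y, fun n l => ?_⟩
    rw [map_sub, map_sum, hy]
    rcases le_total (m l) n with h | h
    · obtain ⟨c, rfl⟩ := Nat.exists_eq_add_of_le h
      rw [Finset.sum_range_add, sub_add_cancel_left, neg_mem_iff]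
      exact Submodule.sum_mem _ fun k _ => by
        rw [h1 _ _ (Nat.le_add_right _ _)]; exact Submodule.zero_mem _
    · obtain ⟨c, hc⟩ := Nat.exists_eq_add_of_le h
      rw [hc, Finset.sum_range_add, add_sub_cancel_left]
      exact Submodule.sum_mem _ fun k _ =>
        tens_mono (grGT_anti (by push_cast; omega)) le_rfl (hx (n + k) l)

theorem closed_coefIn (Z : ℤ → Submodule ℂ (𝔤 ⊗[ℂ] S.A)) : S.filG.Closed (S.coefIn Z) :=
  fun X hX l => by
    obtain ⟨Y, hY, h⟩ := hX (S.bd + 1 - l * S.zdeg)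
    have h1 := S.zcoeff_eq_zero_of_mem h (l := l) (by omega)
    rw [map_sub, sub_eq_zero] at h1
    rw [h1]
    exact hY l

theorem brG_shift : Filt.Shift₂ S.filG S.filG S.filG S.brG := fun d e X hX Y hY =>
  S.brG_mem_coefIn (fun k l _ h1 _ h2 => brA_mem_tens (fun _ _ => Algebra.mem_top)
    (fun _ => grGT_par) (fun a ha b hb => grGT_anti (by nlinarith) (br_mem_grGT ha hb)) h1 h2) hX hY

theorem map_shift {g : 𝔤 →ₗ[ℂ] 𝔤} (hg : ∀ d, ∀ a ∈ S.grGT d, g a ∈ S.grGT d)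
    (d : S.A →ₗ[ℂ] S.A) : Filt.Shift S.filG S.filG 0 (TensorProduct.map g (Laurent.map d)) :=
  fun k X hX l => by
    rw [zcoeff_map, add_zero]
    exact map_mem_tens (hg _) (fun _ _ => Algebra.mem_top) (hX l)

theorem parG_shift : Filt.Shift S.filG S.filG 0 S.parG :=
  S.map_shift (fun _ _ => grGT_par) _

theorem DG_shift : Filt.Shift S.filG S.filG 0 S.DG := S.map_shift (fun _ _ => grGT_par) _

theorem const_mem_Fil {d : ℤ} {X : 𝔤 ⊗[ℂ] S.A} (hX : X ∈ S.tens (S.grGT (d - 1)) ⊤) :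
    S.const X ∈ S.Fil d := fun l => by
  rw [zcoeff_const]
  split_ifs with h
  · subst h; simpa using hX
  · exact Submodule.zero_mem _

theorem tensOne_mem_Fil {d k : ℤ} {a : 𝔤} (ha : a ∈ S.gr (d + k * S.zdeg)) :
    S.tensOne (a ⊗ₜ Laurent.mono k 1) ∈ S.Fil d := fun l => by
  rw [zcoeff_tensOne_tmul, Laurent.coeff_mono]
  split_ifs with h
  · subst h
    rw [one_smul]
    exact tmul_mem_tens (gr_le_grGT (by omega) ha) trivial
  · rw [zero_smul]; exact Submodule.zero_mem _

end DSData

namespace DSData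

variable {𝔤 : Type*} [AddCommGroup 𝔤] [Module ℂ 𝔤] {ι : Type*} [Fintype ι] [DecidableEq ι]
  (S : DSData 𝔤 ι)

/-! ### The Lie superalgebra of Lax operators -/

/-- The extension `a ⊗ u ↦ (-1)^{e p(a)} a ⊗ d u` of a derivation of parity `e` to
`ĝ ⊗ 𝒫(ḡ)`. -/
def extG (e : ZMod 2) (d : S.A →ₗ[ℂ] S.A) : S.G →ₗ[ℂ] S.G := S.extT e (Laurent.map d)

theorem DG_eq : S.DG = S.extG 1 S.D := by
  rw [extG, LieSuperalgebra.extT, LieSuperalgebra.parPow_eq_pw, pw_one]; rfl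

theorem parG_parG (X : S.G) : S.parG (S.parG X) = X := S.parT_parT S.isSuper_tauL X

theorem parG_brG (X Y : S.G) : S.parG (S.brG X Y) = S.brG (S.parG X) (S.parG Y) :=
  S.par_brT S.isSuper_tauL X Y

variable {S} in
theorem jacobiG {e : ZMod 2} {A : S.G} (hA : S.parG A = sgn e • A) (X Y : S.G) :
    S.brG A (S.brG X Y) = S.brG (S.brG A X) Y + S.brG (pw S.parG e X) (S.brG A Y) :=
  S.jacobiT S.isSuper_tauL hA X Y

variable {S} in
theorem skewG {e : ZMod 2} {A : S.G} (hA : S.parG A = sgn e • A) (X : S.G) :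
    S.brG A X = -S.brG (pw S.parG e X) A := S.skewT S.isSuper_tauL hA X

variable {S} in
theorem extG_brG {e : ZMod 2} {d : S.A →ₗ[ℂ] S.A} (hd : SuperPoly.IsSDer S.varPar e d)
    (X Y : S.G) : S.extG e d (S.brG X Y) =
      S.brG (S.extG e d X) Y + S.brG (pw S.parG e X) (S.extG e d Y) :=
  S.extT_brT S.isSuper_tauL (Laurent.isDerOf (S.isDerOf hd)) X Y

variable {S} in
theorem parG_extG {e : ZMod 2} {d : S.A →ₗ[ℂ] S.A} (hd : SuperPoly.IsSDer S.varPar e d)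
    (X : S.G) : S.parG (S.extG e d X) = sgn e • S.extG e d (S.parG X) :=
  S.extT_parity (Laurent.isDerOf (S.isDerOf hd)) X

theorem DG_brG (X Y : S.G) : S.DG (S.brG X Y) = S.brG (S.DG X) Y + S.brG (S.parG X) (S.DG Y) := by
  rw [DG_eq, extG_brG S.D_isSDer, pw_one]

theorem parG_DG (X : S.G) : S.parG (S.DG X) = -S.DG (S.parG X) := by
  rw [DG_eq, parG_extG S.D_isSDer, sgn_one]; module

theorem extG_DG {e : ZMod 2} {d d' : S.A →ₗ[ℂ] S.A}
    (h : ∀ a, d (S.D a) = sgn e • S.D (d a) + d' a) (X : S.G) :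
    S.extG e d (S.DG X) = sgn e • S.DG (S.extG e d X) + S.extG (e + 1) d' X := by
  induction X using TensorProduct.induction_on with
  | zero => simp
  | add x y h1 h2 => simp only [map_add, h1, h2, smul_add]; abel
  | tmul a u =>
    have h1 : Laurent.map d (Laurent.map S.D u) =
        sgn e • Laurent.map S.D (Laurent.map d u) + Laurent.map d' u :=
      Laurent.ext_coeff fun k => by simp [h]
    have h2 : pw S.par e (S.par a) = S.par (pw S.par e a) := by
      rcases parity_cases e with rfl | rfl <;> simp
    have h3 : pw S.par (e + 1) a = S.par (pw S.par e a) := by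
      rw [add_comm, pw_add _ S.par_par, pw_one]
    simp only [DG, extG, TensorProduct.map_tmul, LieSuperalgebra.extT_tmul, h1, h2, h3,
      TensorProduct.tmul_add, TensorProduct.tmul_smul]

/-- The bracket of `ℂ[D] ⋉ (ĝ ⊗ 𝒫(ḡ))` as a bilinear map. -/
def opB : S.Op →ₗ[ℂ] S.Op →ₗ[ℂ] S.Op :=
  LinearMap.mk₂ ℂ S.opBr
    (fun x x' y => by
      refine Prod.ext (by simp [opBr]) (Prod.ext (by simp [opBr]; ring) ?_)
      simp only [opBr, Prod.fst_add, Prod.snd_add, map_add, LinearMap.add_apply]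
      module)
    (fun c x y => by
      refine Prod.ext (by simp [opBr]) (Prod.ext (by simp [opBr]; ring) ?_)
      simp only [opBr, Prod.smul_fst, Prod.smul_snd, map_smul, LinearMap.smul_apply, smul_eq_mul]
      module)
    (fun x y y' => by
      refine Prod.ext (by simp [opBr]) (Prod.ext (by simp [opBr]; ring) ?_)
      simp only [opBr, Prod.fst_add, Prod.snd_add, map_add]
      module)
    (fun c x y => by
      refine Prod.ext (by simp [opBr]) (Prod.ext (by simp [opBr]; ring) ?_)
      simp only [opBr, Prod.smul_fst, Prod.smul_snd, map_smul, smul_eq_mul]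
      module)

theorem opB_apply (x y : S.Op) : S.opB x y = S.opBr x y := rfl

/-- The inclusion of `ĝ ⊗ 𝒫(ḡ)` as a linear map. -/
def opL : S.G →ₗ[ℂ] S.Op := LinearMap.inr ℂ ℂ (ℂ × S.G) ∘ₗ LinearMap.inr ℂ ℂ S.G

theorem opL_apply (X : S.G) : S.opL X = S.op X := rfl

theorem opB_op_op (X Y : S.G) : S.opB (S.op X) (S.op Y) = S.op (S.brG X Y) := by
  refine Prod.ext (by simp [opB_apply, opBr, op]) (Prod.ext (by simp [opB_apply, opBr, op]) ?_)
  simp [opB_apply, opBr, op]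

theorem opB_op (X : S.G) (x : S.Op) : S.opB (S.op X) x =
    S.op (S.brG X x.2.2 - x.1 • S.DG (S.parG X) - x.2.1 • S.DG (S.DG X)) := by
  refine Prod.ext (by simp [opB_apply, opBr, op]) (Prod.ext (by simp [opB_apply, opBr, op]) ?_)
  simp [opB_apply, opBr, op]

/-- The parity involution of `ℂ[D] ⋉ (ĝ ⊗ 𝒫(ḡ))`. -/
def parOp : S.Op →ₗ[ℂ] S.Op :=
  LinearMap.prodMap (-LinearMap.id) (LinearMap.prodMap LinearMap.id S.parG)

theorem parOp_apply (x : S.Op) : S.parOp x = (-x.1, x.2.1, S.parG x.2.2) := rfl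

theorem pw_parOp (e : ZMod 2) (x : S.Op) :
    pw S.parOp e x = (sgn e * x.1, x.2.1, pw S.parG e x.2.2) := by
  rcases parity_cases e with rfl | rfl
  · simp
  · simp [parOp_apply]

variable {S} in
/-- The Jacobi identity: the bracket with an element of parity `e` is a superderivation. -/
theorem opB_jacobi {e : ZMod 2} {A : S.G} (hA : S.parG A = sgn e • A) (x y : S.Op) :
    S.opB (S.op A) (S.opB x y) =
      S.opB (S.opB (S.op A) x) y + S.opB (pw S.parOp e x) (S.opB (S.op A) y) := by
  obtain ⟨α, β, X⟩ := x
  obtain ⟨α', β', Y⟩ := y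
  have hDA : S.parG (S.DG A) = sgn (e + 1) • S.DG A := by
    rw [parG_DG, hA, map_smul, sgn_add, sgn_one]; module
  have hDDA : S.parG (S.DG (S.DG A)) = sgn e • S.DG (S.DG A) := by
    rw [parG_DG, hDA, map_smul, sgn_add, sgn_one]; module
  have k1 : S.brG (pw S.parG e X) (S.DG A) = -S.brG (S.DG A) (S.parG X) := by
    rw [skewG hDA, pw_add _ S.parG_parG, pw_one, parG_parG, neg_neg]
  have k2 : S.brG (pw S.parG e X) (S.DG (S.DG A)) = -S.brG (S.DG (S.DG A)) X := by
    rw [skewG hDDA, neg_neg]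
  have j := jacobiG hA X Y
  refine Prod.ext (by simp [opB_apply, opBr, op]) (Prod.ext (by simp [opB_apply, opBr, op]) ?_)
  rw [opB_op, opB_op, opB_op, pw_parOp]
  simp only [opB_apply, opBr, op, map_add, map_sub, map_smul,
    LinearMap.sub_apply, LinearMap.smul_apply, hA, j, DG_brG, parG_brG, parG_DG, k1, k2,
    map_neg, LinearMap.neg_apply, smul_add, smul_sub, smul_neg, smul_smul, mul_zero, zero_smul,
    zero_mul, add_zero, sub_zero, Prod.snd_add]
  rcases parity_cases e with rfl | rfl
  · simp only [sgn_zero, one_mul, mul_one]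
    module
  · simp only [sgn_one]
    module

/-- The extension of a derivation of `𝒫(ḡ)` to `ℂ[D] ⋉ (ĝ ⊗ 𝒫(ḡ))`, with `D ↦ 0`. -/
def extOp (e : ZMod 2) (d : S.A →ₗ[ℂ] S.A) : S.Op →ₗ[ℂ] S.Op :=
  S.opL ∘ₗ S.extG e d ∘ₗ LinearMap.snd ℂ ℂ S.G ∘ₗ LinearMap.snd ℂ ℂ (ℂ × S.G)

theorem extOp_apply (e : ZMod 2) (d : S.A →ₗ[ℂ] S.A) (x : S.Op) :
    S.extOp e d x = S.op (S.extG e d x.2.2) := rfl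

/-- The filtration of `ℂ[D] ⋉ (ĝ ⊗ 𝒫(ḡ))`; the operators `D` and `D²` have degree `0`. -/
def filOp : Filt S.Op where
  F d :=
    { carrier := {x | x.2.2 ∈ S.Fil d ∧ (0 < d → x.1 = 0 ∧ x.2.1 = 0)}
      add_mem' := fun h h' => ⟨Submodule.add_mem _ h.1 h'.1, fun hd => by
        simp [(h.2 hd).1, (h.2 hd).2, (h'.2 hd).1, (h'.2 hd).2]⟩
      zero_mem' := ⟨Submodule.zero_mem _, fun _ => ⟨rfl, rfl⟩⟩
      smul_mem' := fun r x h => ⟨Submodule.smul_mem _ _ h.1, fun hd => by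
        simp [(h.2 hd).1, (h.2 hd).2]⟩ }
  anti d d' h x hx := ⟨S.Fil_anti h hx.1, fun hd => hx.2 (by omega)⟩
  separated x h := Prod.ext ((h 1).2 (by omega)).1 (Prod.ext ((h 1).2 (by omega)).2
    (S.filG.separated _ fun d => (h d).1))
  exhaustive x := by
    obtain ⟨d, hd⟩ := S.filG.exhaustive x.2.2
    exact ⟨min d 0, S.Fil_anti (min_le_left _ _) hd, fun h => by omega⟩
  complete x d h := by
    obtain ⟨y, hy⟩ := S.filG.complete (fun k => (x k).2.2) d fun k => (h k).1
    obtain ⟨y₁, hy₁⟩ := (Filt.discrete ℂ).complete (fun k => (x k).1) d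
      fun k => Filt.mem_discrete.2 fun hd => ((h k).2 hd).1
    obtain ⟨y₂, hy₂⟩ := (Filt.discrete ℂ).complete (fun k => (x k).2.1) d
      fun k => Filt.mem_discrete.2 fun hd => ((h k).2 hd).2
    refine ⟨(y₁, y₂, y), fun n => ⟨?_, fun hd => ⟨?_, ?_⟩⟩⟩
    · rw [Prod.snd_sub, Prod.snd_sub, Prod.snd_sum, Prod.snd_sum]
      exact hy n
    · have := Filt.mem_discrete.1 (hy₁ n) hd
      simpa [Prod.fst_sum] using this
    · have := Filt.mem_discrete.1 (hy₂ n) hd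
      simpa [Prod.snd_sum, Prod.fst_sum] using this

variable {S} in
theorem mem_filOp {x : S.Op} {d : ℤ} :
    x ∈ S.filOp.F d ↔ x.2.2 ∈ S.Fil d ∧ (0 < d → x.1 = 0 ∧ x.2.1 = 0) := Iff.rfl

variable {S} in
theorem op_mem_filOp {X : S.G} {d : ℤ} : S.op X ∈ S.filOp.F d ↔ X ∈ S.Fil d := by
  simp [mem_filOp, op]

theorem opL_shift : Filt.Shift S.filG S.filOp 0 S.opL := fun d X hX => by
  rw [add_zero]; exact op_mem_filOp.2 hX

theorem opB_shift : Filt.Shift₂ S.filOp S.filOp S.filOp S.opB := by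
  intro d e x hx y hy
  obtain ⟨α, β, X⟩ := x
  obtain ⟨α', β', Y⟩ := y
  obtain ⟨hX, hx⟩ := mem_filOp.1 hx
  obtain ⟨hY, hy⟩ := mem_filOp.1 hy
  have hD : ∀ d X, X ∈ S.Fil d → S.DG X ∈ S.Fil d := fun d X h => by
    have h' := S.DG_shift d X h; rw [add_zero] at h'; exact h'
  have hp : ∀ d X, X ∈ S.Fil d → S.parG X ∈ S.Fil d := fun d X h => by
    have h' := S.parG_shift d X h; rw [add_zero] at h'; exact h'
  have hl : ∀ (c : ℂ) (d e : ℤ) Y, Y ∈ S.Fil e → (0 < d → c = 0) → c • Y ∈ S.Fil (d + e) := by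
    intro c d e Y hY hc
    by_cases hd : 0 < d
    · rw [hc hd, zero_smul]; exact Submodule.zero_mem _
    · exact Submodule.smul_mem _ _ (S.Fil_anti (by omega) hY)
  refine mem_filOp.2 ⟨?_, fun h => ⟨rfl, ?_⟩⟩
  · refine Submodule.sub_mem _ (Submodule.sub_mem _ (Submodule.add_mem _ (Submodule.add_mem _
      (S.brG_shift d e X hX Y hY) ?_) ?_) ?_) ?_
    · exact hl _ _ _ _ (hD _ _ hY) fun h => (hx h).1
    · exact hl _ _ _ _ (hD _ _ (hD _ _ hY)) fun h => (hx h).2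
    · rw [add_comm]; exact hl _ _ _ _ (hD _ _ (hp _ _ hX)) fun h => (hy h).1
    · rw [add_comm]; exact hl _ _ _ _ (hD _ _ (hD _ _ hX)) fun h => (hy h).2
  · show 2 * α * α' = 0
    rcases lt_or_ge 0 d with h' | h'
    · have : α = 0 := (hx h').1
      rw [this]; ring
    · have : α' = 0 := (hy (by omega)).1
      rw [this]; ring

theorem parOp_shift : Filt.Shift S.filOp S.filOp 0 S.parOp := fun d x hx => by
  have h' := S.parG_shift d _ (mem_filOp.1 hx).1
  rw [add_zero] at h' ⊢
  refine mem_filOp.2 ⟨h', fun h => ?_⟩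
  have := (mem_filOp.1 hx).2 h
  simp [parOp_apply, this.1, this.2]

variable {S} in
theorem adT_shift {T : S.G} (hT : T ∈ S.Fil 1) : Filt.Shift S.filOp S.filOp 1 (S.opB (S.op T)) :=
  fun d x hx => by rw [add_comm]; exact S.opB_shift 1 d _ (op_mem_filOp.2 hT) x hx

variable {S} in
theorem adG_shift {T : S.G} (hT : T ∈ S.Fil 1) : Filt.Shift S.filG S.filG 1 (S.brG T) :=
  fun d x hx => by rw [add_comm]; exact S.brG_shift 1 d _ hT x hx

/-- The operator `e^{ad T}`, for `T` of positive degree. -/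
def E (T : S.G) : S.Op →ₗ[ℂ] S.Op := S.filOp.exp (S.opB (S.op T))

section E

variable {S} {T : S.G} (hT : T ∈ S.Fil 1)

include hT

theorem E_fst (x : S.Op) : (S.E T x).1 = x.1 := by
  have h := Filt.exp_map (Φ' := Filt.discrete ℂ) (N' := 0) (adT_shift hT)
    (fun _ _ _ => Submodule.zero_mem _) (c := 0) (φ := LinearMap.fst ℂ ℂ (ℂ × S.G))
    (fun d x hx => by
      rw [add_zero]; exact Filt.mem_discrete.2 fun h => ((mem_filOp.1 hx).2 h).1)
    (fun x => by rw [opB_op]; rfl) x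
  rw [Filt.exp_zero] at h
  exact h

theorem E_snd_fst (x : S.Op) : (S.E T x).2.1 = x.2.1 := by
  have h := Filt.exp_map (Φ' := Filt.discrete ℂ) (N' := 0) (adT_shift hT)
    (fun _ _ _ => Submodule.zero_mem _) (c := 0)
    (φ := LinearMap.fst ℂ ℂ S.G ∘ₗ LinearMap.snd ℂ ℂ (ℂ × S.G))
    (fun d x hx => by
      rw [add_zero]; exact Filt.mem_discrete.2 fun h => ((mem_filOp.1 hx).2 h).2)
    (fun x => by rw [opB_op]; rfl) x
  rw [Filt.exp_zero] at h
  exact h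

theorem E_op (X : S.G) : S.E T (S.op X) = S.op (S.filG.exp (S.brG T) X) := by
  have h := Filt.exp_map (adG_shift hT) (adT_shift hT) S.opL_shift
    (fun X => (S.opB_op_op T X).symm) X
  exact h.symm

theorem E_isExpAd (x : S.Op) : S.IsExpAd T x (S.E T x) := by
  have hit : ∀ k, (S.opBr (S.op T))^[k] x = (S.opB (S.op T) ^ k) x := fun k => by
    rw [Module.End.pow_apply]; rfl
  refine ⟨E_fst hT x, E_snd_fst hT x, fun l => ?_⟩
  obtain ⟨d, hd⟩ := S.filOp.exhaustive x
  set n := (S.bd + 1 - l * S.zdeg - d).toNat with hn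
  have h0 : ∀ k, n ≤ k → S.zcoeff l (((S.opBr (S.op T))^[k] x).2.2) = 0 := fun k hk => by
    rw [hit]
    exact S.zcoeff_eq_zero_of_mem (mem_filOp.1 ((adT_shift hT).iterate hd k)).1 (by omega)
  refine ⟨(Finset.range n).finite_toSet.subset fun k hk => ?_, ?_⟩
  · by_contra h
    simp only [Finset.coe_range, Set.mem_Iio, not_lt] at h
    exact hk (h0 k h)
  · rw [finsum_eq_sum_of_support_subset (s := Finset.range n) _ (fun k hk => by
      by_contra h
      simp only [Finset.coe_range, Set.mem_Iio, not_lt] at h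
      exact hk (by simp only [h0 k h, smul_zero]))]
    have h1 := (mem_filOp.1 (Filt.exp_spec (adT_shift hT) hd n)).1
    have h2 := S.zcoeff_eq_zero_of_mem h1 (l := l) (by omega)
    simp only [Prod.snd_sub, Prod.snd_sum, map_sub, map_sum, sub_eq_zero] at h2
    refine h2.trans (Finset.sum_congr rfl fun k _ => ?_)
    rw [hit, Filt.expTerm, LinearMap.smul_apply, Prod.smul_snd, Prod.smul_snd, map_smul]

theorem eq_E_of_isExpAd {x y : S.Op} (h : S.IsExpAd T x y) : y = S.E T x := by
  have h' := E_isExpAd hT x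
  refine Prod.ext (h.1.trans h'.1.symm) (Prod.ext (h.2.1.trans h'.2.1.symm) ?_)
  exact S.ext_zcoeff fun l => (h.2.2 l).2.trans (h'.2.2 l).2.symm

theorem expAd_eq (x : S.Op) : S.expAd T x = S.E T x := by
  have h : ∃ y, S.IsExpAd T x y := ⟨_, E_isExpAd hT x⟩
  rw [expAd, dif_pos h]
  exact eq_E_of_isExpAd hT h.choose_spec

theorem neg_mem_Fil : -T ∈ S.Fil 1 := Submodule.neg_mem _ hT

theorem E_neg_eq : S.E (-T) = S.filOp.exp (-S.opB (S.op T)) := by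
  have : S.opB (S.op (-T)) = -S.opB (S.op T) := by
    rw [← opL_apply, map_neg, map_neg]; rfl
  rw [E, this]

theorem E_neg_E (x : S.Op) : S.E (-T) (S.E T x) = x := by
  rw [E_neg_eq hT]; exact Filt.exp_neg_exp (adT_shift hT) x

theorem E_E_neg (x : S.Op) : S.E T (S.E (-T) x) = x := by
  rw [E_neg_eq hT]; exact Filt.exp_exp_neg (adT_shift hT) x

end E

end DSData

namespace DSData

variable {𝔤 : Type*} [AddCommGroup 𝔤] [Module ℂ 𝔤] {ι : Type*} [Fintype ι] [DecidableEq ι]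
  (S : DSData 𝔤 ι)

/-! ### The bilinear form and multiplication by powers of `z` -/

/-- The `𝒫(ḡ)`-valued form of `ĝ ⊗ 𝒫(ḡ)` as a bilinear map. -/
def formGB : S.G →ₗ[ℂ] S.G →ₗ[ℂ] S.A :=
  (S.formT (Laurent.map S.tau) S.form).compr₂ (Laurent.coeff 0)

theorem formGB_apply (X Y : S.G) : S.formGB X Y = S.formG X Y := rfl

/-- The `𝒫(ḡ)`-valued form of `𝔤 ⊗ 𝒫(ḡ)`. -/
def formA : 𝔤 ⊗[ℂ] S.A →ₗ[ℂ] 𝔤 ⊗[ℂ] S.A →ₗ[ℂ] S.A := S.formT S.tau S.form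

theorem formGB_inv (X Y Z : S.G) : S.formGB (S.brG X Y) Z = S.formGB X (S.brG Y Z) :=
  congrArg (Laurent.coeff 0) (S.formT_inv S.isSuper_tauL S.form_invariant X Y Z)

theorem tau_formGB (X Y : S.G) : S.tau (S.formGB X Y) = S.formGB (S.parG X) (S.parG Y) := by
  have h := congrArg (Laurent.coeff 0) (S.par_formT S.isSuper_tauL S.form_even X Y)
  rw [Laurent.coeff_map] at h
  exact h

variable {S} in
theorem der_formGB {e : ZMod 2} {d : S.A →ₗ[ℂ] S.A} (hd : SuperPoly.IsSDer S.varPar e d)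
    (X Y : S.G) : d (S.formGB X Y) =
      S.formGB (S.extG e d X) Y + S.formGB (pw S.parG e X) (S.extG e d Y) := by
  have h := congrArg (Laurent.coeff 0)
    (S.extT_formT S.isSuper_tauL S.form_even (Laurent.isDerOf (S.isDerOf hd)) X Y)
  rw [Laurent.coeff_map, map_add] at h
  exact h

theorem D_formGB (X Y : S.G) :
    S.D (S.formGB X Y) = S.formGB (S.DG X) Y + S.formGB (S.parG X) (S.DG Y) := by
  rw [der_formGB S.D_isSDer, pw_one, ← DG_eq]

theorem formGB_eq_sum (X Y : S.G) : ∃ K : ℕ, ∀ K', K ≤ K' → S.formGB X Y =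
    ∑ k ∈ Finset.Icc (-(K' : ℤ)) K', S.formA (S.zcoeff k X) (S.zcoeff (0 - k) Y) := by
  obtain ⟨K, hK⟩ := zc_bilT S.toLieSuperalgebra (τ := S.tau) S.form 0 X Y
  refine ⟨K, fun K' h => ?_⟩
  have h1 := congrArg (TensorProduct.lid ℂ S.A) (hK K' h)
  rw [map_sum] at h1
  have hW : ∀ W : ℂ ⊗[ℂ] Laurent S.A, Laurent.coeff 0 (TensorProduct.lid ℂ (Laurent S.A) W) =
      TensorProduct.lid ℂ S.A (LinearMap.lTensor ℂ (Laurent.coeff 0) W) := fun W => by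
    induction W using TensorProduct.induction_on with
    | zero => simp
    | tmul a u => simp
    | add x y h1 h2 => simp only [map_add, h1, h2]
  exact (hW _).trans h1

theorem formGB_const (X : 𝔤 ⊗[ℂ] S.A) (Y : S.G) :
    S.formGB (S.const X) Y = S.formA X (S.zcoeff 0 Y) := by
  obtain ⟨K, hK⟩ := S.formGB_eq_sum (S.const X) Y
  rw [hK K le_rfl, Finset.sum_eq_single 0]
  · rw [zcoeff_const, if_pos rfl, sub_zero]
  · intro k _ hk
    rw [zcoeff_const, if_neg hk, map_zero, LinearMap.zero_apply]
  · intro h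
    exact absurd (Finset.mem_Icc.2 ⟨by omega, by omega⟩) h

variable {S} in
theorem formGB_eq_zero {d e : ℤ} (h : 0 < d + e) {X Y : S.G} (hX : X ∈ S.Fil d)
    (hY : Y ∈ S.Fil e) : S.formGB X Y = 0 := by
  obtain ⟨K, hK⟩ := S.formGB_eq_sum X Y
  rw [hK K le_rfl]
  refine Finset.sum_eq_zero fun k _ => ?_
  have h1 : S.zcoeff k X ∈ S.tens (S.grGT (k * S.zdeg + d - 1)) ⊤ := hX k
  have h2 : S.zcoeff (0 - k) Y ∈ S.tens (S.grGT ((0 - k) * S.zdeg + e - 1)) ⊤ := hY _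
  refine tens_induction (C := fun U => S.formA U (S.zcoeff (0 - k) Y) = 0) (by simp)
    (fun U V h1 h2 => by rw [map_add, LinearMap.add_apply, h1, h2, add_zero])
    (fun a ha u _ => ?_) h1
  refine tens_induction (C := fun V => S.formA (a ⊗ₜ u) V = 0) (by simp)
    (fun U V h1 h2 => by rw [map_add, h1, h2, add_zero]) (fun b hb v _ => ?_) h2
  have h3 : ∀ e', S.form a (S.proj e' b) = 0 := fun e' =>
    form_eq_zero_of_grGT (by nlinarith) ha (prj_mem (fun _ => grGT_par) e' hb)
  simp [formA, LieSuperalgebra.formT, LinearMap.add_apply, TensorProduct.map₂_apply_tmul, h3]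

theorem formGB_shift : Filt.Shift₂ S.filG S.filG (Filt.discrete S.A) S.formGB :=
  fun _ _ _ hX _ hY => Filt.mem_discrete.2 fun h => formGB_eq_zero h hX hY

/-- Multiplication by `z^k` on `ĝ ⊗ 𝒫(ḡ)`. -/
def zG (k : ℤ) : S.G →ₗ[ℂ] S.G :=
  LinearMap.lTensor 𝔤 (LinearMap.mulLeft ℂ (Laurent.mono k (1 : S.A)))

theorem zcoeff_zG (k l : ℤ) (X : S.G) : S.zcoeff l (S.zG k X) = S.zcoeff (l - k) X := by
  induction X using TensorProduct.induction_on with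
  | zero => simp
  | tmul a u => simp [zcoeff, zG, Laurent.coeff_mono_mul]
  | add x y h1 h2 => simp only [map_add, h1, h2]

theorem zG_eq_right (k : ℤ) : S.zG k =
    LinearMap.lTensor 𝔤 (LinearMap.mulRight ℂ (Laurent.mono k (1 : S.A))) := by
  rw [zG]
  congr 1
  exact LinearMap.ext fun u => Laurent.mono_mul_comm k u

theorem brG_zG (k : ℤ) (X Y : S.G) : S.brG X (S.zG k Y) = S.zG k (S.brG X Y) := by
  rw [zG_eq_right]
  exact S.bilT_rmul S.br _ X Y

theorem map_zG (g : 𝔤 →ₗ[ℂ] 𝔤) (d : S.A →ₗ[ℂ] S.A) (k : ℤ) (X : S.G) :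
    TensorProduct.map g (Laurent.map d) (S.zG k X) = S.zG k (TensorProduct.map g (Laurent.map d) X) :=
  S.ext_zcoeff fun l => by rw [zcoeff_map, zcoeff_zG, zcoeff_zG, zcoeff_map]

theorem parG_zG (k : ℤ) (X : S.G) : S.parG (S.zG k X) = S.zG k (S.parG X) := S.map_zG _ _ k X

theorem DG_zG (k : ℤ) (X : S.G) : S.DG (S.zG k X) = S.zG k (S.DG X) := S.map_zG _ _ k X

theorem zG_shift (k : ℤ) : Filt.Shift S.filG S.filG (-k * S.zdeg) (S.zG k) := fun d X hX l => by
  rw [zcoeff_zG]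
  have : S.zcoeff (l - k) X ∈ S.tens (S.grGT ((l - k) * S.zdeg + d - 1)) ⊤ := hX (l - k)
  rwa [show (l - k) * S.zdeg + d - 1 = l * S.zdeg + (d + -k * S.zdeg) - 1 by ring] at this

theorem zG_zG (k l : ℤ) (X : S.G) : S.zG k (S.zG l X) = S.zG (l + k) X :=
  S.ext_zcoeff fun m => by rw [zcoeff_zG, zcoeff_zG, zcoeff_zG, sub_sub, add_comm]

theorem zG_zero (X : S.G) : S.zG 0 X = X := S.ext_zcoeff fun m => by rw [zcoeff_zG, sub_zero]

/-- The operators with coefficients in the subspaces `Z l`. -/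
def opCoefIn (Z : ℤ → Submodule ℂ (𝔤 ⊗[ℂ] S.A)) : Submodule ℂ S.Op :=
  (S.coefIn Z).comap (LinearMap.snd ℂ ℂ S.G ∘ₗ LinearMap.snd ℂ ℂ (ℂ × S.G))

theorem closed_opCoefIn (Z : ℤ → Submodule ℂ (𝔤 ⊗[ℂ] S.A)) : S.filOp.Closed (S.opCoefIn Z) :=
  fun _ hx => S.closed_coefIn Z _ fun d => by
    obtain ⟨y, hy, h⟩ := hx d
    exact ⟨y.2.2, hy, (mem_filOp.1 h).1⟩

variable {S} in
/-- Brackets with elements whose coefficients lie in a differential subsuperalgebra preserve such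
elements. -/
theorem opB_mem_coef {B : Subalgebra ℂ S.A} (hB : ∀ u ∈ B, S.tau u ∈ B) (hD : ∀ u ∈ B, S.D u ∈ B)
    {T : S.G} (hT : T ∈ S.coefIn fun _ => S.tens ⊤ B) {x : S.Op}
    (hx : x ∈ S.opCoefIn fun _ => S.tens ⊤ B) :
    S.opB (S.op T) x ∈ S.opCoefIn fun _ => S.tens ⊤ B := by
  have hp : ∀ X ∈ S.coefIn fun _ => S.tens ⊤ B, S.parG X ∈ S.coefIn fun _ => S.tens ⊤ B :=
    fun X hX l => by
      rw [parG, zcoeff_map]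
      exact map_mem_tens (U' := ⊤) (fun _ _ => trivial) hB (hX l)
  have hd : ∀ X ∈ S.coefIn fun _ => S.tens ⊤ B, S.DG X ∈ S.coefIn fun _ => S.tens ⊤ B :=
    fun X hX l => by
      rw [DG, zcoeff_map]
      exact map_mem_tens (U' := ⊤) (fun _ _ => trivial) hD (hX l)
  show (S.opB (S.op T) x).2.2 ∈ S.coefIn fun _ => S.tens ⊤ B
  rw [opB_op]
  refine Submodule.sub_mem _ (Submodule.sub_mem _ (S.brG_mem_coefIn (fun _ _ X hX Y hY => ?_) hT hx)
    (Submodule.smul_mem _ _ (hd _ (hp _ hT)))) (Submodule.smul_mem _ _ (hd _ (hd _ hT)))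
  exact brA_mem_tens (U' := ⊤) (U'' := ⊤) hB (fun _ _ => trivial) (fun _ _ _ _ => trivial) hX hY

theorem extG_zero (e : ZMod 2) (X : S.G) : S.extG e 0 X = 0 := by
  have h0 : Laurent.map (0 : S.A →ₗ[ℂ] S.A) = 0 :=
    LinearMap.ext fun u => Laurent.ext_coeff fun k => by simp
  rw [extG, LieSuperalgebra.extT, h0, TensorProduct.map_zero_right]; rfl

theorem extG_shift (e : ZMod 2) (d : S.A →ₗ[ℂ] S.A) : Filt.Shift S.filG S.filG 0 (S.extG e d) :=
  S.map_shift (fun k a ha => by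
    rw [LieSuperalgebra.parPow_eq_pw]
    rcases parity_cases e with rfl | rfl
    · simpa using ha
    · simpa using grGT_par ha) _

/-- Up to terms of high degree, an element of `ĝ ⊗ 𝒫(ḡ)` involves finitely many variables. -/
theorem exists_finset_extG (T : S.G) (c : ℤ) : ∃ s : Finset (ι × ℕ), ∀ y ∉ s, ∀ e,
    S.extG e (SuperPoly.pderiv S.varPar y) T ∈ S.Fil c := by
  have h1 : ∀ X : 𝔤 ⊗[ℂ] S.A, ∃ s : Finset (ι × ℕ), ∀ y ∉ s, ∀ g : 𝔤 →ₗ[ℂ] 𝔤,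
      TensorProduct.map g (SuperPoly.pderiv S.varPar y) X = 0 := fun X => by
    induction X using TensorProduct.induction_on with
    | zero => exact ⟨∅, by simp⟩
    | tmul a u =>
      refine ⟨(SuperPoly.pderiv_finite S.varPar u).toFinset, fun y hy g => ?_⟩
      simp only [Set.Finite.mem_toFinset, Function.mem_support, not_not] at hy
      rw [TensorProduct.map_tmul, hy, TensorProduct.tmul_zero]
    | add x y h1 h2 =>
      obtain ⟨s, hs⟩ := h1
      obtain ⟨s', hs'⟩ := h2
      refine ⟨s ∪ s', fun y hy g => ?_⟩
      simp only [Finset.mem_union, not_or] at hy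
      rw [map_add, hs y hy.1, hs' y hy.2, add_zero]
  choose s hs using fun l => h1 (S.zcoeff l T)
  obtain ⟨K, hK⟩ := exists_zc_eq_zero T
  refine ⟨(Finset.Icc (-S.bd - c.natAbs) K).biUnion s, fun y hy e l => ?_⟩
  rw [extG, LieSuperalgebra.extT, zcoeff_map]
  by_cases hl : l ∈ Finset.Icc (-S.bd - c.natAbs) K
  · rw [hs l y (fun h => hy (Finset.mem_biUnion.2 ⟨l, hl, h⟩))]
    exact Submodule.zero_mem _
  · rw [Finset.mem_Icc, not_and_or, not_le, not_le] at hl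
    rcases hl with hl | hl
    · show _ ∈ S.tens (S.grGT (l * S.zdeg + c - 1)) ⊤
      rw [grGT_eq_top]
      · exact mem_tens_top _
      · have := S.zdeg_pos
        have := S.bd_pos
        nlinarith [Int.le_natAbs (a := c)]
    · have : S.zcoeff l T = 0 := hK l hl
      rw [this, map_zero]
      exact Submodule.zero_mem _

end DSData

/-- A derivation preserves the subalgebra generated by `s` if it maps `s` to it. -/
theorem SuperPoly.IsSDer.mem_adjoin {X : Type*} {p : X → ZMod 2} {e : ZMod 2}
    {d : SuperPoly p →ₗ[ℂ] SuperPoly p} (h : SuperPoly.IsSDer p e d) {s : Set (SuperPoly p)}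
    {B : Subalgebra ℂ (SuperPoly p)} (hs : Algebra.adjoin ℂ s ≤ B)
    (h1 : ∀ a ∈ s, d a ∈ B) (h2 : ∀ a ∈ s, SuperPoly.σ p a ∈ B)
    {a : SuperPoly p} (ha : a ∈ Algebra.adjoin ℂ s) : d a ∈ B := by
  have hp : ∀ a ∈ Algebra.adjoin ℂ s, SuperPoly.parPow p e a ∈ B := fun a ha => by
    rcases parity_cases e with rfl | rfl
    · simpa using hs ha
    · rw [SuperPoly.parPow_one]
      have : Algebra.adjoin ℂ s ≤ B.comap (SuperPoly.σ p) := Algebra.adjoin_le h2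
      exact this ha
  induction ha using Algebra.adjoin_induction with
  | mem x hx => exact h1 x hx
  | algebraMap r => rw [h.map_algebraMap]; exact B.zero_mem
  | add x y _ _ hx hy => rw [map_add]; exact B.add_mem hx hy
  | mul x y hx' hy' hx hy =>
    rw [h.2]
    exact B.add_mem (B.mul_mem hx (hs hy')) (B.mul_mem (hp x hx') hy)

namespace DSData

variable {𝔤 : Type*} [AddCommGroup 𝔤] [Module ℂ 𝔤] {ι : Type*} [Fintype ι] [DecidableEq ι]
  (S : DSData 𝔤 ι)

theorem qbar_mem_P {t : ι} (ht : t ∈ S.I) (n : ℕ) : S.qbar t n ∈ S.P :=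
  Algebra.subset_adjoin ⟨t, ht, n, rfl⟩

theorem tau_qbar (t : ι) (n : ℕ) : S.tau (S.qbar t n) = sgn (S.varPar (t, n)) • S.qbar t n := by
  rw [tau_eq]; exact SuperPoly.σ_gen _ _

theorem tau_mem_P {a : S.A} (ha : a ∈ S.P) : S.tau a ∈ S.P := by
  have : S.P ≤ S.P.comap (S.pp 1) := Algebra.adjoin_le fun a ⟨t, ht, n, h⟩ => by
    subst h
    show S.tau (S.qbar t n) ∈ S.P
    rw [tau_qbar]
    exact S.P.smul_mem (S.qbar_mem_P ht n) _
  exact this ha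

variable {S} in
theorem der_mem_P {e : ZMod 2} {d : S.A →ₗ[ℂ] S.A} (hd : SuperPoly.IsSDer S.varPar e d)
    (h : ∀ t ∈ S.I, ∀ n, d (S.qbar t n) ∈ S.P) {a : S.A} (ha : a ∈ S.P) : d a ∈ S.P :=
  hd.mem_adjoin (B := S.P) le_rfl (fun a ⟨t, ht, n, h'⟩ => h' ▸ h t ht n)
    (fun a ⟨t, ht, n, h'⟩ => by
      rw [← S.pp_one]; exact S.tau_mem_P (h' ▸ S.qbar_mem_P ht n)) ha

theorem D_mem_P {a : S.A} (ha : a ∈ S.P) : S.D a ∈ S.P :=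
  der_mem_P S.D_isSDer (fun t ht n => by rw [D_qbar]; exact S.qbar_mem_P ht (n + 1)) ha

/-! ### Gauge transformations -/

/-- The elements with coefficients in `𝒫`. -/
abbrev coefP : Submodule ℂ S.G := S.coefIn fun _ => S.tens ⊤ S.P

/-- The operators with coefficients in `𝒫`. -/
abbrev opCoefP : Submodule ℂ S.Op := S.opCoefIn fun _ => S.tens ⊤ S.P

/-- The gauge transformations of Lax operators: the automorphisms that the products of the
exponentials `e^{ad T}` give rise to, together with their logarithmic derivatives `Z`. The element
`Z e d` describes the commutator of the transformation with a derivation `d` of parity `e` of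
`𝒫(ḡ)` such that `[d, D] = d'` (in the super sense). -/
structure Gauge where
  toFun : S.Op →ₗ[ℂ] S.Op
  inv : S.Op →ₗ[ℂ] S.Op
  inv_toFun : ∀ x, inv (toFun x) = x
  toFun_inv : ∀ x, toFun (inv x) = x
  fst : ∀ x, (toFun x).1 = x.1
  snd_fst : ∀ x, (toFun x).2.1 = x.2.1
  map_opB : ∀ x y, toFun (S.opB x y) = S.opB (toFun x) (toFun y)
  map_par : ∀ x, toFun (S.parOp x) = S.parOp (toFun x)
  mem : ∀ d, ∀ x ∈ S.filOp.F d, toFun x ∈ S.filOp.F d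
  sub_mem : ∀ d, ∀ x ∈ S.filOp.F d, toFun x - x ∈ S.filOp.F (d + 1)
  form : ∀ X Y, S.formGB (toFun (S.op X)).2.2 (toFun (S.op Y)).2.2 = S.formGB X Y
  coef : ∀ x ∈ S.opCoefP, toFun x ∈ S.opCoefP
  coef_inv : ∀ x ∈ S.opCoefP, inv x ∈ S.opCoefP
  map_z : ∀ k X, (toFun (S.op (S.zG k X))).2.2 = S.zG k (toFun (S.op X)).2.2
  Z : ZMod 2 → (S.A →ₗ[ℂ] S.A) → S.G
  Z_zero : ∀ e, Z e 0 = 0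
  Z_par : ∀ e d, SuperPoly.IsSDer S.varPar e d → S.parG (Z e d) = sgn e • Z e d
  Z_finite : ∀ c, ∃ s : Finset (ι × ℕ), ∀ y ∉ s, ∀ e,
    Z e (SuperPoly.pderiv S.varPar y) ∈ S.Fil c
  derivative : ∀ (e : ZMod 2) (d d' : S.A →ₗ[ℂ] S.A), SuperPoly.IsSDer S.varPar e d →
    (∀ a, d (S.D a) = sgn e • S.D (d a) + d' a) → ∀ x : S.Op, x.2.1 = 0 →
    S.extOp e d (toFun x) = toFun (S.extOp e d x) + S.opB (S.op (Z e d)) (toFun x) -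
      x.1 • S.op (Z (e + 1) d')

variable {S} in
/-- The composition of gauge transformations. -/
def Gauge.comp (E₂ E₁ : S.Gauge) : S.Gauge where
  toFun := E₂.toFun ∘ₗ E₁.toFun
  inv := E₁.inv ∘ₗ E₂.inv
  inv_toFun x := by simp [E₁.inv_toFun, E₂.inv_toFun]
  toFun_inv x := by simp [E₁.toFun_inv, E₂.toFun_inv]
  fst x := by simp [E₁.fst, E₂.fst]
  snd_fst x := by simp [E₁.snd_fst, E₂.snd_fst]
  map_opB x y := by simp [E₁.map_opB, E₂.map_opB]
  map_par x := by simp [E₁.map_par, E₂.map_par]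
  mem d x hx := E₂.mem d _ (E₁.mem d x hx)
  sub_mem d x hx := by
    have := Submodule.add_mem _ (E₂.sub_mem d _ (E₁.mem d x hx)) (E₁.sub_mem d x hx)
    simpa using this
  form X Y := by
    have h : ∀ X, E₁.toFun (S.op X) = S.op (E₁.toFun (S.op X)).2.2 := fun X =>
      Prod.ext (E₁.fst _) (Prod.ext (E₁.snd_fst _) rfl)
    rw [LinearMap.comp_apply, LinearMap.comp_apply, h X, h Y, E₂.form, E₁.form]
  coef x hx := E₂.coef _ (E₁.coef x hx)
  coef_inv x hx := E₁.coef_inv _ (E₂.coef_inv x hx)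
  map_z k X := by
    have h : ∀ X, E₁.toFun (S.op X) = S.op (E₁.toFun (S.op X)).2.2 := fun X =>
      Prod.ext (E₁.fst _) (Prod.ext (E₁.snd_fst _) rfl)
    rw [LinearMap.comp_apply, LinearMap.comp_apply, h, E₁.map_z, E₂.map_z, ← h]
  Z e d := (E₂.toFun (S.op (E₁.Z e d))).2.2 + E₂.Z e d
  Z_zero e := by
    rw [E₁.Z_zero, E₂.Z_zero, add_zero, ← opL_apply, map_zero, map_zero]; rfl
  Z_par e d hd := by
    have h1 := congrArg (fun x : S.Op => x.2.2) (E₂.map_par (S.op (E₁.Z e d)))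
    have h2 : S.parOp (S.op (E₁.Z e d)) = sgn e • S.op (E₁.Z e d) := by
      rw [← opL_apply, ← map_smul, ← E₁.Z_par e d hd]
      exact Prod.ext (by simp [parOp_apply, opL_apply, op]) rfl
    rw [h2, map_smul] at h1
    rw [map_add, E₂.Z_par e d hd, smul_add]
    congr 1
    exact h1.symm
  Z_finite c := by
    obtain ⟨s, hs⟩ := E₁.Z_finite c
    obtain ⟨s', hs'⟩ := E₂.Z_finite c
    refine ⟨s ∪ s', fun y hy e => ?_⟩
    simp only [Finset.mem_union, not_or] at hy
    exact Submodule.add_mem _ (mem_filOp.1 (E₂.mem c _ (op_mem_filOp.2 (hs y hy.1 e)))).1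
      (hs' y hy.2 e)
  derivative e d d' hd hD x hx := by
    have h : ∀ X, E₂.toFun (S.op X) = S.op (E₂.toFun (S.op X)).2.2 := fun X =>
      Prod.ext (E₂.fst _) (Prod.ext (E₂.snd_fst _) rfl)
    rw [LinearMap.comp_apply, E₂.derivative e d d' hd hD _ ((E₁.snd_fst x).trans hx),
      E₁.derivative e d d' hd hD x hx, map_sub, map_add, E₂.map_opB, map_smul, h (E₁.Z e d),
      h (E₁.Z (e + 1) d'), E₁.fst]
    have hL : ∀ X, (S.opL X).2.2 = X := fun _ => rfl
    simp only [← opL_apply, map_add, LinearMap.add_apply, LinearMap.comp_apply, hL]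
    module

section exp

variable {S} {T : S.G}

theorem parOp_opB {T : S.G} (hT : S.parG T = T) (x : S.Op) :
    S.parOp (S.opB (S.op T) x) = S.opB (S.op T) (S.parOp x) := by
  have h : ∀ X, S.parOp (S.op X) = S.op (S.parG X) := fun X =>
    Prod.ext (by simp [parOp_apply, op]) rfl
  rw [opB_op, opB_op, h]
  simp only [map_sub, map_smul, parG_brG, hT, parG_DG, parOp_apply, map_neg]
  congr 1
  module

theorem E_form (hT : T ∈ S.Fil 1) (hp : S.parG T = T) (X Y : S.G) :
    S.formGB (S.filG.exp (S.brG T) X) (S.filG.exp (S.brG T) Y) = S.formGB X Y := by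
  have hp' : S.parG T = sgn 0 • T := by rw [hp, sgn_zero, one_smul]
  have h := Filt.exp_bilin (N' := (0 : S.A →ₗ[ℂ] S.A)) (adG_shift hT) S.formGB_shift (adG_shift hT)
    (fun _ _ _ => Submodule.zero_mem _) (fun u x => ?_) X Y
  · rw [Filt.exp_zero] at h
    exact h.symm
  · rw [skewG hp', map_neg, LinearMap.neg_apply, formGB_inv]
    simp

/-- The derivative of `e^{ad T}`. -/
theorem E_derivative (hT : T ∈ S.Fil 1) (hp : S.parG T = T) {e : ZMod 2} {d d' : S.A →ₗ[ℂ] S.A}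
    (hd : SuperPoly.IsSDer S.varPar e d) (hD : ∀ a, d (S.D a) = sgn e • S.D (d a) + d' a)
    {x : S.Op} (hx : x.2.1 = 0) :
    S.extOp e d (S.E T x) = S.E T (S.extOp e d x) +
      S.opB (S.op (S.filG.exp₁ (S.brG T) (S.extG e d T))) (S.E T x) -
      x.1 • S.op (S.filG.exp₁ (S.brG T) (S.extG (e + 1) d' T)) := by
  have hp' : S.parG T = sgn 0 • T := by rw [hp, sgn_zero, one_smul]
  let β' : S.G →ₗ[ℂ] S.Op →ₗ[ℂ] S.Op :=
    -(LinearMap.lsmul ℂ S.Op ∘ₗ LinearMap.fst ℂ ℂ (ℂ × S.G)).flip ∘ₗ S.opL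
  have hβ' : ∀ X x, β' X x = -(x.1 • S.op X) := fun X x => rfl
  have h := Filt.exp_derivative (Φ := S.filOp) (Ψ := S.filG) (N := S.opB (S.op T)) (NU := S.brG T)
    (β := S.opB ∘ₗ S.opL) (β' := β') (adT_shift hT)
    (fun d e X hX x hx => S.opB_shift d e _ (op_mem_filOp.2 hX) x hx)
    (fun d e X hX x hx => ?_) (adG_shift hT) (fun X x => ?_) (fun X x => ?_) (c := 0)
    (δ := S.extOp e d) (fun k x hx => ?_) (y := S.extG e d T) (y' := S.extG (e + 1) d' T)
    (LinearMap.ker (LinearMap.fst ℂ ℂ S.G ∘ₗ LinearMap.snd ℂ ℂ (ℂ × S.G))) (fun x _ => ?_)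
    (fun x hx => ?_) (x := x) hx
  · have h1 : (S.filOp.exp (S.opB (S.op T)) x).1 = x.1 := E_fst hT x
    rw [hβ', h1] at h
    rw [E, h, sub_eq_add_neg]
    rfl
  · rw [hβ', neg_mem_iff]
    by_cases he : 0 < e
    · rw [((mem_filOp.1 hx).2 he).1, zero_smul]; exact Submodule.zero_mem _
    · exact Submodule.smul_mem _ _ (op_mem_filOp.2 (S.Fil_anti (by omega) hX))
  · have := opB_jacobi hp' (S.op X) x
    rw [pw_zero, opB_op_op] at this
    exact this
  · rw [hβ', hβ', hβ', map_neg, map_smul, opB_op_op]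
    have : (S.opB (S.op T) x).1 = 0 := by rw [opB_op]; rfl
    rw [this, zero_smul, neg_zero, add_zero]
  · have := S.extG_shift e d k _ (mem_filOp.1 hx).1
    rw [add_zero] at this ⊢
    exact op_mem_filOp.2 this
  · show (S.opB (S.op T) x).2.1 = 0
    rw [opB_op]; rfl
  · have hx : x.2.1 = 0 := hx
    rw [hβ', LinearMap.comp_apply, opL_apply, opB_op, opB_op, opB_op, extOp_apply, extOp_apply,
      hx]
    simp only [op, map_sub, map_smul, extG_brG hd, hp, pw_of_hom S.parG e 0 T hp', mul_zero,
      sgn_zero, one_smul, S.extG_DG hD, parG_extG hd, zero_smul, sub_zero]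
    refine Prod.ext (by simp) (Prod.ext (by simp) ?_)
    simp only [Prod.snd_add, Prod.snd_neg, Prod.smul_snd]
    module

/-- The gauge transformation `e^{ad T}`. -/
def Gauge.exp (T : S.G) (hT : T ∈ S.Fil 1) (hp : S.parG T = T) (hc : T ∈ S.coefP) : S.Gauge where
  toFun := S.E T
  inv := S.E (-T)
  inv_toFun := E_neg_E hT
  toFun_inv := E_E_neg hT
  fst := E_fst hT
  snd_fst := E_snd_fst hT
  map_opB := Filt.exp_bilin (adT_shift hT) S.opB_shift (adT_shift hT) (adT_shift hT) fun u x => by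
    have := opB_jacobi (A := T) (e := 0) (by rw [hp, sgn_zero, one_smul]) u x
    rwa [pw_zero] at this
  map_par x := (Filt.exp_map (adT_shift hT) (adT_shift hT) S.parOp_shift (parOp_opB hp) x).symm
  mem d x hx := Filt.exp_mem (adT_shift hT) hx
  sub_mem d x hx := Filt.exp_sub_mem (adT_shift hT) hx
  form X Y := by rw [E_op hT, E_op hT]; exact E_form hT hp X Y
  coef x hx := Filt.exp_mem_closed (adT_shift hT) (S.closed_opCoefIn _)
    (fun _ hx => opB_mem_coef (fun _ => S.tau_mem_P) (fun _ => S.D_mem_P) hc hx) hx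
  coef_inv x hx := Filt.exp_mem_closed (adT_shift (neg_mem_Fil hT)) (S.closed_opCoefIn _)
    (fun _ hx => opB_mem_coef (fun _ => S.tau_mem_P) (fun _ => S.D_mem_P)
      (Submodule.neg_mem _ hc) hx) hx
  map_z k X := by
    rw [E_op hT, E_op hT]
    exact (Filt.exp_map (adG_shift hT) (adG_shift hT) (S.zG_shift k)
      (fun X => (S.brG_zG k T X).symm) X).symm
  Z e d := S.filG.exp₁ (S.brG T) (S.extG e d T)
  Z_zero e := by rw [extG_zero, map_zero]
  Z_par e d hd := by
    have hc : Filt.Shift S.filG S.filG 0 (S.parG - sgn e • LinearMap.id) := fun d x hx =>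
      Submodule.sub_mem _ (S.parG_shift d x hx)
        (Submodule.smul_mem _ _ (by rw [add_zero]; exact hx))
    have h := Filt.exp₁_mem_closed (adG_shift hT) (Filt.closed_ker hc) (fun x hx => ?_)
      (x := S.extG e d T) ?_
    · exact sub_eq_zero.1 h
    · have hx : S.parG x - sgn e • x = 0 := hx
      show S.parG (S.brG T x) - sgn e • S.brG T x = 0
      rw [parG_brG, hp, sub_eq_zero.1 hx, map_smul, sub_self]
    · show S.parG (S.extG e d T) - sgn e • S.extG e d T = 0
      rw [parG_extG hd, hp, sub_self]
  Z_finite c := by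
    obtain ⟨s, hs⟩ := S.exists_finset_extG T c
    exact ⟨s, fun y hy e => Filt.exp₁_mem (adG_shift hT) (hs y hy e)⟩
  derivative e d d' hd hD x hx := E_derivative hT hp hd hD hx

end exp

namespace Gauge

variable {S} (E : S.Gauge)

/-- The restriction of a gauge transformation to `ĝ ⊗ 𝒫(ḡ)`. -/
def onG : S.G →ₗ[ℂ] S.G :=
  (LinearMap.snd ℂ ℂ S.G ∘ₗ LinearMap.snd ℂ ℂ (ℂ × S.G)) ∘ₗ E.toFun ∘ₗ S.opL

/-- The restriction of the inverse of a gauge transformation to `ĝ ⊗ 𝒫(ḡ)`. -/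
def invG : S.G →ₗ[ℂ] S.G :=
  (LinearMap.snd ℂ ℂ S.G ∘ₗ LinearMap.snd ℂ ℂ (ℂ × S.G)) ∘ₗ E.inv ∘ₗ S.opL

theorem toFun_op (X : S.G) : E.toFun (S.op X) = S.op (E.onG X) :=
  Prod.ext (E.fst _) (Prod.ext (E.snd_fst _) rfl)

theorem inv_op (X : S.G) : E.inv (S.op X) = S.op (E.invG X) := by
  have h1 := E.fst (E.inv (S.op X))
  have h2 := E.snd_fst (E.inv (S.op X))
  rw [E.toFun_inv] at h1 h2
  exact Prod.ext h1.symm (Prod.ext h2.symm rfl)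

theorem op_inj {X Y : S.G} (h : S.op X = S.op Y) : X = Y := congrArg (fun x : S.Op => x.2.2) h

theorem onG_invG (X : S.G) : E.onG (E.invG X) = X :=
  op_inj (by rw [← E.toFun_op, ← E.inv_op, E.toFun_inv])

theorem invG_onG (X : S.G) : E.invG (E.onG X) = X :=
  op_inj (by rw [← E.inv_op, ← E.toFun_op, E.inv_toFun])

theorem onG_brG (X Y : S.G) : E.onG (S.brG X Y) = S.brG (E.onG X) (E.onG Y) :=
  op_inj (by rw [← toFun_op, ← opB_op_op, E.map_opB, toFun_op, toFun_op, opB_op_op])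

theorem invG_brG (X Y : S.G) : E.invG (S.brG X Y) = S.brG (E.invG X) (E.invG Y) := by
  rw [← E.invG_onG (S.brG (E.invG X) (E.invG Y)), onG_brG, onG_invG, onG_invG]

theorem onG_parG (X : S.G) : E.onG (S.parG X) = S.parG (E.onG X) := by
  have h := congrArg (fun x : S.Op => x.2.2) (E.map_par (S.op X))
  have h1 : S.parOp (S.op X) = S.op (S.parG X) := Prod.ext (by simp [parOp_apply, op]) rfl
  rw [h1] at h
  exact h

theorem invG_parG (X : S.G) : E.invG (S.parG X) = S.parG (E.invG X) := by
  rw [← E.invG_onG (S.parG (E.invG X)), onG_parG, onG_invG]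

theorem onG_form (X Y : S.G) : S.formGB (E.onG X) (E.onG Y) = S.formGB X Y := E.form X Y

theorem onG_zG (k : ℤ) (X : S.G) : E.onG (S.zG k X) = S.zG k (E.onG X) := E.map_z k X

theorem invG_zG (k : ℤ) (X : S.G) : E.invG (S.zG k X) = S.zG k (E.invG X) := by
  rw [← E.invG_onG (S.zG k (E.invG X)), onG_zG, onG_invG]

theorem invG_coef {X : S.G} (hX : X ∈ S.coefP) : E.invG X ∈ S.coefP :=
  E.coef_inv (S.op X) hX

end Gauge

end DSData

/-! ### Polynomials in an operator -/

section aeval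

variable {W W' : Type*} [AddCommGroup W] [Module ℂ W] [AddCommGroup W'] [Module ℂ W']

theorem aeval_intertwine {c : Module.End ℂ W} {c' : Module.End ℂ W'} {φ : W →ₗ[ℂ] W'}
    (h : ∀ x, φ (c x) = c' (φ x)) (q : Polynomial ℂ) (x : W) :
    φ (Polynomial.aeval c q x) = Polynomial.aeval c' q (φ x) := by
  induction q using Polynomial.induction_on generalizing x with
  | C r => simp
  | add p q h1 h2 => simp [h1, h2]
  | monomial n r ih =>
    rw [pow_succ, ← mul_assoc, map_mul _ (Polynomial.C r * Polynomial.X ^ n) Polynomial.X,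
      map_mul _ (Polynomial.C r * Polynomial.X ^ n) Polynomial.X, Module.End.mul_apply,
      Module.End.mul_apply, ih (Polynomial.aeval c Polynomial.X x), Polynomial.aeval_X,
      Polynomial.aeval_X, h]

theorem aeval_mem {c : Module.End ℂ W} {Z : Submodule ℂ W} (h : ∀ x ∈ Z, c x ∈ Z)
    (q : Polynomial ℂ) {x : W} (hx : x ∈ Z) : Polynomial.aeval c q x ∈ Z := by
  induction q using Polynomial.induction_on generalizing x with
  | C r => simpa using Z.smul_mem r hx
  | add p q h1 h2 => rw [map_add]; exact Z.add_mem (h1 hx) (h2 hx)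
  | monomial n r ih =>
    rw [pow_succ, ← mul_assoc, map_mul _ (Polynomial.C r * Polynomial.X ^ n) Polynomial.X,
      Module.End.mul_apply, Polynomial.aeval_X]
    exact ih (h x hx)

/-- An operator on a finite-dimensional space with `ker c² = ker c` satisfies `c = c² q(c)` for
some polynomial `q`. -/
theorem exists_aeval_pinv [FiniteDimensional ℂ W] (c : Module.End ℂ W)
    (h : ∀ x, c (c x) = 0 → c x = 0) :
    ∃ q : Polynomial ℂ, ∀ x, c (c (Polynomial.aeval c q x)) = c x := by
  have hμ := minpoly.aeval ℂ c
  have hμ0 : minpoly ℂ c ≠ 0 := minpoly.ne_zero (Algebra.IsIntegral.isIntegral c)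
  obtain ⟨ν, hν, hd⟩ := Polynomial.exists_eq_pow_rootMultiplicity_mul_and_not_dvd _ hμ0 0
  rw [Polynomial.C_0, sub_zero] at hν hd
  set n := Polynomial.rootMultiplicity 0 (minpoly ℂ c)
  have h0 : ν.coeff 0 ≠ 0 := fun h' => hd (Polynomial.X_dvd_iff.2 h')
  have h1 : ∀ n x, (c ^ n) x = 0 → c x = 0 := by
    intro n
    induction n with
    | zero => intro x hx; rw [pow_zero, Module.End.one_apply] at hx; rw [hx, map_zero]
    | succ n ih =>
      intro x hx
      rw [pow_succ, Module.End.mul_apply] at hx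
      exact h x (ih _ hx)
  have h2 : ∀ x, c (Polynomial.aeval c ν x) = 0 := fun x => h1 n _ (by
    rw [hν, map_mul, map_pow, Polynomial.aeval_X] at hμ
    exact congrArg (fun f => f x) hμ)
  refine ⟨-Polynomial.C (ν.coeff 0)⁻¹ * ν.divX, fun x => ?_⟩
  have h3 := h2 x
  have h4 : c (Polynomial.aeval c ν.divX x) = Polynomial.aeval c ν.divX (c x) :=
    aeval_intertwine (fun _ => rfl) _ x
  rw [← Polynomial.divX_mul_X_add ν, map_add, map_mul, Polynomial.aeval_X, Polynomial.aeval_C,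
    LinearMap.add_apply, Module.End.mul_apply, ← h4, Module.algebraMap_end_apply, map_add, map_smul] at h3
  rw [map_mul, Module.End.mul_apply, map_neg, Polynomial.aeval_C, LinearMap.neg_apply,
    Module.algebraMap_end_apply, map_neg, map_smul, map_neg, map_smul,
    eq_neg_of_add_eq_zero_left h3, smul_neg, neg_neg, smul_smul, inv_mul_cancel₀ h0, one_smul]

theorem exists_aeval_pinv_on (c : Module.End ℂ W) (Z : Submodule ℂ W) [FiniteDimensional ℂ Z]
    (hZ : ∀ x ∈ Z, c x ∈ Z) (h : ∀ x, c (c x) = 0 → c x = 0) :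
    ∃ q : Polynomial ℂ, ∀ x ∈ Z, c (c (Polynomial.aeval c q x)) = c x := by
  obtain ⟨q, hq⟩ := exists_aeval_pinv (c.restrict hZ) fun x hx =>
    Subtype.ext (h x.1 (congrArg Subtype.val hx))
  refine ⟨q, fun x hx => ?_⟩
  have h1 := congrArg Subtype.val (hq ⟨x, hx⟩)
  have h2 := aeval_intertwine (c := c.restrict hZ) (c' := c) (φ := Z.subtype)
    (fun _ => rfl) q ⟨x, hx⟩
  simp only [Submodule.subtype_apply, LinearMap.coe_restrict_apply] at h1 h2
  rw [← h2, h1]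

end aeval

namespace DSData

variable {𝔤 : Type*} [AddCommGroup 𝔤] [Module ℂ 𝔤] {ι : Type*} [Fintype ι] [DecidableEq ι]
  (S : DSData 𝔤 ι)

/-! ### The loop algebra and its grading -/

theorem loopBr_tmul (a b : 𝔤) (u v : Laurent ℂ) :
    S.loopBr (a ⊗ₜ u) (b ⊗ₜ v) = S.br a b ⊗ₜ (u * v) := by
  simp only [loopBr, LieSuperalgebra.brT, LinearMap.add_apply, TensorProduct.map₂_apply_tmul,
    LinearMap.comp_apply, LinearMap.id_apply, LinearMap.mul_apply', LinearMap.compl₂_apply,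
    TensorProduct.map_tmul, ← TensorProduct.add_tmul, ← map_add]
  rw [LieSuperalgebra.proj_eq, LieSuperalgebra.proj_eq, prj_add_prj]

/-- The homogeneous elements of degree `d` of `ĝ`. -/
def loopDeg (d : ℤ) : Submodule ℂ S.Loop :=
  ⨆ k : ℤ, (S.gr (d + k * S.zdeg)).map ((TensorProduct.mk ℂ 𝔤 (Laurent ℂ)).flip (Laurent.mono k 1))

section

variable {S}

theorem tmul_mem_loopDeg {d k : ℤ} {a : 𝔤} (ha : a ∈ S.gr (d + k * S.zdeg)) :
    a ⊗ₜ Laurent.mono k 1 ∈ S.loopDeg d :=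
  Submodule.mem_iSup_of_mem k ⟨a, ha, rfl⟩

@[elab_as_elim]
theorem loopDeg_induction {d : ℤ} {C : S.Loop → Prop} (h0 : C 0)
    (ha : ∀ X Y, C X → C Y → C (X + Y))
    (ht : ∀ k, ∀ a ∈ S.gr (d + k * S.zdeg), C (a ⊗ₜ Laurent.mono k 1)) {X : S.Loop}
    (hX : X ∈ S.loopDeg d) : C X :=
  Submodule.iSup_induction _ (motive := C) hX (fun k _ ⟨a, h, h'⟩ => h' ▸ ht k a h) h0 ha

theorem loopBr_mem_loopDeg {d e : ℤ} {X Y : S.Loop} (hX : X ∈ S.loopDeg d) (hY : Y ∈ S.loopDeg e) :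
    S.loopBr X Y ∈ S.loopDeg (d + e) := by
  refine loopDeg_induction (C := fun X => S.loopBr X Y ∈ S.loopDeg (d + e)) (by simp)
    (fun X X' h1 h2 => by rw [map_add, LinearMap.add_apply]; exact Submodule.add_mem _ h1 h2)
    (fun k a ha => ?_) hX
  refine loopDeg_induction
    (C := fun Y => S.loopBr (a ⊗ₜ Laurent.mono k 1) Y ∈ S.loopDeg (d + e)) (by simp)
    (fun X X' h1 h2 => by rw [map_add]; exact Submodule.add_mem _ h1 h2)
    (fun l b hb => ?_) hY
  rw [loopBr_tmul, Laurent.mono_one_mul_mono_one]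
  refine tmul_mem_loopDeg ?_
  have := S.gr_br _ _ a ha b hb
  rwa [show d + k * S.zdeg + (e + l * S.zdeg) = d + e + (k + l) * S.zdeg by ring] at this

theorem zmul_mem_loopDeg (k : ℤ) {d : ℤ} {X : S.Loop} (hX : X ∈ S.loopDeg d) :
    S.zmul k X ∈ S.loopDeg (d - k * S.zdeg) := by
  refine loopDeg_induction (C := fun X => S.zmul k X ∈ S.loopDeg (d - k * S.zdeg)) (by simp)
    (fun X X' h1 h2 => by rw [map_add]; exact Submodule.add_mem _ h1 h2)
    (fun l a ha => ?_) hX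
  rw [zmul, LinearMap.lTensor_tmul, LinearMap.mulLeft_apply, Laurent.mono_one_mul_mono_one]
  refine tmul_mem_loopDeg ?_
  rwa [show d - k * S.zdeg + (k + l) * S.zdeg = d + l * S.zdeg by ring]

theorem tensOne_mem_Fil_of_loopDeg {d : ℤ} {X : S.Loop} (hX : X ∈ S.loopDeg d) :
    S.tensOne X ∈ S.Fil d := by
  refine loopDeg_induction (C := fun X => S.tensOne X ∈ S.Fil d) (by simp)
    (fun X X' h1 h2 => by rw [map_add]; exact Submodule.add_mem _ h1 h2)
    (fun l a ha => S.tensOne_mem_Fil ha) hX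

theorem exists_loopDeg_fin (d : ℤ) : ∃ W : Submodule ℂ S.Loop, FiniteDimensional ℂ W ∧
    S.loopDeg d ≤ W := by
  have : FiniteDimensional ℂ 𝔤 := Module.Basis.finiteDimensional_of_finite S.q
  refine ⟨⨆ k : Finset.Icc (-(d.natAbs + S.bd)) (d.natAbs + S.bd), LinearMap.range
    ((TensorProduct.mk ℂ 𝔤 (Laurent ℂ)).flip (Laurent.mono k.1 1)), inferInstance, ?_⟩
  refine iSup_le fun k => ?_
  by_cases hk : k ∈ Finset.Icc (-(d.natAbs + S.bd)) (d.natAbs + S.bd)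
  · exact le_trans (LinearMap.map_le_range) (le_iSup (fun k : Finset.Icc (-(d.natAbs + S.bd))
      (d.natAbs + S.bd) => LinearMap.range
      ((TensorProduct.mk ℂ 𝔤 (Laurent ℂ)).flip (Laurent.mono k.1 1))) ⟨k, hk⟩)
  · rw [gr_eq_bot, Submodule.map_bot]
    · exact bot_le
    · rw [Finset.mem_Icc, not_and_or, not_le, not_le] at hk
      have := S.zdeg_pos
      have := S.bd_pos
      rcases hk with hk | hk
      · left
        have : k * S.zdeg ≤ k := by nlinarith
        omega
      · right
        have : k ≤ k * S.zdeg := by nlinarith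
        omega

end

theorem Lam_mem : S.Lam ∈ S.loopDeg (-S.i) := by
  refine Submodule.add_mem _ (tmul_mem_loopDeg (by simpa using S.f_gr)) (tmul_mem_loopDeg ?_)
  rw [show -S.i + 1 * (S.i + S.j) = S.j by ring]
  exact S.s_gr

theorem LamSq_mem : S.LamSq ∈ S.loopDeg (-2 * S.i) := by
  have := loopBr_mem_loopDeg S.Lam_mem S.Lam_mem
  rw [show -S.i + -S.i = -2 * S.i by ring] at this
  exact Submodule.smul_mem _ _ this

theorem loopBr_zmul (k : ℤ) (X Y : S.Loop) : S.loopBr X (S.zmul k Y) = S.zmul k (S.loopBr X Y) := by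
  have h : S.zmul k = LinearMap.lTensor 𝔤 (LinearMap.mulRight ℂ (Laurent.mono k (1 : ℂ))) := by
    rw [zmul]; congr 1; exact LinearMap.ext fun u => Laurent.mono_mul_comm k u
  rw [h]
  exact S.bilT_rmul S.br _ X Y

theorem zmul_loopBr (k : ℤ) (X Y : S.Loop) : S.loopBr (S.zmul k X) Y = S.zmul k (S.loopBr X Y) := by
  induction X using TensorProduct.induction_on with
  | zero => simp
  | add x y h1 h2 => simp only [map_add, LinearMap.add_apply, h1, h2]
  | tmul a u =>
    induction Y using TensorProduct.induction_on with
    | zero => simp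
    | add x y h1 h2 => simp only [map_add, h1, h2]
    | tmul b v => simp [zmul, loopBr_tmul, mul_assoc]

theorem zmul_zmul (k l : ℤ) (X : S.Loop) : S.zmul k (S.zmul l X) = S.zmul (k + l) X := by
  induction X using TensorProduct.induction_on with
  | zero => simp
  | add x y h1 h2 => simp only [map_add, h1, h2]
  | tmul a u => simp [zmul, ← mul_assoc, Laurent.mono_one_mul_mono_one]

theorem zmul_zero (X : S.Loop) : S.zmul 0 X = X := by
  induction X using TensorProduct.induction_on with
  | zero => simp
  | add x y h1 h2 => simp only [map_add, h1, h2]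
  | tmul a u => simp [zmul, Laurent.mono_zero_one]

/-- The parity involution of `ĝ`. -/
abbrev parL : S.Loop →ₗ[ℂ] S.Loop := LinearMap.rTensor (Laurent ℂ) S.par

theorem parL_loopBr (X Y : S.Loop) : S.parL (S.loopBr X Y) = S.loopBr (S.parL X) (S.parL Y) :=
  S.par_brT isSuper_laurent_complex X Y

theorem parL_parL (X : S.Loop) : S.parL (S.parL X) = X := S.parT_parT isSuper_laurent_complex X

theorem parL_Lam : S.parL S.Lam = -S.Lam := by
  simp [Lam, S.f_odd, S.s_odd, TensorProduct.neg_tmul]; abel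

theorem parL_LamSq : S.parL S.LamSq = S.LamSq := by
  rw [LamSq, map_smul, parL_loopBr, parL_Lam]; simp

theorem tensOne_loopBr (X Y : S.Loop) :
    S.tensOne (S.loopBr X Y) = S.brG (S.tensOne X) (S.tensOne Y) :=
  (S.bilT_map S.br (Laurent.map (Algebra.linearMap ℂ S.A))
    (Laurent.map_mul_of fun u v => by simp)
    (fun u => Laurent.ext_coeff fun k => by simp) X Y).symm

theorem tensOne_zmul (k : ℤ) (X : S.Loop) : S.tensOne (S.zmul k X) = S.zG k (S.tensOne X) := by
  induction X using TensorProduct.induction_on with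
  | zero => simp
  | add x y h1 h2 => simp only [map_add, h1, h2]
  | tmul a u =>
    simp only [zmul, tensOne, zG, LinearMap.lTensor_tmul, LinearMap.mulLeft_apply]
    congr 1
    exact Laurent.ext_coeff fun l => by simp [Laurent.coeff_mono_mul]

theorem parG_tensOne (X : S.Loop) : S.parG (S.tensOne X) = S.tensOne (S.parL X) := by
  induction X using TensorProduct.induction_on with
  | zero => simp
  | add x y h1 h2 => simp only [map_add, h1, h2]
  | tmul a u =>
    simp only [tensOne, parG, LinearMap.lTensor_tmul, TensorProduct.map_tmul,
      LinearMap.rTensor_tmul]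
    congr 1
    exact Laurent.ext_coeff fun l => by simp

variable {S} in
theorem extG_tensOne {e : ZMod 2} {d : S.A →ₗ[ℂ] S.A} (hd : SuperPoly.IsSDer S.varPar e d)
    (X : S.Loop) : S.extG e d (S.tensOne X) = 0 := by
  induction X using TensorProduct.induction_on with
  | zero => simp
  | add x y h1 h2 => simp only [map_add, h1, h2, add_zero]
  | tmul a u =>
    simp only [tensOne, extG, LinearMap.lTensor_tmul, LieSuperalgebra.extT_tmul]
    rw [Laurent.ext_coeff (x := Laurent.map d _) (y := 0) fun l => by
      simp [hd.map_algebraMap], TensorProduct.tmul_zero]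

theorem DG_tensOne (X : S.Loop) : S.DG (S.tensOne X) = 0 := by
  rw [DG_eq, extG_tensOne S.D_isSDer]

/-! ### The semisimple operator `ad Λ²` -/

/-- The operator `ad (Λ² ⊗ 1)`. -/
def adSq : S.G →ₗ[ℂ] S.G := S.brG (S.tensOne S.LamSq)

theorem parG_LamSq : S.parG (S.tensOne S.LamSq) = sgn 0 • S.tensOne S.LamSq := by
  rw [parG_tensOne, parL_LamSq, sgn_zero, one_smul]

theorem adSq_brG (X Y : S.G) : S.adSq (S.brG X Y) = S.brG (S.adSq X) Y + S.brG X (S.adSq Y) := by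
  have := jacobiG S.parG_LamSq X Y
  rwa [pw_zero] at this

theorem adSq_parG (X : S.G) : S.parG (S.adSq X) = S.adSq (S.parG X) := by
  rw [adSq, parG_brG, S.parG_LamSq, sgn_zero, one_smul]

variable {S} in
theorem adSq_extG {e : ZMod 2} {d : S.A →ₗ[ℂ] S.A} (hd : SuperPoly.IsSDer S.varPar e d)
    (X : S.G) : S.extG e d (S.adSq X) = S.adSq (S.extG e d X) := by
  rw [adSq, extG_brG hd, extG_tensOne hd, pw_of_hom S.parG e 0 _ S.parG_LamSq]
  simp

theorem adSq_DG (X : S.G) : S.DG (S.adSq X) = S.adSq (S.DG X) := by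
  rw [DG_eq, adSq_extG S.D_isSDer]

theorem adSq_zG (k : ℤ) (X : S.G) : S.zG k (S.adSq X) = S.adSq (S.zG k X) :=
  (S.brG_zG k _ X).symm

theorem adSq_shift : Filt.Shift S.filG S.filG (-2 * S.i) S.adSq := fun d X hX => by
  rw [add_comm]
  exact S.brG_shift _ d _ (tensOne_mem_Fil_of_loopDeg S.LamSq_mem) X hX

/-- Right multiplication by a series. -/
abbrev rmul (w : Laurent S.A) : S.G →ₗ[ℂ] S.G := LinearMap.lTensor 𝔤 (LinearMap.mulRight ℂ w)

theorem brG_rmul (w : Laurent S.A) (X Y : S.G) : S.brG X (S.rmul w Y) = S.rmul w (S.brG X Y) :=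
  S.bilT_rmul S.br w X Y

theorem zG_rmul (w : Laurent S.A) (k : ℤ) (X : S.G) : S.zG k (S.rmul w X) = S.rmul w (S.zG k X) := by
  induction X using TensorProduct.induction_on with
  | zero => simp
  | add x y h1 h2 => simp only [map_add, h1, h2]
  | tmul a u => simp [zG, mul_assoc]

variable {S} in
/-- A right linear map is determined by its values on `𝔤 ⊗ 1`. -/
theorem eq_zero_of_rmul {φ : S.G →ₗ[ℂ] S.G} (h : ∀ w X, φ (S.rmul w X) = S.rmul w (φ X))
    (h0 : ∀ x : 𝔤, φ (S.tensOne (x ⊗ₜ 1)) = 0) (X : S.G) : φ X = 0 := by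
  induction X using TensorProduct.induction_on with
  | zero => simp
  | add x y h1 h2 => rw [map_add, h1, h2, add_zero]
  | tmul a u =>
    have h1 : (a ⊗ₜ u : S.G) = S.rmul u (S.tensOne (a ⊗ₜ 1)) := by
      simp only [tensOne, LinearMap.lTensor_tmul, LinearMap.mulRight_apply]
      congr 1
      have : Laurent.map (Algebra.linearMap ℂ S.A) 1 = 1 :=
        Laurent.ext_coeff fun k => by
          rw [← Laurent.mono_zero_one, ← Laurent.mono_zero_one, Laurent.coeff_map,
            Laurent.coeff_mono, Laurent.coeff_mono]
          split_ifs <;> simp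
      rw [this, one_mul]
    rw [h1, h, h0, map_zero]

/-- `B` is a pseudoinverse of `ad Λ²`, homogeneous of degree `2 i`, that commutes with whatever
commutes with `ad Λ²` and with multiplication by powers of `z`, and such that `1 - (ad Λ²) B` maps
to elements that commute with the center of `𝒦`. -/
structure IsPinv (B : S.G →ₗ[ℂ] S.G) : Prop where
  adSq_pinv_adSq : ∀ X, S.adSq (B (S.adSq X)) = S.adSq X
  comm : ∀ φ : S.G →ₗ[ℂ] S.G, (∀ X, φ (S.adSq X) = S.adSq (φ X)) →
    (∀ k X, φ (S.zG k X) = S.zG k (φ X)) → ∀ X, φ (B X) = B (φ X)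
  stable : ∀ Z : Submodule ℂ S.G, (∀ X ∈ Z, S.adSq X ∈ Z) → (∀ k, ∀ X ∈ Z, S.zG k X ∈ Z) →
    ∀ X ∈ Z, B X ∈ Z
  shift : Filt.Shift S.filG S.filG (2 * S.i) B
  center : ∀ C ∈ S.center, ∀ X, S.brG (S.tensOne C) (X - S.adSq (B X)) = 0

variable {S} in
theorem loopBr_LamSq_of_sq (hS : S.SemisimpleLamSq) {X : S.Loop}
    (h : S.loopBr S.LamSq (S.loopBr S.LamSq X) = 0) : S.loopBr S.LamSq X = 0 := by
  have := Submodule.disjoint_def.1 hS.disjoint (S.loopBr S.LamSq X) h ⟨X, rfl⟩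
  exact this

variable {S} in
theorem loopBr_LamSq_of_pow (hS : S.SemisimpleLamSq) (n : ℕ) {X : S.Loop}
    (h : (S.loopBr S.LamSq ^ n : Module.End ℂ S.Loop) X = 0) : S.loopBr S.LamSq X = 0 := by
  induction n generalizing X with
  | zero => rw [pow_zero, Module.End.one_apply] at h; rw [h, map_zero]
  | succ n ih =>
    rw [pow_succ, Module.End.mul_apply] at h
    exact loopBr_LamSq_of_sq hS (ih h)

/-- On `𝔤 ⊗ 1` a pseudoinverse of `ad Λ²` is `z^{-2i} (ad Λ²)^N q(c)`, where `N + 1 = i + j`, for a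
polynomial `q` in the operator `c = z^{-2i} (ad Λ²)^{N+1}` of degree `0`. -/
theorem exists_loop_pinv (hS : S.SemisimpleLamSq) : ∃ (N : ℕ) (q : Polynomial ℂ),
    S.zdeg = N + 1 ∧ ∀ x : 𝔤, S.loopBr S.LamSq (x ⊗ₜ 1 - S.loopBr S.LamSq (S.zmul (-2 * S.i)
      (((S.loopBr S.LamSq : Module.End ℂ S.Loop) ^ N) (Polynomial.aeval (S.zmul (-2 * S.i) ∘ₗ
        (S.loopBr S.LamSq : Module.End ℂ S.Loop) ^ (N + 1) : Module.End ℂ S.Loop) q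
          (x ⊗ₜ 1))))) = 0 := by
  obtain ⟨N, hN⟩ : ∃ N : ℕ, S.zdeg = N + 1 := ⟨(S.zdeg - 1).toNat, by have := S.zdeg_pos; omega⟩
  set a₀ : Module.End ℂ S.Loop := S.loopBr S.LamSq with ha₀
  set c₀ : Module.End ℂ S.Loop := S.zmul (-2 * S.i) ∘ₗ a₀ ^ (N + 1) with hc₀
  have za₀ : ∀ k X, S.zmul k (a₀ X) = a₀ (S.zmul k X) := fun k X => (S.loopBr_zmul k _ X).symm
  have ac₀ : ∀ X, a₀ (c₀ X) = c₀ (a₀ X) := fun X => by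
    have h : a₀ ((a₀ ^ (N + 1)) X) = (a₀ ^ (N + 1)) (a₀ X) := by
      rw [← Module.End.mul_apply, ← pow_succ', pow_succ, Module.End.mul_apply]
    rw [hc₀, LinearMap.comp_apply, LinearMap.comp_apply, ← za₀, h]
  have hc0 : ∀ X, c₀ X = 0 → a₀ X = 0 := fun X h => by
    refine loopBr_LamSq_of_pow hS (N + 1) ?_
    have := congrArg (S.zmul (2 * S.i)) h
    rw [hc₀, LinearMap.comp_apply, zmul_zmul, map_zero,
      show 2 * S.i + -2 * S.i = 0 by ring, zmul_zero] at this
    exact this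
  have hc0' : ∀ X, a₀ X = 0 → c₀ X = 0 := fun X h => by
    rw [hc₀, LinearMap.comp_apply, pow_succ, Module.End.mul_apply, h, map_zero, map_zero]
  have hdeg : ∀ d, ∀ X ∈ S.loopDeg d, c₀ X ∈ S.loopDeg d := fun d X hX => by
    have h1 : ∀ n : ℕ, (a₀ ^ n) X ∈ S.loopDeg (d - 2 * S.i * n) := fun n => by
      induction n with
      | zero => simpa using hX
      | succ n ih =>
        rw [pow_succ', Module.End.mul_apply]
        have := loopBr_mem_loopDeg S.LamSq_mem ih
        rwa [show -2 * S.i + (d - 2 * S.i * n) = d - 2 * S.i * (n + 1 : ℕ) by push_cast; ring] at this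
    have := zmul_mem_loopDeg (-2 * S.i) (h1 (N + 1))
    rwa [hN, show d - 2 * S.i * ((N + 1 : ℕ) : ℤ) - -2 * S.i * (N + 1) = d by push_cast; ring] at this
  -- a finite-dimensional subspace that contains `𝔤 ⊗ 1` and is stable under `c`
  set W : Submodule ℂ S.Loop := ⨆ d : Finset.Icc (-S.bd) S.bd, S.loopDeg d.1 with hW
  have hWc : ∀ X ∈ W, c₀ X ∈ W := fun X hX => by
    refine Submodule.iSup_induction _ (motive := fun X => c₀ X ∈ W) hX
      (fun d X h => Submodule.mem_iSup_of_mem d (hdeg _ _ h)) (by simp)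
      (fun X Y h1 h2 => by rw [map_add]; exact Submodule.add_mem _ h1 h2)
  have hfin : FiniteDimensional ℂ W := by
    have : ∀ d : Finset.Icc (-S.bd) S.bd, FiniteDimensional ℂ (S.loopDeg d.1) := fun d => by
      obtain ⟨W', h1, h2⟩ := exists_loopDeg_fin (S := S) d.1
      exact Submodule.finiteDimensional_of_le h2
    infer_instance
  have hW1 : ∀ x : 𝔤, (x ⊗ₜ 1 : S.Loop) ∈ W := fun x => by
    have hx : x ∈ ⨆ k, S.gr k := by rw [S.gr_internal.submodule_iSup_eq_top]; trivial
    refine Submodule.iSup_induction _ (motive := fun x => (x ⊗ₜ 1 : S.Loop) ∈ W) hx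
      (fun d x h => ?_) (by rw [TensorProduct.zero_tmul]; exact Submodule.zero_mem _)
      (fun X Y h1 h2 => by rw [TensorProduct.add_tmul]; exact Submodule.add_mem _ h1 h2)
    by_cases hd : d ∈ Finset.Icc (-S.bd) S.bd
    · refine Submodule.mem_iSup_of_mem ⟨d, hd⟩ ?_
      rw [← Laurent.mono_zero_one]
      exact tmul_mem_loopDeg (by simpa using h)
    · rw [gr_eq_bot (by simp only [Finset.mem_Icc] at hd; omega), Submodule.mem_bot] at h
      rw [h, TensorProduct.zero_tmul]
      exact Submodule.zero_mem _
  -- as `ad Λ²` is semisimple, `ker c ^ 2 = ker c`, so `c` has a polynomial pseudoinverse on `W`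
  obtain ⟨q, hq⟩ := exists_aeval_pinv_on c₀ W hWc fun X hX =>
    hc0' _ (loopBr_LamSq_of_sq hS (hc0 _ (by rw [← ac₀]; exact hc0 _ hX)))
  refine ⟨N, q, hN, fun x => hc0 _ ?_⟩
  rw [← za₀, ← Module.End.mul_apply a₀, ← pow_succ', map_sub]
  show _ - c₀ (c₀ _) = 0
  rw [hq _ (hW1 x), sub_self]

/-- The pseudoinverse `z^{-2i} (ad Λ²)^N q(c)` of the loop algebra extends to `ĝ ⊗ 𝒫(ḡ)`: it is
right linear over the Laurent series, so that its properties need to be checked on `𝔤 ⊗ 1` only. -/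
theorem exists_isPinv (hS : S.SemisimpleLamSq) : ∃ B, S.IsPinv B := by
  obtain ⟨N, q, hN, hq⟩ := S.exists_loop_pinv hS
  obtain ⟨a₀, ha₀⟩ : ∃ a₀ : Module.End ℂ S.Loop, a₀ = S.loopBr S.LamSq := ⟨_, rfl⟩
  rw [← ha₀] at hq
  obtain ⟨c₀, hc₀⟩ : ∃ c₀ : Module.End ℂ S.Loop, c₀ = S.zmul (-2 * S.i) ∘ₗ a₀ ^ (N + 1) := ⟨_, rfl⟩
  rw [← hc₀] at hq
  obtain ⟨B₀, hB₀⟩ : ∃ B₀ : S.Loop →ₗ[ℂ] S.Loop,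
    B₀ = S.zmul (-2 * S.i) ∘ₗ (a₀ ^ N) ∘ₗ Polynomial.aeval c₀ q := ⟨_, rfl⟩
  have hker : ∀ x : 𝔤, a₀ (x ⊗ₜ 1 - a₀ (B₀ (x ⊗ₜ 1))) = 0 := fun x => by
    rw [hB₀]; exact hq x
  -- the corresponding operators on `ĝ ⊗ 𝒫(ḡ)`
  obtain ⟨a, ha⟩ : ∃ a : Module.End ℂ S.G, a = S.adSq := ⟨_, rfl⟩
  obtain ⟨c, hc⟩ : ∃ c : Module.End ℂ S.G, c = S.zG (-2 * S.i) ∘ₗ a ^ (N + 1) := ⟨_, rfl⟩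
  obtain ⟨B, hB⟩ : ∃ B : S.G →ₗ[ℂ] S.G,
    B = S.zG (-2 * S.i) ∘ₗ (a ^ N) ∘ₗ Polynomial.aeval c q := ⟨_, rfl⟩
  have ta : ∀ X, S.tensOne (a₀ X) = a (S.tensOne X) := fun X => by
    rw [ha₀, ha]; exact S.tensOne_loopBr _ X
  have tp : ∀ n X, S.tensOne ((a₀ ^ n) X) = (a ^ n) (S.tensOne X) := fun n X => by
    induction n with
    | zero => rfl
    | succ n ih => rw [pow_succ', Module.End.mul_apply, ta, ih, pow_succ', Module.End.mul_apply]
  have tc : ∀ X, S.tensOne (c₀ X) = c (S.tensOne X) := fun X => by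
    rw [hc₀, LinearMap.comp_apply, tensOne_zmul, tp, hc, LinearMap.comp_apply]
  have tB : ∀ X, S.tensOne (B₀ X) = B (S.tensOne X) := fun X => by
    rw [hB₀, LinearMap.comp_apply, LinearMap.comp_apply, tensOne_zmul, tp, aeval_intertwine tc, hB,
      LinearMap.comp_apply, LinearMap.comp_apply]
  -- `B` is a polynomial in `ad Λ²` and powers of `z`
  have comm : ∀ φ : S.G →ₗ[ℂ] S.G, (∀ X, φ (a X) = a (φ X)) →
      (∀ k X, φ (S.zG k X) = S.zG k (φ X)) → ∀ X, φ (B X) = B (φ X) := fun φ h1 h2 X => by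
    have hp : ∀ n X, φ ((a ^ n) X) = (a ^ n) (φ X) := fun n X => by
      induction n with
      | zero => rfl
      | succ n ih => rw [pow_succ', Module.End.mul_apply, h1, ih, Module.End.mul_apply]
    have hc' : ∀ X, φ (c X) = c (φ X) := fun X => by
      rw [hc, LinearMap.comp_apply, LinearMap.comp_apply, h2, hp]
    rw [hB]
    simp only [LinearMap.comp_apply]
    rw [h2, hp, aeval_intertwine hc']
  have ra : ∀ w X, a (S.rmul w X) = S.rmul w (a X) := fun w X => by
    rw [ha]; exact S.brG_rmul w _ X
  have rB : ∀ w X, B (S.rmul w X) = S.rmul w (B X) := fun w X =>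
    (comm (S.rmul w) (fun X => (ra w X).symm) (fun k X => (S.zG_rmul w k X).symm) X).symm
  have aB : ∀ X, a (B X) = B (a X) := comm a (fun _ => rfl) fun k X => by
    rw [ha, S.adSq_zG k X]
  -- `1 - (ad Λ²) B` maps `𝔤 ⊗ 1` to `𝒦`, so a right linear map that kills `𝒦` kills its range
  have key : ∀ ψ : S.G →ₗ[ℂ] S.G, (∀ w X, ψ (S.rmul w X) = S.rmul w (ψ X)) →
      (∀ X : S.Loop, a₀ X = 0 → ψ (S.tensOne X) = 0) → ∀ X, ψ (X - a (B X)) = 0 :=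
    fun ψ h1 h2 X => by
    refine eq_zero_of_rmul (φ := ψ ∘ₗ (LinearMap.id - a ∘ₗ B)) (fun w X => ?_) (fun x => ?_) X
    · simp only [LinearMap.comp_apply, LinearMap.sub_apply, LinearMap.id_apply]
      rw [rB, ra, ← map_sub (S.rmul w), h1]
    · simp only [LinearMap.comp_apply, LinearMap.sub_apply, LinearMap.id_apply]
      rw [← tB, ← ta, ← map_sub S.tensOne]
      exact h2 _ (hker x)
  have ha_shift : ∀ n : ℕ, Filt.Shift S.filG S.filG (-2 * S.i * n) (a ^ n) := fun n d X hX => by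
    induction n with
    | zero => simpa using hX
    | succ n ih =>
      rw [pow_succ', Module.End.mul_apply]
      rw [ha] at ih ⊢
      have := S.adSq_shift _ _ ih
      rwa [show d + -2 * S.i * n + -2 * S.i = d + -2 * S.i * (n + 1 : ℕ) by push_cast; ring] at this
  have hc_shift : ∀ d, ∀ X ∈ S.Fil d, c X ∈ S.Fil d := fun d X hX => by
    have := S.zG_shift (-2 * S.i) _ _ (ha_shift (N + 1) d X hX)
    rw [hN, show d + -2 * S.i * ((N + 1 : ℕ) : ℤ) + -(-2 * S.i) * (N + 1) = d by
      push_cast; ring] at this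
    rw [hc]
    exact this
  refine ⟨B, ⟨fun X => ?_, fun φ h => comm φ (by rwa [ha]), fun Z h1 h2 X hX => ?_,
    fun d X hX => ?_, fun C hC X => ?_⟩⟩
  · have := key a ra (fun X hX => by rw [← ta, hX, map_zero]) X
    rw [map_sub, sub_eq_zero] at this
    rw [← ha, ← aB]
    exact this.symm
  · have hp : ∀ n, ∀ X ∈ Z, (a ^ n) X ∈ Z := fun n X hX => by
      induction n with
      | zero => exact hX
      | succ n ih => rw [pow_succ', Module.End.mul_apply]; rw [ha]; exact h1 _ (by rwa [ha] at ih)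
    rw [hB]
    refine h2 _ _ (hp N _ (aeval_mem (fun X hX => ?_) q hX))
    rw [hc]
    exact h2 _ _ (hp (N + 1) X hX)
  · have := S.zG_shift (-2 * S.i) _ _ (ha_shift N d _ (aeval_mem (hc_shift d) q hX))
    rw [hN, show d + -2 * S.i * (N : ℤ) + -(-2 * S.i) * (N + 1) = d + 2 * S.i by ring] at this
    rw [hB]
    exact this
  · rw [← ha]
    refine key (S.brG (S.tensOne C)) (fun w X => S.brG_rmul w _ X) (fun Y hY => ?_) X
    rw [ha₀] at hY
    rw [← tensOne_loopBr, hC.2 Y hY, map_zero]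

namespace IsPinv

variable {S} {B : S.G →ₗ[ℂ] S.G} (hB : S.IsPinv B)

include hB

theorem adSq_comm (X : S.G) : S.adSq (B X) = B (S.adSq X) :=
  hB.comm S.adSq (fun _ => rfl) (fun k X => (S.adSq_zG k X).symm) X

theorem parG_comm (X : S.G) : S.parG (B X) = B (S.parG X) :=
  hB.comm S.parG S.adSq_parG S.parG_zG X

theorem DG_comm (X : S.G) : S.DG (B X) = B (S.DG X) := hB.comm S.DG S.adSq_DG S.DG_zG X

theorem adSq_sub (X : S.G) : S.adSq (X - S.adSq (B X)) = 0 := by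
  rw [map_sub, hB.adSq_comm, hB.adSq_pinv_adSq, sub_self]

/-- The elements of `𝒦 ⊗ 𝒫(ḡ)` commute with the center of `𝒦`. -/
theorem brG_center {C : S.Loop} (hC : C ∈ S.center) {X : S.G} (hX : S.adSq X = 0) :
    S.brG (S.tensOne C) X = 0 := by
  have := hB.center C hC X
  rwa [hB.adSq_comm, hX, map_zero, sub_zero] at this

end IsPinv

/-! ### The center -/

section center

variable {S}

theorem zmul_mem_center {C : S.Loop} (hC : C ∈ S.center) (k : ℤ) : S.zmul k C ∈ S.center :=
  ⟨by rw [loopBr_zmul, hC.1, map_zero], fun X hX => by rw [zmul_loopBr, hC.2 X hX, map_zero]⟩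

theorem parL_mem_center {C : S.Loop} (hC : C ∈ S.center) : S.parL C ∈ S.center := by
  have h : ∀ X, S.loopBr S.LamSq X = 0 → S.loopBr S.LamSq (S.parL X) = 0 := fun X hX => by
    have := congrArg S.parL hX
    rwa [parL_loopBr, parL_LamSq, map_zero] at this
  refine ⟨h C hC.1, fun X hX => ?_⟩
  have := congrArg S.parL (hC.2 _ (h X hX))
  rwa [parL_loopBr, parL_parL, map_zero] at this

theorem adSq_tensOne {C : S.Loop} (hC : C ∈ S.center) : S.adSq (S.tensOne C) = 0 := by
  rw [adSq, ← tensOne_loopBr, hC.1, map_zero]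

theorem prj_mem_center {C : S.Loop} (hC : C ∈ S.center) (e : ZMod 2) :
    prj S.parL e C ∈ S.center :=
  Submodule.smul_mem _ _ (Submodule.add_mem _ hC (Submodule.smul_mem _ _ (parL_mem_center hC)))

end center

end DSData

namespace DSData

variable {𝔤 : Type*} [AddCommGroup 𝔤] [Module ℂ 𝔤] {ι : Type*} [Fintype ι] [DecidableEq ι]
  (S : DSData 𝔤 ι)

/-! ### Homogeneous components -/

theorem gr_bijective : Function.Bijective (DirectSum.coeLinearMap S.gr) := S.gr_internal

/-- The projection of `𝔤` onto `𝔤_k`. -/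
def grProj (k : ℤ) : 𝔤 →ₗ[ℂ] 𝔤 :=
  (S.gr k).subtype ∘ₗ DirectSum.component ℂ ℤ (fun k => S.gr k) k ∘ₗ
    (LinearEquiv.ofBijective (DirectSum.coeLinearMap S.gr) S.gr_bijective).symm.toLinearMap

section components

variable {S}

theorem grProj_of_mem {k l : ℤ} {a : 𝔤} (ha : a ∈ S.gr l) :
    S.grProj k a = if l = k then a else 0 := by
  have h : (LinearEquiv.ofBijective (DirectSum.coeLinearMap S.gr) S.gr_bijective).symm a =
      DirectSum.lof ℂ ℤ (fun k => S.gr k) l ⟨a, ha⟩ := by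
    rw [LinearEquiv.symm_apply_eq, LinearEquiv.ofBijective_apply, DirectSum.coeLinearMap_lof]
  rw [grProj, LinearMap.comp_apply, LinearMap.comp_apply, LinearEquiv.coe_toLinearMap, h]
  split_ifs with h'
  · subst h'
    rw [DirectSum.component.lof_self]; rfl
  · rw [DirectSum.component.of, dif_neg h', map_zero]

theorem mem_iSup_gr (a : 𝔤) : a ∈ ⨆ k, S.gr k := by
  rw [S.gr_internal.submodule_iSup_eq_top]; trivial

theorem sum_grProj (a : 𝔤) : ∑ k ∈ Finset.Icc (-S.bd) S.bd, S.grProj k a = a := by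
  refine Submodule.iSup_induction _
    (motive := fun a => ∑ k ∈ Finset.Icc (-S.bd) S.bd, S.grProj k a = a) (mem_iSup_gr (S := S) a)
    (fun l a h => ?_) (by simp) (fun a b h1 h2 => by
      simp only [map_add, Finset.sum_add_distrib, h1, h2])
  simp only [grProj_of_mem h, Finset.sum_ite_eq]
  split_ifs with hl
  · rfl
  · rw [gr_eq_bot (by simp only [Finset.mem_Icc] at hl; omega), Submodule.mem_bot] at h
    exact h.symm

theorem grProj_mem_gr (k : ℤ) (a : 𝔤) : S.grProj k a ∈ S.gr k := by
  rw [grProj]; exact Subtype.prop _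

theorem grProj_mem {U : Submodule ℂ 𝔤} (hU : U ≤ ⨆ k : ℤ, U ⊓ S.gr k) (k : ℤ) {a : 𝔤}
    (ha : a ∈ U) : S.grProj k a ∈ U := by
  refine Submodule.iSup_induction _ (motive := fun a => S.grProj k a ∈ U) (hU ha)
    (fun l a h => ?_) (by simp) (fun a b h1 h2 => by rw [map_add]; exact U.add_mem h1 h2)
  rw [grProj_of_mem h.2]
  split_ifs
  · exact h.1
  · exact U.zero_mem

theorem mem_grGT_iff {d : ℤ} {a : 𝔤} : a ∈ S.grGT d ↔ ∀ k ≤ d, S.grProj k a = 0 := by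
  refine ⟨fun ha k hk => ?_, fun h => ?_⟩
  · refine grGT_induction (C := fun a => S.grProj k a = 0) (by simp)
      (fun a b h1 h2 => by rw [map_add, h1, h2, add_zero]) (fun l hl a h => ?_) ha
    rw [grProj_of_mem h, if_neg (by omega)]
  · rw [← sum_grProj (S := S) a]
    refine Submodule.sum_mem _ fun k _ => ?_
    by_cases hk : k ≤ d
    · rw [h k hk]; exact Submodule.zero_mem _
    · exact gr_le_grGT (by omega) (grProj_mem_gr k a)

theorem grProj_br {k l : ℤ} {a : 𝔤} (ha : a ∈ S.gr l) (x : 𝔤) :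
    S.grProj (l + k) (S.br a x) = S.br a (S.grProj k x) := by
  refine Submodule.iSup_induction _
    (motive := fun x => S.grProj (l + k) (S.br a x) = S.br a (S.grProj k x)) (mem_iSup_gr (S := S) x)
    (fun m x h => ?_) (by simp) (fun a b h1 h2 => by simp only [map_add, h1, h2])
  rw [grProj_of_mem h, grProj_of_mem (S.gr_br _ _ a ha x h)]
  by_cases hm : m = k
  · subst hm; simp
  · rw [if_neg hm, if_neg (by omega), map_zero]

theorem n_gr' : S.n ≤ ⨆ k : ℤ, S.n ⊓ S.gr k := fun a ha => by
  refine (iSup_mono fun k => ?_ : (⨆ k : ℤ, ⨆ _ : 0 < k, S.n ⊓ S.gr k) ≤ _) (S.n_gr ha)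
  exact iSup_le fun _ => le_rfl

theorem n_le_grGT : S.n ≤ S.grGT 0 := fun a ha => by
  refine Submodule.iSup_induction _ (motive := fun a => a ∈ S.grGT 0) (S.n_gr ha) (fun k a h => ?_)
    (Submodule.zero_mem _) (fun _ _ => Submodule.add_mem _)
  refine Submodule.iSup_induction _ (motive := fun a => a ∈ S.grGT 0) h
    (fun hk a h => gr_le_grGT hk h.2) (Submodule.zero_mem _) (fun _ _ => Submodule.add_mem _)

theorem form_left_nondeg {a : 𝔤} (h : ∀ c, S.form a c = 0) : a = 0 := S.form_nondeg.1 a h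

/-- As `𝔪` contains `𝔤_{≥ i}`, its orthogonal complement `𝔟` lies in `𝔤_{> -i}`. -/
theorem b_le_grGT : S.b ≤ S.grGT (-S.i) := fun a ha => mem_grGT_iff.2 fun k hk => by
  refine form_left_nondeg (S := S) fun c => ?_
  have h1 : ∀ l, ∀ c ∈ S.gr l, S.form (S.grProj k a) c = 0 := fun l c hc => by
    by_cases hl : k + l = 0
    · have h2 : S.form a c = 0 := ha c (S.gr_le_m l (by omega) hc)
      rw [← sum_grProj (S := S) a, map_sum, LinearMap.sum_apply] at h2
      by_cases hk' : k ∈ Finset.Icc (-S.bd) S.bd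
      · rw [Finset.sum_eq_single_of_mem k hk'] at h2
        · exact h2
        · intro m _ hm
          exact S.gr_form m l (by omega) _ (grProj_mem_gr m a) c hc
      · have h3 := grProj_mem_gr (S := S) k a
        rw [gr_eq_bot (by simp only [Finset.mem_Icc] at hk'; omega), Submodule.mem_bot] at h3
        rw [h3]; simp
    · exact S.gr_form k l hl _ (grProj_mem_gr k a) c hc
  refine Submodule.iSup_induction _ (motive := fun c => S.form (S.grProj k a) c = 0)
    (mem_iSup_gr (S := S) c) h1 (by simp) (fun a b h1 h2 => by rw [map_add, h1, h2, add_zero])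

theorem mem_b_iff {a : 𝔤} : a ∈ S.b ↔ a ∈ S.V ⊔ S.n.map (S.br S.f) := (S.V_sup a).symm

theorem n_le_b : S.n ≤ S.b := fun a ha c hc =>
  form_eq_zero_of_grGT (by norm_num) (n_le_grGT ha) (n_le_grGT (S.m_le_n hc))

theorem br_n_b {a y : 𝔤} (ha : a ∈ S.n) (hy : y ∈ S.b) : S.br a y ∈ S.b := fun c hc => by
  have key : ∀ e, S.form (S.br (S.proj e a) y) c = 0 := fun e => by
    have ha' := prj_mem S.n_par e ha
    have hp : S.par (S.proj e a) = sgn e • S.proj e a := prj_hom S.par S.par_par e a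
    have hyp : ∀ e', S.form (S.proj e' y) (S.br (S.proj e a) c) = 0 := fun e' => by
      have hb : ∀ y ∈ S.b, S.par y ∈ S.b := fun y hy => by
        rw [mem_b_iff] at hy ⊢
        obtain ⟨v, hv, _, ⟨x, hx, rfl⟩, rfl⟩ := Submodule.mem_sup.1 hy
        rw [map_add, S.par_br, S.f_odd]
        refine Submodule.add_mem_sup (S.V_par v hv) ⟨-S.par x, S.n.neg_mem (S.n_par x hx), by simp⟩
      exact prj_mem hb e' hy _ (S.n_br_m _ ha' c hc)
    have hsk : ∀ e', S.br (S.proj e a) (S.proj e' y) =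
        -(sgn (e * e') • S.br (S.proj e' y) (S.proj e a)) := fun e' =>
      S.skew e e' _ _ hp (prj_hom S.par S.par_par e' y)
    have hy2 : y = S.proj 0 y + S.proj 1 y := (prj_add_prj S.par y).symm
    rw [hy2, map_add, hsk, hsk]
    simp only [map_add, map_neg, map_smul, LinearMap.add_apply, LinearMap.neg_apply,
      LinearMap.smul_apply, S.form_invariant, hyp]
    simp
  have ha2 : a = S.proj 0 a + S.proj 1 a := (prj_add_prj S.par a).symm
  rw [ha2, map_add, LinearMap.add_apply, map_add, LinearMap.add_apply, key, key, add_zero]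

theorem par_mem_b {y : 𝔤} (hy : y ∈ S.b) : S.par y ∈ S.b := by
  rw [mem_b_iff] at hy ⊢
  obtain ⟨v, hv, _, ⟨x, hx, rfl⟩, rfl⟩ := Submodule.mem_sup.1 hy
  rw [map_add, S.par_br, S.f_odd]
  exact Submodule.add_mem_sup (S.V_par v hv) ⟨-S.par x, S.n.neg_mem (S.n_par x hx), by simp⟩

variable (S) in
/-- A map `β` that inverts `ad f` on `[f, 𝔫]` and vanishes on `V`. -/
theorem exists_slice : ∃ β : 𝔤 →ₗ[ℂ] 𝔤, (∀ y, β y ∈ S.n) ∧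
    ∀ v ∈ S.V, ∀ x ∈ S.n, β (v + S.br S.f x) = x := by
  have hinj : LinearMap.ker (S.V.subtype.coprod (S.br S.f ∘ₗ S.n.subtype)) = ⊥ := by
    refine LinearMap.ker_eq_bot'.2 fun ⟨v, x⟩ h => ?_
    simp only [LinearMap.coprod_apply, Submodule.subtype_apply, LinearMap.comp_apply] at h
    have h1 : (v : 𝔤) ∈ S.V ⊓ S.n.map (S.br S.f) :=
      ⟨v.2, ⟨-x, S.n.neg_mem x.2, by rw [map_neg]; exact (eq_neg_of_add_eq_zero_left h).symm⟩⟩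
    rw [S.V_inf, Submodule.mem_bot] at h1
    rw [h1, zero_add] at h
    exact Prod.ext (Subtype.ext h1) (Subtype.ext (S.f_inj _ x.2 h))
  obtain ⟨r, hr⟩ := LinearMap.exists_leftInverse_of_injective _ hinj
  refine ⟨S.n.subtype ∘ₗ LinearMap.snd ℂ _ _ ∘ₗ r, fun y => Subtype.prop _, fun v hv x hx => ?_⟩
  have := congrArg (fun g => (g (⟨v, hv⟩, ⟨x, hx⟩)).2) hr
  exact congrArg Subtype.val this

end components

/-- The map `𝔟 → 𝔫` that inverts `ad f` on `[f, 𝔫]` and vanishes on `V`, extended to `𝔤`. -/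
def slice : 𝔤 →ₗ[ℂ] 𝔤 := S.exists_slice.choose

section slice

variable {S}

theorem slice_mem (y : 𝔤) : S.slice y ∈ S.n := S.exists_slice.choose_spec.1 y

theorem slice_add {v x : 𝔤} (hv : v ∈ S.V) (hx : x ∈ S.n) : S.slice (v + S.br S.f x) = x :=
  S.exists_slice.choose_spec.2 v hv x hx

theorem slice_br {x : 𝔤} (hx : x ∈ S.n) : S.slice (S.br S.f x) = x := by
  simpa using slice_add (S := S) S.V.zero_mem hx

theorem exists_of_mem_b {y : 𝔤} (hy : y ∈ S.b) : ∃ v ∈ S.V, ∃ x ∈ S.n, y = v + S.br S.f x := by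
  obtain ⟨v, hv, _, ⟨x, hx, rfl⟩, rfl⟩ := Submodule.mem_sup.1 (mem_b_iff.1 hy)
  exact ⟨v, hv, x, hx, rfl⟩

theorem sub_slice_mem {y : 𝔤} (hy : y ∈ S.b) : y - S.br S.f (S.slice y) ∈ S.V := by
  obtain ⟨v, hv, x, hx, rfl⟩ := exists_of_mem_b hy
  rw [slice_add hv hx]
  simpa using hv

theorem slice_par {y : 𝔤} (hy : y ∈ S.b) : S.slice (S.par y) = -S.par (S.slice y) := by
  obtain ⟨v, hv, x, hx, rfl⟩ := exists_of_mem_b hy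
  rw [slice_add hv hx, map_add, S.par_br, S.f_odd, map_neg, LinearMap.neg_apply, ← map_neg]
  exact slice_add (S.V_par v hv) (S.n.neg_mem (S.n_par x hx))

theorem slice_mem_grGT {d : ℤ} {y : 𝔤} (hy : y ∈ S.b) (hd : y ∈ S.grGT d) :
    S.slice y ∈ S.grGT (d + S.i) := by
  obtain ⟨v, hv, x, hx, rfl⟩ := exists_of_mem_b hy
  rw [slice_add hv hx]
  refine mem_grGT_iff.2 fun k hk => ?_
  have h := mem_grGT_iff.1 hd (-S.i + k) (by omega)
  rw [map_add, grProj_br S.f_gr] at h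
  rw [← slice_add (grProj_mem S.V_gr (-S.i + k) hv) (grProj_mem n_gr' k hx), h, map_zero]

end slice

/-! ### The differential superalgebra generated by the coefficients of `𝒬` -/

section PQ

variable {S}

theorem coord_D_pow_mem_PQ {Q : 𝔤 ⊗[ℂ] S.A} (φ : Module.Dual ℂ 𝔤) (n : ℕ) :
    (S.D ^ n) (coord φ Q) ∈ S.PQ Q := Algebra.subset_adjoin ⟨φ, n, rfl⟩

theorem D_mem_PQ {Q : 𝔤 ⊗[ℂ] S.A} (hQ : S.parTens Q = -Q) : (∀ u ∈ S.PQ Q, S.tau u ∈ S.PQ Q) ∧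
    ∀ u ∈ S.PQ Q, S.D u ∈ S.PQ Q := by
  have h1 : ∀ φ : Module.Dual ℂ 𝔤, S.tau (coord φ Q) = -coord (φ ∘ₗ S.par) Q := fun φ => by
    have : ∀ X : 𝔤 ⊗[ℂ] S.A, S.tau (coord φ X) = coord (φ ∘ₗ S.par) (S.parTens X) := fun X => by
      induction X using TensorProduct.induction_on with
      | zero => simp
      | add x y h1 h2 => simp only [map_add, h1, h2]
      | tmul a u => simp [parTens, S.par_par]
    rw [this, hQ, map_neg]
  have h2 : ∀ φ : Module.Dual ℂ 𝔤, ∀ n : ℕ, S.tau ((S.D ^ n) (coord φ Q)) ∈ S.PQ Q := fun φ n => by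
    have h3 : S.tau ((S.D ^ n) (coord φ Q)) = (-1 : ℂ) ^ n • (S.D ^ n) (S.tau (coord φ Q)) := by
      induction n with
      | zero => simp
      | succ n ih =>
        have := S.D_isSDer.1 ((S.D ^ n) (coord φ Q))
        rw [← S.pp_one, sgn_one] at this
        have h4 : S.tau (S.D ((S.D ^ n) (coord φ Q))) = (-1 : ℂ) • S.D (S.tau ((S.D ^ n) (coord φ Q))) :=
          this
        rw [pow_succ', Module.End.mul_apply, h4, ih, map_smul, smul_smul, pow_succ',
          Module.End.mul_apply]
    rw [h3, h1, map_neg]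
    exact (S.PQ Q).smul_mem ((S.PQ Q).neg_mem (coord_D_pow_mem_PQ _ n)) _
  have h3 : ∀ u ∈ S.PQ Q, S.tau u ∈ S.PQ Q := fun u hu => by
    have : S.PQ Q ≤ (S.PQ Q).comap (S.pp 1) := Algebra.adjoin_le fun a ⟨φ, n, h⟩ => by
      subst h; exact h2 φ n
    exact this hu
  refine ⟨h3, fun u hu => S.D_isSDer.mem_adjoin (B := S.PQ Q) le_rfl (fun a ⟨φ, n, h⟩ => ?_)
    (fun a ⟨φ, n, h⟩ => ?_) hu⟩
  · subst h
    rw [← Module.End.mul_apply, ← pow_succ']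
    exact coord_D_pow_mem_PQ φ (n + 1)
  · subst h
    rw [← S.pp_one]; exact h2 φ n

theorem mem_tens_PQ (Q : 𝔤 ⊗[ℂ] S.A) : Q ∈ S.tens ⊤ (S.PQ Q) :=
  mem_tens_of_coord fun t => by simpa using coord_D_pow_mem_PQ (Q := Q) (S.q.coord t) 0

theorem PQ_le_P {Q : 𝔤 ⊗[ℂ] S.A} {U : Submodule ℂ 𝔤} (hQ : Q ∈ S.tens U S.P) : S.PQ Q ≤ S.P :=
  Algebra.adjoin_le fun a ⟨φ, n, h⟩ => by
    subst h
    have h1 : coord φ Q ∈ S.P := coord_mem_of_tens hQ φ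
    have h2 : ∀ n : ℕ, (S.D ^ n) (coord φ Q) ∈ S.P := fun n => by
      induction n with
      | zero => simpa using h1
      | succ n ih => rw [pow_succ', Module.End.mul_apply]; exact S.D_mem_P ih
    exact h2 n

end PQ

/-! ### Successive approximation -/

variable {S} in
/-- The equation `R T = 0` has a solution in a closed subspace if it can be solved degree by
degree. -/
theorem exists_solution (R : S.G → S.G) (Z : Submodule ℂ S.G) (hZ : S.filG.Closed Z) (c : ℤ)
    (h0 : R 0 ∈ S.Fil c)
    (step : ∀ n : ℕ, ∀ T ∈ Z, R T ∈ S.Fil (c + n) →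
      ∃ U ∈ Z, U ∈ S.Fil (n + 1) ∧ R (T + U) ∈ S.Fil (c + (n + 1)))
    (cont : ∀ n : ℕ, ∀ T ∈ Z, ∀ T' ∈ Z, T' - T ∈ S.Fil (n + 1) → R T ∈ S.Fil (c + n) →
      R T' ∈ S.Fil (c + n)) : ∃ T ∈ Z, R T = 0 := by
  choose! u hu1 hu2 hu3 using step
  let T : ℕ → S.G := fun n => n.rec 0 fun n T => T + u n T
  have hT : ∀ n, T n ∈ Z ∧ R (T n) ∈ S.Fil (c + n) := fun n => by
    induction n with
    | zero => exact ⟨Z.zero_mem, by simpa [T] using h0⟩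
    | succ n ih =>
      refine ⟨Z.add_mem ih.1 (hu1 n _ ih.1 ih.2), ?_⟩
      have := hu3 n _ ih.1 ih.2
      push_cast
      exact this
  have hsum : ∀ n, T n = ∑ k ∈ Finset.range n, u k (T k) := fun n => by
    induction n with
    | zero => rfl
    | succ n ih => rw [Finset.sum_range_succ, ← ih]
  have hu : ∀ k : ℕ, u k (T k) ∈ S.Fil (1 + k) := fun k => by
    rw [add_comm]; exact hu2 k _ (hT k).1 (hT k).2
  obtain ⟨T', hT'⟩ := S.filG.complete (fun k => u k (T k)) 1 hu
  have hmem : T' ∈ Z := Filt.IsSum.mem ⟨1, hu, hT'⟩ hZ fun k => hu1 k _ (hT k).1 (hT k).2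
  refine ⟨T', hmem, S.filG.separated _ fun d => ?_⟩
  have h1 := hT' (d - c).toNat
  rw [← hsum] at h1
  have h2 := cont (d - c).toNat _ (hT _).1 _ hmem (by rw [add_comm]; exact h1) (hT _).2
  exact S.Fil_anti (by omega) h2

end DSData

namespace DSData

variable {𝔤 : Type*} [AddCommGroup 𝔤] [Module ℂ 𝔤] {ι : Type*} [Fintype ι] [DecidableEq ι]
  (S : DSData 𝔤 ι)

/-! ### Existence of the dressing -/

section

variable {S}

theorem opL_add (X Y : S.G) : S.op (X + Y) = S.op X + S.op Y := map_add S.opL X Y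

theorem opB_op_add (T U : S.G) : S.opB (S.op (T + U)) = S.opB (S.op T) + S.opB (S.op U) := by
  rw [opL_add, map_add]

/-- The variation of `e^{ad T} x`. -/
theorem E_add_sub_mem {T U : S.G} (hT : T ∈ S.Fil 1) {n : ℕ} (hU : U ∈ S.Fil (n + 1)) {x : S.Op}
    {d : ℤ} (hx : x ∈ S.filOp.F d) :
    S.E (T + U) x - S.E T x - S.opB (S.op U) x ∈ S.filOp.F (d + n + 2) := by
  rw [E, E, opB_op_add]
  exact Filt.exp_add_sub_mem (adT_shift hT) (fun k y hy => by
    rw [add_comm]; exact S.opB_shift _ _ _ (op_mem_filOp.2 hU) _ hy) hx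

theorem E_sub_mem {T T' : S.G} (hT : T ∈ S.Fil 1) {n : ℕ} (hU : T' - T ∈ S.Fil (n + 1)) {x : S.Op}
    {d : ℤ} (hx : x ∈ S.filOp.F d) : S.E T' x - S.E T x ∈ S.filOp.F (d + n + 1) := by
  have h1 := E_add_sub_mem hT hU hx
  rw [add_sub_cancel] at h1
  have h2 := S.opB_shift _ _ _ (op_mem_filOp.2 hU) _ hx
  have h3 := Submodule.add_mem _ (S.filOp.anti (show d + n + 1 ≤ d + n + 2 by omega) h1)
    (S.filOp.anti (show d + n + 1 ≤ (n + 1) + d by omega) h2)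
  simpa using h3

theorem E_zero (x : S.Op) : S.E 0 x = x := by
  have : S.opB (S.op 0) = 0 := by rw [← opL_apply, map_zero, map_zero]
  rw [E, this, Filt.exp_zero]

variable (S) in
theorem parG_const (Q : 𝔤 ⊗[ℂ] S.A) : S.parG (S.const Q) = S.const (S.parTens Q) :=
  S.ext_zcoeff fun l => by
    rw [parG, zcoeff_map, zcoeff_const, zcoeff_const]
    split_ifs
    · rfl
    · rw [map_zero]

variable (S) in
theorem const_coefIn {B : Subalgebra ℂ S.A} {Q : 𝔤 ⊗[ℂ] S.A} (hQ : Q ∈ S.tens ⊤ B) :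
    S.const Q ∈ S.coefIn fun _ => S.tens ⊤ B := fun l => by
  rw [zcoeff_const]
  split_ifs
  · exact hQ
  · exact Submodule.zero_mem _

variable (S) in
theorem tensOne_coefIn (B : Subalgebra ℂ S.A) (C : S.Loop) :
    S.tensOne C ∈ S.coefIn fun _ => S.tens ⊤ B := fun l => by
  induction C using TensorProduct.induction_on with
  | zero => simp
  | add x y h1 h2 => rw [map_add, map_add]; exact Submodule.add_mem _ h1 h2
  | tmul a u =>
    rw [zcoeff_tensOne_tmul]
    exact Submodule.smul_mem _ _ (tmul_mem_tens trivial B.one_mem)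

theorem brG_coefIn {B : Subalgebra ℂ S.A} (hB : ∀ u ∈ B, S.tau u ∈ B) {X Y : S.G}
    (hX : X ∈ S.coefIn fun _ => S.tens ⊤ B) (hY : Y ∈ S.coefIn fun _ => S.tens ⊤ B) :
    S.brG X Y ∈ S.coefIn fun _ => S.tens ⊤ B :=
  S.brG_mem_coefIn (fun _ _ _ hX _ hY => brA_mem_tens (U' := ⊤) (U'' := ⊤) hB (fun _ _ => trivial)
    (fun _ _ _ _ => trivial) hX hY) hX hY

theorem DG_coefIn {B : Subalgebra ℂ S.A} (hB : ∀ u ∈ B, S.D u ∈ B) {X : S.G}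
    (hX : X ∈ S.coefIn fun _ => S.tens ⊤ B) : S.DG X ∈ S.coefIn fun _ => S.tens ⊤ B := fun l => by
  rw [DG, zcoeff_map]
  exact map_mem_tens (U' := ⊤) (fun _ _ => trivial) hB (hX l)

theorem zG_coefIn {B : Subalgebra ℂ S.A} (k : ℤ) {X : S.G}
    (hX : X ∈ S.coefIn fun _ => S.tens ⊤ B) : S.zG k X ∈ S.coefIn fun _ => S.tens ⊤ B := fun l => by
  rw [zcoeff_zG]; exact hX (l - k)

variable (S) in
theorem tensOne_Lam_odd : S.parG (S.tensOne S.Lam) = -S.tensOne S.Lam := by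
  rw [parG_tensOne, parL_Lam, map_neg]

/-- The remainder `½ [ℒ_s(𝒬), ℒ_s(𝒬)] - D² - Λ² ⊗ 1`. -/
def sqRem (Q : 𝔤 ⊗[ℂ] S.A) : S.G :=
  (2 : ℂ)⁻¹ • (S.brG (S.const Q) (S.const Q) + S.brG (S.const Q) (S.tensOne S.Lam) +
    S.brG (S.tensOne S.Lam) (S.const Q)) + S.DG (S.const Q)

theorem laxS_sq {Q : 𝔤 ⊗[ℂ] S.A} (hQ : S.parTens Q = -Q) :
    (2 : ℂ)⁻¹ • S.opBr (S.laxS Q) (S.laxS Q) = (0, 1, sqRem Q + S.tensOne S.LamSq) := by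
  refine Prod.ext (by simp [opBr]) (Prod.ext (by simp [opBr, laxS]) ?_)
  have h1 : S.parG (S.const Q) = -S.const Q := by rw [parG_const, hQ, map_neg]
  simp only [opBr, laxS, Prod.smul_snd, sqRem, LamSq, map_smul, tensOne_loopBr, map_add,
    LinearMap.add_apply, h1, tensOne_Lam_odd, map_neg, DG_tensOne, one_smul, zero_smul]
  module

variable (S) in
theorem tensOne_Lam_mem : S.tensOne S.Lam ∈ S.Fil (-S.i) := tensOne_mem_Fil_of_loopDeg S.Lam_mem

theorem const_mem_of_tens_b {Q : 𝔤 ⊗[ℂ] S.A} {B : Subalgebra ℂ S.A} (hQ : Q ∈ S.tens S.b B) :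
    S.const Q ∈ S.Fil (-S.i + 1) :=
  S.const_mem_Fil (tens_mono (by rw [add_sub_cancel_right]; exact b_le_grGT) le_top hQ)

theorem sqRem_mem {Q : 𝔤 ⊗[ℂ] S.A} (hQ : S.const Q ∈ S.Fil (-S.i + 1)) :
    sqRem Q ∈ S.Fil (-2 * S.i + 1) := by
  have hi := S.i_pos
  have h1 := S.brG_shift _ _ _ hQ _ hQ
  have h2 := S.brG_shift _ _ _ hQ _ S.tensOne_Lam_mem
  have h3 := S.brG_shift _ _ _ S.tensOne_Lam_mem _ hQ
  have h4 := S.DG_shift _ _ hQ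
  exact Submodule.add_mem _ (Submodule.smul_mem _ _ (Submodule.add_mem _ (Submodule.add_mem _
    (S.Fil_anti (by omega) h1) (S.Fil_anti (by omega) h2)) (S.Fil_anti (by omega) h3)))
    (S.Fil_anti (by omega) h4)

theorem sqRem_coefIn {Q : 𝔤 ⊗[ℂ] S.A} (hQ : S.parTens Q = -Q) :
    sqRem Q ∈ S.coefIn fun _ => S.tens ⊤ (S.PQ Q) := by
  have h := D_mem_PQ hQ
  have h1 := S.const_coefIn (mem_tens_PQ Q)
  have h2 := S.tensOne_coefIn (S.PQ Q) S.Lam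
  exact Submodule.add_mem _ (Submodule.smul_mem _ _ (Submodule.add_mem _ (Submodule.add_mem _
    (brG_coefIn h.1 h1 h1) (brG_coefIn h.1 h1 h2)) (brG_coefIn h.1 h2 h1))) (DG_coefIn h.2 h1)

/-- The even elements of positive degree in `ℐ ⊗ 𝒫_𝒬`. -/
def dressSpace (B : S.G →ₗ[ℂ] S.G) (Q : 𝔤 ⊗[ℂ] S.A) : Submodule ℂ S.G :=
  S.Fil 1 ⊓ (LinearMap.ker (S.parG - LinearMap.id) ⊓
    (LinearMap.ker (S.adSq ∘ₗ B - LinearMap.id) ⊓ S.coefIn fun _ => S.tens ⊤ (S.PQ Q)))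

theorem mem_dressSpace {B : S.G →ₗ[ℂ] S.G} {Q : 𝔤 ⊗[ℂ] S.A} {T : S.G} :
    T ∈ dressSpace B Q ↔ T ∈ S.Fil 1 ∧ S.parG T = T ∧ S.adSq (B T) = T ∧
      T ∈ S.coefIn fun _ => S.tens ⊤ (S.PQ Q) := by
  simp only [dressSpace, Submodule.mem_inf, LinearMap.mem_ker, LinearMap.sub_apply,
    LinearMap.id_apply, LinearMap.comp_apply, sub_eq_zero]

variable (S) in
theorem id_shift : Filt.Shift S.filG S.filG 0 (LinearMap.id : S.G →ₗ[ℂ] S.G) := fun d X hX => by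
  rw [add_zero]; exact hX

theorem IsPinv.adSq_shift {B : S.G →ₗ[ℂ] S.G} (hB : S.IsPinv B) :
    Filt.Shift S.filG S.filG 0 (S.adSq ∘ₗ B) := fun d X hX => by
  have := S.adSq_shift _ _ (hB.shift d X hX)
  rw [add_assoc, show 2 * S.i + -2 * S.i = 0 by ring] at this
  exact this

theorem closed_dressSpace {B : S.G →ₗ[ℂ] S.G} (hB : S.IsPinv B) (Q : 𝔤 ⊗[ℂ] S.A) :
    S.filG.Closed (dressSpace B Q) := by
  have h1 : Filt.Shift S.filG S.filG 0 (S.parG - LinearMap.id) := fun d X hX =>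
    Submodule.sub_mem _ (S.parG_shift d X hX) (S.id_shift d X hX)
  have h2 : Filt.Shift S.filG S.filG 0 (S.adSq ∘ₗ B - LinearMap.id) := fun d X hX =>
    Submodule.sub_mem _ (hB.adSq_shift d X hX) (S.id_shift d X hX)
  have h3 := S.closed_coefIn fun _ => S.tens ⊤ (S.PQ Q)
  have h4 := (Filt.closed_ker h2).inf h3
  have h5 := (Filt.closed_ker h1).inf h4
  exact (Filt.closed_F (Φ := S.filG) 1).inf h5

variable (S) in
theorem adSq_LamSq : S.adSq (S.tensOne S.LamSq) = 0 := by
  have h := skewG S.parG_LamSq (S.tensOne S.LamSq)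
  rw [pw_zero, LinearMap.id_apply] at h
  have h2 : (2 : ℂ) • S.brG (S.tensOne S.LamSq) (S.tensOne S.LamSq) = 0 := by
    rw [two_smul]; nth_rewrite 1 [h]; exact neg_add_cancel _
  exact (smul_eq_zero.1 h2).resolve_left two_ne_zero

variable (S) in
theorem LamSq_mem_Fil : S.tensOne S.LamSq ∈ S.Fil (-2 * S.i) :=
  tensOne_mem_Fil_of_loopDeg S.LamSq_mem

theorem parG_sqRem {Q : 𝔤 ⊗[ℂ] S.A} (hQ : S.parTens Q = -Q) : S.parG (sqRem Q) = sqRem Q := by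
  have h1 : S.parG (S.const Q) = -S.const Q := by rw [parG_const, hQ, map_neg]
  simp [sqRem, parG_brG, h1, tensOne_Lam_odd, parG_DG]

/-- One step of the approximation: the component in `ℐ` of `e^{ad T} x` is removed in lowest degree
by changing `T`. -/
theorem dressing_step {B : S.G →ₗ[ℂ] S.G} (hB : S.IsPinv B) {R T : S.G}
    (hR : R ∈ S.Fil (-2 * S.i + 1)) (hT : T ∈ S.Fil 1) {n : ℕ} {X : S.G}
    (hX : X = (S.E T (0, 1, R + S.tensOne S.LamSq)).2.2) (hXp : S.parG X = X)
    (hn : S.adSq (B X) ∈ S.Fil (-2 * S.i + 1 + n)) :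
    S.adSq (B (S.E (T + B (S.adSq (B X))) (0, 1, R + S.tensOne S.LamSq)).2.2) ∈
      S.Fil (-2 * S.i + 1 + (n + 1)) := by
  have hi := S.i_pos
  obtain ⟨x, hx⟩ : ∃ x : S.Op, x = (0, 1, R + S.tensOne S.LamSq) := ⟨_, rfl⟩
  rw [← hx] at hX ⊢
  have hxF : x ∈ S.filOp.F (-2 * S.i) := by
    rw [hx]
    exact mem_filOp.2 ⟨Submodule.add_mem _ (S.Fil_anti (by omega) hR) S.LamSq_mem_Fil,
      fun h => by omega⟩
  obtain ⟨U, hU'⟩ : ∃ U, U = B (S.adSq (B X)) := ⟨_, rfl⟩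
  rw [← hU']
  have hU : U ∈ S.Fil (n + 1) := by rw [hU']; exact S.Fil_anti (by omega) (hB.shift _ _ hn)
  have haU : S.adSq U = S.adSq (B X) := by rw [hU', hB.adSq_pinv_adSq]
  have hUp : S.parG U = sgn 0 • U := by
    rw [hU', hB.parG_comm, adSq_parG, hB.parG_comm, hXp, sgn_zero, one_smul]
  have h1 := (mem_filOp.1 (E_add_sub_mem hT hU hxF)).1
  have hk : S.brG U (S.tensOne S.LamSq) = -S.adSq (B X) := by
    rw [skewG hUp, pw_zero, LinearMap.id_apply, ← haU]; rfl
  have h2 : (S.opB (S.op U) x).2.2 = S.brG U R - S.adSq (B X) - S.DG (S.DG U) := by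
    rw [opB_op, hx]
    simp only [op, map_add, hk, zero_smul, one_smul, sub_zero]
    abel
  have h3 : (S.E (T + U) x).2.2 = X + (S.brG U R - S.adSq (B X) - S.DG (S.DG U)) +
      (S.E (T + U) x - S.E T x - S.opB (S.op U) x).2.2 := by
    rw [← h2, Prod.snd_sub, Prod.snd_sub, Prod.snd_sub, Prod.snd_sub, hX]
    abel
  have h4 : S.adSq (B (S.E (T + U) x).2.2) = S.adSq (B (S.brG U R)) -
      S.adSq (B (S.DG (S.DG U))) + S.adSq (B (S.E (T + U) x - S.E T x - S.opB (S.op U) x).2.2) := by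
    rw [h3]
    simp only [map_add, map_sub, hB.adSq_pinv_adSq]
    abel
  have g1 := hB.adSq_shift _ _ (S.brG_shift _ _ _ hU _ hR)
  have g2 := hB.adSq_shift _ _ (S.DG_shift _ _ (S.DG_shift _ _ hU))
  have g3 := hB.adSq_shift _ _ h1
  rw [h4]
  exact Submodule.add_mem _ (Submodule.sub_mem _ (S.Fil_anti (by omega) g1)
    (S.Fil_anti (by omega) g2)) (S.Fil_anti (by omega) g3)

/-- The component in `ℐ` of the transformed operator is removed degree by degree. -/
theorem exists_dressing (hS : S.SemisimpleLamSq) {Q : 𝔤 ⊗[ℂ] S.A} (hQ : S.parTens Q = -Q)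
    (hQ' : S.const Q ∈ S.Fil (-S.i + 1)) : ∃ T H, S.IsDressing Q T H := by
  obtain ⟨B, hB⟩ := S.exists_isPinv hS
  have hi := S.i_pos
  obtain ⟨hτ, hD⟩ := D_mem_PQ hQ
  have hR := sqRem_mem hQ'
  obtain ⟨x, hx⟩ : ∃ x : S.Op, x = (0, 1, sqRem Q + S.tensOne S.LamSq) := ⟨_, rfl⟩
  have hxF : x ∈ S.filOp.F (-2 * S.i) := by
    rw [hx]
    exact mem_filOp.2 ⟨Submodule.add_mem _ (S.Fil_anti (by omega) hR) S.LamSq_mem_Fil,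
      fun h => by omega⟩
  have hxc : x ∈ S.opCoefIn fun _ => S.tens ⊤ (S.PQ Q) := by
    rw [hx]; exact Submodule.add_mem _ (sqRem_coefIn hQ) (S.tensOne_coefIn _ _)
  have hxp : S.parOp x = x := by
    refine Prod.ext (by simp [parOp_apply, hx]) (Prod.ext rfl ?_)
    rw [hx]
    show S.parG (sqRem Q + S.tensOne S.LamSq) = sqRem Q + S.tensOne S.LamSq
    rw [map_add, S.parG_LamSq, sgn_zero, one_smul, parG_sqRem hQ]
  have hBc : ∀ X ∈ S.coefIn (fun _ => S.tens ⊤ (S.PQ Q)), B X ∈ S.coefIn fun _ => S.tens ⊤ (S.PQ Q) :=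
    hB.stable _ (fun X hX => brG_coefIn hτ (S.tensOne_coefIn _ _) hX) fun k X hX => zG_coefIn k hX
  have hEc : ∀ T ∈ dressSpace B Q, (S.E T x).2.2 ∈ S.coefIn fun _ => S.tens ⊤ (S.PQ Q) :=
    fun T hT => by
      obtain ⟨h1, -, -, h4⟩ := mem_dressSpace.1 hT
      exact Filt.exp_mem_closed (adT_shift h1) (S.closed_opCoefIn fun _ => S.tens ⊤ (S.PQ Q))
        (fun _ hx => opB_mem_coef hτ hD h4 hx) hxc
  have hEp : ∀ T ∈ dressSpace B Q, S.parG (S.E T x).2.2 = (S.E T x).2.2 := fun T hT => by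
    obtain ⟨h1, h2, -, -⟩ := mem_dressSpace.1 hT
    have h := Filt.exp_map (adT_shift h1) (adT_shift h1) S.parOp_shift (parOp_opB h2) x
    rw [hxp] at h
    exact congrArg (fun y : S.Op => y.2.2) h
  -- `adSq (B X)` is the component of `X` in `ℐ`; at `T = 0` its degree exceeds `-2 i`,
  -- since the leading term of the operator is `Λ²`, which lies in `𝒦`
  obtain ⟨T, hTZ, hT0⟩ := exists_solution (fun T => S.adSq (B (S.E T x).2.2)) (dressSpace B Q)
    (closed_dressSpace hB Q) (-2 * S.i + 1) (by
      rw [E_zero, hx, map_add, map_add, hB.adSq_comm (S.tensOne _), adSq_LamSq, map_zero, add_zero]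
      have := hB.adSq_shift _ _ hR
      rw [add_zero] at this
      exact this)
    (fun n T hT hn => by
      obtain ⟨X, hX⟩ : ∃ X, X = (S.E T x).2.2 := ⟨_, rfl⟩
      have hXp : S.parG X = X := by rw [hX]; exact hEp T hT
      have hXc := hEc T hT
      have h1 := (mem_dressSpace.1 hT).1
      rw [← hX] at hn hXc
      have hU := hB.shift _ _ hn
      -- to leading order the correction `U` changes `X` by `-[Λ², U] = -adSq (B X)`
      refine ⟨B (S.adSq (B X)), mem_dressSpace.2 ⟨S.Fil_anti (by omega) hU, ?_, ?_, ?_⟩,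
        S.Fil_anti (by omega) hU, ?_⟩
      · rw [hB.parG_comm, adSq_parG, hB.parG_comm, hXp]
      · rw [← hB.adSq_comm (B X), hB.adSq_pinv_adSq]
      · exact hBc _ (brG_coefIn hτ (S.tensOne_coefIn _ _) (hBc _ hXc))
      · rw [hx] at hX ⊢
        exact dressing_step hB hR h1 hX hXp hn)
    (fun n T hT T' hT' hTT hn => by
      have h1 := hB.adSq_shift _ _ (mem_filOp.1 (E_sub_mem (mem_dressSpace.1 hT).1 hTT hxF)).1
      rw [Prod.snd_sub, Prod.snd_sub, map_sub] at h1
      have := Submodule.add_mem _ (S.Fil_anti (show -2 * S.i + 1 + n ≤ -2 * S.i + n + 1 + 0 by omega)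
        h1) hn
      simpa using this)
  obtain ⟨hT1, hTp, hTa, hTc⟩ := mem_dressSpace.1 hTZ
  refine ⟨T, (S.E T x).2.2 - S.tensOne S.LamSq, hTp, fun l => ?_, ⟨B T, hTa⟩, ?_, ?_, ?_⟩
  · refine mem_tens_inf ?_ (hTc l)
    have : S.zcoeff l T ∈ S.tens (S.grGT (l * S.zdeg + 1 - 1)) ⊤ := hT1 l
    rwa [add_sub_cancel_right] at this
  · exact Submodule.sub_mem _ (hEc T hTZ) (S.tensOne_coefIn _ _)
  · show S.adSq _ = 0
    have hT0 : S.adSq (B (S.E T x).2.2) = 0 := hT0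
    rw [← hB.adSq_pinv_adSq, map_sub, adSq_LamSq, sub_zero, ← hB.adSq_comm (S.E T x).2.2, hT0,
      map_zero]
  · rw [laxS_sq hQ, sub_add_cancel, ← hx]
    have := E_isExpAd hT1 x
    have h6 : S.E T x = (0, 1, (S.E T x).2.2) :=
      Prod.ext ((E_fst hT1 x).trans (by rw [hx])) (Prod.ext ((E_snd_fst hT1 x).trans (by rw [hx])) rfl)
    rwa [h6] at this

end

end DSData

namespace DSData

variable {𝔤 : Type*} [AddCommGroup 𝔤] [Module ℂ 𝔤] {ι : Type*} [Fintype ι] [DecidableEq ι]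
  (S : DSData 𝔤 ι)

/-! ### Existence of the canonical form -/

section

variable {S}

open TensorProduct Classical in
theorem mem_tens_top_iff {U : Submodule ℂ 𝔤} {X : 𝔤 ⊗[ℂ] S.A} : X ∈ S.tens U ⊤ ↔
    ∀ i, equivFinsuppOfBasisRight (Module.Basis.ofVectorSpace ℂ S.A) X i ∈ U := by
  refine ⟨fun h i => ?_, fun h => ?_⟩
  · refine tens_induction (C := fun X => equivFinsuppOfBasisRight
      (Module.Basis.ofVectorSpace ℂ S.A) X i ∈ U) (by simp) (fun X Y h1 h2 => ?_)
      (fun a ha u _ => ?_) h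
    · rw [map_add, Finsupp.add_apply]; exact U.add_mem h1 h2
    · rw [equivFinsuppOfBasisRight_apply_tmul_apply]; exact U.smul_mem _ ha
  · rw [← (equivFinsuppOfBasisRight (Module.Basis.ofVectorSpace ℂ S.A)).symm_apply_apply X,
      equivFinsuppOfBasisRight_symm_apply]
    exact Submodule.sum_mem _ fun i _ => tmul_mem_tens (h i) trivial

theorem mem_tens_inf_left {U U' : Submodule ℂ 𝔤} {X : 𝔤 ⊗[ℂ] S.A} (h : X ∈ S.tens U ⊤)
    (h' : X ∈ S.tens U' ⊤) : X ∈ S.tens (U ⊓ U') ⊤ :=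
  mem_tens_top_iff.2 fun i => ⟨mem_tens_top_iff.1 h i, mem_tens_top_iff.1 h' i⟩

variable (S) in
theorem form_qd (t t' : ι) : S.form (S.qd t) (S.q t') = if t' = t then 1 else 0 :=
  LinearMap.BilinForm.apply_dualBasis_left _ _ t t'

variable (S) in
theorem par_qd (t : ι) : S.par (S.qd t) = sgn (S.p t) • S.qd t := by
  refine sub_eq_zero.1 (form_left_nondeg (S := S) fun c => ?_)
  suffices h : S.form (S.par (S.qd t) - sgn (S.p t) • S.qd t) = 0 by rw [h]; rfl
  refine S.q.ext fun t' => ?_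
  rw [map_sub, LinearMap.sub_apply, ← S.form_even, S.par_par, S.q_par]
  simp only [map_smul, LinearMap.smul_apply, form_qd, LinearMap.zero_apply]
  split_ifs with h
  · subst h; simp
  · simp

theorem qd_mem_b {t : ι} (ht : t ∈ S.I) : S.qd t ∈ S.b := fun c hc => by
  rw [← S.span_q] at hc
  refine Submodule.span_induction (p := fun c _ => S.form (S.qd t) c = 0) ?_ (by simp)
    (fun a b _ _ h1 h2 => by rw [map_add, h1, h2, add_zero])
    (fun r a _ h => by rw [map_smul, h, smul_zero]) hc
  rintro _ ⟨t', ht', rfl⟩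
  rw [form_qd, if_neg]
  rintro rfl
  exact ht' ht

variable (S) in
theorem Qu_mem : S.Qu ∈ S.tens S.b S.P := Submodule.sum_mem _ fun t _ => by
  split_ifs with ht
  · exact tmul_mem_tens (qd_mem_b ht) (S.qbar_mem_P ht 0)
  · exact Submodule.zero_mem _

variable (S) in
theorem Qu_odd : S.parTens S.Qu = -S.Qu := by
  rw [Qu, map_sum, ← Finset.sum_neg_distrib]
  refine Finset.sum_congr rfl fun t _ => ?_
  split_ifs with ht
  · rw [parTens, TensorProduct.map_tmul, par_qd, tau_qbar, TensorProduct.smul_tmul_smul]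
    have : sgn (S.p t) * sgn (S.varPar (t, 0)) = -1 := by
      rw [← sgn_add, varPar, Nat.cast_zero, add_zero, ← add_assoc, parity_add_self, zero_add,
        sgn_one]
    rw [this]
    module
  · simp

/-- `U ⊗ 𝒫` as a subspace of `ĝ ⊗ 𝒫(ḡ)`. -/
def constIn (S : DSData 𝔤 ι) (U : Submodule ℂ 𝔤) : Submodule ℂ S.G :=
  S.coefIn fun l => if l = 0 then S.tens U S.P else ⊥

theorem mem_constIn {U : Submodule ℂ 𝔤} {X : S.G} :
    X ∈ S.constIn U ↔ ∃ Q ∈ S.tens U S.P, X = S.const Q := by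
  refine ⟨fun h => ⟨S.zcoeff 0 X, by simpa using h 0, S.ext_zcoeff fun l => ?_⟩, ?_⟩
  · rw [zcoeff_const]
    have := h l
    by_cases hl : l = 0
    · subst hl; simp
    · simpa [hl] using this
  · rintro ⟨Q, hQ, rfl⟩ l
    rw [zcoeff_const]
    by_cases hl : l = 0
    · simpa [hl] using hQ
    · simp [hl]

theorem brG_constIn {U U' U'' : Submodule ℂ 𝔤} (hU : ∀ a ∈ U', S.par a ∈ U')
    (h : ∀ a ∈ U, ∀ b ∈ U', S.br a b ∈ U'') {X Y : S.G} (hX : X ∈ S.constIn U)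
    (hY : Y ∈ S.constIn U') : S.brG X Y ∈ S.constIn U'' := by
  refine S.brG_mem_coefIn (fun k l X hX Y hY => ?_) hX hY
  by_cases hk : k = 0
  · by_cases hl : l = 0
    · subst hk hl
      simp only [if_true, add_zero] at hX hY ⊢
      exact brA_mem_tens (fun _ => S.tau_mem_P) hU h hX hY
    · rw [if_neg hl, Submodule.mem_bot] at hY
      rw [hY, map_zero]; exact Submodule.zero_mem _
  · rw [if_neg hk, Submodule.mem_bot] at hX
    rw [hX, map_zero]; exact Submodule.zero_mem _

theorem map_constIn {U U' : Submodule ℂ 𝔤} {g : 𝔤 →ₗ[ℂ] 𝔤} {d : S.A →ₗ[ℂ] S.A}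
    (hg : ∀ a ∈ U, g a ∈ U') (hd : ∀ u ∈ S.P, d u ∈ S.P) {X : S.G} (hX : X ∈ S.constIn U) :
    TensorProduct.map g (Laurent.map d) X ∈ S.constIn U' := fun l => by
  have := hX l
  rw [zcoeff_map]
  by_cases hl : l = 0
  · simp only [if_pos hl] at this ⊢
    exact map_mem_tens hg hd this
  · simp only [if_neg hl, Submodule.mem_bot] at this ⊢
    rw [this, map_zero]

theorem constIn_mono {U U' : Submodule ℂ 𝔤} (h : U ≤ U') : S.constIn U ≤ S.constIn U' :=
  fun X hX => by
    obtain ⟨Q, hQ, rfl⟩ := mem_constIn.1 hX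
    exact mem_constIn.2 ⟨Q, tens_mono h le_rfl hQ, rfl⟩

variable (S) in
/-- `f ⊗ 1`. -/
abbrev fG : S.G := S.const (S.f ⊗ₜ 1)

variable (S) in
theorem fG_mem : S.fG ∈ S.Fil (-S.i) :=
  S.const_mem_Fil (tmul_mem_tens (gr_le_grGT (by omega) S.f_gr) trivial)

variable (S) in
theorem fG_odd : S.parG S.fG = -S.fG := by
  rw [parG_const, parTens, TensorProduct.map_tmul, S.f_odd, TensorProduct.neg_tmul, map_neg]
  simp

variable (S) in
/-- `ad f` on `ĝ ⊗ 𝒫(ḡ)`. -/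
abbrev adf : S.G →ₗ[ℂ] S.G := TensorProduct.map (S.br S.f) (Laurent.map LinearMap.id)

theorem brG_tmul_of_even (a : 𝔤) {w : Laurent S.A} (hw : Laurent.map S.tau w = w) (X : S.G) :
    S.brG (a ⊗ₜ w) X = TensorProduct.map (S.br a) (LinearMap.mulLeft ℂ w) X := by
  induction X using TensorProduct.induction_on with
  | zero => simp
  | add x y h1 h2 => rw [map_add, map_add, h1, h2]
  | tmul b u =>
    have hb : S.proj 0 b + S.proj 1 b = b := prj_add_prj S.par b
    simp only [brG, LieSuperalgebra.brT, LinearMap.add_apply, TensorProduct.map₂_apply_tmul,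
      LinearMap.compl₂_apply, LinearMap.comp_apply, LinearMap.mul_apply', hw,
      TensorProduct.map_tmul, LinearMap.mulLeft_apply]
    rw [← TensorProduct.add_tmul, ← map_add, hb]

theorem map_tau_mono_one (k : ℤ) :
    Laurent.map S.tau (Laurent.mono k (1 : S.A)) = Laurent.mono k 1 :=
  Laurent.ext_coeff fun l => by
    rw [Laurent.coeff_map, Laurent.coeff_mono]; split_ifs <;> simp

variable (S) in
theorem brG_fG (X : S.G) : S.brG S.fG X = S.adf X := by
  have h : S.fG = S.f ⊗ₜ Laurent.mono 0 1 := rfl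
  have h1 : LinearMap.mulLeft ℂ (1 : Laurent S.A) = Laurent.map LinearMap.id :=
    LinearMap.ext fun u => Laurent.ext_coeff fun k => by
      rw [Laurent.coeff_map, LinearMap.mulLeft_apply, one_mul]; rfl
  rw [h, brG_tmul_of_even S.f (map_tau_mono_one 0), Laurent.mono_zero_one, h1]

variable (S) in
/-- The map `slice` on `ĝ ⊗ 𝒫(ḡ)`. -/
abbrev sliceG : S.G →ₗ[ℂ] S.G := TensorProduct.map S.slice (Laurent.map LinearMap.id)

theorem sliceG_mem {X : S.G} (hX : X ∈ S.constIn S.b) {d : ℤ} (hd : X ∈ S.Fil d) :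
    S.sliceG X ∈ S.Fil (d + S.i) := fun l => by
  rw [zcoeff_map]
  obtain ⟨Q, hQ, rfl⟩ := mem_constIn.1 hX
  have h1 : S.zcoeff l (S.const Q) ∈ S.tens (S.b ⊓ S.grGT (l * S.zdeg + d - 1)) ⊤ := by
    refine mem_tens_inf_left ?_ (hd l)
    rw [zcoeff_const]
    split_ifs
    · exact tens_mono le_rfl le_top hQ
    · exact Submodule.zero_mem _
  refine map_mem_tens (B' := ⊤) (fun a ha => ?_) (fun _ _ => trivial) h1
  have := slice_mem_grGT ha.1 ha.2
  rwa [show l * S.zdeg + d - 1 + S.i = l * S.zdeg + (d + S.i) - 1 by ring] at this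

theorem sliceG_constIn {X : S.G} (hX : X ∈ S.constIn S.b) : S.sliceG X ∈ S.constIn S.n :=
  map_constIn (fun a _ => slice_mem a) (fun _ hu => hu) hX

theorem constIn_induction {U : Submodule ℂ 𝔤} {C : S.G → Prop} (h0 : C 0)
    (ha : ∀ X Y, C X → C Y → C (X + Y)) (ht : ∀ a ∈ U, ∀ u ∈ S.P, C (S.const (a ⊗ₜ u))) {X : S.G}
    (hX : X ∈ S.constIn U) : C X := by
  obtain ⟨Q, hQ, rfl⟩ := mem_constIn.1 hX
  exact tens_induction (C := fun Q => C (S.const Q)) (by rwa [map_zero])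
    (fun X Y h1 h2 => by rw [map_add]; exact ha _ _ h1 h2) ht hQ

theorem map_const_tmul (g : 𝔤 →ₗ[ℂ] 𝔤) (d : S.A →ₗ[ℂ] S.A) (a : 𝔤) (u : S.A) :
    TensorProduct.map g (Laurent.map d) (S.const (a ⊗ₜ u)) = S.const (g a ⊗ₜ d u) :=
  S.ext_zcoeff fun l => by
    rw [zcoeff_map, zcoeff_const, zcoeff_const]
    split_ifs
    · rfl
    · rw [map_zero]

theorem sliceG_parG {X : S.G} (hX : X ∈ S.constIn S.b) :
    S.sliceG (S.parG X) = -S.parG (S.sliceG X) := by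
  refine constIn_induction (C := fun X => S.sliceG (S.parG X) = -S.parG (S.sliceG X)) (by simp)
    (fun X Y h1 h2 => ?_) (fun a ha u _ => ?_) hX
  · simp only [map_add, h1, h2, neg_add]
  · rw [parG, sliceG, map_const_tmul, map_const_tmul, map_const_tmul, map_const_tmul, slice_par ha,
      TensorProduct.neg_tmul, map_neg]
    rfl

theorem sliceG_adf {X : S.G} (hX : X ∈ S.constIn S.n) : S.sliceG (S.adf X) = X := by
  refine constIn_induction (C := fun X => S.sliceG (S.adf X) = X) (by simp)
    (fun X Y h1 h2 => ?_) (fun a ha u _ => ?_) hX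
  · rw [map_add, map_add, h1, h2]
  · rw [adf, sliceG, map_const_tmul, map_const_tmul, slice_br ha]
    rfl

theorem sub_sliceG_mem {X : S.G} (hX : X ∈ S.constIn S.b) :
    X - S.adf (S.sliceG X) ∈ S.constIn S.V := by
  refine constIn_induction (C := fun X => X - S.adf (S.sliceG X) ∈ S.constIn S.V) (by simp)
    (fun X Y h1 h2 => ?_) (fun a ha u hu => ?_) hX
  · have := Submodule.add_mem _ h1 h2
    rw [map_add, map_add]
    convert this using 1
    abel
  · rw [adf, sliceG, map_const_tmul, map_const_tmul, ← map_sub]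
    refine mem_constIn.2 ⟨(a - S.br S.f (S.slice a)) ⊗ₜ u, tmul_mem_tens (sub_slice_mem ha) hu, ?_⟩
    rw [TensorProduct.sub_tmul]
    rfl

/-- The even elements of `𝔫 ⊗ 𝒫`. -/
def gaugeSpace (S : DSData 𝔤 ι) : Submodule ℂ S.G :=
  S.Fil 1 ⊓ (LinearMap.ker (S.parG - LinearMap.id) ⊓ S.constIn S.n)

theorem mem_gaugeSpace {T : S.G} :
    T ∈ S.gaugeSpace ↔ T ∈ S.Fil 1 ∧ S.parG T = T ∧ T ∈ S.constIn S.n := by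
  simp only [gaugeSpace, Submodule.mem_inf, LinearMap.mem_ker, LinearMap.sub_apply,
    LinearMap.id_apply, sub_eq_zero]

variable (S) in
theorem closed_gaugeSpace : S.filG.Closed S.gaugeSpace := by
  have h1 : Filt.Shift S.filG S.filG 0 (S.parG - LinearMap.id) := fun d X hX =>
    Submodule.sub_mem _ (S.parG_shift d X hX) (S.id_shift d X hX)
  have h3 := S.closed_coefIn fun l => if l = 0 then S.tens S.n S.P else ⊥
  have h5 := (Filt.closed_ker h1).inf h3
  exact (Filt.closed_F (Φ := S.filG) 1).inf h5

theorem constIn_n_mem_Fil {T : S.G} (hT : T ∈ S.constIn S.n) : T ∈ S.Fil 1 := by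
  obtain ⟨Q, hQ, rfl⟩ := mem_constIn.1 hT
  exact S.const_mem_Fil (tens_mono n_le_grGT le_top hQ)

variable (S) in
/-- The operators `α D + 𝒬 + α f ⊗ 1` with `𝒬 ∈ 𝔟 ⊗ 𝒫`. -/
def laxSpace : Submodule ℂ S.Op :=
  (S.constIn S.b).comap ((LinearMap.snd ℂ ℂ S.G ∘ₗ LinearMap.snd ℂ ℂ (ℂ × S.G)) -
      (LinearMap.toSpanSingleton ℂ S.G S.fG) ∘ₗ LinearMap.fst ℂ ℂ (ℂ × S.G)) ⊓
    LinearMap.ker (LinearMap.fst ℂ ℂ S.G ∘ₗ LinearMap.snd ℂ ℂ (ℂ × S.G))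

theorem mem_laxSpace {x : S.Op} :
    x ∈ S.laxSpace ↔ x.2.2 - x.1 • S.fG ∈ S.constIn S.b ∧ x.2.1 = 0 := Iff.rfl

variable (S) in
theorem closed_laxSpace : S.filOp.Closed S.laxSpace := fun x hx => by
  obtain ⟨y, hy, hxy⟩ := hx 1
  have h0 := ((mem_filOp.1 hxy).2 one_pos).2
  refine mem_laxSpace.2 ⟨S.closed_coefIn _ _ fun d => ?_, ?_⟩
  · obtain ⟨y, hy, hxy⟩ := hx (max d 1)
    obtain ⟨h1, h2⟩ := mem_filOp.1 hxy
    refine ⟨_, (mem_laxSpace.1 hy).1, ?_⟩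
    have h3 : x.1 = y.1 := sub_eq_zero.1 (h2 (by omega)).1
    rw [h3, sub_sub_sub_cancel_right]
    exact S.Fil_anti (le_max_left _ _) h1
  · rw [← (mem_laxSpace.1 hy).2]; exact sub_eq_zero.1 h0

theorem brG_gauge_fG {T : S.G} (hT : T ∈ S.gaugeSpace) : S.brG T S.fG = -S.adf T := by
  obtain ⟨-, h2, -⟩ := mem_gaugeSpace.1 hT
  rw [skewG (e := 0) (by rw [h2, sgn_zero, one_smul]), pw_zero, LinearMap.id_apply, brG_fG]

theorem adf_mem {T : S.G} (hT : T ∈ S.constIn S.n) : S.adf T ∈ S.constIn S.b :=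
  map_constIn (U' := S.b) (fun a ha => S.br_f_n a ha) (fun _ hu => hu) hT

theorem opB_laxSpace {T : S.G} (hT : T ∈ S.gaugeSpace) {x : S.Op} (hx : x ∈ S.laxSpace) :
    S.opB (S.op T) x ∈ S.laxSpace := by
  obtain ⟨h1, h2⟩ := mem_laxSpace.1 hx
  obtain ⟨-, hp, hn⟩ := mem_gaugeSpace.1 hT
  rw [opB_op, h2, zero_smul, sub_zero, hp]
  refine mem_laxSpace.2 ⟨?_, rfl⟩
  have h3 : S.brG T (x.2.2 - x.1 • S.fG) ∈ S.constIn S.b :=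
    brG_constIn (fun _ => par_mem_b) (fun _ ha _ hy => br_n_b ha hy) hn h1
  have h4 : S.DG T ∈ S.constIn S.n := map_constIn S.n_par (fun _ => S.D_mem_P) hn
  rw [map_sub, map_smul, brG_gauge_fG hT] at h3
  have h5 := Submodule.sub_mem _ (Submodule.sub_mem _ h3 (Submodule.smul_mem _ x.1 (adf_mem hn)))
    (Submodule.smul_mem _ x.1 (constIn_mono n_le_b h4))
  simp only [op, zero_smul, sub_zero]
  convert h5 using 1
  module

variable (S) in
theorem Qu_mem_Fil : S.const S.Qu ∈ S.Fil (-S.i + 1) := const_mem_of_tens_b S.Qu_mem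

variable (S) in
theorem lax_Qu_mem : S.lax S.Qu ∈ S.filOp.F (-S.i) := by
  have hi := S.i_pos
  refine mem_filOp.2 ⟨?_, fun h => by omega⟩
  rw [lax, map_add]
  exact Submodule.add_mem _ (S.Fil_anti (by omega) S.Qu_mem_Fil) S.fG_mem

variable (S) in
theorem lax_Qu_mem_laxSpace : S.lax S.Qu ∈ S.laxSpace := by
  refine mem_laxSpace.2 ⟨?_, rfl⟩
  simp only [lax, map_add, one_smul, add_sub_cancel_right]
  exact mem_constIn.2 ⟨_, S.Qu_mem, rfl⟩

variable (S) in
theorem parOp_lax_Qu : S.parOp (S.lax S.Qu) = -S.lax S.Qu := by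
  refine Prod.ext rfl (Prod.ext (by simp [parOp_apply, lax]) ?_)
  simp only [parOp_apply, lax, map_add, parG_const, Qu_odd, map_neg, Prod.snd_neg]
  rw [← parG_const, fG_odd]
  abel

section gaugeSpace

variable {T : S.G} (hT : T ∈ S.gaugeSpace)

include hT

theorem E_lax_mem : S.E T (S.lax S.Qu) ∈ S.laxSpace :=
  Filt.exp_mem_closed (adT_shift (mem_gaugeSpace.1 hT).1) S.closed_laxSpace
    (fun _ hx => opB_laxSpace hT hx) S.lax_Qu_mem_laxSpace

theorem E_lax_odd : S.parG (S.E T (S.lax S.Qu)).2.2 = -(S.E T (S.lax S.Qu)).2.2 := by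
  obtain ⟨h1, h2, -⟩ := mem_gaugeSpace.1 hT
  have h := Filt.exp_map (adT_shift h1) (adT_shift h1) S.parOp_shift (parOp_opB h2) (S.lax S.Qu)
  rw [parOp_lax_Qu, map_neg] at h
  exact congrArg (fun x : S.Op => x.2.2) h

theorem E_lax_fst : (S.E T (S.lax S.Qu)).1 = 1 := E_fst (mem_gaugeSpace.1 hT).1 _

theorem E_lax_sub_mem : (S.E T (S.lax S.Qu)).2.2 - S.fG ∈ S.constIn S.b := by
  have := (mem_laxSpace.1 (E_lax_mem hT)).1
  rwa [E_lax_fst hT, one_smul] at this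

end gaugeSpace

/-- One step of the approximation: the component in `[f, 𝔫]` of `e^{ad T} ℒ(𝒬_u)` is removed in
lowest degree by changing `T`. -/
theorem canonical_step {T : S.G} (hT : T ∈ S.gaugeSpace) {n : ℕ} {U : S.G}
    (hU' : U = S.sliceG ((S.E T (S.lax S.Qu)).2.2 - S.fG)) (hU : U ∈ S.gaugeSpace)
    (hn : U ∈ S.Fil (n + 1)) :
    S.sliceG ((S.E (T + U) (S.lax S.Qu)).2.2 - S.fG) ∈ S.Fil (n + 2) := by
  have hi := S.i_pos
  obtain ⟨hU1, hUp, hUn⟩ := mem_gaugeSpace.1 hU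
  have h1 := (mem_filOp.1 (E_add_sub_mem (mem_gaugeSpace.1 hT).1 hn S.lax_Qu_mem)).1
  obtain ⟨x, hx⟩ : ∃ x, x = (S.E T (S.lax S.Qu)).2.2 := ⟨_, rfl⟩
  obtain ⟨y, hy⟩ : ∃ y, y = (S.E (T + U) (S.lax S.Qu)).2.2 := ⟨_, rfl⟩
  have hxb := E_lax_sub_mem hT
  have hyb := E_lax_sub_mem (Submodule.add_mem _ hT hU)
  rw [← hx] at hU' hxb
  rw [← hy] at hyb ⊢
  have h2 : (S.opB (S.op U) (S.lax S.Qu)).2.2 = S.brG U (S.const S.Qu) - S.adf U - S.DG U := by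
    rw [opB_op, hUp]
    simp only [op, lax, map_add, brG_gauge_fG hU, zero_smul, one_smul, sub_zero]
    abel
  have h3 : y - x + S.adf U ∈ S.Fil (n + 2 - S.i) := by
    have g1 := S.brG_shift _ _ _ hn _ S.Qu_mem_Fil
    have g2 := S.DG_shift _ _ hn
    rw [Prod.snd_sub, Prod.snd_sub, Prod.snd_sub, Prod.snd_sub, h2, ← hx, ← hy] at h1
    have := Submodule.add_mem _ (S.Fil_anti (show n + 2 - S.i ≤ -S.i + n + 2 by omega) h1)
      (Submodule.sub_mem _ (S.Fil_anti (show n + 2 - S.i ≤ _ by omega) g1)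
        (S.Fil_anti (show n + 2 - S.i ≤ _ by omega) g2))
    convert this using 1
    abel
  have h4 : y - x + S.adf U ∈ S.constIn S.b := by
    have := Submodule.add_mem _ (Submodule.sub_mem _ hyb hxb) (adf_mem hUn)
    convert this using 1
    abel
  have h5 := sliceG_mem h4 h3
  rw [sub_add_cancel] at h5
  have h6 : S.sliceG (y - S.fG) = S.sliceG (y - x + S.adf U) := by
    have : y - S.fG = (x - S.fG) + (y - x) := by abel
    rw [this, map_add, ← hU', map_add, sliceG_adf hUn, add_comm]
  rw [h6]
  exact h5

variable (S) in
/-- The component along `[f, 𝔫]` is removed degree by degree. -/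
theorem exists_isCanonical : ∃ Q, S.IsCanonical Q := by
  have hi := S.i_pos
  obtain ⟨T, hTZ, hT0⟩ := exists_solution
    (fun T => S.sliceG ((S.E T (S.lax S.Qu)).2.2 - S.fG)) S.gaugeSpace S.closed_gaugeSpace 1 (by
      have h1 : (S.lax S.Qu).2.2 - S.fG = S.const S.Qu := by
        simp only [lax, map_add, add_sub_cancel_right]
      have := sliceG_mem (mem_constIn.2 ⟨_, S.Qu_mem, rfl⟩) S.Qu_mem_Fil
      rw [E_zero, h1]
      exact S.Fil_anti (by omega) this)
    -- `sliceG` is the inverse of `ad f` on `[f, 𝔫]` after projection along `V`, so that to leading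
    -- order the correction by `U` takes the component along `[f, 𝔫]` away
    (fun n T hT hn => by
      obtain ⟨U, hU⟩ : ∃ U, U = S.sliceG ((S.E T (S.lax S.Qu)).2.2 - S.fG) := ⟨_, rfl⟩
      rw [← hU] at hn
      have hb := E_lax_sub_mem hT
      have hn' : U ∈ S.Fil (n + 1) := S.Fil_anti (by omega) hn
      have hUZ : U ∈ S.gaugeSpace := by
        refine mem_gaugeSpace.2 ⟨S.Fil_anti (by omega) hn, ?_, hU ▸ sliceG_constIn hb⟩
        have := sliceG_parG hb
        rw [map_sub, E_lax_odd hT, fG_odd, neg_sub_neg, ← neg_sub, map_neg, ← hU] at this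
        exact (neg_injective this).symm
      refine ⟨U, hUZ, hn', ?_⟩
      exact S.Fil_anti (by omega) (canonical_step hT hU hUZ hn'))
    (fun n T hT T' hT' hTT hn => by
      have h1 := (mem_filOp.1 (E_sub_mem (mem_gaugeSpace.1 hT).1 hTT S.lax_Qu_mem)).1
      have h2 := Submodule.sub_mem _ (E_lax_sub_mem hT') (E_lax_sub_mem hT)
      rw [sub_sub_sub_cancel_right] at h2
      have h3 := sliceG_mem h2 h1
      have h4 := Submodule.add_mem _ (S.Fil_anti (show 1 + (n : ℤ) ≤ _ by omega) h3) hn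
      convert h4 using 1
      rw [← map_add, sub_add_sub_cancel])
  have hT0 : S.sliceG ((S.E T (S.lax S.Qu)).2.2 - S.fG) = 0 := hT0
  have h1 := sub_sliceG_mem (E_lax_sub_mem hTZ)
  rw [hT0, map_zero, sub_zero] at h1
  obtain ⟨Q, hQ, hQ'⟩ := mem_constIn.1 h1
  obtain ⟨hT1, hTp, hTn⟩ := mem_gaugeSpace.1 hTZ
  obtain ⟨N, hN, rfl⟩ := mem_constIn.1 hTn
  have hinj : ∀ X Y : 𝔤 ⊗[ℂ] S.A, S.const X = S.const Y → X = Y := fun X Y h => by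
    simpa [zcoeff_const] using congrArg (S.zcoeff 0) h
  refine ⟨Q, hQ, hinj _ _ ?_, N, hN, hinj _ _ (by rw [← parG_const, hTp]), ?_⟩
  · rw [← parG_const, map_neg, ← hQ', map_sub, E_lax_odd hTZ, fG_odd]
    abel
  · have h2 := E_isExpAd hT1 (S.lax S.Qu)
    have h3 : S.E (S.const N) (S.lax S.Qu) = S.lax Q := by
      refine Prod.ext (E_lax_fst hTZ) (Prod.ext (mem_laxSpace.1 (E_lax_mem hTZ)).2 ?_)
      have h4 : (S.lax Q).2.2 = S.const Q + S.fG := map_add S.const _ _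
      rw [h4, ← hQ', sub_add_cancel]
    rwa [h3] at h2

variable (S) in
theorem Qc_isCanonical : S.IsCanonical S.Qc := by
  rw [Qc, dif_pos S.exists_isCanonical]
  exact S.exists_isCanonical.choose_spec

variable (S) in
theorem Qc_mem_Fil : S.const S.Qc ∈ S.Fil (-S.i + 1) :=
  const_mem_of_tens_b (tens_mono (fun _ hv => mem_b_iff.2 (Submodule.mem_sup_left hv)) le_rfl
    S.Qc_isCanonical.1)

theorem dressing_spec (hS : S.SemisimpleLamSq) {Q : 𝔤 ⊗[ℂ] S.A} (hQ : S.parTens Q = -Q)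
    (hQ' : S.const Q ∈ S.Fil (-S.i + 1)) : ∃ H, S.IsDressing Q (S.dressing Q) H := by
  rw [dressing, dif_pos (exists_dressing hS hQ hQ')]
  exact (exists_dressing hS hQ hQ').choose_spec

theorem IsDressing.mem_Fil {Q : 𝔤 ⊗[ℂ] S.A} {T H : S.G} (h : S.IsDressing Q T H) : T ∈ S.Fil 1 :=
  fun l => by
    have := tens_mono le_rfl le_top (h.T_pos l)
    rwa [show l * (S.i + S.j) = l * S.zdeg + 1 - 1 by ring] at this

theorem IsDressing.mem_coefP {Q : 𝔤 ⊗[ℂ] S.A} {T H : S.G} (h : S.IsDressing Q T H)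
    (hQ : S.PQ Q ≤ S.P) : T ∈ S.coefP :=
  fun l => tens_mono le_top hQ (h.T_pos l)

end

end DSData

namespace SuperPoly

variable {X : Type*} {p : X → ZMod 2}

theorem degPart_zero_degPart {r : ℕ} (hr : r ≠ 0) (a : SuperPoly p) :
    degPart p 0 (degPart p r a) = 0 := by
  induction a using SuperPoly.induction generalizing r with
  | hs c => rw [degPart_algebraMap, if_neg hr, map_zero]
  | hg x =>
    rw [degPart_gen]
    split_ifs
    · simp [degPart_gen]
    · rw [map_zero]
  | hm a b h1 h2 =>
    rw [degPart_mul, map_sum]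
    refine Finset.sum_eq_zero fun x hx => ?_
    have hx := Finset.HasAntidiagonal.mem_antidiagonal.1 hx
    rw [degPart_mul, Finset.Nat.antidiagonal_zero, Finset.sum_singleton]
    by_cases h : x.1 = 0
    · rw [h2 (by omega), mul_zero]
    · rw [h1 h, zero_mul]
  | ha a b h1 h2 => rw [map_add, map_add, h1 hr, h2 hr, add_zero]

end SuperPoly

namespace DSData

variable {𝔤 : Type*} [AddCommGroup 𝔤] [Module ℂ 𝔤] {ι : Type*} [Fintype ι] [DecidableEq ι]
  (S : DSData 𝔤 ι)

/-! ### The kernel of `D` -/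

/-- `∂ / ∂q̄_k^{(m)}`. -/
abbrev pd (y : ι × ℕ) : S.A →ₗ[ℂ] S.A := SuperPoly.pderiv S.varPar y

/-- `∂ / ∂q̄_k^{(m-1)}`, and `0` for `m = 0`: the failure of `∂ / ∂q̄_k^{(m)}` to commute with `D`. -/
def pdPred (y : ι × ℕ) : S.A →ₗ[ℂ] S.A := if y.2 = 0 then 0 else S.pd (y.1, y.2 - 1)

theorem pd_isSDer (y : ι × ℕ) : SuperPoly.IsSDer S.varPar (S.varPar y) (S.pd y) :=
  SuperPoly.pderiv_isSDer y

theorem pd_qbar (y : ι × ℕ) (t : ι) (n : ℕ) :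
    S.pd y (S.qbar t n) = if (t, n) = y then 1 else 0 := SuperPoly.pderiv_gen y (t, n)

theorem varPar_succ (t : ι) (n : ℕ) : S.varPar (t, n + 1) = S.varPar (t, n) + 1 := by
  simp only [varPar]; push_cast; ring

theorem pdPred_isSDer (y : ι × ℕ) :
    SuperPoly.IsSDer S.varPar (S.varPar y + 1) (S.pdPred y) := by
  obtain ⟨k, m⟩ := y
  rw [pdPred]
  split_ifs with h
  · exact ⟨fun a => by simp, fun a b => by simp⟩
  · obtain ⟨m, rfl⟩ := Nat.exists_eq_succ_of_ne_zero h
    have := S.pd_isSDer (k, m)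
    rwa [Nat.succ_eq_add_one, varPar_succ, add_assoc, parity_add_self, add_zero]

theorem pd_D (y : ι × ℕ) (a : S.A) :
    S.pd y (S.D a) = sgn (S.varPar y) • S.D (S.pd y a) + S.pdPred y a := by
  have h := ((S.pd_isSDer y).comm S.D_isSDer).ext (S.pdPred_isSDer y) (fun ⟨t, n⟩ => ?_) a
  · rw [mul_one] at h
    rw [← h]
    simp
  · obtain ⟨k, m⟩ := y
    have h1 : S.D (S.pd (k, m) (S.qbar t n)) = 0 := by
      rw [pd_qbar]
      split_ifs
      · exact S.D_isSDer.map_one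
      · exact map_zero _
    simp only [LinearMap.sub_apply, LinearMap.comp_apply, LinearMap.smul_apply]
    change S.pd (k, m) (S.D (S.qbar t n)) - sgn _ • S.D (S.pd (k, m) (S.qbar t n)) =
      S.pdPred (k, m) (S.qbar t n)
    rw [h1, smul_zero, sub_zero, D_qbar, pd_qbar, pdPred]
    cases m with
    | zero => simp
    | succ m => simp [pd_qbar]

theorem degPart_D (r : ℕ) (a : S.A) :
    SuperPoly.degPart S.varPar r (S.D a) = S.D (SuperPoly.degPart S.varPar r a) :=
  SuperPoly.degPart_der S.D_isSDer (fun x r => by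
    have : S.D (SuperPoly.gen S.varPar x) = SuperPoly.gen S.varPar (x.1, x.2 + 1) :=
      S.D_qbar x.1 x.2
    rw [this, SuperPoly.degPart_gen]) r a

variable {S} in
/-- An element of the kernel of `D` is a constant. -/
theorem eq_zero_of_D {a : S.A} (h0 : SuperPoly.degPart S.varPar 0 a = 0) (h : S.D a = 0) :
    a = 0 := by
  refine SuperPoly.eq_zero_of_pderiv h0 fun ⟨k, m⟩ => ?_
  have h1 : ∀ m, S.pd (k, m + 1) a = 0 → S.pd (k, m) a = 0 := fun m hm => by
    have := S.pd_D (k, m + 1) a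
    rw [h, hm, map_zero, map_zero, smul_zero, zero_add] at this
    simpa [pdPred] using this.symm
  obtain ⟨M, hM⟩ : ∃ M, ∀ m, M ≤ m → S.pd (k, m) a = 0 := by
    obtain ⟨M, hM⟩ := ((SuperPoly.pderiv_finite S.varPar a).image Prod.snd).bddAbove
    refine ⟨M + 1, fun m hm => ?_⟩
    by_contra h'
    have : m ≤ M := hM ⟨(k, m), h', rfl⟩
    omega
  have h2 : ∀ n, S.pd (k, M - n) a = 0 := fun n => by
    induction n with
    | zero => exact hM _ le_rfl
    | succ n ih =>
      rcases Nat.lt_or_ge n M with hn | hn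
      · refine h1 _ ?_
        rwa [show M - (n + 1) + 1 = M - n by omega]
      · rwa [show M - (n + 1) = M - n by omega]
  rcases Nat.le_total M m with hm | hm
  · exact hM m hm
  · have := h2 (M - m)
    rwa [show M - (M - m) = m by omega] at this

/-! ### Polynomial degree -/

/-- The part of polynomial degree `r` of the coefficients. -/
def degG (r : ℕ) : S.G →ₗ[ℂ] S.G :=
  TensorProduct.map LinearMap.id (Laurent.map (SuperPoly.degPart S.varPar r))

theorem degG_shift (r : ℕ) : Filt.Shift S.filG S.filG 0 (S.degG r) :=
  S.map_shift (fun _ _ h => h) _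

theorem degG_DG (r : ℕ) (X : S.G) : S.degG r (S.DG X) = S.DG (S.degG r X) := by
  refine S.ext_zcoeff fun l => ?_
  rw [degG, DG, zcoeff_map, zcoeff_map, zcoeff_map, zcoeff_map]
  induction S.zcoeff l X using TensorProduct.induction_on with
  | zero => simp
  | add x y h1 h2 => simp only [map_add, h1, h2]
  | tmul a u => simp [degPart_D]

theorem degG_parG (r : ℕ) (X : S.G) : S.degG r (S.parG X) = S.parG (S.degG r X) := by
  refine S.ext_zcoeff fun l => ?_
  rw [degG, parG, zcoeff_map, zcoeff_map, zcoeff_map, zcoeff_map]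
  induction S.zcoeff l X using TensorProduct.induction_on with
  | zero => simp
  | add x y h1 h2 => simp only [map_add, h1, h2]
  | tmul a u => exact congrArg (S.par a ⊗ₜ[ℂ] ·) (SuperPoly.degPart_parPow r 1 u)

theorem map_degPart_mul (r : ℕ) (u v : Laurent S.A) :
    Laurent.map (SuperPoly.degPart S.varPar r) (u * v) =
      ∑ x ∈ Finset.HasAntidiagonal.antidiagonal r, Laurent.map (SuperPoly.degPart S.varPar x.1) u *
        Laurent.map (SuperPoly.degPart S.varPar x.2) v := by
  refine Laurent.ext_coeff fun l => ?_
  rw [map_sum, Laurent.coeff_map]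
  have h1 : ∀ x : ℕ × ℕ, ∃ K : ℕ, ∀ K', K ≤ K' → Laurent.coeff l
      (Laurent.map (SuperPoly.degPart S.varPar x.1) u *
        Laurent.map (SuperPoly.degPart S.varPar x.2) v) = _ := fun x => Laurent.coeff_mul l _ _
  choose K hK using h1
  obtain ⟨K', hK'⟩ := Laurent.coeff_mul l u v
  obtain ⟨M, hM⟩ : ∃ M, M = max K' ((Finset.HasAntidiagonal.antidiagonal r).sup K) := ⟨_, rfl⟩
  rw [hK' M (hM ▸ le_max_left _ _), map_sum]
  rw [Finset.sum_congr rfl fun x hx => hK x M (hM ▸ le_max_of_le_right (Finset.le_sup hx)),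
    Finset.sum_comm]
  simp only [Laurent.coeff_map, SuperPoly.degPart_mul]

theorem degG_brG (r : ℕ) (X Y : S.G) : S.degG r (S.brG X Y) =
    ∑ x ∈ Finset.HasAntidiagonal.antidiagonal r, S.brG (S.degG x.1 X) (S.degG x.2 Y) := by
  have hτ : ∀ r u, Laurent.map S.tau (Laurent.map (SuperPoly.degPart S.varPar r) u) =
      Laurent.map (SuperPoly.degPart S.varPar r) (Laurent.map S.tau u) := fun r u =>
    Laurent.ext_coeff fun l => by
      simp only [Laurent.coeff_map]
      exact (SuperPoly.degPart_parPow _ _ _).symm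
  induction X using TensorProduct.induction_on with
  | zero => simp
  | add x y h1 h2 => simp only [map_add, LinearMap.add_apply, h1, h2, Finset.sum_add_distrib]
  | tmul a u =>
    induction Y using TensorProduct.induction_on with
    | zero => simp
    | add x y h1 h2 => simp only [map_add, h1, h2, Finset.sum_add_distrib]
    | tmul b v =>
      simp only [brG, LieSuperalgebra.brT, LinearMap.add_apply, TensorProduct.map₂_apply_tmul,
        LinearMap.compl₂_apply, LinearMap.comp_apply, LinearMap.mul_apply', degG,
        TensorProduct.map_tmul, map_add, hτ, map_degPart_mul, LinearMap.id_apply,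
        TensorProduct.tmul_sum, Finset.sum_add_distrib]

variable {S} in
theorem eq_zero_of_degG {X : S.G} (h : ∀ r, S.degG r X = 0) : X = 0 := by
  refine S.ext_zcoeff fun l => ext_coord S.q fun t => ?_
  rw [map_zero, map_zero]
  refine SuperPoly.eq_zero_of_degPart fun r => ?_
  have h1 := congrArg (fun X => coord (S.q.coord t) (S.zcoeff l X)) (h r)
  simp only [degG, zcoeff_map, map_zero] at h1
  rw [← h1]
  exact (coord_lTensor _ _ _).symm

variable {S} in
theorem degG_eq_zero_of_DG {r : ℕ} (hr : r ≠ 0) {X : S.G} (h : S.DG (S.degG r X) = 0) :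
    S.degG r X = 0 := by
  refine S.ext_zcoeff fun l => ext_coord S.q fun t => ?_
  rw [map_zero, map_zero, degG, zcoeff_map]
  have h2 : ∀ φ : Module.Dual ℂ 𝔤, ∀ Z : 𝔤 ⊗[ℂ] S.A,
      S.D (coord (φ ∘ₗ S.par) Z) = coord φ (TensorProduct.map S.par S.D Z) := fun φ Z => by
    induction Z using TensorProduct.induction_on with
    | zero => simp
    | add x y h1 h2 => simp only [map_add, h1, h2]
    | tmul a u => simp
  have h3 : ∀ φ : Module.Dual ℂ 𝔤, S.D (coord φ (S.zcoeff l (S.degG r X))) = 0 := fun φ => by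
    have h1 := h2 (φ ∘ₗ S.par) (S.zcoeff l (S.degG r X))
    have h4 : (φ ∘ₗ S.par) ∘ₗ S.par = φ := LinearMap.ext fun a => by simp [S.par_par]
    rw [h4, ← zcoeff_map] at h1
    have h5 : S.zcoeff l (TensorProduct.map S.par (Laurent.map S.D) (S.degG r X)) = 0 := by
      have : TensorProduct.map S.par (Laurent.map S.D) (S.degG r X) = 0 := h
      rw [this, map_zero]
    rw [h1, h5, map_zero]
  have h4 := h3 (S.q.coord t)
  rw [degG, zcoeff_map] at h4
  have h5 : coord (S.q.coord t) (TensorProduct.map LinearMap.id (SuperPoly.degPart S.varPar r)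
      (S.zcoeff l X)) = SuperPoly.degPart S.varPar r (coord (S.q.coord t) (S.zcoeff l X)) :=
    coord_lTensor _ _ _
  rw [h5] at h4 ⊢
  exact eq_zero_of_D (SuperPoly.degPart_zero_degPart hr _) h4

/-! ### Constant terms -/

theorem D_degPart_zero (a : S.A) : S.D (SuperPoly.degPart S.varPar 0 a) = 0 := by
  obtain ⟨c, hc⟩ := SuperPoly.exists_degPart_zero a
  rw [hc, S.D_isSDer.map_algebraMap]

theorem DG_degG_zero (X : S.G) : S.DG (S.degG 0 X) = 0 := by
  refine S.ext_zcoeff fun l => ?_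
  rw [degG, DG, zcoeff_map, zcoeff_map, map_zero]
  induction S.zcoeff l X using TensorProduct.induction_on with
  | zero => simp
  | add x y h1 h2 => simp only [map_add, h1, h2, add_zero]
  | tmul a u => simp [D_degPart_zero]

theorem degG_zero_brG (X Y : S.G) : S.degG 0 (S.brG X Y) = S.brG (S.degG 0 X) (S.degG 0 Y) := by
  rw [degG_brG, Finset.Nat.antidiagonal_zero, Finset.sum_singleton]

theorem degG_zero_tensOne (C : S.Loop) : S.degG 0 (S.tensOne C) = S.tensOne C := by
  refine S.ext_zcoeff fun l => ?_
  rw [degG, zcoeff_map]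
  induction C using TensorProduct.induction_on with
  | zero => simp
  | add x y h1 h2 => simp only [map_add, h1, h2]
  | tmul a u =>
    rw [zcoeff_tensOne_tmul, map_smul, TensorProduct.map_tmul, LinearMap.id_apply]
    have := SuperPoly.degPart_algebraMap (p := S.varPar) 0 1
    rw [map_one, if_pos rfl] at this
    rw [this]

theorem degG_zero_Qu : S.degG 0 (S.const S.Qu) = 0 := by
  rw [Qu, map_sum, map_sum]
  refine Finset.sum_eq_zero fun t _ => ?_
  split_ifs
  · rw [degG, map_const_tmul, qbar, SuperPoly.degPart_gen]; simp
  · simp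

/-- The constant term of a Lax operator. -/
def augOp : S.Op →ₗ[ℂ] S.Op := LinearMap.prodMap LinearMap.id (LinearMap.prodMap LinearMap.id (S.degG 0))

theorem augOp_apply (x : S.Op) : S.augOp x = (x.1, x.2.1, S.degG 0 x.2.2) := rfl

theorem augOp_shift : Filt.Shift S.filOp S.filOp 0 S.augOp := fun d x hx => by
  obtain ⟨h1, h2⟩ := mem_filOp.1 hx
  have := S.degG_shift 0 _ _ h1
  rw [add_zero] at this ⊢
  exact mem_filOp.2 ⟨this, h2⟩

theorem augOp_opB (T : S.G) (x : S.Op) :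
    S.augOp (S.opB (S.op T) x) = S.opB (S.op (S.degG 0 T)) (S.augOp x) := by
  rw [opB_op, opB_op, augOp_apply, augOp_apply]
  simp only [op, map_sub, map_smul, degG_zero_brG, degG_DG, ← degG_parG, DG_degG_zero, map_zero]

variable {S} in
theorem augOp_E {T : S.G} (hT : T ∈ S.Fil 1) (x : S.Op) :
    S.augOp (S.E T x) = S.E (S.degG 0 T) (S.augOp x) := by
  have h := S.degG_shift 0 _ _ hT
  rw [add_zero] at h
  exact Filt.exp_map (adT_shift hT) (adT_shift h) S.augOp_shift (S.augOp_opB T) x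

end DSData

namespace DSData

variable {𝔤 : Type*} [AddCommGroup 𝔤] [Module ℂ 𝔤] {ι : Type*} [Fintype ι] [DecidableEq ι]
  {S : DSData 𝔤 ι}

/-! ### The dressing has no constant term -/

theorem adSq_degG (r : ℕ) (X : S.G) : S.degG r (S.adSq X) = S.adSq (S.degG r X) := by
  rw [adSq, degG_brG, Finset.sum_eq_single_of_mem (0, r) (by simp)]
  · rw [degG_zero_tensOne]
  · intro x hx h
    have hx := Finset.HasAntidiagonal.mem_antidiagonal.1 hx
    have h1 : x.1 ≠ 0 := fun h0 => h (Prod.ext h0 (by simp; omega))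
    have h2 : S.degG x.1 (S.tensOne S.LamSq) = 0 := by
      rw [← degG_zero_tensOne]
      refine S.ext_zcoeff fun l => ?_
      rw [degG, degG, zcoeff_map, zcoeff_map, map_zero]
      induction S.zcoeff l (S.tensOne S.LamSq) using TensorProduct.induction_on with
      | zero => simp
      | add x y h1 h2 => simp only [map_add, h1, h2, add_zero]
      | tmul a u =>
        obtain ⟨c, hc⟩ := SuperPoly.exists_degPart_zero u
        simp [hc, SuperPoly.degPart_algebraMap, h1]
    rw [h2, map_zero, LinearMap.zero_apply]

theorem degG_zero_sqRem {Q : 𝔤 ⊗[ℂ] S.A} (hQ : S.degG 0 (S.const Q) = 0) :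
    S.degG 0 (sqRem Q) = 0 := by
  simp [sqRem, degG_zero_brG, hQ, degG_DG]

theorem eq_zero_of_mem_succ {X : S.G} (h0 : X ∈ S.Fil 1)
    (h : ∀ n : ℕ, X ∈ S.Fil (n + 1) → X ∈ S.Fil (n + 2)) : X = 0 := by
  have h1 : ∀ n : ℕ, X ∈ S.Fil (n + 1) := fun n => by
    induction n with
    | zero => simpa using h0
    | succ n ih => exact S.Fil_anti (by push_cast; omega) (h n ih)
  exact S.filG.separated _ fun d => S.Fil_anti (by omega) (h1 d.toNat)

/-- The constant term of `T_𝒬` vanishes if the one of `𝒬` does: the constant terms of the defining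
equation say that `e^{ad T₀}` takes `Λ²` into the kernel of `ad Λ²`, and the component of lowest
degree of `T₀ ∈ ℐ` would have to commute with `Λ²`. -/
theorem IsDressing.degG_zero {B : S.G →ₗ[ℂ] S.G} (hB : S.IsPinv B) {Q : 𝔤 ⊗[ℂ] S.A} {T H : S.G}
    (hT : S.IsDressing Q T H) (hQ : S.parTens Q = -Q) (hQ0 : S.degG 0 (S.const Q) = 0) :
    S.degG 0 T = 0 := by
  have hT1 := hT.mem_Fil
  have h1 := S.degG_shift 0 _ _ hT1
  rw [add_zero] at h1
  have h2 := eq_E_of_isExpAd hT1 hT.eq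
  rw [laxS_sq hQ] at h2
  have h3 := congrArg S.augOp h2
  rw [augOp_E hT1, augOp_apply, augOp_apply] at h3
  simp only [map_add, degG_zero_sqRem hQ0, degG_zero_tensOne, zero_add] at h3
  obtain ⟨T', hT'⟩ := hT.T_image
  obtain ⟨Y, hY⟩ : ∃ Y, S.degG 0 T = S.adSq Y :=
    ⟨S.degG 0 T', by rw [← adSq_degG]; exact congrArg _ hT'.symm⟩
  -- `ad Λ²` is invertible on `ℐ`, which contains `T₀`
  have hBB : B (B (S.adSq (S.adSq (S.degG 0 T)))) = S.degG 0 T := by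
    rw [hY, ← hB.adSq_comm (S.adSq (S.adSq Y)), hB.adSq_pinv_adSq, ← hB.adSq_comm,
      hB.adSq_pinv_adSq]
  have hH : S.adSq (S.degG 0 H) = 0 := by
    rw [← adSq_degG]
    have : S.adSq H = 0 := hT.H_ker
    rw [this, map_zero]
  have hp : S.parG (S.degG 0 T) = sgn 0 • S.degG 0 T := by
    rw [← degG_parG, hT.T_even, sgn_zero, one_smul]
  have hD := S.DG_degG_zero T
  obtain ⟨T₀, hT₀⟩ : ∃ T₀, T₀ = S.degG 0 T := ⟨_, rfl⟩
  rw [← hT₀] at h1 h3 hBB hp hD ⊢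
  have hi := S.i_pos
  refine eq_zero_of_mem_succ h1 fun n hn => ?_
  have hx : ((0, 1, S.tensOne S.LamSq) : S.Op) ∈ S.filOp.F (-2 * S.i) :=
    mem_filOp.2 ⟨S.LamSq_mem_Fil, fun h => by omega⟩
  have h4 := (mem_filOp.1 (E_add_sub_mem (T := 0) (Submodule.zero_mem _) hn hx)).1
  rw [zero_add, E_zero, ← h3, opB_op] at h4
  simp only [Prod.snd_sub, op, hD, map_zero, smul_zero, sub_zero, add_sub_cancel_right] at h4
  rw [skewG hp, pw_zero, LinearMap.id_apply, zero_smul, sub_zero, sub_neg_eq_add] at h4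
  have h5 := S.adSq_shift _ _ h4
  rw [map_add, hH, zero_add] at h5
  have h6 := hB.shift _ _ (hB.shift _ _ h5)
  have h7 : B (B (S.adSq (S.brG (S.tensOne S.LamSq) T₀))) = T₀ := hBB
  rw [h7] at h6
  exact S.Fil_anti (by omega) h6

theorem degG_zero_constIn {U : Submodule ℂ 𝔤} {X : S.G} (hX : X ∈ S.constIn U) :
    S.degG 0 X ∈ S.constIn U :=
  map_constIn (fun _ h => h) (fun u _ => by
    obtain ⟨c, hc⟩ := SuperPoly.exists_degPart_zero u
    rw [hc]; exact S.P.algebraMap_mem c) hX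

theorem degG_zero_fG : S.degG 0 S.fG = S.fG := by
  rw [degG, fG, map_const_tmul]
  have := SuperPoly.degPart_algebraMap (p := S.varPar) 0 1
  rw [map_one, if_pos rfl] at this
  rw [this]; rfl

theorem sliceG_V {X : S.G} (hX : X ∈ S.constIn S.V) : S.sliceG X = 0 := by
  refine constIn_induction (C := fun X => S.sliceG X = 0) (by simp)
    (fun X Y h1 h2 => by rw [map_add, h1, h2, add_zero]) (fun a ha u hu => ?_) hX
  have := slice_add (S := S) ha S.n.zero_mem
  rw [map_zero, add_zero] at this
  rw [sliceG, map_const_tmul, this]; simp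

/-- The gauge transformation to the canonical form has no constant term: otherwise its component
`a ∈ 𝔫` of lowest degree would satisfy `[f, a] ∈ V`, so that `[f, a] = 0`, and `ad f` is injective
on `𝔫`. -/
theorem degG_zero_gauge {N Q : 𝔤 ⊗[ℂ] S.A} (hQ : Q ∈ S.tens S.V S.P) (hN : S.const N ∈ S.gaugeSpace)
    (h : S.E (S.const N) (S.lax S.Qu) = S.lax Q) : S.degG 0 (S.const N) = 0 := by
  obtain ⟨hT1, hp, hn⟩ := mem_gaugeSpace.1 hN
  have h1 := S.degG_shift 0 _ _ hT1
  rw [add_zero] at h1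
  have h3 := congrArg S.augOp h
  rw [augOp_E hT1] at h3
  have hlax : ∀ Q, S.augOp (S.lax Q) = (1, 0, S.degG 0 (S.const Q) + S.fG) := fun Q => by
    rw [augOp_apply, lax, map_add, map_add, degG_zero_fG]
  rw [hlax, hlax, degG_zero_Qu, zero_add] at h3
  have hQV := degG_zero_constIn (mem_constIn.2 ⟨Q, hQ, rfl⟩)
  have hD := S.DG_degG_zero (S.const N)
  obtain ⟨T₀, hT₀⟩ : ∃ T₀, T₀ = S.degG 0 (S.const N) := ⟨_, rfl⟩
  have hg : T₀ ∈ S.gaugeSpace := mem_gaugeSpace.2 ⟨by rw [hT₀]; exact h1,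
    by rw [hT₀, ← degG_parG, hp], by rw [hT₀]; exact degG_zero_constIn hn⟩
  rw [← hT₀] at h1 h3 hD ⊢
  have hi := S.i_pos
  refine eq_zero_of_mem_succ h1 fun n hn' => ?_
  have hx : ((1, 0, S.fG) : S.Op) ∈ S.filOp.F (-S.i) := mem_filOp.2 ⟨S.fG_mem, fun h => by omega⟩
  have h4 := (mem_filOp.1 (E_add_sub_mem (T := 0) (Submodule.zero_mem _) hn' hx)).1
  rw [zero_add, E_zero, h3, opB_op, (mem_gaugeSpace.1 hg).2.1] at h4
  simp only [Prod.snd_sub, op, hD, smul_zero, map_zero, sub_zero, add_sub_cancel_right,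
    brG_gauge_fG hg, sub_neg_eq_add] at h4
  have hT₀n := (mem_gaugeSpace.1 hg).2.2
  have h5 := sliceG_mem (Submodule.add_mem _
    (constIn_mono (fun v hv => mem_b_iff.2 (Submodule.mem_sup_left hv)) hQV) (adf_mem hT₀n)) h4
  rw [map_add, sliceG_V hQV, sliceG_adf hT₀n, zero_add] at h5
  exact S.Fil_anti (by omega) h5

/-! ### Diagonalization of the universal Lax operator -/

/-- A gauge transformation without constant term that takes `½ [ℒ_s, ℒ_s]` to `D² + H + Λ²` with
`H ∈ 𝒦 ⊗ 𝒫`. -/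
structure IsDiag (E : S.Gauge) (H : S.G) : Prop where
  aug : ∀ x, S.augOp (E.toFun x) = S.augOp x
  sq : E.toFun (0, 1, sqRem S.Qu + S.tensOne S.LamSq) = (0, 1, H + S.tensOne S.LamSq)
  ker : S.adSq H = 0

theorem const_mem_coefP {U : Submodule ℂ 𝔤} {Q : 𝔤 ⊗[ℂ] S.A} (hQ : Q ∈ S.tens U S.P) :
    S.const Q ∈ S.coefP := S.const_coefIn (tens_mono le_top le_rfl hQ)

theorem Qc_odd : S.parTens S.Qc = -S.Qc := S.Qc_isCanonical.2.1

theorem augOp_exp {T : S.G} (hT : T ∈ S.Fil 1) (h0 : S.degG 0 T = 0) (x : S.Op) :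
    S.augOp (S.E T x) = S.augOp x := by rw [augOp_E hT, h0, E_zero]

/-- The diagonalization `e^{ad T}` for `T = T_{𝒬_u}`. -/
theorem exists_isDiag_dressing {B : S.G →ₗ[ℂ] S.G} (hB : S.IsPinv B) (hS : S.SemisimpleLamSq) :
    ∃ E H, S.dressing S.Qu ∈ S.Fil 1 ∧ IsDiag E H ∧
      E.inv = S.E (-S.dressing S.Qu) := by
  obtain ⟨H, hT⟩ := dressing_spec hS S.Qu_odd S.Qu_mem_Fil
  refine ⟨Gauge.exp _ hT.mem_Fil hT.T_even (hT.mem_coefP (PQ_le_P S.Qu_mem)), H, hT.mem_Fil,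
    ⟨augOp_exp hT.mem_Fil (hT.degG_zero hB S.Qu_odd S.degG_zero_Qu), ?_, hT.H_ker⟩, rfl⟩
  have h := eq_E_of_isExpAd hT.mem_Fil hT.eq
  rw [laxS_sq S.Qu_odd] at h
  exact h.symm

theorem laxS_eq (Q : 𝔤 ⊗[ℂ] S.A) : S.laxS Q = S.lax Q + S.op (S.s ⊗ₜ Laurent.mono 1 1) := by
  have h : ∀ k, Laurent.map (Algebra.linearMap ℂ S.A) (Laurent.mono k (1 : ℂ)) = Laurent.mono k 1 :=
    fun k => Laurent.ext_coeff fun l => by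
      rw [Laurent.coeff_map, Laurent.coeff_mono, Laurent.coeff_mono]; split_ifs <;> simp
  refine Prod.ext (by simp [laxS, lax, op]) (Prod.ext (by simp [laxS, lax, op]) ?_)
  simp only [laxS, lax, op, Prod.snd_add, map_add, Lam, tensOne, LinearMap.lTensor_tmul, h, const]
  abel

/-- Because `[s, 𝔫] = 0`, gauge transformations by `𝔫` act on `ℒ_s` as they do on `ℒ`. -/
theorem E_gauge_laxS {N Q : 𝔤 ⊗[ℂ] S.A} (hN : S.const N ∈ S.gaugeSpace)
    (h : S.E (S.const N) (S.lax S.Qu) = S.lax Q) : S.E (S.const N) (S.laxS S.Qu) = S.laxS Q := by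
  obtain ⟨h1, hp, hn⟩ := mem_gaugeSpace.1 hN
  have h2 : S.brG (S.const N) (S.s ⊗ₜ Laurent.mono 1 1) = 0 := by
    rw [skewG (e := 0) (by rw [hp, sgn_zero, one_smul]), pw_zero, LinearMap.id_apply,
      brG_tmul_of_even S.s (map_tau_mono_one 1), neg_eq_zero]
    refine constIn_induction (C := fun X => TensorProduct.map (S.br S.s)
      (LinearMap.mulLeft ℂ (Laurent.mono 1 (1 : S.A))) X = 0) (by simp)
      (fun X Y h1 h2 => by rw [map_add, h1, h2, add_zero]) (fun a ha u hu => ?_) hn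
    rw [const, LinearMap.lTensor_tmul, TensorProduct.map_tmul, S.s_n a ha, TensorProduct.zero_tmul]
  rw [laxS_eq, laxS_eq, map_add, h, E]
  congr 1
  exact Filt.exp_of_apply_eq_zero (adT_shift h1) (by rw [opB_op_op, h2]; rfl)

/-- The diagonalization `e^{ad T} e^{ad N}`, where `e^{ad N}` takes `𝒬_u` to `𝒬^c` and
`T = T_{𝒬^c}`. -/
theorem exists_isDiag_canonical {B : S.G →ₗ[ℂ] S.G} (hB : S.IsPinv B) (hS : S.SemisimpleLamSq) :
    ∃ E H, S.dressing S.Qc ∈ S.Fil 1 ∧ IsDiag E H ∧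
      E.toFun S.L = S.E (S.dressing S.Qc) (S.laxS S.Qc) := by
  obtain ⟨H, hT⟩ := dressing_spec hS Qc_odd S.Qc_mem_Fil
  obtain ⟨hQ, -, N, hN, hNp, hNe⟩ := S.Qc_isCanonical
  have hNn : S.const N ∈ S.constIn S.n := mem_constIn.2 ⟨N, hN, rfl⟩
  have hN1 := constIn_n_mem_Fil hNn
  have hNp' : S.parG (S.const N) = S.const N := by rw [parG_const, hNp]
  have hNg : S.const N ∈ S.gaugeSpace := mem_gaugeSpace.2 ⟨hN1, hNp', hNn⟩
  have hNE := (eq_E_of_isExpAd hN1 hNe).symm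
  have hN0 := degG_zero_gauge hQ hNg hNE
  have hL := E_gauge_laxS hNg hNE
  have hQc0 : S.degG 0 (S.const S.Qc) = 0 := by
    have h1 := congrArg (fun x : S.Op => x.2.2) (congrArg S.augOp hNE)
    rw [augOp_exp hN1 hN0, augOp_apply, augOp_apply] at h1
    simpa [lax, degG_zero_Qu] using h1
  refine ⟨(Gauge.exp _ hT.mem_Fil hT.T_even (hT.mem_coefP (PQ_le_P hQ))).comp
    (Gauge.exp _ hN1 hNp' (const_mem_coefP hN)), H, hT.mem_Fil, ⟨fun x => ?_, ?_, hT.H_ker⟩, ?_⟩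
  · have h1 := augOp_exp hT.mem_Fil (hT.degG_zero hB Qc_odd hQc0) (S.E (S.const N) x)
    rw [augOp_exp hN1 hN0] at h1
    exact h1
  · have h := eq_E_of_isExpAd hT.mem_Fil hT.eq
    rw [h, ← laxS_sq S.Qu_odd]
    have h2 := (Gauge.exp _ hN1 hNp' (const_mem_coefP hN)).map_opB (S.laxS S.Qu) (S.laxS S.Qu)
    have h3 : (Gauge.exp _ hN1 hNp' (const_mem_coefP hN)).toFun (S.laxS S.Qu) = S.laxS S.Qc := hL
    rw [h3] at h2
    show S.E (S.dressing S.Qc) (S.E (S.const N) _) = _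
    congr 1
    rw [map_smul]
    congr 1
  · show S.E (S.dressing S.Qc) (S.E (S.const N) (S.laxS S.Qu)) = _
    rw [hL]

end DSData

namespace DSData

variable {𝔤 : Type*} [AddCommGroup 𝔤] [Module ℂ 𝔤] {ι : Type*} [Fintype ι] [DecidableEq ι]
  {S : DSData 𝔤 ι}

/-! ### Consequences of the diagonalization -/

/-- If `X` commutes with `D² + H + Λ²` up to `𝒦 ⊗ 𝒫`, then `X ∈ 𝒦 ⊗ 𝒫`: by the equation the
component of `X` in `ℐ ⊗ 𝒫` has arbitrarily high degree. -/
theorem adSq_eq_zero {B : S.G →ₗ[ℂ] S.G} (hB : S.IsPinv B) {H X W : S.G}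
    (hH : H ∈ S.Fil (-2 * S.i + 1)) (hHa : S.adSq H = 0) (hW : S.adSq W = 0)
    (h : S.adSq X = W - S.DG (S.DG X) - S.brG H X) : S.adSq X = 0 := by
  have hi := S.i_pos
  obtain ⟨X₁, hX₁⟩ : ∃ X₁, X₁ = S.adSq (B X) := ⟨_, rfl⟩
  have h0 : S.adSq (X - X₁) = 0 := by rw [hX₁]; exact hB.adSq_sub X
  have h1 : S.adSq X₁ = S.adSq X := by rw [map_sub] at h0; exact (sub_eq_zero.1 h0).symm
  have h2 : S.adSq (S.brG H (X - X₁)) = 0 := by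
    rw [adSq_brG, hHa, h0, map_zero, LinearMap.zero_apply, map_zero, add_zero]
  have h3 : S.adSq X₁ = -S.DG (S.DG X₁) - S.adSq (B (S.brG H X₁)) := by
    have h4 : S.brG H X = S.brG H (X - X₁) + S.brG H X₁ := by rw [← map_add, sub_add_cancel]
    have h5 := congrArg (fun Y => S.adSq (B Y)) h
    simp only [hB.adSq_pinv_adSq, map_sub] at h5
    rw [h1, h5, h4, map_add, map_add, hB.adSq_comm W, hW, hB.adSq_comm (S.brG H (X - X₁)), h2,
      ← hB.DG_comm, ← hB.DG_comm, ← adSq_DG, ← adSq_DG, ← hX₁, map_zero]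
    abel
  have h6 : B (S.adSq X₁) = X₁ := by
    rw [hX₁, hB.adSq_comm X, hB.adSq_pinv_adSq]
  have h7 : ∀ d, X₁ ∈ S.Fil d → X₁ ∈ S.Fil (d + 1) := fun d hd => by
    have g1 := S.DG_shift _ _ (S.DG_shift _ _ hd)
    have g2 := hB.adSq_shift _ _ (S.brG_shift _ _ _ hH _ hd)
    have g3 : S.adSq X₁ ∈ S.Fil (d + 1 - 2 * S.i) := by
      rw [h3]
      exact Submodule.sub_mem _ (Submodule.neg_mem _ (S.Fil_anti (by omega) g1))
        (S.Fil_anti (by omega) g2)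
    have g4 := hB.shift _ _ g3
    rw [h6, sub_add_cancel] at g4
    exact g4
  obtain ⟨d, hd⟩ := S.filG.exhaustive X₁
  have h8 : ∀ n : ℕ, X₁ ∈ S.Fil (d + n) := fun n => by
    induction n with
    | zero => rw [Nat.cast_zero, add_zero]; exact hd
    | succ n ih => push_cast; rw [← add_assoc]; exact h7 _ ih
  have h9 : X₁ = 0 := S.filG.separated _ fun d' => S.Fil_anti (by omega) (h8 (d' - d).toNat)
  rw [← h1, h9, map_zero]

namespace IsDiag

variable {E : S.Gauge} {H : S.G} (h : IsDiag E H)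

include h

theorem mem : H ∈ S.Fil (-2 * S.i + 1) := by
  have hi := S.i_pos
  have h1 := sqRem_mem S.Qu_mem_Fil
  have hx : ((0, 1, sqRem S.Qu + S.tensOne S.LamSq) : S.Op) ∈ S.filOp.F (-2 * S.i) :=
    mem_filOp.2 ⟨Submodule.add_mem _ (S.Fil_anti (by omega) h1) S.LamSq_mem_Fil,
      fun h => by omega⟩
  have h2 := (mem_filOp.1 (E.sub_mem _ _ hx)).1
  rw [h.sq] at h2
  simp only [Prod.snd_sub, add_sub_add_right_eq_sub] at h2
  have := Submodule.add_mem _ h2 h1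
  rwa [sub_add_cancel] at this

theorem even : S.parG (H + S.tensOne S.LamSq) = H + S.tensOne S.LamSq := by
  have h1 := E.map_par (0, 1, sqRem S.Qu + S.tensOne S.LamSq)
  have h2 : S.parOp (0, 1, sqRem S.Qu + S.tensOne S.LamSq) =
      (0, 1, sqRem S.Qu + S.tensOne S.LamSq) := by
    rw [parOp_apply, map_add, S.parG_LamSq, sgn_zero, one_smul, parG_sqRem S.Qu_odd, neg_zero]
  rw [h2, h.sq] at h1
  exact (congrArg (fun x : S.Op => x.2.2) h1).symm

theorem degG_zero : S.degG 0 H = 0 := by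
  have h1 := h.aug (0, 1, sqRem S.Qu + S.tensOne S.LamSq)
  rw [h.sq, augOp_apply, augOp_apply] at h1
  have h2 := congrArg (fun x : S.Op => x.2.2) h1
  simpa [degG_zero_sqRem S.degG_zero_Qu] using h2

theorem onG_aug (X : S.G) : S.degG 0 (E.onG X) = S.degG 0 X :=
  congrArg (fun x : S.Op => x.2.2) (h.aug (S.op X))

/-- The constants of `𝒵` correspond to each other under any two diagonalizations: `E E'⁻¹ C`
commutes with `D² + H + Λ²`, and this together with its constant term `C` determines it. -/
theorem onG_invG_center {B : S.G →ₗ[ℂ] S.G} (hB : S.IsPinv B) {E' : S.Gauge} {H' : S.G}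
    (h' : IsDiag E' H') {C : S.Loop} (hC : C ∈ S.center) :
    E.onG (E'.invG (S.tensOne C)) = S.tensOne C := by
  obtain ⟨Ω, hΩ⟩ : ∃ Ω : S.Op, Ω = (0, 1, sqRem S.Qu + S.tensOne S.LamSq) := ⟨_, rfl⟩
  have h1 : S.opB (S.op (E'.invG (S.tensOne C))) Ω = 0 := by
    have g1 : E'.toFun (S.opB (S.op (E'.invG (S.tensOne C))) Ω) = 0 := by
      rw [E'.map_opB, E'.toFun_op, E'.onG_invG, hΩ, h'.sq, opB_op]
      simp only [map_add, hB.brG_center hC h'.ker, hB.brG_center hC S.adSq_LamSq, DG_tensOne,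
        map_zero, zero_smul, smul_zero, sub_zero, add_zero]
      rfl
    rw [← E'.inv_toFun (S.opB _ _), g1, map_zero]
  have h2 := congrArg E.toFun h1
  rw [E.map_opB, E.toFun_op, hΩ, h.sq, map_zero, opB_op] at h2
  obtain ⟨Y, hY⟩ : ∃ Y, Y = E.onG (E'.invG (S.tensOne C)) := ⟨_, rfl⟩
  have hY0 : S.degG 0 Y = S.tensOne C := by
    rw [hY, h.onG_aug, ← h'.onG_aug, E'.onG_invG, degG_zero_tensOne]
  rw [← hY] at h2 ⊢
  have h3 : S.brG Y (H + S.tensOne S.LamSq) = S.DG (S.DG Y) := by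
    have := congrArg (fun x : S.Op => x.2.2) h2
    simp only [op, zero_smul, sub_zero, one_smul] at this
    exact sub_eq_zero.1 this
  have h4 : S.brG (H + S.tensOne S.LamSq) Y = -S.DG (S.DG Y) := by
    rw [skewG (e := 0) (by rw [h.even, sgn_zero, one_smul]), pw_zero, LinearMap.id_apply, h3]
  have h5 : S.adSq Y = 0 - S.DG (S.DG Y) - S.brG H Y := by
    rw [map_add, LinearMap.add_apply] at h4
    rw [zero_sub, ← h4, adSq]
    abel
  have h6 := adSq_eq_zero hB h.mem h.ker (map_zero _) h5
  obtain ⟨X, hX⟩ : ∃ X, X = Y - S.tensOne C := ⟨_, rfl⟩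
  have hHC : S.brG H (S.tensOne C) = 0 := by
    have hp : S.parG H = sgn 0 • H := by
      have := h.even
      rw [map_add, S.parG_LamSq, sgn_zero, one_smul] at this
      rw [sgn_zero, one_smul]; exact add_right_cancel this
    rw [skewG hp, pw_zero, LinearMap.id_apply, hB.brG_center hC h.ker, neg_zero]
  have h7 : S.DG (S.DG X) = -S.brG H X := by
    rw [h6, zero_sub] at h5
    rw [hX, map_sub, map_sub, map_sub, DG_tensOne, hHC, map_zero, sub_zero, sub_zero]
    rw [eq_sub_iff_add_eq, zero_add] at h5
    rw [h5, neg_neg]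
  -- `H` has no constant term, so `D² X = -[H, X]` determines each homogeneous component of `X` in
  -- the variables from the lower ones
  have h8 : ∀ r, S.degG r X = 0 := fun r => by
    induction r using Nat.strong_induction_on with
    | _ r ih =>
    by_cases hr : r = 0
    · rw [hr, hX, map_sub, hY0, degG_zero_tensOne, sub_self]
    · refine degG_eq_zero_of_DG hr ?_
      rw [← degG_DG]
      refine degG_eq_zero_of_DG hr ?_
      rw [← degG_DG, h7, map_neg, degG_brG, neg_eq_zero]
      refine Finset.sum_eq_zero fun x hx => ?_
      have hx := Finset.HasAntidiagonal.mem_antidiagonal.1 hx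
      by_cases h0 : x.1 = 0
      · rw [h0, h.degG_zero, map_zero, LinearMap.zero_apply]
      · rw [ih x.2 (by omega), map_zero]
  exact sub_eq_zero.1 (hX ▸ eq_zero_of_degG h8)

end IsDiag

/-- `[ℒ, ½ [ℒ, ℒ]] = 0` for an odd operator `ℒ = D + X`. -/
theorem opB_self_sq {X : S.G} (hX : S.parG X = -X) {y : S.Op} (hy : y = (1, 0, X)) :
    S.opB y ((2 : ℂ)⁻¹ • S.opB y y) = 0 := by
  have hX' : S.parG X = sgn 1 • X := by rw [hX, sgn_one, neg_one_smul]
  have h1 : S.brG X (S.brG X X) = 0 := by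
    have g1 := jacobiG hX' X X
    have hp : S.parG (S.brG X X) = sgn 0 • S.brG X X := by
      rw [parG_brG, hX, sgn_zero, one_smul]; simp
    rw [pw_one, hX, skewG hp, pw_zero, LinearMap.id_apply, map_neg, LinearMap.neg_apply] at g1
    have g2 : (3 : ℂ) • S.brG X (S.brG X X) = 0 := by
      have g3 : (3 : ℂ) • S.brG X (S.brG X X) = S.brG X (S.brG X X) -
        (-S.brG X (S.brG X X) + -S.brG X (S.brG X X)) := by module
      rw [g3, ← g1, sub_self]
    exact (smul_eq_zero.1 g2).resolve_left (by norm_num)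
  have h2 : S.brG (S.DG X) X = -S.brG X (S.DG X) := by
    have hp : S.parG (S.DG X) = sgn 0 • S.DG X := by
      rw [parG_DG, hX, map_neg, neg_neg, sgn_zero, one_smul]
    rw [skewG hp, pw_zero, LinearMap.id_apply]
  rw [opB_apply, opB_apply, hy]
  refine Prod.ext rfl (Prod.ext ?_ ?_)
  · simp [opBr]
  · simp only [opBr, Prod.smul_snd, Prod.smul_fst, one_smul, zero_smul, add_zero, sub_zero, map_add,
      map_sub, map_smul, hX, map_neg, h1, DG_brG, h2, LinearMap.neg_apply, smul_zero]
    simp only [smul_eq_mul, mul_one]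
    norm_num
    module

variable (S) in
theorem parG_L : S.parG S.L.2.2 = -S.L.2.2 := by
  rw [L, laxS, map_add, parG_const, Qu_odd, tensOne_Lam_odd, map_neg]
  simp only
  abel

variable (S) in
theorem L_eq : S.L = (1, 0, S.L.2.2) := rfl

namespace IsDiag

variable {E : S.Gauge} {H : S.G} (h : IsDiag E H)

include h

/-- The transformed Lax operator is `D + Y` with `Y ∈ 𝒦 ⊗ 𝒫`, because it commutes with its square
`D² + H + Λ²`. -/
theorem adSq_L {B : S.G →ₗ[ℂ] S.G} (hB : S.IsPinv B) : S.adSq (E.toFun S.L).2.2 = 0 := by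
  obtain ⟨Y, hY⟩ : ∃ Y, Y = (E.toFun S.L).2.2 := ⟨_, rfl⟩
  have hL : E.toFun S.L = (1, 0, Y) :=
    Prod.ext (E.fst _) (Prod.ext (E.snd_fst _) hY.symm)
  have h1 := congrArg E.toFun (opB_self_sq S.parG_L S.L_eq)
  rw [E.map_opB] at h1
  have h2 : (2 : ℂ)⁻¹ • S.opB S.L S.L = (0, 1, sqRem S.Qu + S.tensOne S.LamSq) := laxS_sq S.Qu_odd
  rw [h2, h.sq, map_zero, hL, opB_apply] at h1
  have h3 := congrArg (fun x : S.Op => x.2.2) h1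
  simp only [opBr, one_smul, zero_smul, add_zero, sub_zero, Prod.snd_zero] at h3
  have h4 : S.brG (H + S.tensOne S.LamSq) Y = -S.brG Y (H + S.tensOne S.LamSq) := by
    rw [skewG (e := 0) (by rw [h.even, sgn_zero, one_smul]), pw_zero, LinearMap.id_apply]
  rw [← hY]
  refine adSq_eq_zero hB h.mem h.ker (W := S.DG H) (by rw [← adSq_DG, h.ker, map_zero]) ?_
  rw [map_add, LinearMap.add_apply] at h4
  have h5 : S.adSq Y = -S.brG Y (H + S.tensOne S.LamSq) - S.brG H Y := by
    rw [← h4, adSq]; abel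
  rw [map_add S.DG, DG_tensOne, add_zero] at h3
  rw [h5, eq_sub_of_add_eq (sub_eq_zero.1 h3)]
  abel

theorem odd_L : S.parG (E.toFun S.L).2.2 = -(E.toFun S.L).2.2 := by
  have h1 := E.map_par S.L
  have h2 : S.parOp S.L = -S.L :=
    Prod.ext rfl (Prod.ext (by simp [parOp_apply, L, laxS]) S.parG_L)
  rw [h2, map_neg] at h1
  exact (congrArg (fun x : S.Op => x.2.2) h1).symm

end IsDiag

end DSData

namespace DSData

variable {𝔤 : Type*} [AddCommGroup 𝔤] [Module ℂ 𝔤] {ι : Type*} [Fintype ι] [DecidableEq ι]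
  (S : DSData 𝔤 ι)

/-! ### Variational derivatives -/

/-- The sign `(-1)^{m p(q̄_k) + m(m+1)/2}`. -/
def varSgn (k : ι) (m : ℕ) : ℂ :=
  sgn ((m : ZMod 2) * S.varPar (k, 0) + ((m * (m + 1) / 2 : ℕ) : ZMod 2))

/-- The variational derivative `∑_m ± D^m (∂a / ∂q̄_k^{(m)})`. -/
def varD (k : ι) : S.A →ₗ[ℂ] S.A :=
  (Finsupp.lsum ℂ fun x : ι × ℕ => if x.1 = k then S.varSgn k x.2 • S.D ^ x.2 else 0) ∘ₗ
    SuperPoly.grad S.varPar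

theorem varPar_eq (k : ι) (m : ℕ) : S.varPar (k, m) = S.varPar (k, 0) + m := by
  simp [varPar]

theorem varSgn_zero (k : ι) : S.varSgn k 0 = 1 := by simp [varSgn, sgn_zero]

theorem varSgn_succ (k : ι) (m : ℕ) :
    S.varSgn k (m + 1) = -(S.varSgn k m * sgn (S.varPar (k, m))) := by
  have h1 : (m + 1) * (m + 1 + 1) / 2 = m * (m + 1) / 2 + (m + 1) := by
    rw [show (m + 1) * (m + 1 + 1) = m * (m + 1) + (m + 1) * 2 by ring,
      Nat.add_mul_div_right _ _ two_pos]
  rw [varSgn, varSgn, h1, S.varPar_eq k m, ← sgn_add]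
  have h2 : ∀ x, -sgn x = sgn (x + 1) := fun x => by rw [sgn_add, sgn_one, mul_neg_one]
  rw [h2]
  push_cast
  congr 1
  ring

variable {S} in
theorem varD_eq_sum {k : ι} {M : ℕ} {a : S.A} (h : ∀ m, M ≤ m → S.pd (k, m) a = 0) :
    S.varD k a = ∑ m ∈ Finset.range M, S.varSgn k m • (S.D ^ m) (S.pd (k, m) a) := by
  have h1 : S.varD k a = ∑ x ∈ (SuperPoly.grad S.varPar a).support,
      if x.1 = k then S.varSgn k x.2 • (S.D ^ x.2) (S.pd x a) else 0 := by
    rw [varD, LinearMap.comp_apply, Finsupp.lsum_apply, Finsupp.sum]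
    refine Finset.sum_congr rfl fun x _ => ?_
    split_ifs
    · rfl
    · rfl
  obtain ⟨F, hF⟩ : ∃ F : ι × ℕ → S.A,
      F = fun x => if x.1 = k then S.varSgn k x.2 • (S.D ^ x.2) (S.pd x a) else 0 := ⟨_, rfl⟩
  have h2 : ∀ x, S.pd x a = 0 → F x = 0 := fun x hx => by
    simp only [hF, hx, map_zero, smul_zero, ite_self]
  have h3 : ∀ m, F (k, m) = S.varSgn k m • (S.D ^ m) (S.pd (k, m) a) := fun m => by
    rw [hF]; exact if_pos rfl
  have h4 : S.varD k a = ∑ x ∈ (SuperPoly.grad S.varPar a).support, F x := by rw [h1, hF]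
  have h5 : ∀ x ∉ (Finset.range M).image fun m => (k, m), F x = 0 := fun ⟨k', m⟩ hx => by
    by_cases hk : k' = k
    · subst hk
      refine h2 _ (h m ?_)
      by_contra hm
      exact hx (Finset.mem_image.2 ⟨m, Finset.mem_range.2 (by omega), rfl⟩)
    · rw [hF]; exact if_neg hk
  simp only [← h3]
  rw [h4, ← Finset.sum_image (f := F) (g := fun m => (k, m))
    (fun m _ m' _ h => (Prod.ext_iff.1 h).2)]
  rw [Finset.sum_subset (Finset.subset_union_left (s₂ := (Finset.range M).image fun m => (k, m)))
    (fun x _ hx => h2 x (Finsupp.notMem_support_iff.1 hx)),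
    Finset.sum_subset (Finset.subset_union_right (s₁ := (SuperPoly.grad S.varPar a).support))
    (fun x _ hx => h5 x hx)]

/-- The telescoping sum behind `δ ∘ D = 0`. -/
theorem sum_varSgn_telescope (k : ι) (z : ℕ → S.A) (M : ℕ) (hM : z M = 0) :
    ∑ m ∈ Finset.range (M + 1), S.varSgn k m • (S.D ^ m) (sgn (S.varPar (k, m)) • S.D (z m) +
      if m = 0 then 0 else z (m - 1)) = 0 := by
  have h : ∀ n, ∑ m ∈ Finset.range (n + 1), S.varSgn k m • (S.D ^ m)
      (sgn (S.varPar (k, m)) • S.D (z m) + if m = 0 then 0 else z (m - 1)) =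
      (S.varSgn k n * sgn (S.varPar (k, n))) • (S.D ^ (n + 1)) (z n) := fun n => by
    induction n with
    | zero => simp [smul_smul]
    | succ n ih =>
      rw [Finset.sum_range_succ, ih, if_neg n.succ_ne_zero, Nat.add_sub_cancel, map_add, map_smul,
        S.varSgn_succ k n, pow_succ S.D (n + 1), Module.End.mul_apply]
      module
  rw [h, hM, map_zero, smul_zero]

theorem exists_pd_eq_zero (k : ι) (a : S.A) : ∃ M, ∀ m, M ≤ m → S.pd (k, m) a = 0 := by
  obtain ⟨M, hM⟩ := ((SuperPoly.pderiv_finite S.varPar a).image Prod.snd).bddAbove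
  refine ⟨M + 1, fun m hm => ?_⟩
  by_contra h'
  have : m ≤ M := hM ⟨(k, m), h', rfl⟩
  omega

/-- The variational derivatives vanish on total derivatives. -/
theorem varD_D (k : ι) (a : S.A) : S.varD k (S.D a) = 0 := by
  obtain ⟨M, hM⟩ := S.exists_pd_eq_zero k a
  rw [varD_eq_sum (M := M + 1) fun m hm => ?_]
  · rw [← S.sum_varSgn_telescope k (fun m => S.pd (k, m) a) M (hM M le_rfl)]
    refine Finset.sum_congr rfl fun m _ => ?_
    rw [pd_D, pdPred]
    split_ifs <;> rfl
  · rw [pd_D, pdPred, hM m (by omega), map_zero, smul_zero, zero_add]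
    split_ifs
    · rfl
    · exact hM _ (by simp only; omega)

/-! ### Super Hamiltonian vector fields -/

theorem chiD_apply_zero (Y : S.Chi) : S.chiD Y 0 = S.D (Y 0) := by
  induction Y using Finsupp.induction_linear with
  | zero => simp
  | add f g hf hg => rw [map_add, Finsupp.add_apply, hf, hg, Finsupp.add_apply, map_add]
  | single n a =>
    rw [chiD, Finsupp.lsum_single]
    cases n with
    | zero => simp [sgn_zero]
    | succ n =>
      simp only [LinearMap.add_apply, LinearMap.sub_apply, LinearMap.smul_apply,
        LinearMap.comp_apply, Finsupp.lsingle_apply, Finsupp.add_apply, Finsupp.sub_apply,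
        Finsupp.smul_apply, Finsupp.single_apply]
      simp

theorem chiD_pow_apply_zero (n : ℕ) (Y : S.Chi) : (S.chiD ^ n) Y 0 = (S.D ^ n) (Y 0) := by
  induction n with
  | zero => rfl
  | succ n ih =>
    rw [pow_succ', Module.End.mul_apply, chiD_apply_zero, ih, pow_succ', Module.End.mul_apply]

theorem brLeft_apply_zero (l : ι) (a : S.A) : S.brLeft l a 0 =
    ∑ k, (sgn (S.varPar (l, 0) * S.varPar (k, 0)) * S.brVars k l) •
      S.varD k (S.pp (S.varPar (l, 0)) a) := by
  have hs : ∀ x : ι × ℕ, sgn (S.varPar (l, 0) * (S.varPar (x.1, 0) + x.2) +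
      x.2 * (S.varPar (x.1, 0) + S.varPar (l, 0) + 1) + ((x.2 * (x.2 - 1) / 2 : ℕ) : ZMod 2)) =
      sgn (S.varPar (l, 0) * S.varPar (x.1, 0)) * S.varSgn x.1 x.2 := fun ⟨k, m⟩ => by
    have h1 : m * (m + 1) / 2 = m * (m - 1) / 2 + m := by
      cases m with
      | zero => rfl
      | succ m =>
        rw [Nat.add_sub_cancel, show (m + 1) * (m + 1 + 1) = (m + 1) * m + (m + 1) * 2 by ring,
          Nat.add_mul_div_right _ _ two_pos]
    rw [varSgn, ← sgn_add, h1]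
    push_cast
    congr 1
    linear_combination (S.varPar (l, 0) * m) * LieSuperalgebra.two_parity
  obtain ⟨b, hb⟩ : ∃ b, b = S.pp (S.varPar (l, 0)) a := ⟨_, rfl⟩
  have h1 : S.brLeft l a 0 = (SuperPoly.grad S.varPar b).sum fun x u =>
      (sgn (S.varPar (l, 0) * S.varPar (x.1, 0)) * S.varSgn x.1 x.2 * S.brVars x.1 l) •
        (S.D ^ x.2) u := by
    rw [brLeft, LinearMap.comp_apply, LinearMap.comp_apply, Finsupp.lsum_apply, Finsupp.sum,
      Finsupp.sum, Finsupp.finsetSum_apply, hb]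
    refine Finset.sum_congr rfl fun x _ => ?_
    rw [LinearMap.smul_apply, LinearMap.comp_apply, Finsupp.smul_apply, chiD_pow_apply_zero, hs]
    simp
  have h2 : ∀ k, S.varD k b = (SuperPoly.grad S.varPar b).sum fun x u =>
      if x.1 = k then S.varSgn k x.2 • (S.D ^ x.2) u else 0 := fun k => by
    rw [varD, LinearMap.comp_apply, Finsupp.lsum_apply, Finsupp.sum, Finsupp.sum]
    refine Finset.sum_congr rfl fun x _ => ?_
    split_ifs <;> rfl
  rw [h1, ← hb]
  simp only [h2, Finsupp.sum, Finset.smul_sum]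
  rw [Finset.sum_comm]
  refine Finset.sum_congr rfl fun x _ => ?_
  simp only [smul_ite, smul_zero, smul_smul, Finset.sum_ite_eq, Finset.mem_univ, if_true]
  congr 1
  ring

/-- The value of a Hamiltonian vector field on `q̄_l`. -/
def hamVal (l : ι) : S.A →ₗ[ℂ] S.A := Finsupp.lapply 0 ∘ₗ S.brLeft l

theorem hamVal_apply (l : ι) (a : S.A) : S.hamVal l a =
    ∑ k, (sgn (S.varPar (l, 0) * S.varPar (k, 0)) * S.brVars k l) •
      S.varD k (S.pp (S.varPar (l, 0)) a) := S.brLeft_apply_zero l a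

theorem ham_apply (h a : S.A) : S.ham h a = (SuperPoly.grad S.varPar a).sum fun x u =>
    (sgn (x.2 : ZMod 2) • (S.D ^ x.2) (S.hamVal x.1 (S.pp x.2 h))) * u := by
  rw [ham, chiBr, LinearMap.comp_apply, LinearMap.comp_apply, Finsupp.lsum_apply,
    Finsupp.lapply_apply, Finsupp.sum, Finsupp.finsetSum_apply, Finsupp.sum]
  refine Finset.sum_congr rfl fun x _ => ?_
  show (S.brLeftDer x h) 0 * _ = _
  rw [brLeftDer, Finsupp.smul_apply, chiD_pow_apply_zero]
  rfl

theorem ham_add (h g : S.A) : S.ham (h + g) = S.ham h + S.ham g := by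
  refine LinearMap.ext fun a => ?_
  rw [LinearMap.add_apply, ham_apply, ham_apply, ham_apply, Finsupp.sum, Finsupp.sum, Finsupp.sum,
    ← Finset.sum_add_distrib]
  refine Finset.sum_congr rfl fun x _ => ?_
  rw [map_add, map_add, map_add, smul_add, add_mul]

theorem ham_smul (r : ℂ) (h : S.A) : S.ham (r • h) = r • S.ham h := by
  refine LinearMap.ext fun a => ?_
  rw [LinearMap.smul_apply, ham_apply, ham_apply, Finsupp.sum, Finsupp.sum, Finset.smul_sum]
  refine Finset.sum_congr rfl fun x _ => ?_
  rw [map_smul, map_smul, map_smul, smul_comm, smul_mul_assoc]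

theorem pp_D (e : ZMod 2) (a : S.A) : S.pp e (S.D a) = sgn e • S.D (S.pp e a) := by
  rcases parity_cases e with rfl | rfl
  · simp [sgn_zero, SuperPoly.parPow_zero]
  · have := S.D_isSDer.1 a
    rwa [← S.pp_one] at this

theorem hamVal_D (l : ι) (a : S.A) : S.hamVal l (S.D a) = 0 := by
  rw [hamVal_apply]
  exact Finset.sum_eq_zero fun k _ => by rw [pp_D, map_smul, varD_D, smul_zero, smul_zero]

theorem ham_D (a : S.A) : S.ham (S.D a) = 0 := by
  refine LinearMap.ext fun b => ?_
  rw [ham_apply, LinearMap.zero_apply]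
  exact Finset.sum_eq_zero fun x _ => by
    simp only []
    rw [pp_D, map_smul, hamVal_D, smul_zero, map_zero, smul_zero, zero_mul]

variable {S} in
theorem ham_eq_of_functional_eq {h g : S.A} (hg : S.functional h = S.functional g) :
    S.ham h = S.ham g := by
  obtain ⟨a, ha⟩ := (Submodule.Quotient.eq _).1 hg
  have h1 : h = g + S.D a := by rw [ha]; abel
  rw [h1, ham_add, ham_D, add_zero]

variable {S} in
theorem tau_D_pow {e : ZMod 2} {a : S.A} (ha : S.tau a = sgn e • a) (n : ℕ) :
    S.tau ((S.D ^ n) a) = sgn (e + n) • (S.D ^ n) a := by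
  induction n with
  | zero => simpa using ha
  | succ n ih =>
    rw [pow_succ', Module.End.mul_apply]
    have h1 : S.tau (S.D ((S.D ^ n) a)) = sgn 1 • S.D (S.tau ((S.D ^ n) a)) := S.pp_D 1 _
    rw [h1, ih, map_smul, smul_smul, ← sgn_add]
    congr 2
    push_cast; ring

variable {S} in
theorem brVars_eq_zero {k l : ι} (h : S.varPar (k, 0) ≠ S.varPar (l, 0) + 1) :
    S.brVars k l = 0 := by
  have h1 := S.form_even S.s (S.br (S.q k) (S.q l))
  rw [S.par_br, S.q_par, S.q_par, S.s_odd] at h1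
  simp only [map_smul, map_neg, LinearMap.smul_apply, LinearMap.neg_apply, smul_smul,
    ← sgn_add] at h1
  have h2 : S.p k + S.p l = 0 := by
    have : ∀ a b : ZMod 2, a + 1 + 0 ≠ b + 1 + 0 + 1 → a + b = 0 := by decide
    exact this _ _ h
  rw [add_comm (S.p l), h2, sgn_zero, one_smul] at h1
  have h3 : S.form S.s (S.br (S.q k) (S.q l)) = 0 := by
    linear_combination (-1 / 2 : ℂ) * h1
  rw [brVars, h3, mul_zero]

variable {S} in
theorem tau_hamVal {e : ZMod 2} {h : S.A} (hh : S.tau h = sgn e • h) (l : ι) :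
    S.tau (S.hamVal l h) = sgn (e + 1 + S.varPar (l, 0)) • S.hamVal l h := by
  have hh' : SuperPoly.σ S.varPar h = sgn e • h := by rw [← S.pp_one]; exact hh
  have h1 : ∀ k, S.tau (S.varD k h) = sgn (e + S.varPar (k, 0)) • S.varD k h := fun k => by
    obtain ⟨M, hM⟩ := S.exists_pd_eq_zero k h
    rw [varD_eq_sum hM, map_sum, Finset.smul_sum]
    refine Finset.sum_congr rfl fun m _ => ?_
    have h2 : S.tau (S.pd (k, m) h) = sgn (e + S.varPar (k, m)) • S.pd (k, m) h := by
      rw [tau_eq]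
      have := (S.pd_isSDer (k, m)).1 h
      rw [hh', map_smul, smul_smul, ← sgn_add] at this
      rw [AlgHom.toLinearMap_apply, add_comm e, this]
    rw [map_smul, tau_D_pow h2, smul_comm]
    congr 2
    rw [S.varPar_eq k m]
    linear_combination (m : ZMod 2) * LieSuperalgebra.two_parity
  rw [hamVal_apply, map_sum, Finset.smul_sum]
  refine Finset.sum_congr rfl fun k _ => ?_
  by_cases hk : S.varPar (k, 0) = S.varPar (l, 0) + 1
  · rw [SuperPoly.parPow_of_hom _ _ e _ hh', map_smul, map_smul, map_smul, h1, hk,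
      show e + (S.varPar (l, 0) + 1) = e + 1 + S.varPar (l, 0) by ring]
    module
  · rw [brVars_eq_zero hk]; simp

variable {S} in
/-- The Hamiltonian vector field of `h` as a derivation of parity `p(h) + 1`. -/
theorem ham_isSDer {e : ZMod 2} {h : S.A} (hh : S.tau h = sgn e • h) :
    SuperPoly.IsSDer S.varPar (e + 1) (S.ham h) := by
  have hv : ∀ x : ι × ℕ, SuperPoly.σ S.varPar (sgn (x.2 : ZMod 2) • (S.D ^ x.2)
      (S.hamVal x.1 (S.pp x.2 h))) = sgn (e + 1 + S.varPar x) • (sgn (x.2 : ZMod 2) • (S.D ^ x.2)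
      (S.hamVal x.1 (S.pp x.2 h))) := fun ⟨l, n⟩ => by
    have hh' : SuperPoly.σ S.varPar h = sgn e • h := by rw [← S.pp_one]; exact hh
    have h1 := tau_D_pow (tau_hamVal hh l) n
    rw [tau_eq] at h1
    rw [SuperPoly.parPow_of_hom _ _ e _ hh', map_smul, map_smul, map_smul, map_smul]
    have h2 : (SuperPoly.σ S.varPar) ((S.D ^ n) (S.hamVal l h)) = _ := h1
    rw [h2, S.varPar_eq l n, ← add_assoc]
    module
  have h1 : S.ham h = SuperPoly.der S.varPar (e + 1) _ hv := LinearMap.ext fun a => by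
    rw [SuperPoly.der_isSDer.eq_sum_grad, ham_apply, Finsupp.sum]
    refine Finset.sum_congr rfl fun x _ => ?_
    simp only []
    rw [SuperPoly.der_gen]
  rw [h1]
  exact SuperPoly.der_isSDer

variable {S} in
theorem ham_qbar (h : S.A) (l : ι) (n : ℕ) : S.ham h (S.qbar l n) =
    sgn (n : ZMod 2) • (S.D ^ n) (S.hamVal l (S.pp n h)) := by
  rw [ham_apply]
  have h1 : SuperPoly.grad S.varPar (S.qbar l n) = Finsupp.single (l, n) 1 := by
    refine Finsupp.ext fun y => ?_
    rw [Finsupp.single_apply]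
    exact S.pd_qbar y l n
  rw [h1, Finsupp.sum_single_index (by rw [mul_zero]), mul_one]

variable {S} in
theorem ham_D_comm {e : ZMod 2} {h : S.A} (hh : S.tau h = sgn e • h) (a : S.A) :
    S.ham h (S.D a) = sgn (e + 1) • S.D (S.ham h a) := by
  have hh' : SuperPoly.σ S.varPar h = sgn e • h := by rw [← S.pp_one]; exact hh
  have h1 := ((ham_isSDer hh).comm S.D_isSDer).ext (d' := 0)
    ⟨fun a => by simp, fun a b => by simp⟩ (fun ⟨l, n⟩ => ?_) a
  · rw [mul_one] at h1
    exact sub_eq_zero.1 h1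
  · show S.ham h (S.D (S.qbar l n)) - sgn ((e + 1) * 1) • S.D (S.ham h (S.qbar l n)) = 0
    rw [D_qbar, ham_qbar, ham_qbar, SuperPoly.parPow_of_hom _ _ e _ hh',
      SuperPoly.parPow_of_hom _ _ e _ hh', pow_succ', Module.End.mul_apply]
    simp only [map_smul, smul_smul, ← sgn_add]
    rw [sub_eq_zero]
    congr 2
    push_cast; ring

end DSData

namespace DSData

variable {𝔤 : Type*} [AddCommGroup 𝔤] [Module ℂ 𝔤] {ι : Type*} [Fintype ι] [DecidableEq ι]
  {S : DSData 𝔤 ι}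

/-! ### Coordinates -/

theorem tau_one : S.tau 1 = 1 := map_one (S.pp 1)

theorem formA_tmul_one (a : 𝔤) (X : 𝔤 ⊗[ℂ] S.A) : S.formA (a ⊗ₜ 1) X = coord (S.form a) X := by
  induction X using TensorProduct.induction_on with
  | zero => simp
  | add x y h1 h2 => rw [map_add, map_add, h1, h2]
  | tmul b u =>
    have hb : S.proj 0 b + S.proj 1 b = b := prj_add_prj S.par b
    simp only [formA, LieSuperalgebra.formT, LinearMap.compr₂_apply, LinearMap.add_apply,
      TensorProduct.map₂_apply_tmul, LinearMap.comp_apply, tau_one, coord_tmul]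
    rw [TensorProduct.map_tmul, TensorProduct.map_tmul, ← TensorProduct.add_tmul,
      LinearMap.compl₂_apply, LinearMap.compl₂_apply, ← map_add, hb]
    simp

variable (S) in
theorem form_qd_eq (k : ι) : S.form (S.qd k) = S.q.coord k :=
  S.q.ext fun t => by
    rw [form_qd, Module.Basis.coord_apply, Module.Basis.repr_self, Finsupp.single_apply]

variable (S) in
theorem qd_coord (t : ι) : S.qd.coord t = S.form.flip (S.q t) :=
  S.qd.ext fun k => by
    show _ = S.form (S.qd k) (S.q t)
    rw [form_qd, Module.Basis.coord_apply, Module.Basis.repr_self, Finsupp.single_apply]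
    simp only [eq_comm]

theorem zcoeff_brG_const (X : S.G) (Q : 𝔤 ⊗[ℂ] S.A) (l : ℤ) :
    S.zcoeff l (S.brG X (S.const Q)) = S.brA (S.zcoeff l X) Q := by
  obtain ⟨K, hK⟩ := S.zcoeff_brG l X (S.const Q)
  rw [hK (K + l.natAbs) (Nat.le_add_right _ _), Finset.sum_eq_single_of_mem l]
  · rw [zcoeff_const, if_pos (sub_self l)]
  · exact Finset.mem_Icc.2 ⟨by omega, by omega⟩
  · intro k _ hk
    rw [zcoeff_const, if_neg (by omega), map_zero]

theorem L_snd : S.L.2.2 = S.const (S.Qu + S.f ⊗ₜ 1) + S.zG 1 (S.const (S.s ⊗ₜ 1)) := by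
  have h := congrArg (fun x : S.Op => x.2.2) (laxS_eq (S := S) S.Qu)
  have h2 : S.zG 1 (S.const (S.s ⊗ₜ 1)) = S.s ⊗ₜ Laurent.mono 1 1 := by
    show S.s ⊗ₜ[ℂ] (Laurent.mono 1 (1 : S.A) * Laurent.mono 0 (1 : S.A)) = _
    rw [Laurent.mono_one_mul_mono_one]; rfl
  rw [h2]
  exact h

theorem zcoeff_brG_L (X : S.G) (l : ℤ) : S.zcoeff l (S.brG X S.L.2.2) =
    S.brA (S.zcoeff l X) (S.Qu + S.f ⊗ₜ 1) + S.brA (S.zcoeff (l - 1) X) (S.s ⊗ₜ 1) := by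
  rw [L_snd, map_add, map_add, zcoeff_brG_const, brG_zG, zcoeff_zG, zcoeff_brG_const]

/-- If `X` commutes with `ℒ_s` then `[X^+, ℒ_s]` has no dependence on `z`. -/
theorem opB_posPart_L {X : S.G} (h : S.opB (S.op X) S.L = 0) : S.opB (S.op (S.posPart X)) S.L =
    S.op (S.const (-S.brA (S.zcoeff (-1) X) (S.s ⊗ₜ 1))) := by
  have key : ∀ X, S.opB (S.op X) S.L = S.op (S.brG X S.L.2.2 - S.DG (S.parG X)) := fun X => by
    rw [opB_op, L_eq]; simp
  have hz : ∀ (X : S.G) (l : ℤ), S.zcoeff l (S.brG X S.L.2.2 - S.DG (S.parG X)) =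
      S.brA (S.zcoeff l X) (S.Qu + S.f ⊗ₜ 1) + S.brA (S.zcoeff (l - 1) X) (S.s ⊗ₜ 1) -
        TensorProduct.map S.par S.D (TensorProduct.map S.par S.tau (S.zcoeff l X)) := fun X l => by
    rw [map_sub, zcoeff_brG_L, DG, parG, zcoeff_map, zcoeff_map]
  have h0 : S.brG X S.L.2.2 - S.DG (S.parG X) = 0 := by
    rw [key] at h
    exact congrArg (fun x : S.Op => x.2.2) h
  rw [key]
  congr 1
  refine S.ext_zcoeff fun l => ?_
  have h1 := hz X l
  rw [h0, map_zero] at h1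
  rw [hz, zcoeff_const]
  simp only [zcoeff_posPart]
  rcases lt_trichotomy l 0 with hl | hl | hl
  · rw [if_neg (by omega), if_neg (by omega), if_neg (by omega)]; simp
  · subst hl
    rw [if_pos le_rfl, if_neg (by omega), if_pos rfl, eq_neg_iff_add_eq_zero]
    refine Eq.trans ?_ h1.symm
    simp only [zero_sub, map_zero, LinearMap.zero_apply, add_zero]
    abel
  · rw [if_pos (by omega), if_pos (by omega), if_neg (by omega), ← h1]

theorem brA_s_mem {X : 𝔤 ⊗[ℂ] S.A} (hX : X ∈ S.tens ⊤ S.P) :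
    S.brA X (S.s ⊗ₜ 1) ∈ S.tens S.b S.P := by
  refine brA_mem_tens (U := ⊤) (U' := ℂ ∙ S.s) (U'' := S.b) (fun _ => S.tau_mem_P) (fun a ha => ?_)
    (fun a _ b hb c hc => ?_) hX
    (tmul_mem_tens (Submodule.mem_span_singleton_self _) S.P.one_mem)
  · obtain ⟨r, rfl⟩ := Submodule.mem_span_singleton.1 ha
    rw [map_smul, S.s_odd]
    exact Submodule.smul_mem _ _ (Submodule.neg_mem _ (Submodule.mem_span_singleton_self _))
  · obtain ⟨r, rfl⟩ := Submodule.mem_span_singleton.1 hb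
    rw [map_smul, map_smul, LinearMap.smul_apply, S.form_invariant, S.s_n c (S.m_le_n hc)]
    simp

/-! ### The variation of the universal Lax operator -/

theorem extG_L {e : ZMod 2} {d : S.A →ₗ[ℂ] S.A} (hd : SuperPoly.IsSDer S.varPar e d) :
    S.extG e d S.L.2.2 = S.const (TensorProduct.map (S.parPow e) d S.Qu) := by
  rw [L, laxS, map_add, extG_tensOne hd, add_zero]
  have : ∀ Q : 𝔤 ⊗[ℂ] S.A, S.extG e d (S.const Q) =
      S.const (TensorProduct.map (S.parPow e) d Q) := fun Q => by
    induction Q using TensorProduct.induction_on with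
    | zero => simp
    | add x y h1 h2 => simp only [map_add, h1, h2]
    | tmul a u => exact map_const_tmul _ _ a u
  exact this _

open Classical in
theorem map_Qu (e : ZMod 2) (d : S.A →ₗ[ℂ] S.A) : TensorProduct.map (S.parPow e) d S.Qu =
    ∑ t, if t ∈ S.I then sgn (e * S.p t) • (S.qd t ⊗ₜ d (S.qbar t 0)) else 0 := by
  rw [Qu, map_sum]
  refine Finset.sum_congr rfl fun t _ => ?_
  split_ifs
  · have : S.parPow e (S.qd t) = sgn (e * S.p t) • S.qd t := by
      rw [LieSuperalgebra.parPow_eq_pw, pw_of_hom S.par e (S.p t) _ (S.par_qd t)]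
    rw [TensorProduct.map_tmul, this, TensorProduct.smul_tmul']
  · rw [map_zero]

open Classical in
theorem coord_map_Qu (e : ZMod 2) (d : S.A →ₗ[ℂ] S.A) (t : ι) :
    coord (S.form.flip (S.q t)) (TensorProduct.map (S.parPow e) d S.Qu) =
      if t ∈ S.I then sgn (e * S.p t) • d (S.qbar t 0) else 0 := by
  rw [map_Qu, map_sum, Finset.sum_eq_single_of_mem t (Finset.mem_univ t)]
  · split_ifs
    · rw [map_smul, coord_tmul, LinearMap.BilinForm.flip_apply, form_qd, if_pos rfl, one_smul]
    · rw [map_zero]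
  · intro t' _ h
    split_ifs
    · rw [map_smul, coord_tmul, LinearMap.BilinForm.flip_apply, form_qd, if_neg h.symm, zero_smul,
        smul_zero]
    · rw [map_zero]

open Classical in
theorem extG_pd_L (k : ι) (m : ℕ) : S.extG (S.varPar (k, m)) (S.pd (k, m)) S.L.2.2 =
    if m = 0 ∧ k ∈ S.I then S.const (S.qd k ⊗ₜ 1) else 0 := by
  rw [extG_L (S.pd_isSDer _), map_Qu]
  by_cases hm : m = 0
  · subst hm
    rw [Finset.sum_eq_single_of_mem k (Finset.mem_univ k)]
    · have : sgn (S.varPar (k, 0) * S.p k) = 1 := by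
        have : ∀ a : ZMod 2, (a + 1 + 0) * a = 0 := by decide
        rw [varPar, Nat.cast_zero, this, sgn_zero]
      rw [pd_qbar, if_pos rfl, this, one_smul]
      by_cases hk : k ∈ S.I
      · rw [if_pos hk, if_pos ⟨rfl, hk⟩]
      · rw [if_neg hk, if_neg (fun h => hk h.2), map_zero]
    · intro t _ ht
      rw [pd_qbar, if_neg (fun h => ht (Prod.ext_iff.1 h).1)]; simp
  · rw [if_neg (fun h => hm h.1), Finset.sum_eq_zero, map_zero]
    intro t _
    rw [pd_qbar, if_neg (fun h => hm (Prod.ext_iff.1 h).2.symm)]; simp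

/-! ### The variational derivatives of the Hamiltonians -/

namespace IsDiag

variable {E : S.Gauge} {H : S.G} (h : IsDiag E H) {B : S.G →ₗ[ℂ] S.G} (hB : S.IsPinv B)
  {C : S.Loop} (hC : C ∈ S.center)

include h hB hC

theorem brG_center_L : S.brG (S.tensOne C) (E.toFun S.L).2.2 = 0 :=
  hB.brG_center hC (h.adSq_L hB)

theorem brG_L_center : S.brG (E.toFun S.L).2.2 (S.tensOne C) = 0 := by
  have h1 : S.parG (E.toFun S.L).2.2 = sgn 1 • (E.toFun S.L).2.2 := by
    rw [h.odd_L, sgn_one, neg_one_smul]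
  rw [skewG h1, pw_one, parG_tensOne, h.brG_center_L hB (parL_mem_center hC), neg_zero]

theorem opB_invG_L : S.opB (S.op (E.invG (S.tensOne C))) S.L = 0 := by
  have g1 : E.toFun (S.opB (S.op (E.invG (S.tensOne C))) S.L) = 0 := by
    rw [E.map_opB, E.toFun_op, E.onG_invG, opB_op, h.brG_center_L hB hC, E.fst, E.snd_fst,
      parG_tensOne, DG_tensOne, DG_tensOne]
    simp only [smul_zero, sub_zero, map_zero]
    rfl
  rw [← E.inv_toFun (S.opB _ _), g1, map_zero]

/-- The variation of the Hamiltonian density. -/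
theorem der_ham {e : ZMod 2} {d d' : S.A →ₗ[ℂ] S.A} (hd : SuperPoly.IsSDer S.varPar e d)
    (hD : ∀ a, d (S.D a) = sgn e • S.D (d a) + d' a) :
    d (S.formGB (E.toFun S.L).2.2 (S.tensOne C)) =
      S.formGB (S.extG e d S.L.2.2) (E.invG (S.tensOne C)) -
        (sgn e • S.D (S.formGB (E.Z e d) (S.tensOne C)) +
          S.formGB (E.Z (e + 1) d') (S.tensOne C)) := by
  have h1 := congrArg (fun x : S.Op => x.2.2) (E.derivative e d d' hd hD S.L rfl)
  have h2 : S.extOp e d S.L = S.op (S.extG e d S.L.2.2) := rfl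
  simp only [h2, E.toFun_op, opB_op, E.fst, E.snd_fst, Prod.snd_sub, Prod.snd_add, Prod.smul_snd] at h1
  have h3 : S.L.1 = 1 := rfl
  have h4 : S.L.2.1 = 0 := rfl
  simp only [h3, h4, op, one_smul, zero_smul, sub_zero] at h1
  have h5 : S.extG e d (E.toFun S.L).2.2 = _ := h1
  rw [der_formGB hd, extG_tensOne hd, map_zero, add_zero, h5]
  simp only [map_sub, map_add, LinearMap.sub_apply, LinearMap.add_apply, formGB_inv,
    h.brG_L_center hB hC, map_zero]
  have h6 : S.formGB (E.onG (S.extG e d S.L.2.2)) (S.tensOne C) =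
      S.formGB (S.extG e d S.L.2.2) (E.invG (S.tensOne C)) := by
    rw [← E.onG_form (S.extG e d S.L.2.2), E.onG_invG]
  have h7 : S.D (S.formGB (E.Z e d) (S.tensOne C)) = S.formGB (S.DG (E.Z e d)) (S.tensOne C) := by
    rw [D_formGB, DG_tensOne, map_zero, add_zero]
  rw [h6, h7, E.Z_par e d hd, map_smul, map_smul, LinearMap.smul_apply]
  abel

open Classical in
/-- The variational derivatives of the Hamiltonians are the coefficients of the constant term of
`M_C`. -/
theorem varD_ham (k : ι) : S.varD k (S.formGB (E.toFun S.L).2.2 (S.tensOne C)) =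
    if k ∈ S.I then coord (S.q.coord k) (S.zcoeff 0 (E.invG (S.tensOne C))) else 0 := by
  obtain ⟨z, hz⟩ : ∃ z : ℕ → S.A, z = fun m =>
    S.formGB (E.Z (S.varPar (k, m)) (S.pd (k, m))) (S.tensOne C) := ⟨_, rfl⟩
  obtain ⟨a, ha⟩ : ∃ a, a = S.formGB (E.toFun S.L).2.2 (S.tensOne C) := ⟨_, rfl⟩
  rw [← ha]
  have h1 : ∀ m, S.pd (k, m) a = (if m = 0 ∧ k ∈ S.I then
      coord (S.q.coord k) (S.zcoeff 0 (E.invG (S.tensOne C))) else 0) -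
      (sgn (S.varPar (k, m)) • S.D (z m) + if m = 0 then 0 else z (m - 1)) := fun m => by
    rw [ha, h.der_ham hB hC (S.pd_isSDer (k, m)) (S.pd_D (k, m)), extG_pd_L, hz]
    congr 1
    · split_ifs
      · rw [formGB_const, formA_tmul_one, form_qd_eq]
      · rw [map_zero, LinearMap.zero_apply]
    · congr 1
      rw [pdPred]
      cases m with
      | zero => simp [E.Z_zero]
      | succ m =>
        rw [if_neg m.succ_ne_zero, if_neg m.succ_ne_zero, varPar_succ, add_assoc, parity_add_self,
          add_zero]
        rfl
  obtain ⟨c, hc⟩ := S.filG.exhaustive (S.tensOne C)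
  obtain ⟨s, hs⟩ := E.Z_finite (1 - c)
  obtain ⟨M, hM⟩ := S.exists_pd_eq_zero k a
  obtain ⟨M', hM'⟩ : ∃ M', M' = max M (s.sup fun y => y.2 + 1) := ⟨_, rfl⟩
  have hzM : z M' = 0 := by
    rw [hz]
    refine formGB_eq_zero (d := 1 - c) (e := c) (by omega) (hs _ (fun hmem => ?_) _) hc
    have : M' + 1 ≤ s.sup fun y => y.2 + 1 := Finset.le_sup (f := fun y : ι × ℕ => y.2 + 1) hmem
    omega
  rw [varD_eq_sum (M := M' + 1) fun m hm => hM m (by omega)]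
  simp only [h1, map_sub, smul_sub, Finset.sum_sub_distrib]
  rw [S.sum_varSgn_telescope k z M' hzM, sub_zero, Finset.sum_eq_single_of_mem 0 (by simp)]
  · simp [varSgn_zero]
  · intro m _ hm
    rw [if_neg fun h => hm h.1, map_zero, smul_zero]

end IsDiag

end DSData

namespace DSData

variable {𝔤 : Type*} [AddCommGroup 𝔤] [Module ℂ 𝔤] {ι : Type*} [Fintype ι] [DecidableEq ι]
  {S : DSData 𝔤 ι}

/-! ### The Hamiltonian flows -/

theorem varD_algebraMap (k : ι) (r : ℂ) : S.varD k (algebraMap ℂ S.A r) = 0 := by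
  rw [varD_eq_sum (M := 0) fun m _ => (S.pd_isSDer (k, m)).map_algebraMap r]
  simp

theorem ham_algebraMap (r : ℂ) : S.ham (algebraMap ℂ S.A r) = 0 := by
  ext a
  rw [ham_apply]
  simp [hamVal_apply, varD_algebraMap]

theorem ham_apply_algebraMap (h : S.A) (r : ℂ) : S.ham h (algebraMap ℂ S.A r) = 0 := by
  have : SuperPoly.grad S.varPar (algebraMap ℂ S.A r) = 0 :=
    Finsupp.ext fun x => (S.pd_isSDer x).map_algebraMap r
  rw [ham_apply, this, Finsupp.sum_zero_index]

theorem eq_algebraMap_of_D {a : S.A} (h : S.D a = 0) : ∃ r, a = algebraMap ℂ S.A r := by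
  obtain ⟨r, hr⟩ := SuperPoly.exists_degPart_zero a
  refine ⟨r, ?_⟩
  rw [← hr, ← sub_eq_zero]
  refine eq_zero_of_D ?_ ?_
  · rw [map_sub, hr, SuperPoly.degPart_algebraMap, if_pos rfl, sub_self]
  · rw [map_sub, h, D_degPart_zero, sub_zero]

theorem formGB_tensOne (X Y : S.Loop) :
    ∃ r, S.formGB (S.tensOne X) (S.tensOne Y) = algebraMap ℂ S.A r :=
  eq_algebraMap_of_D (by rw [D_formGB, DG_tensOne, DG_tensOne]; simp)

/-- The density `(Y | C ⊗ 1)` for the transformed Lax operator `D + Y`. -/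
def Gauge.dens (E : S.Gauge) (C : S.Loop) : S.A := S.formGB (E.toFun S.L).2.2 (S.tensOne C)

theorem q_mem_m {t : ι} (ht : t ∉ S.I) : S.q t ∈ S.m := by
  rw [← S.span_q]; exact Submodule.subset_span ⟨t, ht, rfl⟩

/-- As `𝔪 ⊆ 𝔫` commutes with `s`, the variables that correspond to `𝔪` are central for the
bracket. -/
theorem brVars_left_eq_zero {k : ι} (hk : k ∉ S.I) (t : ι) : S.brVars k t = 0 := by
  rw [brVars, ← S.form_invariant, S.s_n _ (S.m_le_n (q_mem_m hk)), map_zero, LinearMap.zero_apply,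
    mul_zero]

theorem brVars_right_eq_zero {t : ι} (ht : t ∉ S.I) (k : ι) : S.brVars k t = 0 := by
  rw [brVars, S.skew _ _ _ _ (S.q_par k) (S.q_par t), map_neg, map_smul, ← S.form_invariant,
    S.s_n _ (S.m_le_n (q_mem_m ht)), map_zero, LinearMap.zero_apply]
  simp

/-- The coordinates of `[X, s]` for homogeneous `X ∈ 𝔤 ⊗ 𝒫(ḡ)`. -/
theorem coord_brA_s {e : ZMod 2} {X : 𝔤 ⊗[ℂ] S.A} (hX : S.parTens X = sgn e • X) (t : ι) :
    coord (S.form.flip (S.q t)) (S.brA X (S.s ⊗ₜ 1)) =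
      ∑ k, (sgn (e + S.p k) * S.brVars k t) • coord (S.q.coord k) X := by
  have hs : S.par S.s = sgn 1 • S.s := by rw [S.s_odd, sgn_one, neg_one_smul]
  have hu : ∀ k, S.tau (coord (S.q.coord k) X) = sgn (e + S.p k) • coord (S.q.coord k) X :=
    fun k => by
    have h1 : ∀ Y, coord (S.q.coord k) (S.parTens Y) = sgn (S.p k) • S.tau (coord (S.q.coord k) Y) :=
      fun Y => by
      have h2 : S.q.coord k ∘ₗ S.par = sgn (S.p k) • S.q.coord k := S.q.ext fun l => by
        rw [LinearMap.comp_apply, S.q_par, map_smul, LinearMap.smul_apply, Module.Basis.coord_apply,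
          Module.Basis.repr_self, Finsupp.single_apply]
        split_ifs with h
        · rw [h]
        · simp
      induction Y using TensorProduct.induction_on with
      | zero => simp
      | add x y h1 h2 => simp only [map_add, h1, h2, smul_add]
      | tmul a u =>
        have h3 := LinearMap.congr_fun h2 a
        rw [LinearMap.comp_apply, LinearMap.smul_apply] at h3
        rw [parTens, TensorProduct.map_tmul, coord_tmul, coord_tmul, h3, map_smul, smul_eq_mul,
          mul_smul]
    have h2 := h1 X
    rw [hX, map_smul] at h2
    rw [add_comm, sgn_add, mul_smul, h2, smul_smul, SuperPoly.sgn_mul_self, one_smul]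
  have key : ∀ k, coord (S.form.flip (S.q t)) (S.brA (S.q k ⊗ₜ coord (S.q.coord k) X) (S.s ⊗ₜ 1)) =
      (sgn (e + S.p k) * S.brVars k t) • coord (S.q.coord k) X := fun k => by
    have h1 : S.form (S.br (S.q k) S.s) (S.q t) = S.brVars k t := by
      rw [S.skew _ _ _ _ (S.q_par k) hs, map_neg, LinearMap.neg_apply, map_smul,
        LinearMap.smul_apply, S.form_invariant, brVars, smul_eq_mul, mul_one, sgn_add, sgn_one]
      ring
    rw [brA, S.brT_tmul _ _ _ _ hs (hu k), map_smul, coord_tmul, LinearMap.BilinForm.flip_apply, h1,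
      smul_smul, mul_one, one_mul]
  conv_lhs => rw [← sum_coord S.q X]
  rw [map_sum, LinearMap.sum_apply, map_sum]
  exact Finset.sum_congr rfl fun k _ => key k

namespace IsDiag

variable {E : S.Gauge} {H : S.G} (h : IsDiag E H) {B : S.G →ₗ[ℂ] S.G} (hB : S.IsPinv B)
  {C : S.Loop} (hC : C ∈ S.center) {e : ZMod 2} (he : S.HasParity e C)

include h he

theorem tau_dens : S.tau (E.dens C) = sgn (e + 1) • E.dens C := by
  have he' : S.parL C = sgn e • C := he
  rw [Gauge.dens, tau_formGB, h.odd_L, parG_tensOne, he', sgn_add, sgn_one]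
  simp

theorem parTens_coeff (l : ℤ) : S.parTens (S.zcoeff l (E.invG (S.tensOne C))) =
    sgn e • S.zcoeff l (E.invG (S.tensOne C)) := by
  have he' : S.parL C = sgn e • C := he
  rw [parTens, ← zcoeff_map]
  show S.zcoeff l (S.parG _) = _
  rw [← E.invG_parG, parG_tensOne, he']
  simp

theorem flow_isSDer : SuperPoly.IsSDer S.varPar e (S.ham (E.dens C)) := by
  have := ham_isSDer (h.tau_dens he)
  rwa [add_assoc, parity_add_self, add_zero] at this

theorem flow_D (a : S.A) : S.ham (E.dens C) (S.D a) = sgn e • S.D (S.ham (E.dens C) a) := by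
  have := ham_D_comm (h.tau_dens he) a
  rwa [add_assoc, parity_add_self, add_zero] at this

include hB hC

/-- The Hamiltonian flow on the variables. -/
theorem coord_flow (t : ι) : coord (S.form.flip (S.q t))
    (S.brA (S.zcoeff 0 (E.invG (S.tensOne C))) (S.s ⊗ₜ 1)) =
      sgn (e * S.p t) • S.ham (E.dens C) (S.qbar t 0) := by
  classical
  have h1 : S.pp (S.varPar (t, 0)) (E.dens C) = sgn (S.varPar (t, 0) * (e + 1)) • E.dens C :=
    SuperPoly.parPow_of_hom _ _ _ _ (by rw [← pp_one]; exact h.tau_dens he)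
  have h2 : S.pp ((0 : ℕ) : ZMod 2) (E.dens C) = E.dens C := by
    simp [SuperPoly.parPow]
  rw [coord_brA_s (h.parTens_coeff he 0), ham_qbar, h2, hamVal_apply, h1, Nat.cast_zero, sgn_zero,
    pow_zero, one_smul, Module.End.one_apply, Finset.smul_sum]
  refine Finset.sum_congr rfl fun k _ => ?_
  rw [map_smul, smul_smul, smul_smul, Gauge.dens, h.varD_ham hB hC]
  by_cases hk : k ∈ S.I
  · rw [if_pos hk]
    by_cases hkt : S.varPar (k, 0) = S.varPar (t, 0) + 1
    · congr 1
      have h3 : ∀ e a b : ZMod 2, a + 1 + 0 = b + 1 + 0 + 1 →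
          e + a = e * b + ((b + 1 + 0) * (a + 1 + 0) + (b + 1 + 0) * (e + 1)) := by decide
      have h4 := h3 e (S.p k) (S.p t) (by simpa [varPar] using hkt)
      have h5 : sgn (e + S.p k) = sgn (e * S.p t) * (sgn (S.varPar (t, 0) * S.varPar (k, 0)) *
          sgn (S.varPar (t, 0) * (e + 1))) := by
        rw [← sgn_add, ← sgn_add, h4]
        simp only [varPar, Nat.cast_zero]
      rw [h5]; ring
    · rw [brVars_eq_zero hkt]; simp
  · rw [if_neg hk, brVars_left_eq_zero hk]; simp

theorem flow_qbar_of_notMem {t : ι} (ht : t ∉ S.I) : S.ham (E.dens C) (S.qbar t 0) = 0 := by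
  have h1 := h.coord_flow hB hC he t
  rw [coord_brA_s (h.parTens_coeff he 0)] at h1
  simp only [brVars_right_eq_zero ht, mul_zero, zero_smul, Finset.sum_const_zero] at h1
  exact (smul_eq_zero.1 h1.symm).resolve_left (sgn_ne_zero _)

/-- The Hamiltonian flow in Lax form. -/
theorem map_flow_Qu : TensorProduct.map (S.parPow e) (S.ham (E.dens C)) S.Qu =
    S.brA (S.zcoeff 0 (E.invG (S.tensOne C))) (S.s ⊗ₜ 1) := by
  classical
  refine ext_coord S.qd fun t => ?_
  rw [qd_coord, coord_map_Qu, h.coord_flow hB hC he]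
  split_ifs with ht
  · rfl
  · rw [h.flow_qbar_of_notMem hB hC he ht, smul_zero]

theorem extG_flow_L : S.extG e (S.ham (E.dens C)) S.L.2.2 =
    S.const (S.brA (S.zcoeff 0 (E.invG (S.tensOne C))) (S.s ⊗ₜ 1)) := by
  rw [extG_L (h.flow_isSDer he), h.map_flow_Qu hB hC he]

/-- The Lax equation of the flow of `(Y | C)`. -/
theorem extOp_flow_L : S.extOp e (S.ham (E.dens C)) S.L =
    -S.opB (S.op (S.posPart (S.zG (-1) (E.invG (S.tensOne C))))) S.L := by
  have hz : S.zG (-1) (E.invG (S.tensOne C)) = E.invG (S.tensOne (S.zmul (-1) C)) := by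
    rw [tensOne_zmul, E.invG_zG]
  have h1 : S.opB (S.op (S.zG (-1) (E.invG (S.tensOne C)))) S.L = 0 := by
    rw [hz]; exact h.opB_invG_L hB (zmul_mem_center hC (-1))
  rw [opB_posPart_L h1, zcoeff_zG, sub_self, map_neg, ← opL_apply, map_neg, neg_neg, opL_apply,
    ← h.extG_flow_L hB hC he]
  rfl

theorem flow_mem_P {a : S.A} (ha : a ∈ S.P) : S.ham (E.dens C) a ∈ S.P := by
  refine der_mem_P (h.flow_isSDer he) (fun t _ n => ?_) ha
  induction n with
  | zero =>
    have h1 := congrArg (fun x => sgn (e * S.p t) • x) (h.coord_flow hB hC he t)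
    simp only [smul_smul, SuperPoly.sgn_mul_self, one_smul] at h1
    rw [← h1]
    exact S.P.smul_mem (coord_mem_of_tens (brA_s_mem (E.invG_coef (S.tensOne_coefIn _ _) 0)) _) _
  | succ n ih =>
    rw [← D_qbar, h.flow_D he]
    exact S.P.smul_mem (S.D_mem_P ih) _

end IsDiag

end DSData

namespace DSData

variable {𝔤 : Type*} [AddCommGroup 𝔤] [Module ℂ 𝔤] {ι : Type*} [Fintype ι] [DecidableEq ι]
  {S : DSData 𝔤 ι}

/-! ### Commutativity of the flows -/

theorem zcoeff_brG_of_neg {X Y : S.G} (hX : ∀ k < 0, S.zcoeff k X = 0)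
    (hY : ∀ k < 0, S.zcoeff k Y = 0) {l : ℤ} (hl : l < 0) : S.zcoeff l (S.brG X Y) = 0 := by
  obtain ⟨K, hK⟩ := S.zcoeff_brG l X Y
  rw [hK K le_rfl]
  refine Finset.sum_eq_zero fun k _ => ?_
  by_cases hk : k < 0
  · rw [hX k hk, map_zero, LinearMap.zero_apply]
  · rw [hY (l - k) (by omega), map_zero]

theorem zcoeff_brG_of_nonneg {X Y : S.G} (hX : ∀ k, 0 ≤ k → S.zcoeff k X = 0)
    (hY : ∀ k, 0 ≤ k → S.zcoeff k Y = 0) {l : ℤ} (hl : -1 ≤ l) : S.zcoeff l (S.brG X Y) = 0 := by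
  obtain ⟨K, hK⟩ := S.zcoeff_brG l X Y
  rw [hK K le_rfl]
  refine Finset.sum_eq_zero fun k _ => ?_
  by_cases hk : 0 ≤ k
  · rw [hX k hk, map_zero, LinearMap.zero_apply]
  · rw [hY (l - k) (by omega), map_zero]

/-- The classical `r`-matrix identity: the residue of `[X^+, Y] + [X, Y^+]` vanishes if `X` and `Y`
commute. -/
theorem residue_posPart {X Y : S.G} (h : S.brG X Y = 0) :
    S.zcoeff (-1) (S.brG (S.posPart X) Y) + S.zcoeff (-1) (S.brG X (S.posPart Y)) = 0 := by
  obtain ⟨X', hX'⟩ : ∃ X', X' = X - S.posPart X := ⟨_, rfl⟩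
  obtain ⟨Y', hY'⟩ : ∃ Y', Y' = Y - S.posPart Y := ⟨_, rfl⟩
  have h1 : S.brG (S.posPart X) Y + S.brG X (S.posPart Y) = S.brG X Y +
      S.brG (S.posPart X) (S.posPart Y) - S.brG X' Y' := by
    rw [hX', hY']; simp only [map_sub, LinearMap.sub_apply]; abel
  have hneg : ∀ X' X : S.G, X' = X - S.posPart X → ∀ k, 0 ≤ k → S.zcoeff k X' = 0 :=
    fun X' X hX k hk => by rw [hX, map_sub, zcoeff_posPart, if_pos hk, sub_self]
  have hpos : ∀ X : S.G, ∀ k < 0, S.zcoeff k (S.posPart X) = 0 :=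
    fun X k hk => by rw [zcoeff_posPart, if_neg (by omega)]
  rw [← map_add, h1, h, zero_add, map_sub,
    zcoeff_brG_of_neg (hpos X) (hpos Y) (by norm_num),
    zcoeff_brG_of_nonneg (hneg _ _ hX') (hneg _ _ hY') le_rfl, sub_zero]

theorem zG_brG {e : ZMod 2} {X : S.G} (hX : S.parG X = sgn e • X) (k : ℤ) (Y : S.G) :
    S.brG (S.zG k X) Y = S.zG k (S.brG X Y) := by
  have h : S.parG (S.zG k X) = sgn e • S.zG k X := by rw [parG_zG, hX, map_smul]
  rw [skewG h, skewG hX, brG_zG, map_neg]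

/-- If `δ ℒ = - [X, ℒ]` for an odd operator `ℒ = D + Y` and a derivation `δ` that supercommutes with
`D`, then `δ` acts on `½ [ℒ, ℒ]` in the same way. -/
theorem extG_sq {e : ZMod 2} {d : S.A →ₗ[ℂ] S.A} (hd : SuperPoly.IsSDer S.varPar e d)
    (hD : ∀ a, d (S.D a) = sgn e • S.D (d a)) {X Y : S.G} (hX : S.parG X = sgn e • X)
    (hY : S.parG Y = -Y) (h : S.extG e d Y = -(S.brG X Y - S.DG (S.parG X))) :
    S.extG e d ((2 : ℂ)⁻¹ • S.brG Y Y + S.DG Y) =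
      -S.brG X ((2 : ℂ)⁻¹ • S.brG Y Y + S.DG Y) + S.DG (S.DG X) := by
  have hY' : S.parG Y = sgn 1 • Y := by rw [hY, sgn_one, neg_one_smul]
  have hpY : pw S.parG e Y = sgn e • Y := by rw [pw_of_hom _ e 1 _ hY', mul_one]
  obtain ⟨W, hW⟩ : ∃ W, W = S.brG X Y := ⟨_, rfl⟩
  have hWp : S.parG W = sgn (e + 1) • W := by
    rw [hW, parG_brG, hX, hY, sgn_add, sgn_one]; simp
  have hskew : ∀ Z : S.G, S.parG Z = sgn (e + 1) • Z → sgn e • S.brG Y Z = S.brG Z Y :=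
    fun Z hZ => by
    rw [skewG hY', pw_one, hZ, map_smul, LinearMap.smul_apply, sgn_add, sgn_one, smul_neg,
      smul_smul, ← mul_assoc, SuperPoly.sgn_mul_self, one_mul, neg_one_smul, neg_neg]
  have hDX : S.parG (S.DG X) = sgn (e + 1) • S.DG X := by
    rw [parG_DG, hX, map_smul, sgn_add, sgn_one]; simp
  have h0 : S.extG e d Y = -W + sgn e • S.DG X := by
    rw [h, hX, map_smul, hW]; abel
  have h1 : S.extG e d (S.brG Y Y) = -((2 : ℂ) • S.brG W Y) + (2 : ℂ) • sgn e • S.brG (S.DG X) Y := by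
    rw [extG_brG hd, hpY, map_smul, LinearMap.smul_apply, h0]
    simp only [map_add, map_neg, map_smul, LinearMap.add_apply, LinearMap.neg_apply,
      LinearMap.smul_apply, smul_add, smul_neg]
    rw [hskew W hWp, smul_comm (sgn e) (sgn e) (S.brG Y (S.DG X)), hskew _ hDX]
    module
  have h2 : S.extG e d (S.DG Y) = -(sgn e • S.DG W) + S.DG (S.DG X) := by
    rw [S.extG_DG (d' := 0) (fun a => by rw [hD, LinearMap.zero_apply, add_zero]), extG_zero,
      add_zero, h0, map_add, map_neg, map_smul, smul_add, smul_smul, SuperPoly.sgn_mul_self, one_smul,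
      smul_neg]
  have h3 : S.DG W = S.brG (S.DG X) Y + sgn e • S.brG X (S.DG Y) := by
    rw [hW, DG_brG, hX, map_smul, LinearMap.smul_apply]
  have h4 : S.brG X (S.brG Y Y) = (2 : ℂ) • S.brG W Y := by
    rw [jacobiG hX, hpY, map_smul, LinearMap.smul_apply, ← hW, hskew W hWp]
    module
  rw [map_add, map_smul, h1, h2, h3, map_add, map_smul, h4, smul_add (sgn e), smul_smul (sgn e),
    SuperPoly.sgn_mul_self]
  module

theorem coord_map_parPow (e : ZMod 2) (d : S.A →ₗ[ℂ] S.A) (t : ι) (X : 𝔤 ⊗[ℂ] S.A) :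
    coord (S.form.flip (S.q t)) (TensorProduct.map (S.parPow e) d X) =
      sgn (e * S.p t) • d (coord (S.form.flip (S.q t)) X) := by
  have h1 : ∀ a, S.form.flip (S.q t) (S.parPow e a) = sgn (e * S.p t) • S.form.flip (S.q t) a :=
    fun a => by
    rw [LinearMap.BilinForm.flip_apply, LinearMap.BilinForm.flip_apply]
    rcases parity_cases e with rfl | rfl
    · simp [LieSuperalgebra.parPow, sgn_zero]
    · have h2 := S.form_even a (S.q t)
      rw [S.q_par, map_smul] at h2
      rw [← h2, one_mul, smul_smul, SuperPoly.sgn_mul_self, one_smul]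
      simp [LieSuperalgebra.parPow]
  induction X using TensorProduct.induction_on with
  | zero => simp
  | add x y h1 h2 => simp only [map_add, h1, h2, smul_add]
  | tmul a u =>
    rw [TensorProduct.map_tmul, coord_tmul, coord_tmul, h1, map_smul, smul_eq_mul, mul_smul]

theorem map_brA_s {e : ZMod 2} {d : S.A →ₗ[ℂ] S.A} (hd : SuperPoly.IsSDer S.varPar e d)
    (X : 𝔤 ⊗[ℂ] S.A) : TensorProduct.map (S.parPow e) d (S.brA X (S.s ⊗ₜ 1)) =
      S.brA (TensorProduct.map (S.parPow e) d X) (S.s ⊗ₜ 1) := by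
  have h1 := S.extT_brT S.isSuper_tau (S.isDerOf hd) X (S.s ⊗ₜ 1)
  have h2 : S.extT e d (S.s ⊗ₜ 1) = 0 := by
    rw [LieSuperalgebra.extT, TensorProduct.map_tmul, hd.map_one, TensorProduct.tmul_zero]
  rw [h2, map_zero, add_zero] at h1
  exact h1

/-- Evolutionary derivations are determined by their values on the variables `q̄_t`. -/
theorem eq_zero_on_qbar {c : ℂ} {d : S.A →ₗ[ℂ] S.A} (hD : ∀ a, d (S.D a) = c • S.D (d a)) {t : ι}
    (h : d (S.qbar t 0) = 0) (n : ℕ) : d (S.qbar t n) = 0 := by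
  induction n with
  | zero => exact h
  | succ n ih => rw [← D_qbar, hD, ih, map_zero, smul_zero]

namespace IsDiag

variable {E : S.Gauge} {H : S.G} (h : IsDiag E H) {B : S.G →ₗ[ℂ] S.G} (hB : S.IsPinv B)

include h hB

theorem sq_L : (2 : ℂ)⁻¹ • S.brG (E.toFun S.L).2.2 (E.toFun S.L).2.2 + S.DG (E.toFun S.L).2.2 =
    H + S.tensOne S.LamSq := by
  have h2 : (2 : ℂ)⁻¹ • S.opB S.L S.L = (0, 1, sqRem S.Qu + S.tensOne S.LamSq) := laxS_sq S.Qu_odd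
  have h3 := congrArg E.toFun h2
  rw [map_smul, E.map_opB, h.sq, opB_apply] at h3
  have h4 := congrArg (fun x : S.Op => x.2.2) h3
  have h5 : (E.toFun S.L).1 = 1 := E.fst _
  have h6 : (E.toFun S.L).2.1 = 0 := E.snd_fst _
  simp only [opBr, h5, h6, Prod.smul_snd, one_smul, zero_smul, add_zero, sub_zero, h.odd_L, map_neg,
    sub_neg_eq_add] at h4
  rw [← h4]
  module

/-- An evolutionary derivation `δ` with `δ ℒ_s = - [X, ℒ_s]` satisfies `δ M = - [X, M]` for the
elements `M` that are transformed into the center of `𝒦`. -/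
theorem extG_invG_center {e : ZMod 2} {d : S.A →ₗ[ℂ] S.A} (hd : SuperPoly.IsSDer S.varPar e d)
    (hD : ∀ a, d (S.D a) = sgn e • S.D (d a)) {X : S.G} (hX : S.parG X = sgn e • X)
    (hL : S.extOp e d S.L = -S.opB (S.op X) S.L) {C : S.Loop} (hC : C ∈ S.center) :
    S.extG e d (E.invG (S.tensOne C)) = -S.brG X (E.invG (S.tensOne C)) := by
  have hder := E.derivative e d 0 hd fun a => by rw [hD, LinearMap.zero_apply, add_zero]
  obtain ⟨X', hX'⟩ : ∃ X', X' = E.onG X - E.Z e d := ⟨_, rfl⟩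
  have hp : S.parG X' = sgn e • X' := by
    rw [hX', map_sub, ← E.onG_parG, hX, map_smul, E.Z_par e d hd, smul_sub]
  have h1 : S.extG e d (E.toFun S.L).2.2 =
      -(S.brG X' (E.toFun S.L).2.2 - S.DG (S.parG X')) := by
    have g1 := congrArg (fun x : S.Op => x.2.2) (hder S.L rfl)
    rw [hL, map_neg, E.map_opB, E.toFun_op, opB_op, opB_op, E.fst, E.snd_fst, E.Z_zero] at g1
    have h3 : S.L.1 = 1 := rfl
    have h4 : S.L.2.1 = 0 := rfl
    simp only [h3, h4, op, one_smul, zero_smul, sub_zero, Prod.snd_sub, Prod.snd_add, Prod.snd_neg]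
      at g1
    have g2 : S.extG e d (E.toFun S.L).2.2 = _ := g1
    rw [g2, hX']
    simp only [map_sub, LinearMap.sub_apply]
    abel
  have h2 := extG_sq hd hD hp h.odd_L h1
  rw [h.sq_L hB] at h2
  -- by the equation for `½ [D + Y, D + Y]`, the transform of `X` less the logarithmic derivative
  -- lies in `𝒦 ⊗ 𝒫`
  have h3 : S.adSq X' = 0 := by
    have g1 : S.brG (H + S.tensOne S.LamSq) X' = -S.brG X' (H + S.tensOne S.LamSq) := by
      rw [skewG (e := 0) (by rw [h.even, sgn_zero, one_smul]), pw_zero, LinearMap.id_apply]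
    refine adSq_eq_zero hB h.mem h.ker (W := S.extG e d H)
      (by rw [← adSq_extG hd, h.ker, map_zero]) ?_
    rw [map_add, extG_tensOne hd, add_zero, ← g1, map_add, LinearMap.add_apply] at h2
    rw [h2, adSq]
    abel
  have h4 : S.brG X' (S.tensOne C) = 0 := by
    rw [skewG hp, neg_eq_zero]
    rcases parity_cases e with rfl | rfl
    · exact hB.brG_center hC h3
    · rw [pw_one, parG_tensOne]; exact hB.brG_center (parL_mem_center hC) h3
  have h5 := congrArg (fun x : S.Op => x.2.2) (hder (S.op (E.invG (S.tensOne C))) rfl)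
  have h6 : ∀ Y, S.extOp e d (S.op Y) = S.op (S.extG e d Y) := fun Y => rfl
  simp only [E.toFun_op, E.onG_invG, h6, opB_op_op, extG_tensOne hd] at h5
  have h7 : 0 = E.onG (S.extG e d (E.invG (S.tensOne C))) + S.brG (E.Z e d) (S.tensOne C) := by
    simpa [op] using h5
  rw [hX', map_sub, LinearMap.sub_apply] at h4
  rw [← sub_eq_zero.1 h4] at h7
  rw [eq_neg_iff_add_eq_zero, ← E.invG_onG (_ + _), map_add E.onG, E.onG_brG, E.onG_invG, ← h7,
    map_zero]

end IsDiag

namespace IsDiag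

variable {E : S.Gauge} {H : S.G} (h : IsDiag E H) {B : S.G →ₗ[ℂ] S.G} (hB : S.IsPinv B)
  {C : S.Loop} (hC : C ∈ S.center) {e : ZMod 2} (he : S.HasParity e C)

theorem posPart_parG (X : S.G) : S.parG (S.posPart X) = S.posPart (S.parG X) :=
  S.ext_zcoeff fun l => by
    rw [zcoeff_posPart, parG, zcoeff_map, zcoeff_map, zcoeff_posPart]
    split_ifs
    · rfl
    · rw [map_zero]

include he in
theorem parG_posPart_M (k : ℤ) : S.parG (S.posPart (S.zG k (E.invG (S.tensOne C)))) =
    sgn e • S.posPart (S.zG k (E.invG (S.tensOne C))) := by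
  have he' : S.parL C = sgn e • C := he
  rw [posPart_parG, parG_zG, ← E.invG_parG, parG_tensOne, he']
  simp only [map_smul]

include h hB hC he

theorem extG_flow_invG {C' : S.Loop} (hC' : C' ∈ S.center) :
    S.extG e (S.ham (E.dens C)) (E.invG (S.tensOne C')) =
      -S.brG (S.posPart (S.zG (-1) (E.invG (S.tensOne C)))) (E.invG (S.tensOne C')) :=
  h.extG_invG_center hB (h.flow_isSDer he) (h.flow_D he) (parG_posPart_M he _)
    (h.extOp_flow_L hB hC he) hC'

/-- The equality of the second derivatives of the variables. -/
theorem flow_flow_qbar {C' : S.Loop} (hC' : C' ∈ S.center) {e' : ZMod 2} (he' : S.HasParity e' C')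
    (t : ι) : S.ham (E.dens C) (S.ham (E.dens C') (S.qbar t 0)) =
      sgn (e * e') • S.ham (E.dens C') (S.ham (E.dens C) (S.qbar t 0)) := by
  obtain ⟨X, hX⟩ : ∃ X, X = E.invG (S.tensOne C) := ⟨_, rfl⟩
  obtain ⟨X', hX'⟩ : ∃ X', X' = E.invG (S.tensOne C') := ⟨_, rfl⟩
  obtain ⟨d, hd⟩ : ∃ d, d = S.ham (E.dens C) := ⟨_, rfl⟩
  obtain ⟨d', hd'⟩ : ∃ d', d' = S.ham (E.dens C') := ⟨_, rfl⟩
  have hdD : SuperPoly.IsSDer S.varPar e d := hd ▸ h.flow_isSDer he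
  have hdD' : SuperPoly.IsSDer S.varPar e' d' := hd' ▸ h.flow_isSDer he'
  have hXX' : S.brG X X' = 0 := by
    rw [hX, hX', ← E.invG_brG, hB.brG_center hC (adSq_tensOne hC'), map_zero]
  have h1 := h.extG_flow_invG hB hC he hC'
  have h2 := h.extG_flow_invG hB hC' he' hC
  have hp' := parG_posPart_M (E := E) he' (-1)
  have hq := h.coord_flow hB hC he t
  have hq' := h.coord_flow hB hC' he' t
  have hXp : S.parG X = sgn e • X := by
    have he1 : S.parL C = sgn e • C := he
    rw [hX, ← E.invG_parG, parG_tensOne, he1]; simp only [map_smul]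
  rw [← hX, ← hd] at hq
  rw [← hX', ← hd'] at hq'
  rw [← hX, ← hX', ← hd] at h1
  rw [← hX, ← hX', ← hd'] at h2
  rw [← hX'] at hp'
  rw [← hd, ← hd']
  have hz : ∀ X Y l, S.zcoeff l (S.brG X (S.zG (-1) Y)) = S.zcoeff (l + 1) (S.brG X Y) :=
    fun X Y l => by rw [brG_zG, zcoeff_zG, sub_neg_eq_add]
  have hzl : ∀ Y l, S.zcoeff l (S.brG (S.zG (-1) X) Y) = S.zcoeff (l + 1) (S.brG X Y) :=
    fun Y l => by
    rw [zG_brG hXp, zcoeff_zG, sub_neg_eq_add]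
  have h3 : S.brG (S.zG (-1) X) (S.zG (-1) X') = 0 := by
    rw [brG_zG, zG_brG hXp, hXX', map_zero, map_zero]
  -- the constant terms of `[M^+, M']` and `[M, M'^+]`, with `M^+` the part of `z⁻¹ M` with
  -- nonnegative powers, are the residue of the `r`-matrix identity for `z⁻¹ M` and `z⁻¹ M'`
  have h4 := residue_posPart h3
  rw [hz, hzl, neg_add_cancel] at h4
  have h5 : TensorProduct.map (S.parPow e) d (S.zcoeff 0 X') =
      sgn (e * e') • TensorProduct.map (S.parPow e') d' (S.zcoeff 0 X) := by
    have g1 := congrArg (S.zcoeff 0) h1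
    have g2 := congrArg (S.zcoeff 0) h2
    have g3 : ∀ (e : ZMod 2) (d : S.A →ₗ[ℂ] S.A) (X : S.G), S.zcoeff 0 (S.extG e d X) =
      TensorProduct.map (S.parPow e) d (S.zcoeff 0 X) := fun e d X => S.zcoeff_map _ _ _ _
    rw [g3] at g1 g2
    have g4 : S.brG (S.posPart (S.zG (-1) X')) X =
        -(sgn (e * e') • S.brG X (S.posPart (S.zG (-1) X'))) := by
      rw [skewG hp', pw_of_hom _ _ _ _ hXp, map_smul, LinearMap.smul_apply, mul_comm]
    rw [g1, g2, g4, map_neg, map_neg, map_neg, map_smul, neg_neg, smul_smul,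
      SuperPoly.sgn_mul_self, one_smul]
    exact neg_eq_of_add_eq_zero_right h4
  have h6 := congrArg (fun Y => coord (S.form.flip (S.q t)) (S.brA Y (S.s ⊗ₜ 1))) h5
  simp only [map_smul, LinearMap.smul_apply, ← map_brA_s hdD, ← map_brA_s hdD', coord_map_parPow,
    hq, hq', smul_smul] at h6
  have h7 : sgn (e * S.p t) * sgn (e' * S.p t) ≠ 0 := mul_ne_zero (sgn_ne_zero _) (sgn_ne_zero _)
  refine smul_right_injective _ h7 ?_
  simp only [smul_smul]
  rw [h6]
  congr 1
  ring

/-- The Hamiltonian flows supercommute. -/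
theorem flow_comm {C' : S.Loop} (hC' : C' ∈ S.center) {e' : ZMod 2} (he' : S.HasParity e' C') :
    S.SuperComm e e' (S.ham (E.dens C)) (S.ham (E.dens C')) := fun a => by
  have h1 := (h.flow_isSDer he).comm (h.flow_isSDer he')
  have h2 := (h.flow_isSDer (e := e + e') (C := 0) (by simp [HasParity])).smul 0
  refine sub_eq_zero.1 ((h1.ext h2 (fun x => ?_) a).trans (by simp))
  rw [zero_smul]
  refine eq_zero_on_qbar (c := sgn (e + e')) (fun a => ?_) ?_ x.2
  · simp only [LinearMap.sub_apply, LinearMap.smul_apply, LinearMap.comp_apply, h.flow_D he,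
      h.flow_D he', map_smul, map_sub, smul_sub, smul_smul, sgn_add]
    congr 2 <;> ring
  · simp only [LinearMap.sub_apply, LinearMap.smul_apply, LinearMap.comp_apply,
      h.flow_flow_qbar hB hC he hC' he', sub_self]

/-- The densities `(Y | C ⊗ 1)` are conserved. -/
theorem functional_flow_dens {C' : S.Loop} (hC' : C' ∈ S.center) :
    S.functional (S.ham (E.dens C) (E.dens C')) = 0 := by
  have hder := h.der_ham hB hC' (h.flow_isSDer he) (d' := 0)
    fun a => by rw [h.flow_D he, LinearMap.zero_apply, add_zero]
  obtain ⟨X, hX⟩ : ∃ X, X = S.posPart (S.zG (-1) (E.invG (S.tensOne C))) := ⟨_, rfl⟩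
  obtain ⟨M, hM⟩ : ∃ M, M = E.invG (S.tensOne C') := ⟨_, rfl⟩
  have hL : S.extG e (S.ham (E.dens C)) S.L.2.2 = -(S.brG X S.L.2.2 - S.DG (S.parG X)) := by
    have g1 := congrArg (fun x : S.Op => x.2.2) (h.extOp_flow_L hB hC he)
    rw [opB_op, ← hX] at g1
    have h3 : S.L.1 = 1 := rfl
    have h4 : S.L.2.1 = 0 := rfl
    simp only [h3, h4, op, one_smul, zero_smul, sub_zero, Prod.snd_neg] at g1
    exact g1
  have hLM : S.brG S.L.2.2 M = -S.DG M := by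
    have g1 := h.opB_invG_L hB (parL_mem_center hC')
    rw [← parG_tensOne, E.invG_parG, ← hM, opB_op, parG_parG] at g1
    have h3 : S.L.1 = 1 := rfl
    have h4 : S.L.2.1 = 0 := rfl
    have g2 := congrArg (fun x : S.Op => x.2.2) g1
    simp only [h3, h4, op, one_smul, zero_smul, sub_zero, Prod.snd_zero] at g2
    have h1 : S.parG S.L.2.2 = sgn 1 • S.L.2.2 := by rw [S.parG_L, sgn_one, neg_one_smul]
    rw [skewG h1, pw_one, sub_eq_zero.1 g2]
  have htot : S.formGB (S.extG e (S.ham (E.dens C)) S.L.2.2) M = S.D (S.formGB (S.parG X) M) := by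
    rw [hL, D_formGB, parG_parG, map_neg, map_sub, LinearMap.neg_apply, LinearMap.sub_apply,
      formGB_inv, hLM, map_neg]
    abel
  rw [← hM, htot, E.Z_zero, map_zero, LinearMap.zero_apply, add_zero, ← map_smul, ← map_sub] at hder
  rw [Gauge.dens, Gauge.dens] at *
  rw [hder]
  exact (Submodule.Quotient.mk_eq_zero _).2 ⟨_, rfl⟩

end IsDiag

end DSData

namespace DSData

variable {𝔤 : Type*} [AddCommGroup 𝔤] [Module ℂ 𝔤] {ι : Type*} [Fintype ι] [DecidableEq ι]
  {S : DSData 𝔤 ι}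

/-! ### The Hamiltonians and the Lax equations -/

theorem isDer_iff {e : ZMod 2} {d : S.A →ₗ[ℂ] S.A} :
    S.IsDer e d ↔ SuperPoly.IsSDer S.varPar e d := by
  have hσ : ∀ a, S.pp 1 (S.pp 1 a) = a := fun a => by
    rw [← SuperPoly.parPow_add, parity_add_self]; simp [SuperPoly.parPow]
  refine and_congr_left fun _ => ⟨fun h a => ?_, fun h a => ?_⟩
  · rw [← pp_one, ← h (S.pp 1 a), hσ]
  · rw [pp_one] at hσ ⊢
    rw [h, hσ]

theorem superComm_D_iff {e : ZMod 2} {d : S.A →ₗ[ℂ] S.A} :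
    S.SuperComm e 1 d S.D ↔ ∀ a, d (S.D a) = sgn e • S.D (d a) := by
  rw [SuperComm, mul_one]

theorem extDer_eq (e : ZMod 2) (d : S.A →ₗ[ℂ] S.A) (x : S.Op) : S.extDer e d x = S.extOp e d x := rfl

/-- The Hamiltonians `h_C` and the elements `M_C` in terms of a single diagonalization of the
universal Lax operator. -/
theorem exists_isDiag (hS : S.SemisimpleLamSq) : ∃ (B : S.G →ₗ[ℂ] S.G) (E : S.Gauge) (H : S.G),
    S.IsPinv B ∧ IsDiag E H ∧
      S.IsExpAd (S.dressing S.Qc) (S.laxS S.Qc) (1, 0, S.K S.Qc + S.tensOne S.Lam) ∧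
      (∀ C, ∃ r, S.h C = E.dens C - algebraMap ℂ S.A r) ∧
      ∀ C ∈ S.center, S.M C = E.invG (S.tensOne C) ∧
        S.IsExpAd (-S.dressing S.Qu) (S.op (S.tensOne C)) (S.op (S.M C)) := by
  obtain ⟨B, hB⟩ := S.exists_isPinv hS
  obtain ⟨E, H, hT, hE, hEL⟩ := exists_isDiag_canonical hB hS
  obtain ⟨E', H', hT', hE', hEi⟩ := exists_isDiag_dressing hB hS
  have hK : S.K S.Qc = (E.toFun S.L).2.2 - S.tensOne S.Lam := by
    rw [K, expAd_eq hT, ← hEL]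
  have hM : ∀ C, S.M C = E'.invG (S.tensOne C) := fun C => by
    rw [M, expAd_eq (neg_mem_Fil hT'), ← hEi, E'.inv_op]; rfl
  refine ⟨B, E, H, hB, hE, ?_, fun C => ?_, fun C hC => ⟨?_, ?_⟩⟩
  · have h1 := E_isExpAd hT (S.laxS S.Qc)
    rw [← hEL] at h1
    have h2 : E.toFun S.L = (1, 0, S.K S.Qc + S.tensOne S.Lam) := by
      rw [hK, sub_add_cancel]
      exact Prod.ext (E.fst _) (Prod.ext (E.snd_fst _) rfl)
    rwa [h2] at h1
  · obtain ⟨r, hr⟩ := formGB_tensOne (S := S) S.Lam C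
    exact ⟨r, by rw [h, hK, ← formGB_apply, map_sub, LinearMap.sub_apply, hr, Gauge.dens]⟩
  · rw [hM, ← hE.onG_invG_center hB hE' hC, E.invG_onG]
    rw [hE.onG_invG_center hB hE' hC]
  · rw [hM, ← E'.inv_op, hEi]
    exact E_isExpAd (neg_mem_Fil hT') _

/-- An evolutionary derivation that does not change `ℒ_s` vanishes on `𝒫`. -/
theorem eq_of_extOp_L {e : ZMod 2} {d d' : S.A →ₗ[ℂ] S.A} (hd : SuperPoly.IsSDer S.varPar e d)
    (hd' : SuperPoly.IsSDer S.varPar e d') (hD : ∀ a, d (S.D a) = sgn e • S.D (d a))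
    (hD' : ∀ a, d' (S.D a) = sgn e • S.D (d' a)) (h : S.extOp e d S.L = S.extOp e d' S.L) {a : S.A}
    (ha : a ∈ S.P) : d a = d' a := by
  classical
  have h1 : S.extG e d S.L.2.2 = S.extG e d' S.L.2.2 := congrArg (fun x : S.Op => x.2.2) h
  rw [extG_L hd, extG_L hd'] at h1
  have h2 := congrArg (S.zcoeff 0) h1
  rw [zcoeff_const, zcoeff_const, if_pos rfl, if_pos rfl] at h2
  have h3 : ∀ t ∈ S.I, d (S.qbar t 0) = d' (S.qbar t 0) := fun t ht => by
    have h4 := congrArg (coord (S.form.flip (S.q t))) h2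
    rw [coord_map_Qu, coord_map_Qu, if_pos ht, if_pos ht] at h4
    exact smul_right_injective _ (sgn_ne_zero _) h4
  have h5 : ∀ t ∈ S.I, ∀ n, d (S.qbar t n) = d' (S.qbar t n) := fun t ht n => by
    refine sub_eq_zero.1 (eq_zero_on_qbar (d := d - d') (c := sgn e) (fun a => ?_) ?_ n)
    · simp only [LinearMap.sub_apply, hD, hD', map_sub, smul_sub]
    · rw [LinearMap.sub_apply, h3 t ht, sub_self]
  refine Algebra.adjoin_induction (p := fun a _ => d a = d' a) ?_ (fun r => ?_) (fun a b _ _ h1 h2 => ?_)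
    (fun a b _ _ h1 h2 => ?_) ha
  · rintro _ ⟨t, ht, n, rfl⟩; exact h5 t ht n
  · rw [hd.map_algebraMap, hd'.map_algebraMap]
  · rw [map_add, map_add, h1, h2]
  · rw [hd.2, hd'.2, h1, h2]

theorem HasParity.zmul {e : ZMod 2} {C : S.Loop} (hC : S.HasParity e C) (k : ℤ) :
    S.HasParity e (S.zmul k C) := by
  have h : ∀ X, S.parL (S.zmul k X) = S.zmul k (S.parL X) := fun X => by
    induction X using TensorProduct.induction_on with
    | zero => simp
    | add x y h1 h2 => simp only [map_add, h1, h2]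
    | tmul a u => rfl
  have hC' : S.parL C = sgn e • C := hC
  show S.parL (S.zmul k C) = _
  rw [h, hC', map_smul]

theorem hasParity_prj (e : ZMod 2) (C : S.Loop) : S.HasParity e (prj S.parL e C) :=
  prj_hom S.parL S.parL_parL e C

theorem zG_neg_one_zmul_one (C : S.Loop) :
    S.zG (-1) (S.tensOne (S.zmul 1 C)) = S.tensOne C := by
  rw [tensOne_zmul, zG_zG, add_neg_cancel, zG_zero]

theorem extOp_neg (e : ZMod 2) (d : S.A →ₗ[ℂ] S.A) (x : S.Op) :
    S.extOp e (-d) x = -S.extOp e d x := by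
  have h : ∀ X : S.G, S.extG e (-d) X = -S.extG e d X := fun X => S.ext_zcoeff fun l => by
    have h1 : ∀ d, S.zcoeff l (S.extG e d X) = TensorProduct.map (S.parPow e) d (S.zcoeff l X) :=
      fun d => S.zcoeff_map _ _ _ _
    rw [map_neg, h1, h1]
    induction S.zcoeff l X using TensorProduct.induction_on with
    | zero => simp
    | add x y h1 h2 => simp only [map_add, h1, h2, neg_add]
    | tmul a u => rw [TensorProduct.map_tmul, TensorProduct.map_tmul, LinearMap.neg_apply,
        TensorProduct.tmul_neg]
  show S.op (S.extG e (-d) x.2.2) = -S.op (S.extG e d x.2.2)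
  rw [h, ← opL_apply, map_neg, opL_apply]

end DSData
end SuperDS

end

theorem theorem5 {𝔤 : Type*} [AddCommGroup 𝔤] [Module ℂ 𝔤] {ι : Type*} [Fintype ι] [DecidableEq ι]
    (S : SuperDS.DSData 𝔤 ι) (hS : S.SemisimpleLamSq) :
    -- the canonical form, `T` for `𝒬_u` and for its canonical form, and `M_C` are well defined
    (S.IsCanonical S.Qc ∧
      (∃ H, S.IsDressing S.Qu (S.dressing S.Qu) H) ∧
      (∃ H, S.IsDressing S.Qc (S.dressing S.Qc) H) ∧
      S.IsExpAd (S.dressing S.Qc) (S.laxS S.Qc) (1, 0, S.K S.Qc + S.tensOne S.Lam) ∧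
      ∀ C ∈ S.center,
        S.IsExpAd (-S.dressing S.Qu) (S.op (S.tensOne C)) (S.op (S.M C))) ∧
    -- the center is stable under `z^k` and under the parity involution
    (∀ C ∈ S.center, (∀ k : ℤ, S.zmul k C ∈ S.center) ∧
      LinearMap.rTensor (SuperDS.Laurent ℂ) S.par C ∈ S.center) ∧
    -- the Lax equations are well defined: `[M_C^+, ℒ_s] ∈ 𝔟 ⊗ 𝒫`
    (∀ C ∈ S.center, ∃ R ∈ S.tens S.b S.P, S.laxRHS C = S.op (S.const R)) ∧
    -- a super Hamiltonian equation depends on its Hamiltonian only through the class `∫h`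
    (∀ h g : S.A, S.functional h = S.functional g → S.ham h = S.ham g) ∧
    -- `d/dt_C` is an evolutionary derivation of parity `p(C)` that preserves `𝒫`, and
    -- `d ℒ_s / dt_C = - [M_{z⁻¹ C}^+, ℒ_s]`
    (∀ (e : ZMod 2), ∀ C ∈ S.center, S.HasParity e C →
      S.IsDer e (S.flow C) ∧ S.SuperComm e 1 (S.flow C) S.D ∧ (∀ a ∈ S.P, S.flow C a ∈ S.P) ∧
      S.extDer e (S.flow C) S.L = -S.laxRHS (S.zmul (-1) C)) ∧
    -- the equation `d ℒ_s = [M_C^+, ℒ_s]` induces on `𝒫` the super Hamiltonian equation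
    -- `d = - d/dt_{z C}` and no other
    (∀ (e : ZMod 2), ∀ C ∈ S.center, S.HasParity e C →
      S.SolvesLax e C (-S.flow (S.zmul 1 C)) ∧
      ∀ d, S.SolvesLax e C d → ∀ a ∈ S.P, d a = -S.flow (S.zmul 1 C) a) ∧
    -- the derivations `d/dt_C` of `𝒫(ḡ)` pairwise supercommute
    (∀ (e₁ e₂ : ZMod 2), ∀ C₁ ∈ S.center, ∀ C₂ ∈ S.center,
      S.HasParity e₁ C₁ → S.HasParity e₂ C₂ → S.SuperComm e₁ e₂ (S.flow C₁) (S.flow C₂)) ∧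
    -- every `∫h_C` is an integral of motion of each of the equations: `{∫h_{C₁}, ∫h_{C₂}}₂ = 0`
    (∀ C₁ ∈ S.center, ∀ C₂ ∈ S.center, S.functional (S.ham (S.h C₁) (S.h C₂)) = 0) := by
  obtain ⟨B, E, H, hB, hE, hK, hh, hM⟩ := SuperDS.DSData.exists_isDiag hS
  have hlax : ∀ C ∈ S.center, S.laxRHS C =
      S.opB (S.op (S.posPart (E.invG (S.tensOne C)))) S.L := fun C hC => by
    rw [SuperDS.DSData.laxRHS, (hM C hC).1]; rfl
  have hflow : ∀ C, S.flow C = S.ham (E.dens C) := fun C => by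
    obtain ⟨r, hr⟩ := hh C
    rw [SuperDS.DSData.flow, hr, sub_eq_add_neg, ← neg_one_smul ℂ, SuperDS.DSData.ham_add,
      SuperDS.DSData.ham_smul, SuperDS.DSData.ham_algebraMap, smul_zero, add_zero]
  have hsol : ∀ (e : ZMod 2), ∀ C ∈ S.center, S.HasParity e C →
      S.extOp e (S.flow C) S.L = -S.laxRHS (S.zmul (-1) C) := fun e C hC he => by
    rw [hflow, hE.extOp_flow_L hB hC he, hlax _ (SuperDS.DSData.zmul_mem_center hC (-1)),
      SuperDS.DSData.tensOne_zmul, E.invG_zG]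
  have hsolves : ∀ (e : ZMod 2), ∀ C ∈ S.center, S.HasParity e C →
      S.SolvesLax e C (-S.flow (S.zmul 1 C)) := fun e C hC he => by
    have h1 := hE.flow_isSDer (he.zmul 1)
    have h2 := hE.flow_D (he.zmul 1)
    have h3 := hsol e _ (SuperDS.DSData.zmul_mem_center hC 1) (he.zmul 1)
    rw [← hflow] at h1 h2
    refine ⟨SuperDS.DSData.isDer_iff.2 h1.neg, SuperDS.DSData.superComm_D_iff.2 fun a => ?_, ?_⟩
    · rw [LinearMap.neg_apply, h2, LinearMap.neg_apply, map_neg, smul_neg]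
    · have h4 : S.zmul (-1) (S.zmul 1 C) ∈ S.center :=
        SuperDS.DSData.zmul_mem_center (SuperDS.DSData.zmul_mem_center hC 1) (-1)
      rw [SuperDS.DSData.extDer_eq, SuperDS.DSData.extOp_neg, h3, neg_neg, hlax _ hC, hlax _ h4,
        SuperDS.DSData.tensOne_zmul, SuperDS.DSData.zG_neg_one_zmul_one]
  refine ⟨⟨S.Qc_isCanonical, SuperDS.DSData.dressing_spec hS S.Qu_odd S.Qu_mem_Fil,
    SuperDS.DSData.dressing_spec hS SuperDS.DSData.Qc_odd S.Qc_mem_Fil, hK, fun C hC => (hM C hC).2⟩,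
    fun C hC => ⟨fun k => SuperDS.DSData.zmul_mem_center hC k, SuperDS.DSData.parL_mem_center hC⟩,
    fun C hC => ?_, fun h g hg => SuperDS.DSData.ham_eq_of_functional_eq hg,
    fun e C hC he => ?_, fun e C hC he => ⟨hsolves e C hC he, fun d hd a ha => ?_⟩,
    fun e₁ e₂ C₁ hC₁ C₂ hC₂ he₁ he₂ => ?_, fun C₁ hC₁ C₂ hC₂ => ?_⟩
  · refine ⟨_, ?_, (hlax C hC).trans (SuperDS.DSData.opB_posPart_L (hE.opB_invG_L hB hC))⟩
    exact Submodule.neg_mem _ (SuperDS.DSData.brA_s_mem (E.invG_coef (S.tensOne_coefIn _ _) _))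
  · have h1 := hsol e C hC he
    rw [hflow] at h1 ⊢
    exact ⟨SuperDS.DSData.isDer_iff.2 (hE.flow_isSDer he),
      SuperDS.DSData.superComm_D_iff.2 (hE.flow_D he), fun a ha => hE.flow_mem_P hB hC he ha, h1⟩
  · have h1 := hsolves e C hC he
    exact SuperDS.DSData.eq_of_extOp_L (SuperDS.DSData.isDer_iff.1 hd.1)
      (SuperDS.DSData.isDer_iff.1 h1.1) (SuperDS.DSData.superComm_D_iff.1 hd.2.1)
      (SuperDS.DSData.superComm_D_iff.1 h1.2.1) (hd.2.2.trans h1.2.2.symm) ha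
  · rw [hflow, hflow]
    exact hE.flow_comm hB hC₁ he₁ hC₂ he₂
  · have h1 : ∀ e, S.functional (S.ham (E.dens (SuperDS.prj S.parL e C₁)) (E.dens C₂)) = 0 := fun e =>
      hE.functional_flow_dens hB (SuperDS.DSData.prj_mem_center hC₁ e)
        (SuperDS.DSData.hasParity_prj e C₁) hC₂
    have h2 : E.dens C₁ = E.dens (SuperDS.prj S.parL 0 C₁) + E.dens (SuperDS.prj S.parL 1 C₁) := by
      simp only [SuperDS.DSData.Gauge.dens]
      rw [← map_add, ← map_add, SuperDS.prj_add_prj]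
    obtain ⟨r, hr⟩ := hh C₂
    have h3 : S.ham (S.h C₁) = S.ham (E.dens C₁) := hflow C₁
    rw [h3, hr, map_sub, SuperDS.DSData.ham_apply_algebraMap, sub_zero, h2,
      SuperDS.DSData.ham_add, LinearMap.add_apply, map_add, h1, h1, add_zero]
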